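/- **Setting.** Let $V$ be a countable set, $p:V\times V\to[0,1]$ with $\sum_y p(x,y)=1$ for all $x$, and $\alpha:V\to(0,\infty)$ with $\sum_x\alpha(x)<\infty$ and $\sup_x\sum_y p(x,y)\alpha(y)/\alpha(x)<\infty$. Let $F^+,F^-:\mathbb N_0\to\mathbb R$ satisfy $F^\pm(0)=0$, $0\le F^+\le F^-$, and $F^+-F^-$ non-increasing. Put $E_0=\{\eta\in\mathbb N_0^V:\sum_x\eta(x)<\infty\}$ and $E_\alpha=\{\eta\in\mathbb N_0^V:\sum_x\alpha(x)\eta(x)<\infty\}$ with the metric $d(\eta,\zeta)=\sum_x\alpha(x)|\eta(x)-\zeta(x)|$. The marks are $\mathcal M=\{(x,+),(x,-),(x,y):x,y\in V\}$, with transitions $\Gamma^{x,+}\eta=\eta+\delta_x$, $\Gamma^{x,-}\eta=\eta-\delta_x$, $\Gamma^{x,y}\eta=\eta-\delta_x+\delta_y$ and rates $R^{x,+}(\eta)=F^+(\eta(x))$, $R^{x,-}(\eta)=F^-(\eta(x))$, $R^{x,y}(\eta)=p(x,y)\eta(x)$ (a transition that would remove a particle from an empty site has rate $0$). **The process.** On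 a probability space $(\Omega,\mathcal F,\mathbb P)$ let $(\mathcal X^m)_{m\in\mathcal M}$ be independent Poisson point processes on $(0,\infty)^2$ with Lebesgue intensity. For $\eta\in E_0$ and $0\le s\le t$, let $s^0=s$, $\eta^0=\eta$, let $s^k$ be the infimum of the $r\in(s^{k-1},t]$ for which there are $m\in\mathcal M$ and $u>0$ with $(r,u)\in\mathcal X^m$ and $u<R^m(\eta^{k-1})$ (with $\inf\varnothing=\infty$), and, if $s^k<\infty$, let $\eta^k=\Gamma^{m}(\eta^{k-1})$ for the a.s. unique such mark $m$ at time $s^k$. Set $\Phi_{s,t}(\eta)=\eta^k$ for the a.s. existing $k$ with $s^k<\infty=s^{k+1}$, and $\Phi_t=\Phi_{0,t}$. For $\eta\in E_\alpha$, let $\Phi_t(\eta)$ be the ($\mathbb P$-a.s. existing) common limit in $E_\alpha$ of $\Phi_t(\eta_n)$ over all increasing sequences $(\eta_n)$ in $E_0$ with $d(\eta_n,\eta)\to0$. Let $\mathcal F^\Phi_t$ be the completion of $\sigma(\Phi_s(\eta):s\le t,\ \eta\in E_0)$ with all $\mathbb P$-null sets. **Operators.** For $f:E_\alpha\to\mathbb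 R$ put $$Lf(\eta)=\sum_{m\in\mathcal M}R^m(\eta)\,\bigl(f(\Gamma^m\eta)-f(\eta)\bigr),\qquad Qf=L(f^2)-2fLf,$$ $$M^{L,f}_t(\eta)=f(\Phi_t(\eta))-f(\eta)-\int_0^tLf(\Phi_s(\eta))\,ds,\qquad N^{L,f}_t(\eta)=\bigl(M^{L,f}_t(\eta)\bigr)^2-\int_0^tQf(\Phi_s(\eta))\,ds .$$ The function $f$ is *local* if there is a finite set $B\subset V$ such that $f(\eta)=f(\eta')$ whenever $\eta=\eta'$ on $B$. **Proposition.** Let $f:E_\alpha\to\mathbb R$ be continuous and local. Then the series defining $Lf(\eta)$ converges absolutely and $Qf(\eta)=\sum_{m}R^m(\eta)\bigl(f(\Gamma^m\eta)-f(\eta)\bigr)^2$ (convergent) for every $\eta\in E_\alpha$; for every $\eta\in E_\alpha$, almost surely $s\mapsto Lf(\Phi_s(\eta))$ and $s\mapsto Qf(\Phi_s(\eta))$ are integrable on $[0,t]$ for all $t\ge 0$; and for every $\eta\in E_\alpha$ the processes $(M^{L,f}_t(\eta))_{t\ge0}$ and $(N^{L,f}_t(\eta))_{t\ge0}$ are local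 martingales under $\mathbb P$ with respect to $(\mathcal F^\Phi_t)_{t\ge0}$ (in the sense that the stopped processes along a localizing sequence are martingales with a.s. right-continuous paths with left limits). -/

import Mathlib

open MeasureTheory ProbabilityTheory Filter Topology
open scoped NNReal ENNReal

/-! ### Marks, transitions and the data of the model -/

/-- The marks: birth at `x`, death at `x`, jump from `x` to `y`. -/
inductive Mark (V : Type*) where
  | birth (x : V) : Mark V
  | death (x : V) : Mark V
  | jump (x y : V) : Mark V

open scoped Classical in
/-- The transition operators `Γ`. Subtraction is truncated, but a death at `x` or a jump out of `x`
has rate zero as soon as `η x = 0`. -/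
noncomputable def transition {V : Type*} : Mark V → (V → ℕ) → (V → ℕ)
  | .birth x, η => η + Pi.single x 1
  | .death x, η => η - Pi.single x 1
  | .jump x y, η => η - Pi.single x 1 + Pi.single y 1

/-- The data of a reaction-diffusion model on the set of sites `V`: a transition kernel `p`, a
localization function `α` for `p`, and the reaction functions `F⁺`, `F⁻`. -/
structure ReactionDiffusion (V : Type*) where
  p : V → V → ℝ
  p_nonneg : ∀ x y, 0 ≤ p x y
  p_hasSum : ∀ x, HasSum (p x) 1
  α : V → ℝ
  α_pos : ∀ x, 0 < α x
  α_summable : Summable α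
  α_localization : BddAbove (Set.range fun x => ∑' y, p x y * (α y / α x))
  Fplus : ℕ → ℝ
  Fminus : ℕ → ℝ
  Fplus_zero : Fplus 0 = 0
  Fminus_zero : Fminus 0 = 0
  Fplus_nonneg : ∀ k, 0 ≤ Fplus k
  Fplus_le_Fminus : ∀ k, Fplus k ≤ Fminus k
  antitone_sub : Antitone fun k => Fplus k - Fminus k

/-- The finite configurations `E₀`. -/
def FiniteConfig (V : Type*) : Type _ := {η : V → ℕ // Summable fun x => (η x : ℝ)}

theorem summable_transition {V : Type*} (w : V → ℝ) (m : Mark V) {η : V → ℕ}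
    (hη : Summable fun x => w x * (η x : ℝ)) :
    Summable fun x => w x * (transition m η x : ℝ) := by
  classical
  have key : ∀ s : Finset V, (∀ x ∉ s, transition m η x = η x) →
      Summable fun x => w x * (transition m η x : ℝ) := by
    intro s hs
    refine (Summable.congr_cofinite hη ?_)
    refine (s.finite_toSet.subset ?_)
    intro x hx
    by_contra hxs
    exact hx (by simp [hs x hxs])
  cases m with
  | birth x =>
    exact key {x} fun z hz => by
      have : z ≠ x := by simpa using hz
      simp [transition, this]
  | death x =>
    exact key {x} fun z hz => by
      have : z ≠ x := by simpa using hz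
      simp [transition, this]
  | jump x y =>
    exact key {x, y} fun z hz => by
      have : z ≠ x ∧ z ≠ y := by simpa using hz
      simp [transition, this.1, this.2]

/-- The transition operators on finite configurations. -/
noncomputable def FiniteConfig.transition {V : Type*} (m : Mark V) (η : FiniteConfig V) :
    FiniteConfig V :=
  ⟨_root_.transition m η.1, by simpa using summable_transition (fun _ => 1) m (by simpa using η.2)⟩

namespace ReactionDiffusion

variable {V : Type*} (S : ReactionDiffusion V)

/-- The transition rates `R`. -/
def rate : Mark V → (V → ℕ) → ℝ
  | .birth x, η => S.Fplus (η x)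
  | .death x, η => S.Fminus (η x)
  | .jump x y, η => S.p x y * (η x : ℝ)

/-- The `α`-summable configurations `E_α`. -/
def Config : Type _ := {η : V → ℕ // Summable fun x => S.α x * (η x : ℝ)}

theorem summable_dist (η ζ : S.Config) :
    Summable fun x => S.α x * |(η.1 x : ℝ) - (ζ.1 x : ℝ)| := by
  refine Summable.of_nonneg_of_le (fun x => mul_nonneg (S.α_pos x).le (abs_nonneg _))
    (fun x => ?_) (η.2.add ζ.2)
  rw [← mul_add]
  refine mul_le_mul_of_nonneg_left ?_ (S.α_pos x).le
  refine (abs_sub _ _).trans ?_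
  simp

/-- The metric `d(η, ζ) = ∑ₓ α(x) |η(x) - ζ(x)|` on `E_α`. -/
noncomputable instance : MetricSpace S.Config where
  dist η ζ := ∑' x, S.α x * |(η.1 x : ℝ) - (ζ.1 x : ℝ)|
  dist_self η := by simp
  dist_comm η ζ := by simp only [abs_sub_comm]
  dist_triangle η ζ ξ := by
    rw [← (S.summable_dist η ζ).tsum_add (S.summable_dist ζ ξ)]
    refine (S.summable_dist η ξ).tsum_le_tsum (fun x => ?_)
      ((S.summable_dist η ζ).add (S.summable_dist ζ ξ))
    rw [← mul_add]
    exact mul_le_mul_of_nonneg_left (abs_sub_le _ _ _) (S.α_pos x).le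
  eq_of_dist_eq_zero {η ζ} h := by
    have h0 : ∀ x, 0 ≤ S.α x * |(η.1 x : ℝ) - (ζ.1 x : ℝ)| :=
      fun x => mul_nonneg (S.α_pos x).le (abs_nonneg _)
    have h1 := (hasSum_zero_iff_of_nonneg h0).1 (h ▸ (S.summable_dist η ζ).hasSum)
    refine Subtype.ext (funext fun x => ?_)
    have h2 : S.α x * |(η.1 x : ℝ) - (ζ.1 x : ℝ)| = 0 := congrFun h1 x
    have h3 := (mul_eq_zero.1 h2).resolve_left (S.α_pos x).ne'
    exact_mod_cast sub_eq_zero.1 (abs_eq_zero.1 h3)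

/-- The inclusion `E₀ ⊆ E_α`. -/
def ofFinite (η : FiniteConfig V) : S.Config :=
  ⟨η.1, by
    obtain ⟨C, hC⟩ : ∃ C, ∀ x, S.α x ≤ C :=
      ⟨∑' x, S.α x, fun x => S.α_summable.le_tsum x fun y _ => (S.α_pos y).le⟩
    exact Summable.of_nonneg_of_le (fun x => mul_nonneg (S.α_pos x).le (Nat.cast_nonneg _))
      (fun x => mul_le_mul_of_nonneg_right (hC x) (Nat.cast_nonneg _)) (η.2.mul_left C)⟩

/-- The transition operators on `E_α`. -/
noncomputable def move (m : Mark V) (η : S.Config) : S.Config :=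
  ⟨transition m η.1, summable_transition S.α m η.2⟩

/-! ### Formal generator and formal carré du champ -/

/-- The formal generator `L`. -/
noncomputable def gen (f : S.Config → ℝ) (η : S.Config) : ℝ :=
  ∑' m : Mark V, S.rate m η.1 * (f (S.move m η) - f η)

/-- The formal carré du champ `Q f = L (f²) - 2 f L f`. -/
noncomputable def carre (f : S.Config → ℝ) (η : S.Config) : ℝ :=
  S.gen (fun ζ => f ζ ^ 2) η - 2 * f η * S.gen f η

/-- Local functions on `E_α`: they depend on the configuration in a finite set only. -/
def IsLocal (f : S.Config → ℝ) : Prop :=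
  ∃ B : Finset V, ∀ η ζ : S.Config, (∀ x ∈ B, η.1 x = ζ.1 x) → f η = f ζ

/-! ### The flow driven by a family of point configurations -/

/-- The marks `m` that have a point `(r, u)` with `0 < u < R^m(η)`. -/
def firing (X : Mark V → Set (ℝ × ℝ)) (η : V → ℕ) (r : ℝ) : Set (Mark V) :=
  {m | ∃ u, 0 < u ∧ (r, u) ∈ X m ∧ u < S.rate m η}

/-- The times in `(s, t]` at which some mark fires, when the configuration is `η`. -/
def firingTimes (X : Mark V → Set (ℝ × ℝ)) (η : V → ℕ) (s t : ℝ) : Set ℝ :=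
  {r | s < r ∧ r ≤ t ∧ (S.firing X η r).Nonempty}

open scoped Classical in
/-- One step `(sᵏ⁻¹, ηᵏ⁻¹) ↦ (sᵏ, ηᵏ)` of the recursion that defines the flow up to time `t`.
The time is `⊤` once there is no further transition in `(s, t]`. If several marks fire at once or
the infimum is not attained (which has probability zero), the choice made is irrelevant. -/
noncomputable def flowStep (X : Mark V → Set (ℝ × ℝ)) (t : ℝ) :
    WithTop ℝ × FiniteConfig V → WithTop ℝ × FiniteConfig V
  | (⊤, η) => (⊤, η)
  | ((s : ℝ), η) =>
    if (S.firingTimes X η.1 s t).Nonempty then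
      let r : ℝ := sInf (S.firingTimes X η.1 s t)
      ((r : WithTop ℝ),
        if h : (S.firing X η.1 r).Nonempty then η.transition h.some else η)
    else (⊤, η)

open scoped Classical in
/-- The flow `Φ_{s,t}` on `E₀`: the configuration `ηᵏ` for the index `k` with
`sᵏ < ∞ = sᵏ⁺¹` (almost surely there is one; otherwise the value is irrelevant). -/
noncomputable def finiteFlow (X : Mark V → Set (ℝ × ℝ)) (s t : ℝ) (η : FiniteConfig V) :
    FiniteConfig V :=
  if h : ∃ k : ℕ, ((S.flowStep X t)^[k] ((s : WithTop ℝ), η)).1 ≠ ⊤ ∧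
      ((S.flowStep X t)^[k + 1] ((s : WithTop ℝ), η)).1 = ⊤ then
    ((S.flowStep X t)^[h.choose] ((s : WithTop ℝ), η)).2
  else η

open scoped Classical in
/-- The infinite-volume process `Φ_t` on `E_α`: the common limit of `Φ_{0,t}(ηₙ)` over all
increasing sequences `(ηₙ)` of finite configurations with `ηₙ → η` (it exists almost surely;
otherwise the value is irrelevant). -/
noncomputable def flow (X : Mark V → Set (ℝ × ℝ)) (t : ℝ) (η : S.Config) : S.Config :=
  if h : ∃ ξ : S.Config, ∀ a : ℕ → FiniteConfig V, (Monotone fun n => (a n).1) →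
      Tendsto (fun n => S.ofFinite (a n)) atTop (𝓝 η) →
      Tendsto (fun n => S.ofFinite (S.finiteFlow X 0 t (a n))) atTop (𝓝 ξ) then
    h.choose
  else η

end ReactionDiffusion

/-! ### Poisson point processes, completed filtrations, local martingales -/

/-- The random set `X` is a Poisson point process with intensity `ν`. -/
structure IsPoissonPointProcess {Ω E : Type*} [MeasurableSpace Ω] [MeasurableSpace E]
    (X : Ω → Set E) (ν : Measure E) (P : Measure Ω) : Prop where
  measurable_count : ∀ A : Set E, MeasurableSet A → Measurable fun ω => (X ω ∩ A).encard
  law_count : ∀ A : Set E, MeasurableSet A → ν A ≠ ∞ →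
    P.map (fun ω => (X ω ∩ A).encard) =
      (poissonMeasure (ν A).toNNReal).map (fun k : ℕ => (k : ℕ∞))
  indep_count : ∀ (n : ℕ) (A : Fin n → Set E), (∀ i, MeasurableSet (A i)) →
    Pairwise (Function.onFun Disjoint A) → iIndepFun (fun i ω => (X ω ∩ A i).encard) P

/-- A family of independent Poisson point processes on `(0, ∞)²` with Lebesgue intensity,
indexed by the marks. -/
structure IsPoissonClocks {V Ω : Type*} [MeasurableSpace Ω]
    (X : Mark V → Ω → Set (ℝ × ℝ)) (P : Measure Ω) : Prop where
  poisson : ∀ m, IsPoissonPointProcess (X m)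
    ((volume : Measure (ℝ × ℝ)).restrict (Set.Ioi 0 ×ˢ Set.Ioi 0)) P
  indep : iIndepFun (fun (m : Mark V) (ω : Ω) (A : {A : Set (ℝ × ℝ) // MeasurableSet A}) =>
    (X m ω ∩ A.1).encard) P

/-- The completion of the ambient `σ`-algebra with respect to `P`. -/
abbrev completedSigma {Ω : Type*} [MeasurableSpace Ω] (P : Measure Ω) : MeasurableSpace Ω :=
  inferInstanceAs (MeasurableSpace (NullMeasurableSpace Ω P))

/-- The completion of `P`, as a measure on the completed `σ`-algebra. -/
noncomputable abbrev completedMeasure {Ω : Type*} [MeasurableSpace Ω] (P : Measure Ω) :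
    @Measure Ω (completedSigma P) :=
  P.completion

/-- The `σ`-algebra `σ(Φ_s(η) : s ≤ t, η ∈ E₀)`. -/
@[reducible] noncomputable def flowSigma {V Ω : Type*} (S : ReactionDiffusion V)
    (X : Mark V → Ω → Set (ℝ × ℝ)) (t : ℝ≥0) : MeasurableSpace Ω :=
  ⨆ (s : ℝ≥0) (_ : s ≤ t) (η : FiniteConfig V),
    MeasurableSpace.comap
      (fun ω => (S.finiteFlow (fun m => X m ω) 0 (s : ℝ) η).1) MeasurableSpace.pi

theorem flowSigma_mono {V Ω : Type*} (S : ReactionDiffusion V)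
    (X : Mark V → Ω → Set (ℝ × ℝ)) : Monotone (flowSigma S X) := by
  intro t t' h
  unfold flowSigma
  exact iSup_le fun s => iSup_le fun hs => le_iSup₂_of_le s (hs.trans h) le_rfl

/-- The completion, with all `P`-null sets, of the filtration `t ↦ σ(Φ_s(η) : s ≤ t, η ∈ E₀)`.
The infimum with the completed ambient `σ`-algebra is there only because a `Filtration` has to
consist of sub-`σ`-algebras of the ambient one: the random variables `Φ_s(η)` are measurable
with respect to the latter. -/
noncomputable def flowFiltration {V Ω : Type*} [MeasurableSpace Ω] (S : ReactionDiffusion V)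
    (X : Mark V → Ω → Set (ℝ × ℝ)) (P : Measure Ω) :
    @Filtration Ω ℝ≥0 _ (completedSigma P) :=
  @Filtration.mk Ω ℝ≥0 _ (completedSigma P)
    (fun t => (flowSigma S X t ⊔ MeasurableSpace.generateFrom {N : Set Ω | P N = 0})
      ⊓ completedSigma P)
    (fun _ _ hst => inf_le_inf_right _ (sup_le_sup_right (flowSigma_mono S X hst) _))
    (fun _ => inf_le_right)

/-- Right-continuous paths with left limits. -/
def IsCadlagPath (g : ℝ≥0 → ℝ) : Prop :=
  ∀ t, ContinuousWithinAt g (Set.Ici t) t ∧ ∃ l, Tendsto g (𝓝[<] t) (𝓝 l)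

/-- Local martingales: there is a localizing sequence along which the stopped process is a
martingale whose paths are almost surely right-continuous with left limits. -/
def IsLocalMartingale {Ω : Type*} {mΩ : MeasurableSpace Ω} (Y : ℝ≥0 → Ω → ℝ)
    (𝓕 : Filtration ℝ≥0 mΩ) (P : Measure Ω) : Prop :=
  Locally (fun Z => Martingale Z 𝓕 P ∧ ∀ᵐ ω ∂P, IsCadlagPath fun t => Z t ω) 𝓕 Y P

namespace ReactionDiffusion

variable {V Ω : Type*} (S : ReactionDiffusion V)

/-- The Dynkin process `M^{L,f}(η)`. -/
noncomputable def dynkinM (X : Mark V → Ω → Set (ℝ × ℝ)) (f : S.Config → ℝ) (η : S.Config) :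
    ℝ≥0 → Ω → ℝ := fun t ω =>
  f (S.flow (fun m => X m ω) t η) - f η
    - ∫ s in (0 : ℝ)..t, S.gen f (S.flow (fun m => X m ω) s η)

/-- The compensated square `N^{L,f}(η)`. -/
noncomputable def dynkinN (X : Mark V → Ω → Set (ℝ × ℝ)) (f : S.Config → ℝ) (η : S.Config) :
    ℝ≥0 → Ω → ℝ := fun t ω =>
  S.dynkinM X f η t ω ^ 2 - ∫ s in (0 : ℝ)..t, S.carre f (S.flow (fun m => X m ω) s η)

/-- The class `𝒟` of functions `f` for which `M^{L,f}(η)` and `N^{L,f}(η)` are local martingales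
for every initial configuration `η ∈ E_α`. -/
def dynkinClass [MeasurableSpace Ω] (X : Mark V → Ω → Set (ℝ × ℝ)) (P : Measure Ω) :
    Set (S.Config → ℝ) :=
  {f | ∀ η : S.Config,
    IsLocalMartingale (S.dynkinM X f η) (flowFiltration S X P) (completedMeasure P) ∧
    IsLocalMartingale (S.dynkinN X f η) (flowFiltration S X P) (completedMeasure P)}

end ReactionDiffusion

/-! ### Counts of a Poisson point process -/

/-! Finite configurations. When simultaneous points and explosion are excluded, the flow started
from a finite configuration is a jump path: it moves exactly when a clock has a point below the rate
of the current left limit. The increment of a function along it is therefore a finite sum over such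
points (`IsJumpPath.jumps_finite_and_sub_eq`). The path is adapted to the past of the clocks
(`measurableSet_jumpPath`), and counts after a time are independent of that past. The compensation
formula (`IsPoissonClocks.compensation`) follows by discretizing time, and summing it over marks and
states gives Dynkin's formula up to a stopping time before which the rates of change are bounded
(`IsJumpProcess.dynkin`). Nonexplosion is obtained from the same formula, applied to the total mass,
which has nonpositive drift, and to the number of transitions (`ReactionDiffusion.ae_nonexplosive`).

Infinite volume. Paths driven by the same clocks stay ordered (`ReactionDiffusion.isJumpPath_mono`).
For an ordered pair the distance is a difference of two `α`-weighted masses, so its drift can be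
computed with the generator; monotonicity of `F⁺ - F⁻` and the localization property of `α` bound
the drift by a multiple of the distance. Gronwall's inequality and Markov's inequality at a hitting
time give a maximal inequality (`ReactionDiffusion.measure_exists_sub_ge_le`). With Borel-Cantelli
it shows that the flows of a fast increasing approximation of `η` converge uniformly on bounded time
intervals (`ReactionDiffusion.ae_flowConverges`), and order preservation makes the limit independent
of the approximation (`ReactionDiffusion.flow_spec`).

Local functions. Convergence in `E_α` freezes each coordinate, so a local function along the
approximating flows is eventually equal to its value along the limit, while the generator converges
by dominated convergence along increasing sequences (`ReactionDiffusion.LocalOn.tendsto_gen`). Up to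
the exit from a ball of `E_α` all quantities are bounded, so Dynkin's formula passes to the limit
(`ReactionDiffusion.setIntegral_stoppedFlow_sub`). The exit is expressed through the approximating
flows together with a vanishing margin; this makes it a stopping time that is determined by
countably many finite flows.

Martingales. The stopped `f` and the stopped `f²` are then bounded processes `u`, `u²` with bounded
rates `l`, `l₂`. The first gives `M = u - c - ∫ l`. For the square one uses that `M² - ∫ (l₂ - 2 u
l)` equals `(u² - c² - ∫ l₂) - 2c M - 2 (M ∫ l - ∫ M l)`, where the last bracket is `∫ (M_t - M_r)
l_r dr` and is a martingale by conditioning at time `r` (`IsBoundedDynkin.martingale_sq`).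

Null sets. On the completed space the clocks are altered on a null set so that every path property
holds everywhere (`ReactionDiffusion.exists_goodClocks`). The flow filtration contains the events of
the altered flow, and up to null sets it is contained in the past of the altered clocks, so the
formulas transfer in both directions. -/

theorem lintegral_natCast_poissonMeasure (r : ℝ≥0) :
    ∫⁻ k : ℕ, (k : ℝ≥0∞) ∂(poissonMeasure r) = r := by
  have h1 : ∀ n : ℕ, ENNReal.ofReal (Real.exp (-r) * r ^ (n + 1) / (n + 1).factorial) *
      ((n + 1 : ℕ) : ℝ≥0∞) = ENNReal.ofReal (Real.exp (-r) * r ^ n / n.factorial) * r := by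
    intro n
    rw [← ENNReal.ofReal_natCast, ← ENNReal.ofReal_mul (by positivity),
      ← ENNReal.ofReal_coe_nnreal, ← ENNReal.ofReal_mul (by positivity)]
    congr 1
    rw [Nat.factorial_succ]
    push_cast
    field_simp
    ring
  rw [lintegral_countable', tsum_eq_zero_add' ENNReal.summable]
  simp only [poissonMeasure_singleton, Nat.cast_zero, zero_mul, zero_add, mul_comm (Nat.cast _)]
  simp_rw [h1, ENNReal.tsum_mul_right]
  rw [← ENNReal.ofReal_tsum_of_nonneg (fun n => by positivity)
    (hasSum_one_poissonMeasure r).summable, (hasSum_one_poissonMeasure r).tsum_eq]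
  simp

/-- `1 - e^{-r} (1 + r) ≤ r²` because `e^{-r} ≥ 1 - r`. The quadratic order is what rules out two
points at the same time. -/
theorem poissonMeasure_two_le (r : ℝ≥0) :
    poissonMeasure r {k | 2 ≤ k} ≤ (r : ℝ≥0∞) ^ 2 := by
  have hc : {k : ℕ | 2 ≤ k} = ({0, 1} : Set ℕ)ᶜ := by
    ext k
    simp only [Set.mem_ofPred_eq, Set.mem_compl_iff, Set.mem_insert_iff, Set.mem_singleton_iff]
    omega
  have h01 : poissonMeasure r ({0, 1} : Set ℕ) =
      ENNReal.ofReal (Real.exp (-r) * (1 + r)) := by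
    rw [Set.insert_eq, measure_union (by simp) (MeasurableSet.singleton _),
      poissonMeasure_singleton, poissonMeasure_singleton, ← ENNReal.ofReal_add (by positivity)
        (by positivity)]
    congr 1
    simp
    ring
  rw [hc, prob_compl_eq_one_sub (Set.Finite.measurableSet (by simp)), h01,
    ← ENNReal.ofReal_one, ← ENNReal.ofReal_sub _ (by positivity), ← ENNReal.ofReal_coe_nnreal,
    ← ENNReal.ofReal_pow (by positivity)]
  refine ENNReal.ofReal_le_ofReal ?_
  have h := Real.add_one_le_exp (-(r : ℝ))
  have hr : (0 : ℝ) ≤ r := r.2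
  nlinarith

theorem isPoisson_of_counts {Ω E : Type*} {mΩ : MeasurableSpace Ω} [MeasurableSpace E]
    {X : Ω → Set E} {ν : Measure E} {P : Measure Ω}
    (h₁ : ∀ A : Set E, MeasurableSet A → Measurable fun ω => (X ω ∩ A).encard)
    (h₂ : ∀ A : Set E, MeasurableSet A → ν A ≠ ∞ → P.map (fun ω => (X ω ∩ A).encard) =
      (poissonMeasure (ν A).toNNReal).map (fun k : ℕ => (k : ℕ∞)))
    (h₃ : ∀ (n : ℕ) (A : Fin n → Set E), (∀ i, MeasurableSet (A i)) →
      Pairwise (Function.onFun Disjoint A) → iIndepFun (fun i ω => (X ω ∩ A i).encard) P) :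
    IsPoissonPointProcess X ν P := ⟨h₁, h₂, h₃⟩

namespace IsPoissonPointProcess

variable {Ω E : Type*} [MeasurableSpace Ω] [MeasurableSpace E] {X : Ω → Set E} {ν : Measure E}
  {P : Measure Ω}

theorem lintegral_count (hX : IsPoissonPointProcess X ν P) {A : Set E} (hA : MeasurableSet A)
    (hν : ν A ≠ ∞) : ∫⁻ ω, ((X ω ∩ A).encard : ℝ≥0∞) ∂P = ν A := by
  rw [← lintegral_map (f := fun k : ℕ∞ => (k : ℝ≥0∞)) (by measurability)
    (hX.measurable_count A hA), hX.law_count A hA hν, lintegral_map (by measurability)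
    (by measurability)]
  simp [lintegral_natCast_poissonMeasure, hν]

theorem measure_one_le_count (hX : IsPoissonPointProcess X ν P) {A : Set E} (hA : MeasurableSet A)
    (hν : ν A ≠ ∞) : P {ω | 1 ≤ (X ω ∩ A).encard} ≤ ν A := by
  rw [← hX.lintegral_count hA hν]
  have := mul_meas_ge_le_lintegral (μ := P) (f := fun ω => ((X ω ∩ A).encard : ℝ≥0∞))
    ((by measurability : Measurable fun k : ℕ∞ => (k : ℝ≥0∞)).comp (hX.measurable_count A hA)) 1
  rw [one_mul] at this
  refine le_trans (le_of_eq ?_) this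
  congr 1
  ext ω
  simp only [Set.mem_ofPred_eq]
  rw [← ENat.toENNReal_one, ENat.toENNReal_le]

theorem measure_two_le_count (hX : IsPoissonPointProcess X ν P) {A : Set E} (hA : MeasurableSet A)
    (hν : ν A ≠ ∞) : P {ω | 2 ≤ (X ω ∩ A).encard} ≤ ν A ^ 2 := by
  have h := poissonMeasure_two_le (ν A).toNNReal
  rw [ENNReal.coe_toNNReal hν] at h
  refine le_trans (le_of_eq ?_) h
  have h2 := congrArg (fun μ => μ {k : ℕ∞ | 2 ≤ k}) (hX.law_count A hA hν)
  rw [Measure.map_apply (hX.measurable_count A hA) (by trivial),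
    Measure.map_apply (by measurability) (by trivial)] at h2
  convert! h2 using 2
  ext k
  simp only [Set.mem_ofPred_eq, Set.mem_preimage]
  exact_mod_cast Iff.rfl

theorem iIndepFun_count (hX : IsPoissonPointProcess X ν P) {ι : Type*} [Fintype ι] (A : ι → Set E)
    (hA : ∀ i, MeasurableSet (A i)) (hd : Pairwise (Function.onFun Disjoint A)) :
    iIndepFun (fun i ω => (X ω ∩ A i).encard) P := by
  have e := Fintype.equivFin ι
  have h := hX.indep_count (Fintype.card ι) (fun i => A (e.symm i)) (fun i => hA _)
    (fun i j hij => hd (e.symm.injective.ne hij))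
  have h2 := h.precomp e.injective
  simpa using h2

open scoped Classical in
/-- Counts in finitely many subsets of `D` are independent of the count in a set disjoint
from `D`. -/
theorem indep_finset_count [IsProbabilityMeasure P] (hX : IsPoissonPointProcess X ν P)
    {D B : Set E} (hD : MeasurableSet D) (hB : MeasurableSet B) (hDB : Disjoint D B)
    (F : Finset {A : Set E // MeasurableSet A ∧ A ⊆ D}) :
    Indep (⨆ A ∈ F, MeasurableSpace.comap (fun ω => (X ω ∩ A.1).encard) ⊤)
      (MeasurableSpace.comap (fun ω => (X ω ∩ B).encard) ⊤) P := by
  -- The atoms of the partition of `D` generated by the sets in `F`. Together with `B` (coded by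
  -- `none` below) they are finitely many disjoint sets, and every count of a set in `F` is a sum of
  -- counts of atoms.
  let atom : (F → Bool) → Set E := fun σ => {x | x ∈ D ∧ ∀ A : F, (x ∈ A.1.1 ↔ σ A = true)}
  have hatom : ∀ σ, MeasurableSet (atom σ) := by
    intro σ
    have : atom σ = D ∩ ⋂ A : F, {x | x ∈ A.1.1 ↔ σ A = true} := by
      ext x; simp [atom]
    rw [this]
    refine hD.inter (MeasurableSet.iInter fun A => ?_)
    cases h : σ A
    · have : {x | x ∈ A.1.1 ↔ false = true} = (A.1.1)ᶜ := by ext x; simp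
      rw [this]
      exact A.1.2.1.compl
    · have : {x | x ∈ A.1.1 ↔ true = true} = A.1.1 := by ext x; simp
      rw [this]
      exact A.1.2.1
  let S : Option (F → Bool) → Set E := fun o => o.elim B atom
  have hS : ∀ o, MeasurableSet (S o) := by
    rintro (_ | σ)
    · exact hB
    · exact hatom σ
  have hd : Pairwise (Function.onFun Disjoint S) := by
    rintro (_ | σ) (_ | σ') hne
    · exact absurd rfl hne
    · exact (hDB.mono_left fun x hx => hx.1).symm
    · exact hDB.mono_left fun x hx => hx.1
    · refine Set.disjoint_left.2 fun x hx hx' => hne ?_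
      congr 1
      funext A
      rw [Bool.eq_iff_iff]
      exact (hx.2 A).symm.trans (hx'.2 A)
  have hind := (iIndepFun_iff_iIndep _ _ _).1 (hX.iIndepFun_count S hS hd)
  have h2 := indep_iSup_of_disjoint (fun o => (hX.measurable_count _ (hS o)).comap_le) hind
    (S := {o | o ≠ none}) (T := {none}) (by simp)
  refine indep_of_indep_of_le_left (indep_of_indep_of_le_right h2 ?_) ?_
  · exact le_iSup₂_of_le none rfl le_rfl
  · refine iSup₂_le fun A hA => ?_
    have hcount : (fun ω => (X ω ∩ A.1).encard) =
        fun ω => ∑ σ ∈ Finset.univ.filter (fun σ : F → Bool => σ ⟨A, hA⟩ = true),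
          (X ω ∩ atom σ).encard := by
      funext ω
      have hU : X ω ∩ A.1 = ⋃ σ ∈ ((Finset.univ.filter
          (fun σ : F → Bool => σ ⟨A, hA⟩ = true) : Finset _) : Set (F → Bool)), X ω ∩ atom σ := by
        ext x
        simp only [Set.mem_inter_iff, Finset.coe_filter, Finset.mem_univ, true_and,
          Set.mem_ofPred_eq, Set.mem_iUnion, exists_prop]
        constructor
        · rintro ⟨hx, hxA⟩
          exact ⟨fun C => decide (x ∈ C.1.1), by simpa using hxA, hx, A.2.2 hxA,
            fun C => by simp⟩
        · rintro ⟨σ, hσ, hx, hxσ⟩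
          exact ⟨hx, (hxσ.2 ⟨A, hA⟩).2 hσ⟩
      rw [hU, Set.Finite.encard_biUnion (Finset.finite_toSet _), finsum_mem_coe_finset]
      intro σ _ σ' _ hne
      exact (hd (i := some σ) (j := some σ') (by simpa using hne)).mono
        Set.inter_subset_right Set.inter_subset_right
    rw [hcount]
    refine Measurable.comap_le ?_
    refine Finset.measurable_fun_sum _ fun σ _ => ?_
    refine Measurable.of_comap_le ?_
    exact le_iSup₂_of_le (some σ) (by simp) le_rfl

/-- The counts in the subsets of `D` are independent of the count in a set disjoint from `D`. -/
theorem indep_count_of_disjoint [IsProbabilityMeasure P] (hX : IsPoissonPointProcess X ν P)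
    {D B : Set E} (hD : MeasurableSet D) (hB : MeasurableSet B) (hDB : Disjoint D B) :
    Indep (⨆ A : {A : Set E // MeasurableSet A ∧ A ⊆ D},
        MeasurableSpace.comap (fun ω => (X ω ∩ A.1).encard) ⊤)
      (MeasurableSpace.comap (fun ω => (X ω ∩ B).encard) ⊤) P := by
  classical
  -- Finite subfamilies are directed, so independence passes to the generated `σ`-algebra.
  rw [iSup_eq_iSup_finset]
  refine indep_iSup_of_directed_le (fun F => hX.indep_finset_count hD hB hDB F) (fun F => ?_)
    (hX.measurable_count B hB).comap_le ?_
  · exact iSup₂_le fun A _ => (hX.measurable_count _ A.2.1).comap_le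
  · intro F F'
    exact ⟨F ∪ F', biSup_mono fun A hA => Finset.mem_union_left _ hA,
      biSup_mono fun A hA => Finset.mem_union_right _ hA⟩

end IsPoissonPointProcess

/-- The sets `a ∩ c` form a π-system that generates `m₁ ⊔ m₃`, and `P(a ∩ b ∩ c) = P(a ∩ b) P(c) =
P(a) P(b) P(c) = P(a ∩ c) P(b)`. Used with the past of one clock, a later count of it, and all other
clocks. -/
theorem indep_sup_of_indep_sup {Ω : Type*} {mΩ : MeasurableSpace Ω} {P : Measure Ω}
    [IsProbabilityMeasure P] {m₁ m₂ m₃ : MeasurableSpace Ω} (h₁ : m₁ ≤ mΩ) (h₂ : m₂ ≤ mΩ)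
    (h₃ : m₃ ≤ mΩ) (h12 : Indep m₁ m₂ P) (h123 : Indep (m₁ ⊔ m₂) m₃ P) :
    Indep (m₁ ⊔ m₃) m₂ P := by
  let π : Set (Set Ω) := {s | ∃ a c, MeasurableSet[m₁] a ∧ MeasurableSet[m₃] c ∧ s = a ∩ c}
  have hle : m₁ ⊔ m₃ ≤ MeasurableSpace.generateFrom π := by
    refine sup_le (fun a ha => ?_) (fun c hc => ?_)
    · exact MeasurableSpace.measurableSet_generateFrom
        ⟨a, Set.univ, ha, MeasurableSet.univ, by simp⟩
    · exact MeasurableSpace.measurableSet_generateFrom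
        ⟨Set.univ, c, MeasurableSet.univ, hc, by simp⟩
  have hgen : MeasurableSpace.generateFrom {s | MeasurableSet[m₂] s} = m₂ :=
    @MeasurableSpace.generateFrom_measurableSet _ m₂
  refine indep_of_indep_of_le_left ?_ hle
  rw [← hgen]
  refine IndepSets.indep' ?_ (fun s hs => h₂ _ hs) ?_ (@MeasurableSpace.isPiSystem_measurableSet _ m₂) ?_
  · rintro s ⟨a, c, ha, hc, rfl⟩
    exact (h₁ _ ha).inter (h₃ _ hc)
  · rintro s ⟨a, c, ha, hc, rfl⟩ s' ⟨a', c', ha', hc', rfl⟩ _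
    exact ⟨a ∩ a', c ∩ c', @MeasurableSet.inter _ m₁ _ _ ha ha', @MeasurableSet.inter _ m₃ _ _ hc hc',
      Set.inter_inter_inter_comm _ _ _ _⟩
  · rw [IndepSets_iff]
    rintro s b ⟨a, c, ha, hc, rfl⟩ hb
    have hb' : MeasurableSet[m₁ ⊔ m₂] b := le_sup_right (a := m₁) _ hb
    have ha' : MeasurableSet[m₁ ⊔ m₂] a := le_sup_left (b := m₂) _ ha
    rw [Set.inter_right_comm, (Indep_iff _ _ _).1 h123 _ _
      (@MeasurableSet.inter _ (m₁ ⊔ m₂) _ _ ha' hb') hc,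
      (Indep_iff _ _ _).1 h12 _ _ ha hb, (Indep_iff _ _ _).1 h123 _ _ ha' hc]
    ring

/-! ### The past of a family of Poisson clocks -/

/-- The `σ`-algebra generated by the points of all clocks up to time `t`. -/
@[reducible] noncomputable def clockPast {V Ω : Type*} (X : Mark V → Ω → Set (ℝ × ℝ)) (t : ℝ) :
    MeasurableSpace Ω :=
  ⨆ (m : Mark V) (A : {A : Set (ℝ × ℝ) // MeasurableSet A ∧ A ⊆ Set.Iic t ×ˢ Set.univ}),
    MeasurableSpace.comap (fun ω => (X m ω ∩ A.1).encard) ⊤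

/-- The `σ`-algebra generated by the points of one clock. -/
@[reducible] noncomputable def clockSigma {V Ω : Type*} (X : Mark V → Ω → Set (ℝ × ℝ))
    (m : Mark V) : MeasurableSpace Ω :=
  MeasurableSpace.comap (fun (ω : Ω) (A : {A : Set (ℝ × ℝ) // MeasurableSet A}) =>
      (X m ω ∩ A.1).encard) MeasurableSpace.pi

theorem clockPast_mono {V Ω : Type*} (X : Mark V → Ω → Set (ℝ × ℝ)) : Monotone (clockPast X) := by
  intro s t hst
  refine iSup_mono fun m => iSup_le fun A => ?_
  exact le_iSup (fun A : {A : Set (ℝ × ℝ) // MeasurableSet A ∧ A ⊆ Set.Iic t ×ˢ Set.univ} =>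
    MeasurableSpace.comap (fun ω => (X m ω ∩ A.1).encard) ⊤)
    ⟨A.1, A.2.1, A.2.2.trans (Set.prod_mono (Set.Iic_subset_Iic.2 hst) le_rfl)⟩

theorem measurable_clockPast_count {V Ω : Type*} (X : Mark V → Ω → Set (ℝ × ℝ)) {t : ℝ}
    (m : Mark V) {A : Set (ℝ × ℝ)} (hA : MeasurableSet A) (hAt : A ⊆ Set.Iic t ×ˢ Set.univ) :
    Measurable[clockPast X t] fun ω => (X m ω ∩ A).encard := by
  refine Measurable.of_comap_le ?_
  exact le_iSup_of_le m (le_iSup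
    (fun A : {A : Set (ℝ × ℝ) // MeasurableSet A ∧ A ⊆ Set.Iic t ×ˢ Set.univ} =>
    MeasurableSpace.comap (fun ω => (X m ω ∩ A.1).encard) ⊤) ⟨A, hA, hAt⟩)

namespace IsPoissonClocks

variable {V Ω : Type*} [MeasurableSpace Ω] {X : Mark V → Ω → Set (ℝ × ℝ)} {P : Measure Ω}

theorem clockPast_le (hX : IsPoissonClocks X P) (t : ℝ) : clockPast X t ≤ ‹MeasurableSpace Ω› :=
  iSup_le fun m => iSup_le fun A => ((hX.poisson m).measurable_count _ A.2.1).comap_le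

/-- The past up to `s` is independent of the count of a clock in a set of times after `s`. -/
theorem indep_clockPast [IsProbabilityMeasure P] (hX : IsPoissonClocks X P) {s : ℝ} (m : Mark V)
    {B : Set (ℝ × ℝ)} (hB : MeasurableSet B) (hBs : B ⊆ Set.Ioi s ×ˢ Set.univ) :
    Indep (clockPast X s) (MeasurableSpace.comap (fun ω => (X m ω ∩ B).encard) ⊤) P := by
  have hfull : ∀ m, clockSigma X m ≤ ‹MeasurableSpace Ω› := fun m =>
    (measurable_pi_lambda _ fun A => (hX.poisson m).measurable_count _ A.2).comap_le
  have hcount : ∀ (m : Mark V) (A : Set (ℝ × ℝ)), MeasurableSet A →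
      MeasurableSpace.comap (fun ω => (X m ω ∩ A).encard) ⊤ ≤ clockSigma X m := by
    intro m A hA
    refine Measurable.comap_le (m₁ := clockSigma X m) ?_
    exact (measurable_pi_apply (X := fun _ : {A : Set (ℝ × ℝ) // MeasurableSet A} => ℕ∞)
      ⟨A, hA⟩).comp (comap_measurable _)
  have hown : (⨆ A : {A : Set (ℝ × ℝ) // MeasurableSet A ∧ A ⊆ Set.Iic s ×ˢ Set.univ},
      MeasurableSpace.comap (fun ω => (X m ω ∩ A.1).encard) ⊤) ≤ clockSigma X m :=
    iSup_le fun A => hcount m _ A.2.1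
  -- Two sources of independence: disjoint time strips of the clock `m` itself, and, in `h3`, the
  -- clock `m` against all other clocks.
  have h12 := (hX.poisson m).indep_count_of_disjoint
    ((measurableSet_Iic (a := s)).prod MeasurableSet.univ) hB
      (Set.disjoint_left.2 fun x hx hx' => (Set.mem_Ioi.1 (hBs hx').1).not_ge (Set.mem_Iic.1 hx.1))
  have h3 := indep_iSup_of_disjoint hfull ((iIndepFun_iff_iIndep _ _ _).1 hX.indep)
    (S := {m}) (T := {m}ᶜ) (by simp)
  rw [iSup_singleton] at h3
  have h123 := indep_of_indep_of_le_left h3 (sup_le hown (hcount m B hB))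
  have key := indep_sup_of_indep_sup (hown.trans (hfull m)) ((hcount m B hB).trans (hfull m))
    (iSup₂_le fun m' _ => hfull m') h12 h123
  refine indep_of_indep_of_le_left key (iSup_le fun m' => ?_)
  by_cases hm : m' = m
  · subst hm
    exact le_sup_left
  · exact le_sup_of_le_right (le_iSup₂_of_le m' hm (iSup_le fun A => hcount m' _ A.2.1))

theorem _root_.restrict_Ioi_prod_Ioc_prod_Ioo {a b c : ℝ} (ha : 0 ≤ a) :
    ((volume : Measure (ℝ × ℝ)).restrict (Set.Ioi 0 ×ˢ Set.Ioi 0))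
      (Set.Ioc a b ×ˢ Set.Ioo 0 c) = ENNReal.ofReal c * ENNReal.ofReal (b - a) := by
  rw [Measure.restrict_apply (measurableSet_Ioc.prod measurableSet_Ioo),
    Set.inter_eq_left.2 (show Set.Ioc a b ×ˢ Set.Ioo 0 c ⊆ Set.Ioi (0 : ℝ) ×ˢ Set.Ioi (0 : ℝ) from
      Set.prod_mono (fun x hx => ha.trans_lt hx.1) fun x hx => hx.1),
    Measure.volume_eq_prod, Measure.prod_prod, Real.volume_Ioc, Real.volume_Ioo, sub_zero,
    mul_comm]

theorem lintegral_count_Ioc (hX : IsPoissonClocks X P) (m : Mark V)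
    {a b c : ℝ} (ha : 0 ≤ a) :
    ∫⁻ ω, ((X m ω ∩ Set.Ioc a b ×ˢ Set.Ioo 0 c).encard : ℝ≥0∞) ∂P =
      ENNReal.ofReal c * ENNReal.ofReal (b - a) := by
  rw [(hX.poisson m).lintegral_count (measurableSet_Ioc.prod measurableSet_Ioo)] <;>
    rw [restrict_Ioi_prod_Ioc_prod_Ioo ha]
  exact ENNReal.mul_ne_top ENNReal.ofReal_ne_top ENNReal.ofReal_ne_top

/-- The compensation formula for one time cell: `A` is known at time `a` and the points are later
than `a`. -/
theorem setLIntegral_count_Ioc [IsProbabilityMeasure P] (hX : IsPoissonClocks X P) (m : Mark V)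
    {a b c : ℝ} (ha : 0 ≤ a) {A : Set Ω} (hA : MeasurableSet[clockPast X a] A) :
    ∫⁻ ω in A, ((X m ω ∩ Set.Ioc a b ×ˢ Set.Ioo 0 c).encard : ℝ≥0∞) ∂P =
      P A * (ENNReal.ofReal c * ENNReal.ofReal (b - a)) := by
  have hA' := hX.clockPast_le a A hA
  have hm : MeasurableSet (Set.Ioc a b ×ˢ Set.Ioo 0 c) := measurableSet_Ioc.prod measurableSet_Ioo
  have h := lintegral_mul_eq_lintegral_mul_lintegral_of_independent_measurableSpace (μ := P)
    (f := A.indicator fun _ => 1)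
    (g := fun ω => ((X m ω ∩ Set.Ioc a b ×ˢ Set.Ioo 0 c).encard : ℝ≥0∞))
    (hX.clockPast_le a) ((hX.poisson m).measurable_count _ hm).comap_le
    (hX.indep_clockPast m hm (Set.prod_mono (fun x hx => hx.1) (Set.subset_univ _)))
    (measurable_const.indicator hA)
    (Measurable.comp (by measurability : Measurable fun k : ℕ∞ => (k : ℝ≥0∞))
      (comap_measurable _))
  rw [hX.lintegral_count_Ioc m ha, lintegral_indicator_const hA', one_mul] at h
  rw [← h, ← lintegral_indicator hA']
  refine lintegral_congr fun ω => ?_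
  by_cases hω : ω ∈ A <;> simp [hω]

/-- Clocks remain Poisson clocks on the completed probability space. -/
theorem completion (hX : IsPoissonClocks X P) :
    @IsPoissonClocks V Ω (completedSigma P) X (completedMeasure P) := by
  have hle : ‹MeasurableSpace Ω› ≤ completedSigma P := fun s hs => hs.nullMeasurableSet
  refine @IsPoissonClocks.mk V Ω (completedSigma P) X (completedMeasure P) (fun m => ?_) ?_
  · refine @isPoisson_of_counts Ω _ (completedSigma P) _ _ _ (completedMeasure P) (fun A hA => ?_)
      (fun A hA hν => ?_) (fun n A hA hd => ?_)
    · exact ((hX.poisson m).measurable_count A hA).mono hle le_rfl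
    · rw [← (hX.poisson m).law_count A hA hν]
      refine Measure.ext fun B hB => ?_
      rw [Measure.map_apply ((hX.poisson m).measurable_count A hA) hB,
        @Measure.map_apply _ _ (completedSigma P) _ (completedMeasure P) _
        (((hX.poisson m).measurable_count A hA).mono hle le_rfl) _ hB]
      rfl
    · have h := (hX.poisson m).indep_count n A hA hd
      rw [iIndepFun_iff_measure_inter_preimage_eq_mul] at h ⊢
      exact h
  · have h := hX.indep
    rw [iIndepFun_iff_measure_inter_preimage_eq_mul] at h ⊢
    exact h

open scoped Classical in
/-- Changing the clocks on a null set. -/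
theorem modify [P.IsComplete] (hX : IsPoissonClocks X P) {S : Set Ω} (hS : ∀ᵐ ω ∂P, ω ∈ S)
    (ω₀ : Ω) : IsPoissonClocks (fun m ω => if ω ∈ S then X m ω else X m ω₀) P := by
  have hcongr : ∀ (m : Mark V) (A : Set (ℝ × ℝ)),
      (fun ω => (X m ω ∩ A).encard) =ᵐ[P]
        fun ω => ((if ω ∈ S then X m ω else X m ω₀) ∩ A).encard := by
    intro m A
    filter_upwards [hS] with ω hω
    simp [hω]
  refine ⟨fun m => ⟨fun A hA => ?_, fun A hA hν => ?_, fun n A hA hd => ?_⟩, ?_⟩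
  · exact ((hX.poisson m).measurable_count A hA).congr_ae (hcongr m A)
  · rw [← (hX.poisson m).law_count A hA hν]
    exact Measure.map_congr (hcongr m A).symm
  · exact ((hX.poisson m).indep_count n A hA hd).congr fun i => hcongr m _
  · refine hX.indep.congr fun m => ?_
    filter_upwards [hS] with ω hω
    simp [hω]

end IsPoissonClocks

/-! ### The compensation formula -/

/-- The left neighbour of `r` in the grid of mesh `1 / (n + 1)`. -/
noncomputable def leftGrid (n : ℕ) (r : ℝ) : ℝ := ((⌈((n : ℝ) + 1) * r⌉₊ - 1 : ℕ) : ℝ) / (n + 1)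

theorem ceil_eq_iff_mem_Ioc (n k : ℕ) (r : ℝ) :
    ⌈((n : ℝ) + 1) * r⌉₊ = k + 1 ↔ r ∈ Set.Ioc ((k : ℝ) / (n + 1)) ((k + 1 : ℝ) / (n + 1)) := by
  have hn : (0 : ℝ) < n + 1 := by positivity
  rw [Nat.ceil_eq_iff (by omega), Set.mem_Ioc, div_lt_iff₀ hn, le_div_iff₀ hn]
  push_cast
  simp [mul_comm]

theorem leftGrid_of_mem {n k : ℕ} {r : ℝ}
    (h : r ∈ Set.Ioc ((k : ℝ) / (n + 1)) ((k + 1 : ℝ) / (n + 1))) :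
    leftGrid n r = k / (n + 1) := by
  rw [leftGrid, (ceil_eq_iff_mem_Ioc n k r).2 h, Nat.add_sub_cancel]

theorem exists_mem_Ioc_grid (n : ℕ) {r : ℝ} (hr : 0 < r) :
    ∃ k : ℕ, r ∈ Set.Ioc ((k : ℝ) / (n + 1)) ((k + 1 : ℝ) / (n + 1)) := by
  have h : 0 < ⌈((n : ℝ) + 1) * r⌉₊ := Nat.ceil_pos.2 (by positivity)
  exact ⟨⌈((n : ℝ) + 1) * r⌉₊ - 1, (ceil_eq_iff_mem_Ioc n _ r).1 (by omega)⟩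

/-- The inequality is strict even at grid points, because the cells are open on the left; hence
values along the grid see the left limit and never a jump at `r` itself. -/
theorem leftGrid_lt (n : ℕ) {r : ℝ} (hr : 0 < r) : leftGrid n r < r := by
  obtain ⟨k, hk⟩ := exists_mem_Ioc_grid n hr
  rw [leftGrid_of_mem hk]
  exact hk.1

theorem sub_le_leftGrid (n : ℕ) {r : ℝ} (hr : 0 < r) : r - 1 / (n + 1) ≤ leftGrid n r := by
  obtain ⟨k, hk⟩ := exists_mem_Ioc_grid n hr
  rw [leftGrid_of_mem hk]
  have := hk.2
  rw [add_div] at this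
  linarith

theorem tendsto_leftGrid {r : ℝ} (hr : 0 < r) :
    Tendsto (fun n => leftGrid n r) atTop (𝓝[<] r) := by
  refine tendsto_nhdsWithin_iff.2 ⟨?_, Eventually.of_forall fun n => leftGrid_lt n hr⟩
  refine tendsto_of_tendsto_of_tendsto_of_le_of_le (g := fun n : ℕ => r - 1 / ((n : ℝ) + 1))
    ?_ tendsto_const_nhds (fun n => sub_le_leftGrid n hr) fun n => (leftGrid_lt n hr).le
  simpa using (tendsto_const_nhds (x := r)).sub tendsto_one_div_add_atTop_nhds_zero_nat

/-- If `D` has left limits `Dm` along every path then the latter are jointly measurable. -/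
theorem measurableSet_leftLim {Ω : Type*} [MeasurableSpace Ω] {D Dm : ℝ → Set Ω}
    (hD : ∀ r, 0 ≤ r → MeasurableSet (D r))
    (hleft : ∀ ω, ∀ r, 0 < r → ∀ᶠ r' in 𝓝[<] r, (ω ∈ D r' ↔ ω ∈ Dm r)) :
    MeasurableSet {p : ℝ × Ω | 0 < p.1 ∧ p.2 ∈ Dm p.1} := by
  have h1 : ∀ n : ℕ, MeasurableSet {p : ℝ × Ω | p.2 ∈ D (leftGrid n p.1)} := by
    intro n
    have : {p : ℝ × Ω | p.2 ∈ D (leftGrid n p.1)} =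
        ⋃ k : ℕ, {r : ℝ | ⌈((n : ℝ) + 1) * r⌉₊ = k} ×ˢ D (((k - 1 : ℕ) : ℝ) / (n + 1)) := by
      ext p
      simp only [Set.mem_ofPred_eq, Set.mem_iUnion, Set.mem_prod]
      constructor
      · intro h
        exact ⟨_, rfl, h⟩
      · rintro ⟨k, hk, h⟩
        rw [leftGrid, hk]
        exact h
    rw [this]
    refine MeasurableSet.iUnion fun k => MeasurableSet.prod ?_ (hD _ (by positivity))
    exact (Nat.measurable_ceil.comp (measurable_const_mul ((n : ℝ) + 1))) (measurableSet_singleton k)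
  -- Membership in the left limit is eventual membership along the left grid points.
  have h2 : {p : ℝ × Ω | 0 < p.1 ∧ p.2 ∈ Dm p.1} = {p : ℝ × Ω | 0 < p.1} ∩
      ⋃ N : ℕ, ⋂ n : ℕ, {p : ℝ × Ω | N ≤ n → p.2 ∈ D (leftGrid n p.1)} := by
    ext p
    simp only [Set.mem_ofPred_eq, Set.mem_inter_iff, Set.mem_iUnion, Set.mem_iInter]
    refine and_congr_right fun hp => ?_
    have h := (tendsto_leftGrid hp).eventually (hleft p.2 p.1 hp)
    obtain ⟨N, hN⟩ := eventually_atTop.1 h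
    constructor
    · exact fun hm => ⟨N, fun n hn => (hN n hn).2 hm⟩
    · rintro ⟨N', hN'⟩
      exact (hN (max N N') (le_max_left _ _)).1 (hN' _ (le_max_right _ _))
  rw [h2]
  refine (measurableSet_lt measurable_const measurable_fst).inter
    (MeasurableSet.iUnion fun N => MeasurableSet.iInter fun n => ?_)
  by_cases hNn : N ≤ n
  · simpa [hNn] using h1 n
  · simp [hNn]

theorem measurable_indicator_leftGrid {Ω : Type*} (D : ℝ → Set Ω) (n : ℕ) (ω : Ω) :
    Measurable fun r : ℝ => (D (leftGrid n r)).indicator (1 : Ω → ℝ≥0∞) ω := by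
  have h : (fun r : ℝ => (D (leftGrid n r)).indicator (1 : Ω → ℝ≥0∞) ω) =
      (fun k : ℕ => (D (((k - 1 : ℕ) : ℝ) / (n + 1))).indicator (1 : Ω → ℝ≥0∞) ω) ∘
        fun r => ⌈((n : ℝ) + 1) * r⌉₊ := by
    funext r
    simp [leftGrid]
  rw [h]
  exact (Measurable.of_discrete).comp (Nat.measurable_ceil.comp (measurable_const_mul _))

theorem iUnion_Ioc_grid (n T : ℕ) :
    (⋃ k ∈ Finset.range ((n + 1) * T),
      Set.Ioc ((k : ℝ) / (n + 1)) ((k + 1 : ℝ) / (n + 1))) = Set.Ioc (0 : ℝ) T := by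
  have hn : (0 : ℝ) < n + 1 := by positivity
  ext r
  simp only [Set.mem_iUnion, Finset.mem_range, exists_prop]
  constructor
  · rintro ⟨k, hk, h⟩
    refine ⟨lt_of_le_of_lt (by positivity) h.1, h.2.trans ?_⟩
    rw [div_le_iff₀ hn]
    have : (k + 1 : ℕ) ≤ (n + 1) * T := hk
    have h' : ((k + 1 : ℕ) : ℝ) ≤ (((n + 1) * T : ℕ) : ℝ) := by exact_mod_cast this
    push_cast at h'
    linarith
  · intro h
    obtain ⟨k, hk⟩ := exists_mem_Ioc_grid n h.1
    refine ⟨k, ?_, hk⟩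
    have h1 : (k : ℝ) / (n + 1) < T := hk.1.trans_le h.2
    rw [div_lt_iff₀ hn] at h1
    have : (k : ℝ) < (((n + 1) * T : ℕ) : ℝ) := by push_cast; linarith
    exact_mod_cast this

theorem pairwise_disjoint_Ioc_grid (n : ℕ) : Pairwise (Function.onFun Disjoint
    fun k : ℕ => Set.Ioc ((k : ℝ) / (n + 1)) ((k + 1 : ℝ) / (n + 1))) := by
  intro k l hkl
  refine Set.disjoint_left.2 fun r hr hr' => hkl ?_
  have h1 := (ceil_eq_iff_mem_Ioc n k r).2 hr
  have h2 := (ceil_eq_iff_mem_Ioc n l r).2 hr'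
  omega

theorem lintegral_indicator_leftGrid {Ω : Type*} (D : ℝ → Set Ω) (n T : ℕ) (ω : Ω) :
    ∫⁻ r in Set.Ioc (0 : ℝ) T, (D (leftGrid n r)).indicator (1 : Ω → ℝ≥0∞) ω =
      ∑ k ∈ Finset.range ((n + 1) * T), (D ((k : ℝ) / (n + 1))).indicator (1 : Ω → ℝ≥0∞) ω *
        ENNReal.ofReal (1 / (n + 1)) := by
  rw [← iUnion_Ioc_grid n T, lintegral_biUnion_finset
    (fun k _ l _ h => pairwise_disjoint_Ioc_grid n h) (fun k _ => measurableSet_Ioc)]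
  refine Finset.sum_congr rfl fun k _ => ?_
  rw [setLIntegral_congr_fun (g := fun _ => (D ((k : ℝ) / (n + 1))).indicator (1 : Ω → ℝ≥0∞) ω)
    measurableSet_Ioc (fun r hr => by simp only [leftGrid_of_mem hr]), setLIntegral_const,
    Real.volume_Ioc, ← sub_div]
  simp

/-- On a cell the left grid point is constant, so the count splits into terms of the form "event at
the left end, number of points in the cell", which is the shape needed for independence. -/
theorem encard_leftGrid {Ω : Type*} (D : ℝ → Set Ω) (S : Ω → Set (ℝ × ℝ)) (n T : ℕ) (U : Set ℝ)
    (ω : Ω) :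
    (({p ∈ S ω ∩ Set.Ioc (0 : ℝ) T ×ˢ U | ω ∈ D (leftGrid n p.1)}.encard : ℕ∞) : ℝ≥0∞) =
      ∑ k ∈ Finset.range ((n + 1) * T), (D ((k : ℝ) / (n + 1))).indicator
        (fun ω => ((S ω ∩ Set.Ioc ((k : ℝ) / (n + 1)) ((k + 1 : ℝ) / (n + 1)) ×ˢ U).encard :
          ℝ≥0∞)) ω := by
  have h : {p ∈ S ω ∩ Set.Ioc (0 : ℝ) T ×ˢ U | ω ∈ D (leftGrid n p.1)} =
      ⋃ k ∈ (Finset.range ((n + 1) * T) : Set ℕ),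
        {p ∈ S ω ∩ Set.Ioc ((k : ℝ) / (n + 1)) ((k + 1 : ℝ) / (n + 1)) ×ˢ U |
          ω ∈ D ((k : ℝ) / (n + 1))} := by
    ext p
    rw [← iUnion_Ioc_grid n T]
    simp only [Set.mem_ofPred_eq, Set.mem_inter_iff, Set.mem_prod, Set.mem_iUnion, exists_prop,
      Finset.mem_coe]
    constructor
    · rintro ⟨⟨hS, ⟨k, hk, hp⟩, hU⟩, hD⟩
      exact ⟨k, hk, ⟨hS, hp, hU⟩, by rwa [leftGrid_of_mem hp] at hD⟩
    · rintro ⟨k, hk, ⟨hS, hp, hU⟩, hD⟩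
      exact ⟨⟨hS, ⟨k, hk, hp⟩, hU⟩, by rwa [leftGrid_of_mem hp]⟩
  rw [h, Set.Finite.encard_biUnion (Finset.finite_toSet _), finsum_mem_coe_finset]
  · rw [← ENat.toENNRealRingHom_apply, map_sum]
    refine Finset.sum_congr rfl fun k _ => ?_
    by_cases hD : ω ∈ D ((k : ℝ) / (n + 1))
    · simp only [hD, and_true, Set.indicator_of_mem, ENat.toENNRealRingHom_apply]
      rfl
    · simp [hD]
  · intro k _ l _ hkl
    refine Set.disjoint_left.2 fun p hp hp' => ?_
    exact Set.disjoint_left.1 (pairwise_disjoint_Ioc_grid n hkl) hp.1.2.1 hp'.1.2.1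

theorem IsPoissonClocks.measurable_toENNReal_count {V Ω : Type*} [MeasurableSpace Ω]
    {X : Mark V → Ω → Set (ℝ × ℝ)} {P : Measure Ω} (hX : IsPoissonClocks X P) (m : Mark V)
    {A : Set (ℝ × ℝ)} (hA : MeasurableSet A) :
    Measurable fun ω => ((X m ω ∩ A).encard : ℝ≥0∞) :=
  (by measurability : Measurable fun k : ℕ∞ => (k : ℝ≥0∞)).comp
    ((hX.poisson m).measurable_count A hA)

theorem IsPoissonClocks.ae_finite_count {V Ω : Type*} [MeasurableSpace Ω]
    {X : Mark V → Ω → Set (ℝ × ℝ)} {P : Measure Ω} (hX : IsPoissonClocks X P) (m : Mark V)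
    (T c : ℝ) : ∀ᵐ ω ∂P, (X m ω ∩ Set.Ioc 0 T ×ˢ Set.Ioo 0 c).Finite := by
  have hfin : ∫⁻ ω, ((X m ω ∩ Set.Ioc (0 : ℝ) T ×ˢ Set.Ioo 0 c).encard : ℝ≥0∞) ∂P ≠ ∞ := by
    rw [hX.lintegral_count_Ioc m le_rfl]
    exact ENNReal.mul_ne_top ENNReal.ofReal_ne_top ENNReal.ofReal_ne_top
  filter_upwards [ae_lt_top (hX.measurable_toENNReal_count m
    (measurableSet_Ioc.prod measurableSet_Ioo)) hfin] with ω hω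
  rw [ENat.toENNReal_lt_top] at hω
  exact Set.encard_lt_top_iff.1 hω

theorem IsPoissonClocks.measurable_encard_leftGrid {V Ω : Type*} [MeasurableSpace Ω]
    {X : Mark V → Ω → Set (ℝ × ℝ)} {P : Measure Ω} (hX : IsPoissonClocks X P) (T : ℕ)
    {D : ℝ → Set Ω} (hD : ∀ r, 0 ≤ r → MeasurableSet (D r)) (m : Mark V) (c : ℝ) (n : ℕ) :
    Measurable fun ω => (({p ∈ X m ω ∩ Set.Ioc (0 : ℝ) T ×ˢ Set.Ioo 0 c |
      ω ∈ D (leftGrid n p.1)}.encard : ℕ∞) : ℝ≥0∞) := by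
  simp_rw [encard_leftGrid D (X m)]
  refine Finset.measurable_fun_sum _ fun k _ => ?_
  exact (hX.measurable_toENNReal_count m (measurableSet_Ioc.prod measurableSet_Ioo)).indicator
    (hD _ (by positivity))

/-- Only finitely many points matter, so one mesh is fine enough for all of them and the sequence is
eventually constant. -/
theorem tendsto_encard_leftGrid {Ω : Type*} {D Dm : ℝ → Set Ω} {ω : Ω}
    (hleft : ∀ r, 0 < r → ∀ᶠ r' in 𝓝[<] r, (ω ∈ D r' ↔ ω ∈ Dm r)) {S : Set (ℝ × ℝ)}
    (hS : S.Finite) (hpos : ∀ p ∈ S, 0 < p.1) :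
    Tendsto (fun n => (({p ∈ S | ω ∈ D (leftGrid n p.1)}.encard : ℕ∞) : ℝ≥0∞)) atTop
      (𝓝 (({p ∈ S | ω ∈ Dm p.1}.encard : ℕ∞) : ℝ≥0∞)) := by
  refine tendsto_const_nhds.congr' ?_
  have h : ∀ᶠ n : ℕ in atTop, ∀ p ∈ S, (ω ∈ D (leftGrid n p.1) ↔ ω ∈ Dm p.1) :=
    (eventually_all_finite hS).2 fun p hp =>
      (tendsto_leftGrid (hpos p hp)).eventually (hleft p.1 (hpos p hp))
  filter_upwards [h] with n hn
  congr 2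
  ext p
  exact and_congr_right fun hp => (hn p hp).symm

theorem IsPoissonClocks.aemeasurable_encard_leftLim {V Ω : Type*} [MeasurableSpace Ω]
    {X : Mark V → Ω → Set (ℝ × ℝ)} {P : Measure Ω} (hX : IsPoissonClocks X P) (T : ℕ)
    {D Dm : ℝ → Set Ω} (hD : ∀ r, 0 ≤ r → MeasurableSet (D r))
    (hleft : ∀ ω, ∀ r, 0 < r → ∀ᶠ r' in 𝓝[<] r, (ω ∈ D r' ↔ ω ∈ Dm r)) (m : Mark V) (c : ℝ) :
    AEMeasurable (fun ω => (({p ∈ X m ω ∩ Set.Ioc (0 : ℝ) T ×ˢ Set.Ioo 0 c |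
      ω ∈ Dm p.1}.encard : ℕ∞) : ℝ≥0∞)) P := by
  refine aemeasurable_of_tendsto_metrizable_ae atTop
    (fun n => (hX.measurable_encard_leftGrid T hD m c n).aemeasurable) ?_
  filter_upwards [hX.ae_finite_count m T c] with ω hω
  exact tendsto_encard_leftGrid (hleft ω) hω fun p hp => hp.2.1.1

/-- The compensation formula for the points of a clock and an adapted set-valued process with
left limits. -/
theorem IsPoissonClocks.compensation {V Ω : Type*} [MeasurableSpace Ω]
    {X : Mark V → Ω → Set (ℝ × ℝ)} {P : Measure Ω} [IsProbabilityMeasure P]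
    (hX : IsPoissonClocks X P) (T : ℕ) {D Dm : ℝ → Set Ω}
    (hD : ∀ r, 0 ≤ r → MeasurableSet[clockPast X r] (D r))
    (hleft : ∀ ω, ∀ r, 0 < r → ∀ᶠ r' in 𝓝[<] r, (ω ∈ D r' ↔ ω ∈ Dm r))
    (m : Mark V) (c : ℝ) :
    ∫⁻ ω, (({p ∈ X m ω ∩ Set.Ioc (0 : ℝ) T ×ˢ Set.Ioo 0 c | ω ∈ Dm p.1}.encard : ℕ∞) : ℝ≥0∞) ∂P =
      ENNReal.ofReal c *
        ∫⁻ ω, (∫⁻ r in Set.Ioc (0 : ℝ) T, (Dm r).indicator (1 : Ω → ℝ≥0∞) ω) ∂P := by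
  have hDm : ∀ r, 0 ≤ r → MeasurableSet (D r) := fun r hr => hX.clockPast_le r _ (hD r hr)
  have hmeas := fun A hA => hX.measurable_toENNReal_count m (A := A) hA
  have hbox : ∀ a b : ℝ, MeasurableSet (Set.Ioc a b ×ˢ Set.Ioo 0 c) :=
    fun a b => measurableSet_Ioc.prod measurableSet_Ioo
  have hfin : ∫⁻ ω, ((X m ω ∩ Set.Ioc (0 : ℝ) T ×ˢ Set.Ioo 0 c).encard : ℝ≥0∞) ∂P ≠ ∞ := by
    rw [hX.lintegral_count_Ioc m le_rfl]
    exact ENNReal.mul_ne_top ENNReal.ofReal_ne_top ENNReal.ofReal_ne_top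
  -- Domination by the total number of points in the box, which has finite expectation.
  have lim1 : Tendsto (fun n : ℕ => ∫⁻ ω, (({p ∈ X m ω ∩ Set.Ioc (0 : ℝ) T ×ˢ Set.Ioo 0 c |
      ω ∈ D (leftGrid n p.1)}.encard : ℕ∞) : ℝ≥0∞) ∂P) atTop
      (𝓝 (∫⁻ ω, (({p ∈ X m ω ∩ Set.Ioc (0 : ℝ) T ×ˢ Set.Ioo 0 c | ω ∈ Dm p.1}.encard : ℕ∞) :
        ℝ≥0∞) ∂P)) := by
    refine tendsto_lintegral_of_dominated_convergence
      (fun ω => ((X m ω ∩ Set.Ioc (0 : ℝ) T ×ˢ Set.Ioo 0 c).encard : ℝ≥0∞)) (fun n =>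
        hX.measurable_encard_leftGrid T hDm m c n)
      (fun n => Eventually.of_forall fun ω => ?_) hfin ?_
    · exact ENat.toENNReal_mono (Set.encard_le_encard (Set.sep_subset _ _))
    · filter_upwards [hX.ae_finite_count m T c] with ω hω
      exact tendsto_encard_leftGrid (hleft ω) hω fun p hp => hp.2.1.1
  have lim2 : Tendsto (fun n : ℕ => ∫⁻ ω, (∫⁻ r in Set.Ioc (0 : ℝ) T,
      (D (leftGrid n r)).indicator (1 : Ω → ℝ≥0∞) ω) ∂P) atTop
      (𝓝 (∫⁻ ω, (∫⁻ r in Set.Ioc (0 : ℝ) T, (Dm r).indicator (1 : Ω → ℝ≥0∞) ω) ∂P)) := by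
    have hle : ∀ (B : Set Ω) ω, B.indicator (1 : Ω → ℝ≥0∞) ω ≤ 1 := fun B ω =>
      Set.indicator_le_self' (by simp) ω
    refine tendsto_lintegral_of_dominated_convergence
      (fun ω => ∫⁻ r in Set.Ioc (0 : ℝ) T, 1) (fun n => ?_)
      (fun n => Eventually.of_forall fun ω => lintegral_mono fun r => hle _ _) (by simp)
      (Eventually.of_forall fun ω => ?_)
    · simp_rw [lintegral_indicator_leftGrid]
      exact Finset.measurable_fun_sum _ fun k _ =>
        (measurable_const.indicator (hDm _ (by positivity))).mul_const _
    · refine tendsto_lintegral_of_dominated_convergence (fun _ => 1)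
        (fun n => measurable_indicator_leftGrid D n ω)
        (fun n => Eventually.of_forall fun r => hle _ _) (by simp) ?_
      filter_upwards [ae_restrict_mem measurableSet_Ioc] with r hr
      refine tendsto_const_nhds.congr' ?_
      filter_upwards [(tendsto_leftGrid hr.1).eventually (hleft ω r hr.1)] with n hn
      by_cases h : ω ∈ Dm r
      · simp [h, hn.2 h]
      · simp [h, mt hn.1 h]
  refine tendsto_nhds_unique lim1 ?_
  -- For a fixed grid the two sides agree cell by cell, by independence of the future from `D` at
  -- the left end.
  refine (ENNReal.Tendsto.const_mul lim2 (Or.inr ENNReal.ofReal_ne_top)).congr fun n => ?_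
  simp_rw [encard_leftGrid D (X m), lintegral_indicator_leftGrid]
  rw [lintegral_finsetSum _ fun k _ => ((measurable_one.indicator
      (hDm _ (by positivity))).mul_const _), lintegral_finsetSum _ fun k _ =>
      ((hmeas _ (hbox _ _)).indicator (hDm _ (by positivity))), Finset.mul_sum]
  refine Finset.sum_congr rfl fun k _ => ?_
  have hk : (0 : ℝ) ≤ (k : ℝ) / (n + 1) := by positivity
  rw [lintegral_indicator (hDm _ hk), hX.setLIntegral_count_Ioc m hk (hD _ hk),
    lintegral_mul_const _ (measurable_one.indicator (hDm _ hk)), lintegral_indicator_one (hDm _ hk),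
    ← sub_div, add_sub_cancel_left]
  ring

/-! ### Jump paths driven by point configurations -/

/-- At the infimum of the exceptional set `p` holds by the left clause, and the right clause carries
it beyond the infimum, a contradiction. -/
theorem real_induction {a : ℝ} {p : ℝ → Prop} (h0 : p a)
    (hr : ∀ t, a ≤ t → p t → ∀ᶠ t' in 𝓝[>] t, p t')
    (hl : ∀ t, a < t → (∀ t', a ≤ t' → t' < t → p t') → p t) : ∀ t, a ≤ t → p t := by
  intro t ht
  by_contra hpt
  let B : Set ℝ := {t | a ≤ t ∧ ¬ p t}
  have hB : B.Nonempty := ⟨t, ht, hpt⟩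
  have hbdd : BddBelow B := ⟨a, fun x hx => hx.1⟩
  have hab : a ≤ sInf B := le_csInf hB fun x hx => hx.1
  have hlt : ∀ t', a ≤ t' → t' < sInf B → p t' := by
    intro t' h1 h2
    by_contra h3
    exact not_lt.2 (csInf_le hbdd ⟨h1, h3⟩) h2
  have hb : p (sInf B) := by
    rcases hab.eq_or_lt with h | h
    · rw [← h]; exact h0
    · exact hl _ h hlt
  obtain ⟨c, hc, hcp⟩ := (mem_nhdsGT_iff_exists_Ioo_subset).1 (hr _ hab hb)
  obtain ⟨x, hx, hxc⟩ := exists_lt_of_csInf_lt hB (Set.mem_Ioi.1 hc)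
  rcases (csInf_le hbdd hx).eq_or_lt with h | h
  · exact hx.2 (h ▸ hb)
  · exact hx.2 (hcp ⟨h, hxc⟩)

section JumpPath

variable {V E : Type*}

/-- The clock with mark `m` has a point at `(r, u)` that lies below the rate in the state `e`. -/
def Fires (X : Mark V → Set (ℝ × ℝ)) (R : Mark V → E → ℝ) (e : E) (m : Mark V) (r u : ℝ) : Prop :=
  (r, u) ∈ X m ∧ 0 < u ∧ u < R m e

/-- A right-continuous path `z` with left limits `zm` whose jumps are those prescribed by the
clocks. -/
structure IsJumpPath (X : Mark V → Set (ℝ × ℝ)) (R : Mark V → E → ℝ) (Γ : Mark V → E → E) (s : ℝ)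
    (z zm : ℝ → E) : Prop where
  right : ∀ t, s ≤ t → ∀ᶠ t' in 𝓝[>] t, z t' = z t
  left : ∀ t, s < t → ∀ᶠ t' in 𝓝[<] t, z t' = zm t
  stay : ∀ t, s < t → (∀ m u, ¬ Fires X R (zm t) m t u) → z t = zm t
  jump : ∀ t, s < t → ∀ m u, Fires X R (zm t) m t u → z t = Γ m (zm t)

/-- No two points of the clocks have the same time. -/
def ClocksSimple (X : Mark V → Set (ℝ × ℝ)) : Prop :=
  ∀ m m' r u u', 0 < r → 0 < u → 0 < u' → (r, u) ∈ X m → (r, u') ∈ X m' → m = m' ∧ u = u'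

/-- For each state only finitely many points lie below the rates in a bounded time interval. -/
def ClocksFinite (X : Mark V → Set (ℝ × ℝ)) (R : Mark V → E → ℝ) : Prop :=
  ∀ (e : E) (T : ℝ), {q : Mark V × ℝ × ℝ | 0 < q.2.1 ∧ q.2.1 ≤ T ∧
    Fires X R e q.1 q.2.1 q.2.2}.Finite

variable {X : Mark V → Set (ℝ × ℝ)} {R : Mark V → E → ℝ} {Γ : Mark V → E → E}

theorem ClocksFinite.times (hF : ClocksFinite X R) (e : E) (T : ℝ) :
    {r : ℝ | 0 < r ∧ r ≤ T ∧ ∃ m u, Fires X R e m r u}.Finite := by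
  refine ((hF e T).image fun q => q.2.1).subset ?_
  rintro r ⟨h0, hT, m, u, h⟩
  exact ⟨(m, r, u), ⟨h0, hT, h⟩, rfl⟩

/-- The firing times for a fixed state are finite in number, so after removing `t` they keep a
positive distance from `t`. -/
theorem ClocksFinite.eventually_right (hF : ClocksFinite X R) (e : E) {t : ℝ} (ht : 0 ≤ t) :
    ∀ᶠ t' in 𝓝[>] t, ∀ r, t < r → r ≤ t' → ∀ m u, ¬ Fires X R e m r u := by
  have h1 : ({r : ℝ | 0 < r ∧ r ≤ t + 1 ∧ ∃ m u, Fires X R e m r u} \ {t})ᶜ ∈ 𝓝 t :=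
    ((hF.times e (t + 1)).sdiff).isClosed.isOpen_compl.mem_nhds (by simp)
  obtain ⟨ε, hε, hball⟩ := Metric.mem_nhds_iff.1 h1
  have h2 : Set.Ioo t (t + min ε 1) ∈ 𝓝[>] t := Ioo_mem_nhdsGT (by linarith [lt_min hε one_pos])
  filter_upwards [h2] with t' ht' r hr hrt m u hfire
  have hmin1 := min_le_left ε 1
  have hmin2 := min_le_right ε 1
  have hr' : r ∈ Metric.ball t ε := by
    rw [Metric.mem_ball, Real.dist_eq, abs_of_pos (by linarith)]
    linarith [ht'.2]
  exact hball hr' ⟨⟨by linarith, by linarith [ht'.2], m, u, hfire⟩, by simpa using hr.ne'⟩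

theorem ClocksFinite.eventually_left (hF : ClocksFinite X R) (e : E) {t : ℝ} (ht : 0 < t) :
    ∀ᶠ t' in 𝓝[<] t, ∀ r, t' ≤ r → r < t → ∀ m u, ¬ Fires X R e m r u := by
  have h1 : ({r : ℝ | 0 < r ∧ r ≤ t ∧ ∃ m u, Fires X R e m r u} \ {t})ᶜ ∈ 𝓝 t :=
    ((hF.times e t).sdiff).isClosed.isOpen_compl.mem_nhds (by simp)
  obtain ⟨ε, hε, hball⟩ := Metric.mem_nhds_iff.1 h1
  have h2 : Set.Ioo (t - min ε t) t ∈ 𝓝[<] t := Ioo_mem_nhdsLT (by linarith [lt_min hε ht])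
  filter_upwards [h2] with t' ht' r hr hrt m u hfire
  have hmin1 := min_le_left ε t
  have hmin2 := min_le_right ε t
  have hr' : r ∈ Metric.ball t ε := by
    rw [Metric.mem_ball, Real.dist_eq, abs_of_neg (by linarith)]
    linarith [ht'.1]
  exact hball hr' ⟨⟨by linarith [ht'.1], hrt.le, m, u, hfire⟩, by simpa using hrt.ne⟩

namespace IsJumpPath

variable {s : ℝ} {z zm : ℝ → E}

theorem leftLim_eq (hz : IsJumpPath X R Γ s z zm) {a t : ℝ} {e : E} (hs : s < t) (hat : a < t)
    (h : ∀ r, a < r → r < t → z r = e) : zm t = e := by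
  obtain ⟨r, h1, h2⟩ := ((hz.left t hs).and (Ioo_mem_nhdsLT hat)).exists
  rw [← h1, h r h2.1 h2.2]

/-- A path is constant as long as no clock fires. -/
theorem eq_of_not_fires (hz : IsJumpPath X R Γ s z zm) {a b : ℝ} (hsa : s ≤ a)
    (hno : ∀ r, a < r → r ≤ b → ∀ m u, ¬ Fires X R (z a) m r u) :
    ∀ r, a ≤ r → r ≤ b → z r = z a := by
  refine real_induction (fun _ => rfl) ?_ ?_
  · intro t hat ht
    by_cases htb : t < b
    · filter_upwards [hz.right t (hsa.trans hat)] with t' h1 h2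
      rw [h1, ht htb.le]
    · filter_upwards [self_mem_nhdsWithin] with t' h1 h2
      exact absurd (lt_of_lt_of_le (Set.mem_Ioi.1 h1) h2) htb
  · intro t hat ht htb
    have hm : zm t = z a := hz.leftLim_eq (hsa.trans_lt hat) hat
      fun r h1 h2 => ht r h1.le h2 (h2.le.trans htb)
    rw [hz.stay t (hsa.trans_lt hat) (by rw [hm]; exact hno t hat htb), hm]

/-- The points of the clocks that make the path jump in `(s, t]`. -/
def jumps (X : Mark V → Set (ℝ × ℝ)) (R : Mark V → E → ℝ) (zm : ℝ → E) (s t : ℝ) :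
    Set (Mark V × ℝ × ℝ) :=
  {q | s < q.2.1 ∧ q.2.1 ≤ t ∧ Fires X R (zm q.2.1) q.1 q.2.1 q.2.2}

theorem jumps_union {a b c : ℝ} (hab : a ≤ b) (hbc : b ≤ c) :
    jumps X R zm a c = jumps X R zm a b ∪ jumps X R zm b c := by
  ext q
  constructor
  · rintro ⟨h1, h2, h3⟩
    by_cases h : q.2.1 ≤ b
    · exact Or.inl ⟨h1, h, h3⟩
    · exact Or.inr ⟨not_le.1 h, h2, h3⟩
  · rintro (⟨h1, h2, h3⟩ | ⟨h1, h2, h3⟩)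
    · exact ⟨h1, h2.trans hbc, h3⟩
    · exact ⟨hab.trans_lt h1, h2, h3⟩

theorem jumps_disjoint {a b c : ℝ} : Disjoint (jumps X R zm a b) (jumps X R zm b c) :=
  Set.disjoint_left.2 fun _ hq hq' => not_lt.2 hq.2.1 hq'.1

/-- The increment of a function along a path is the sum of its increments over the jumps. -/
theorem jumps_finite_and_sub_eq (hz : IsJumpPath X R Γ s z zm) (hs : 0 ≤ s)
    (hS : ClocksSimple X) (hF : ClocksFinite X R) : ∀ t, s ≤ t →
    (jumps X R zm s t).Finite ∧ ∀ W : E → ℝ, W (z t) - W (z s) =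
      ∑ᶠ q ∈ jumps X R zm s t, (W (Γ q.1 (zm q.2.1)) - W (zm q.2.1)) := by
  refine real_induction ?_ ?_ ?_
  · have : jumps X R zm s s = ∅ := by
      ext q
      simp only [jumps, Set.mem_ofPred_eq, Set.mem_empty_iff_false, iff_false]
      rintro ⟨h1, h2, -⟩
      exact not_lt.2 h2 h1
    simp [this]
  · intro t hst ⟨hfin, hW⟩
    obtain ⟨c, hc, hcz⟩ := mem_nhdsGT_iff_exists_Ioo_subset.1
      ((hz.right t hst).and (hF.eventually_right (z t) (hs.trans hst)))
    filter_upwards [Ioo_mem_nhdsGT (Set.mem_Ioi.1 hc)] with t' ht'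
    have hempty : jumps X R zm t t' = ∅ := by
      ext q
      simp only [jumps, Set.mem_ofPred_eq, Set.mem_empty_iff_false, iff_false]
      rintro ⟨h1, h2, h3⟩
      have hm : zm q.2.1 = z t := hz.leftLim_eq (hst.trans_lt h1) h1
        fun r hr1 hr2 => (hcz ⟨hr1, hr2.trans_le (h2.trans ht'.2.le)⟩).1
      rw [hm] at h3
      exact (hcz ht').2 _ h1 h2 _ _ h3
    rw [jumps_union hst ht'.1.le, hempty, Set.union_empty, (hcz ht').1]
    exact ⟨hfin, hW⟩
  · intro t hst ih
    -- Choose `t'` so close to `t` that on `[t', t)` the path already equals its left limit at `t`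
    -- and no clock fires for that state. The only possible new jump is then at `t`.
    obtain ⟨c, hc, hcz⟩ := mem_nhdsLT_iff_exists_Ioo_subset.1
      ((hz.left t hst).and (hF.eventually_left (zm t) (hs.trans_lt hst)))
    have hct : max c s < t := max_lt (Set.mem_Iio.1 hc) hst
    obtain ⟨t', ht1, ht2⟩ := exists_between hct
    have hct' : c < t' := (le_max_left _ _).trans_lt ht1
    have hst' : s ≤ t' := (le_max_right c s).trans ht1.le
    obtain ⟨hfin, hW⟩ := ih t' hst' ht2
    have hnew : jumps X R zm t' t = {q | q.2.1 = t ∧ Fires X R (zm t) q.1 t q.2.2} := by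
      ext q
      constructor
      · rintro ⟨h1, h2, h3⟩
        rcases h2.eq_or_lt with h | h
        · exact ⟨h, h ▸ h3⟩
        · exfalso
          have hm : zm q.2.1 = zm t := hz.leftLim_eq (hst'.trans_lt h1) h1
            fun r hr1 hr2 => (hcz ⟨hct'.trans hr1, hr2.trans h⟩).1
          rw [hm] at h3
          exact (hcz ⟨hct', ht2⟩).2 _ h1.le h _ _ h3
      · rintro ⟨h1, h2⟩
        exact ⟨h1 ▸ ht2, h1.le, by rw [h1]; exact h2⟩
    have hzt' : z t' = zm t := (hcz ⟨hct', ht2⟩).1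
    rw [jumps_union hst' ht2.le, hnew]
    by_cases hfire : ∃ m u, Fires X R (zm t) m t u
    · obtain ⟨m, u, hmu⟩ := hfire
      -- Simplicity of the clocks leaves exactly one point at time `t`.
      have hsing : {q : Mark V × ℝ × ℝ | q.2.1 = t ∧ Fires X R (zm t) q.1 t q.2.2} =
          {(m, t, u)} := by
        ext ⟨m', r', u'⟩
        constructor
        · rintro ⟨h1, h2⟩
          obtain ⟨h3, h4⟩ := hS _ _ _ _ _ (hs.trans_lt hst) h2.2.1 hmu.2.1 h2.1 hmu.1
          simp only at h1 h3 h4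
          simp [h1, h3, h4]
        · intro h
          rw [Set.mem_singleton_iff] at h
          cases h
          exact ⟨rfl, hmu⟩
      have hd : Disjoint (jumps X R zm s t') {(m, t, u)} := by
        rw [← hsing, ← hnew]; exact jumps_disjoint
      rw [hsing]
      refine ⟨hfin.union (Set.finite_singleton _), fun W => ?_⟩
      rw [finsum_mem_union hd hfin (Set.finite_singleton _), ← hW W, finsum_mem_singleton, hzt',
        hz.jump t hst m u hmu]
      ring
    · push Not at hfire
      have hempty : {q : Mark V × ℝ × ℝ | q.2.1 = t ∧ Fires X R (zm t) q.1 t q.2.2} = ∅ := by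
        ext q
        simp only [Set.mem_ofPred_eq, Set.mem_empty_iff_false, iff_false]
        exact fun h => hfire _ _ h.2
      rw [hempty, Set.union_empty, hz.stay t hst hfire, ← hzt']
      exact ⟨hfin, hW⟩

/-- A path visits only finitely many states in a bounded interval. -/
theorem finite_image (hz : IsJumpPath X R Γ s z zm) : ∀ t, s ≤ t → (z '' Set.Icc s t).Finite := by
  refine real_induction (by simp) ?_ ?_
  · intro t hst ih
    obtain ⟨c, hc, hcz⟩ := mem_nhdsGT_iff_exists_Ioo_subset.1 (hz.right t hst)
    filter_upwards [Ioo_mem_nhdsGT (Set.mem_Ioi.1 hc)] with t' ht'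
    refine ih.subset ?_
    rintro _ ⟨r, hr, rfl⟩
    by_cases h : r ≤ t
    · exact ⟨r, ⟨hr.1, h⟩, rfl⟩
    · exact ⟨t, ⟨hst, le_rfl⟩, (hcz ⟨not_le.1 h, hr.2.trans_lt ht'.2⟩).symm⟩
  · intro t hst ih
    obtain ⟨c, hc, hcz⟩ := mem_nhdsLT_iff_exists_Ioo_subset.1 (hz.left t hst)
    have hct : max c s < t := max_lt (Set.mem_Iio.1 hc) hst
    obtain ⟨t', ht1, ht2⟩ := exists_between hct
    have hst' : s ≤ t' := (le_max_right c s).trans ht1.le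
    refine ((ih t' hst' ht2).union (Set.toFinite {zm t, z t})).subset ?_
    rintro _ ⟨r, hr, rfl⟩
    by_cases h : r ≤ t'
    · exact Or.inl ⟨r, ⟨hr.1, h⟩, rfl⟩
    · rcases hr.2.eq_or_lt with h' | h'
      · right; simp [h']
      · right
        left
        exact hcz ⟨((le_max_left c s).trans_lt ht1).trans (not_le.1 h), h'⟩

/-- The times at which a path differs from its left limit are countable. -/
theorem countable_ne [Countable V] [Countable E] (hz : IsJumpPath X R Γ 0 z zm)
    (hF : ClocksFinite X R) : {r : ℝ | 0 < r ∧ z r ≠ zm r}.Countable := by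
  refine (Set.countable_iUnion fun e : E => Set.countable_iUnion fun n : ℕ =>
    (hF.times e n).countable).mono ?_
  rintro r ⟨h0, hr⟩
  have : ∃ m u, Fires X R (zm r) m r u := by
    by_contra h
    push Not at h
    exact hr (hz.stay r h0 h)
  obtain ⟨n, hn⟩ := exists_nat_ge r
  exact Set.mem_iUnion.2 ⟨zm r, Set.mem_iUnion.2 ⟨n, h0, hn, this⟩⟩

end IsJumpPath

end JumpPath

/-! ### Adaptedness of jump paths -/

section Adapted

variable {V E Ω : Type*}

/-- The configurations that the path started in `e₀` can have at the `i`-th point of the grid `a`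
if in each interval of the grid there is at most one jump. -/
def gridReach (X : Mark V → Ω → Set (ℝ × ℝ)) (R : Mark V → E → ℝ) (Γ : Mark V → E → E) (e₀ : E)
    (a : ℕ → ℝ) : ℕ → E → Set Ω
  | 0, e => {_ω | e = e₀}
  | i + 1, e' => (gridReach X R Γ e₀ a i e' ∩
      ⋂ m, {ω | (X m ω ∩ Set.Ioc (a i) (a (i + 1)) ×ˢ Set.Ioo 0 (R m e')).encard = 0}) ∪
      ⋃ (e) (m) (_ : Γ m e = e'), gridReach X R Γ e₀ a i e ∩
        {ω | (X m ω ∩ Set.Ioc (a i) (a (i + 1)) ×ˢ Set.Ioo 0 (R m e)).encard = 0}ᶜ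

variable {X : Mark V → Ω → Set (ℝ × ℝ)} {R : Mark V → E → ℝ} {Γ : Mark V → E → E} {e₀ : E}

instance [Countable V] : Countable (Mark V) := by
  let f : Mark V → V ⊕ V ⊕ (V × V) := fun m => match m with
    | .birth x => .inl x
    | .death x => .inr (.inl x)
    | .jump x y => .inr (.inr (x, y))
  refine Function.Injective.countable (f := f) ?_
  intro m m' h
  cases m <;> cases m' <;> simp_all [f]

theorem measurableSet_gridReach [Countable V] [Countable E] {a : ℕ → ℝ} (ha : Monotone a) (i : ℕ)
    (e : E) : MeasurableSet[clockPast X (a i)] (gridReach X R Γ e₀ a i e) := by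
  have hcnt : ∀ (i : ℕ) (m : Mark V) (e : E), MeasurableSet[clockPast X (a (i + 1))]
      {ω | (X m ω ∩ Set.Ioc (a i) (a (i + 1)) ×ˢ Set.Ioo 0 (R m e)).encard = 0} := by
    intro i m e
    exact measurable_clockPast_count X m (measurableSet_Ioc.prod measurableSet_Ioo)
      (Set.prod_mono (fun x hx => hx.2) (Set.subset_univ _)) (measurableSet_singleton 0)
  induction i generalizing e with
  | zero => exact MeasurableSet.const _
  | succ i ih =>
    have ih' : ∀ e, MeasurableSet[clockPast X (a (i + 1))] (gridReach X R Γ e₀ a i e) := fun e =>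
      clockPast_mono X (ha (Nat.le_succ i)) _ (ih e)
    refine MeasurableSet.union ((ih' e).inter (MeasurableSet.iInter fun m => hcnt i m e)) ?_
    exact MeasurableSet.iUnion fun e' => MeasurableSet.iUnion fun m => MeasurableSet.iUnion
      fun _ => (ih' e').inter (hcnt i m e').compl

/-- The hypothesis `hsep` says that, over all states visited, the clocks fire at no more than one
time in each cell. In a cell the path then either stays or makes its single jump, which is what the
recursion records. -/
theorem mem_gridReach_iff {z zm : ℝ → E} {ω : Ω}
    (hz : IsJumpPath (fun m => X m ω) R Γ 0 z zm) (hz0 : z 0 = e₀)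
    (hS : ClocksSimple fun m => X m ω) {a : ℕ → ℝ} (ha : StrictMono a) (ha0 : a 0 = 0) {N : ℕ}
    (hsep : ∀ i < N, ∀ r ∈ Set.Icc 0 (a N), ∀ r' ∈ Set.Icc 0 (a N),
      ∀ q ∈ Set.Ioc (a i) (a (i + 1)), ∀ q' ∈ Set.Ioc (a i) (a (i + 1)), ∀ m u m' u',
      Fires (fun m => X m ω) R (z r) m q u → Fires (fun m => X m ω) R (z r') m' q' u' → q = q') :
    ∀ i ≤ N, ∀ e, ω ∈ gridReach X R Γ e₀ a i e ↔ z (a i) = e := by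
  intro i
  induction i with
  | zero =>
    intro _ e
    rw [ha0, hz0]
    exact eq_comm
  | succ i ih =>
    intro hi e'
    have ih := ih (by omega)
    have hai : 0 ≤ a i := ha0 ▸ ha.monotone (Nat.zero_le i)
    have haiN : a i ≤ a N := ha.monotone (by omega)
    have hai1N : a (i + 1) ≤ a N := ha.monotone hi
    have hstep : a i < a (i + 1) := ha (Nat.lt_succ_self i)
    have hbox : ∀ m e, (X m ω ∩ Set.Ioc (a i) (a (i + 1)) ×ˢ Set.Ioo 0 (R m e)).encard = 0 ↔
        ∀ r ∈ Set.Ioc (a i) (a (i + 1)), ∀ u, ¬ Fires (fun m => X m ω) R e m r u := by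
      intro m e
      rw [Set.encard_eq_zero, Set.eq_empty_iff_forall_notMem]
      constructor
      · rintro h r hr u ⟨h1, h2, h3⟩
        exact h (r, u) ⟨h1, hr, h2, h3⟩
      · rintro h ⟨r, u⟩ ⟨h1, hr, h2, h3⟩
        exact h r hr u ⟨h1, h2, h3⟩
    simp only [gridReach, Set.mem_union, Set.mem_inter_iff, Set.mem_iInter, Set.mem_iUnion,
      Set.mem_compl_iff, Set.mem_ofPred_eq, ih, hbox, exists_prop]
    by_cases hno : ∀ r ∈ Set.Ioc (a i) (a (i + 1)), ∀ m u,
        ¬ Fires (fun m => X m ω) R (z (a i)) m r u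
    · have hconst : z (a (i + 1)) = z (a i) := hz.eq_of_not_fires hai
        (fun r h1 h2 => hno r ⟨h1, h2⟩) _ hstep.le le_rfl
      rw [hconst]
      constructor
      · rintro (⟨h, -⟩ | ⟨e, m, -, rfl, h⟩)
        · exact h
        · exact absurd (fun r hr u => hno r hr m u) h
      · rintro rfl
        exact Or.inl ⟨rfl, fun m r hr u => hno r hr m u⟩
    · push Not at hno
      obtain ⟨q, hq, m, u, hf⟩ := hno
      -- Separation is applied twice: to the state at the left end of the cell, so that nothing
      -- happens before `q`, and below to the state reached at `q`, so that nothing happens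
      -- afterwards.
      have hbefore : ∀ r, a i < r → r < q → z r = z (a i) := fun r h1 h2 =>
        hz.eq_of_not_fires (b := r) hai (fun r' h3 h4 m' u' h => h4.not_gt (h2.trans_eq
          (hsep i (by omega) (a i) ⟨hai, haiN⟩ (a i) ⟨hai, haiN⟩ q hq r' ⟨h3, h4.trans
            (h2.le.trans hq.2)⟩ m u m' u' hf h))) r h1.le le_rfl
      have hq0 : 0 < q := hai.trans_lt hq.1
      have hm : zm q = z (a i) := hz.leftLim_eq hq0 hq.1 hbefore
      have hzq : z q = Γ m (z (a i)) := by
        rw [hz.jump q hq0 m u (by rw [hm]; exact hf), hm]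
      have hafter : z (a (i + 1)) = z q := hz.eq_of_not_fires hq0.le
        (fun r' h3 h4 m' u' h => h3.ne (hsep i (by omega) (a i) ⟨hai, haiN⟩ q
          ⟨hq0.le, hq.2.trans hai1N⟩ q hq r' ⟨hq.1.trans h3, h4⟩ m u m' u' hf h)) _ hq.2 le_rfl
      rw [hafter, hzq]
      constructor
      · rintro (⟨h, h'⟩ | ⟨e, m', h1, rfl, h⟩)
        · exact absurd (h ▸ hf) (h' m q hq u)
        · push Not at h
          obtain ⟨q', hq', u', hf'⟩ := h
          have hqq := hsep i (by omega) (a i) ⟨hai, haiN⟩ (a i) ⟨hai, haiN⟩ q hq q' hq' m u m' u'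
            hf hf'
          subst hqq
          rw [(hS m m' q u u' hq0 hf.2.1 hf'.2.1 hf.1 hf'.1).1, h1]
      · intro h
        refine Or.inr ⟨z (a i), m, h, rfl, fun h' => h' q hq u hf⟩

/-- Jump paths are adapted to the past of the clocks. -/
theorem measurableSet_jumpPath [Countable V] [Countable E] {Z Zm : ℝ → Ω → E}
    (hz : ∀ ω, IsJumpPath (fun m => X m ω) R Γ 0 (fun t => Z t ω) fun t => Zm t ω)
    (hz0 : ∀ ω, Z 0 ω = e₀) (hS : ∀ ω, ClocksSimple fun m => X m ω)
    (hF : ∀ ω, ClocksFinite (fun m => X m ω) R) {t : ℝ} (ht : 0 ≤ t) (e : E) :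
    MeasurableSet[clockPast X t] {ω | Z t ω = e} := by
  rcases ht.eq_or_lt with rfl | htpos
  · simp only [hz0]
    exact MeasurableSet.const _
  let a : ℕ → ℕ → ℝ := fun n i => t * (i / (n + 1))
  have ha : ∀ n, StrictMono (a n) := fun n i j hij =>
    mul_lt_mul_of_pos_left (div_lt_div_of_pos_right (by exact_mod_cast hij) (by positivity)) htpos
  have haN : ∀ n, a n (n + 1) = t := fun n => by
    simp only [a]
    push_cast
    field_simp
  -- The mesh needed depends on the path, so the event is written as a lower limit over the meshes.
  have hset : {ω | Z t ω = e} =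
      ⋃ N : ℕ, ⋂ n : ℕ, {ω | N ≤ n → ω ∈ gridReach X R Γ e₀ (a n) (n + 1) e} := by
    ext ω
    simp only [Set.mem_ofPred_eq, Set.mem_iUnion, Set.mem_iInter]
    -- All firing times for all states visited, whether or not they cause a jump; finite because the
    -- path visits finitely many states. A mesh below their minimal gap `ε` separates them.
    have hfin : (⋃ e' ∈ (fun t => Z t ω) '' Set.Icc 0 t,
        {r : ℝ | 0 < r ∧ r ≤ t ∧ ∃ m u, Fires (fun m => X m ω) R e' m r u}).Finite :=
      ((hz ω).finite_image t ht).biUnion fun e' _ => (hF ω).times e' t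
    obtain ⟨ε, hε, hεr⟩ := hfin.relatively_discrete
    obtain ⟨δ, hδ0, hδε⟩ := ENNReal.lt_iff_exists_nnreal_btwn.1 hε
    have hδ : (0 : ℝ) < δ := by exact_mod_cast hδ0
    obtain ⟨N, hN⟩ := exists_nat_gt (t / (δ : ℝ))
    have key : ∀ n, N ≤ n → (ω ∈ gridReach X R Γ e₀ (a n) (n + 1) e ↔ Z t ω = e) := by
      intro n hn
      rw [mem_gridReach_iff (hz ω) (hz0 ω) (hS ω) (ha n) (by simp [a]) (N := n + 1) ?_ _ le_rfl,
        haN n]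
      rw [haN n]
      intro i hi r hr r' hr' q hq q' hq' m u m' u' hf hf'
      have hai0 : 0 ≤ a n i := by positivity
      have hai : a n (i + 1) ≤ t := by rw [← haN n]; exact (ha n).monotone hi
      by_contra hne
      have h1 := hεr q (Set.mem_biUnion ⟨r, hr, rfl⟩ ⟨hai0.trans_lt hq.1, hq.2.trans hai, m, u, hf⟩)
        q' (Set.mem_biUnion ⟨r', hr', rfl⟩ ⟨hai0.trans_lt hq'.1, hq'.2.trans hai, m', u', hf'⟩) hne
      have h2 : a n (i + 1) - a n i = t / (n + 1) := by
        simp only [a]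
        push_cast
        field_simp
        ring
      have h3 : t / (n + 1) < δ := by
        rw [div_lt_iff₀ (by positivity)]
        rw [div_lt_iff₀ hδ] at hN
        have : (N : ℝ) ≤ n := by exact_mod_cast hn
        nlinarith
      have h1 := hδε.trans_le h1
      rw [edist_nndist, ENNReal.coe_lt_coe, ← NNReal.coe_lt_coe, coe_nndist, Real.dist_eq] at h1
      have h4 : |q - q'| < δ := by
        rw [abs_lt]
        constructor <;> linarith [hq.1, hq.2, hq'.1, hq'.2]
      linarith
    constructor
    · exact fun h => ⟨N, fun n hn => (key n hn).2 h⟩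
    · rintro ⟨N', h⟩
      exact (key (max N N') (le_max_left _ _)).1 (h _ (le_max_right _ _))
  rw [hset]
  refine MeasurableSet.iUnion fun N => MeasurableSet.iInter fun n => ?_
  by_cases hNn : N ≤ n
  · have := measurableSet_gridReach (X := X) (R := R) (Γ := Γ) (e₀ := e₀) (ha n).monotone (n + 1) e
    rw [haN n] at this
    simpa only [hNn, true_imp_iff, Set.ofPred_mem_eq] using this
  · simp only [hNn, false_imp_iff]
    exact MeasurableSet.const _

end Adapted

/-! ### The flow on finite configurations as a jump path -/

namespace ReactionDiffusion

variable {V : Type*} (S : ReactionDiffusion V)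

theorem rate_nonneg (m : Mark V) (η : V → ℕ) : 0 ≤ S.rate m η := by
  cases m with
  | birth x => exact S.Fplus_nonneg _
  | death x => exact (S.Fplus_nonneg _).trans (S.Fplus_le_Fminus _)
  | jump x y => exact mul_nonneg (S.p_nonneg _ _) (Nat.cast_nonneg _)

/-- The rates on finite configurations. -/
def finiteRate (m : Mark V) (η : FiniteConfig V) : ℝ := S.rate m η.1

/-- The rates on finite configurations together with the number of transitions that are still
allowed. -/
def countRate (m : Mark V) (e : FiniteConfig V × ℕ) : ℝ := if e.2 = 0 then 0 else S.rate m e.1.1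

/-- The transitions of finite configurations together with the number of transitions that are
still allowed. -/
noncomputable def countMap (m : Mark V) (e : FiniteConfig V × ℕ) : FiniteConfig V × ℕ :=
  (e.1.transition m, e.2 - 1)

open scoped Classical in
/-- The configuration after a transition at time `r`. -/
noncomputable def afterFiring (X : Mark V → Set (ℝ × ℝ)) (η : FiniteConfig V) (r : ℝ) :
    FiniteConfig V :=
  if h : (S.firing X η.1 r).Nonempty then η.transition h.some else η

open scoped Classical in
/-- The flow up to time `t`, stopped after `k` transitions, together with the number of unused
transitions. -/
noncomputable def run (X : Mark V → Set (ℝ × ℝ)) (t : ℝ) :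
    ℕ → ℝ → FiniteConfig V → FiniteConfig V × ℕ
  | 0, _, η => (η, 0)
  | k + 1, s, η =>
    if (S.firingTimes X η.1 s t).Nonempty then
      run X t k (sInf (S.firingTimes X η.1 s t))
        (S.afterFiring X η (sInf (S.firingTimes X η.1 s t)))
    else (η, k + 1)

variable {S} {X : Mark V → Set (ℝ × ℝ)}

theorem flowStep_iterate_top (t : ℝ) (η : FiniteConfig V) (k : ℕ) :
    (S.flowStep X t)^[k] (⊤, η) = (⊤, η) :=
  Function.iterate_fixed (by rfl) k

/-- Translates the iteration with the absorbing time `⊤` into a recursion on the number of allowed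
transitions: time `⊤` is reached exactly when some of them are left over. -/
theorem run_eq_flowStep (t : ℝ) (k : ℕ) (s : ℝ) (η : FiniteConfig V) :
    ((S.flowStep X t)^[k] ((s : WithTop ℝ), η)).2 = (S.run X t k s η).1 ∧
      (((S.flowStep X t)^[k] ((s : WithTop ℝ), η)).1 = ⊤ ↔ (S.run X t k s η).2 ≠ 0) := by
  induction k generalizing s η with
  | zero => simp [run]
  | succ k ih =>
    rw [Function.iterate_succ_apply]
    by_cases h : (S.firingTimes X η.1 s t).Nonempty
    · have h1 : S.flowStep X t ((s : WithTop ℝ), η) =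
        (((sInf (S.firingTimes X η.1 s t) : ℝ) : WithTop ℝ),
          S.afterFiring X η (sInf (S.firingTimes X η.1 s t))) := by
        simp only [flowStep]
        rw [if_pos h]
        rfl
      rw [h1, run, if_pos h]
      exact ih _ _
    · have h1 : S.flowStep X t ((s : WithTop ℝ), η) = (⊤, η) := by
        simp only [flowStep]
        rw [if_neg h]
      rw [h1, flowStep_iterate_top, run, if_neg h]
      simp

theorem run_snd_le (t : ℝ) (k : ℕ) (s : ℝ) (η : FiniteConfig V) : (S.run X t k s η).2 ≤ k := by
  induction k generalizing s η with
  | zero => simp [run]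
  | succ k ih =>
    rw [run]
    by_cases h : (S.firingTimes X η.1 s t).Nonempty
    · rw [if_pos h]
      exact (ih _ _).trans (Nat.le_succ k)
    · rw [if_neg h]

/-- Once the time is `⊤` the iteration is constant, so the chosen index is the last one before `⊤`;
the step into `⊤` does not change the configuration. -/
theorem finiteFlow_eq_run {t : ℝ} {k : ℕ} {s : ℝ} {η : FiniteConfig V}
    (h : (S.run X t k s η).2 ≠ 0) : S.finiteFlow X s t η = (S.run X t k s η).1 := by
  obtain ⟨h1, h2⟩ := run_eq_flowStep (S := S) (X := X) t k s η
  have htop := h2.2 h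
  have hex : ∃ k : ℕ, ((S.flowStep X t)^[k] ((s : WithTop ℝ), η)).1 ≠ ⊤ ∧
      ((S.flowStep X t)^[k + 1] ((s : WithTop ℝ), η)).1 = ⊤ := by
    by_contra hcon
    push Not at hcon
    have : ∀ j, ((S.flowStep X t)^[j] ((s : WithTop ℝ), η)).1 ≠ ⊤ := by
      intro j
      induction j with
      | zero => simp
      | succ j ih => exact hcon j ih
    exact this k htop
  rw [finiteFlow, dif_pos hex, ← h1]
  obtain ⟨hc1, hc2⟩ := hex.choose_spec
  set j := hex.choose
  have htop' : ∀ i l, ((S.flowStep X t)^[i] ((s : WithTop ℝ), η)).1 = ⊤ →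
      (S.flowStep X t)^[l + i] ((s : WithTop ℝ), η) =
        (S.flowStep X t)^[i] ((s : WithTop ℝ), η) := by
    intro i l hi
    rw [Function.iterate_add_apply]
    have : (S.flowStep X t)^[i] ((s : WithTop ℝ), η) =
      (⊤, ((S.flowStep X t)^[i] ((s : WithTop ℝ), η)).2) := Prod.ext hi rfl
    rw [this, flowStep_iterate_top]
  have hjk : j + 1 ≤ k := by
    by_contra hlt
    obtain ⟨l, hl⟩ := Nat.exists_eq_add_of_le' (show k ≤ j by omega)
    rw [hl, htop' k l htop] at hc1
    exact hc1 htop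
  obtain ⟨l, hl⟩ := Nat.exists_eq_add_of_le' hjk
  rw [hl, htop' _ _ hc2]
  rw [Function.iterate_succ_apply'] at hc2 ⊢
  set e := (S.flowStep X t)^[j] ((s : WithTop ℝ), η)
  obtain ⟨e1, e2⟩ := e
  cases e1 with
  | top => exact absurd rfl hc1
  | coe r =>
    by_cases hne : (S.firingTimes X e2.1 r t).Nonempty
    · exfalso
      have hst : (S.flowStep X t ((r : WithTop ℝ), e2)).1 =
          ((sInf (S.firingTimes X e2.1 r t) : ℝ) : WithTop ℝ) := by
        simp only [flowStep]
        rw [if_pos hne]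
      rw [hst] at hc2
      exact WithTop.coe_ne_top hc2
    · have hst : S.flowStep X t ((r : WithTop ℝ), e2) = (⊤, e2) := by
        simp only [flowStep]
        rw [if_neg hne]
      rw [hst]

theorem firing_nonempty_iff {η : FiniteConfig V} {r : ℝ} :
    (S.firing X η.1 r).Nonempty ↔ ∃ m u, Fires X S.finiteRate η m r u := by
  constructor
  · rintro ⟨m, u, h1, h2, h3⟩
    exact ⟨m, u, h2, h1, h3⟩
  · rintro ⟨m, u, h2, h1, h3⟩
    exact ⟨m, u, h1, h2, h3⟩

/-- Finiteness makes the infimum a minimum, and this first firing time does not depend on the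
horizon. Hence the runs for different horizons share their transitions. -/
theorem exists_first_firing (hF : ClocksFinite X S.finiteRate) {s t : ℝ} (hs : 0 ≤ s)
    {η : FiniteConfig V} (h : (S.firingTimes X η.1 s t).Nonempty) :
    ∃ r, s < r ∧ (S.firing X η.1 r).Nonempty ∧
      (∀ t', t' < r → ¬ (S.firingTimes X η.1 s t').Nonempty) ∧
      ∀ t', r ≤ t' → (S.firingTimes X η.1 s t').Nonempty ∧ sInf (S.firingTimes X η.1 s t') = r := by
  have hfin : (S.firingTimes X η.1 s t).Finite := by
    refine (hF.times η t).subset ?_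
    rintro r ⟨h1, h2, h3⟩
    exact ⟨hs.trans_lt h1, h2, firing_nonempty_iff.1 h3⟩
  have hmem := h.csInf_mem hfin
  set r := sInf (S.firingTimes X η.1 s t)
  have hlow : ∀ r', s < r' → (S.firing X η.1 r').Nonempty → r ≤ r' := by
    intro r' h1 h2
    by_contra hlt
    have hlt := not_le.1 hlt
    exact not_le.2 hlt (csInf_le hfin.bddBelow ⟨h1, hlt.le.trans hmem.2.1, h2⟩)
  refine ⟨r, hmem.1, hmem.2.2, ?_, ?_⟩
  · rintro t' ht' ⟨r', h1, h2, h3⟩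
    exact not_lt.2 (hlow r' h1 h3) (h2.trans_lt ht')
  · intro t' ht'
    have hleast : IsLeast (S.firingTimes X η.1 s t') r :=
      ⟨⟨hmem.1, ht', hmem.2.2⟩, fun r' h' => hlow r' h'.1 h'.2.2⟩
    exact ⟨⟨r, hleast.1⟩, hleast.csInf_eq⟩

theorem ClocksFinite.countRate (hF : ClocksFinite X S.finiteRate) : ClocksFinite X S.countRate := by
  intro e T
  refine (hF e.1 T).subset ?_
  rintro q ⟨h1, h2, h3, h4, h5⟩
  refine ⟨h1, h2, h3, h4, ?_⟩
  simp only [ReactionDiffusion.countRate] at h5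
  split_ifs at h5 with h
  · exact absurd h5 (not_lt.2 h4.le)
  · exact h5

/-- The stopped flow is a jump path. -/
theorem exists_isJumpPath_run (hS : ClocksSimple X) (hF : ClocksFinite X S.finiteRate) (k : ℕ)
    (s : ℝ) (hs : 0 ≤ s) (η : FiniteConfig V) :
    S.run X s k s η = (η, k) ∧
      ∃ zm, IsJumpPath X S.countRate countMap s (fun t => S.run X t k s η) zm := by
  induction k generalizing s η with
  | zero =>
    refine ⟨rfl, fun _ => (η, 0), ⟨fun t _ => Eventually.of_forall fun _ => rfl,
      fun t _ => Eventually.of_forall fun _ => rfl, fun t _ _ => rfl, fun t _ m u h => ?_⟩⟩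
    have := h.2.2
    simp only [ReactionDiffusion.countRate, if_true] at this
    exact absurd this (not_lt.2 h.2.1.le)
  | succ k ih =>
    have hself : ¬ (S.firingTimes X η.1 s s).Nonempty := by
      rintro ⟨r, h1, h2, -⟩
      exact not_lt.2 h2 h1
    refine ⟨by rw [run, if_neg hself], ?_⟩
    have hfire : ∀ {m t u}, Fires X S.countRate (η, k + 1) m t u ↔ Fires X S.finiteRate η m t u := by
      intro m t u
      simp [Fires, ReactionDiffusion.countRate, finiteRate]
    by_cases hall : ∀ t, ¬ (S.firingTimes X η.1 s t).Nonempty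
    · have hconst : ∀ t, S.run X t (k + 1) s η = (η, k + 1) := fun t => by
        rw [run, if_neg (hall t)]
      simp_rw [hconst]
      refine ⟨fun _ => (η, k + 1), ⟨fun t _ => Eventually.of_forall fun _ => rfl,
        fun t _ => Eventually.of_forall fun _ => rfl, fun t _ _ => rfl, fun t ht m u h => ?_⟩⟩
      exact absurd ⟨t, ht, le_rfl, firing_nonempty_iff.2 ⟨m, u, hfire.1 h⟩⟩ (hall t)
    · push Not at hall
      obtain ⟨t₀, ht₀⟩ := hall
      obtain ⟨r, hsr, hne, hbefore, hafter⟩ := exists_first_firing hF hs ht₀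
      have hr0 : 0 < r := hs.trans_lt hsr
      obtain ⟨hstart, zm, hzm⟩ := ih r hr0.le (η.transition hne.some)
      have hrun1 : ∀ t, t < r → S.run X t (k + 1) s η = (η, k + 1) := fun t ht => by
        rw [run, if_neg (hbefore t ht)]
      have hrun2 : ∀ t, r ≤ t →
          S.run X t (k + 1) s η = S.run X t k r (η.transition hne.some) := fun t ht => by
        rw [run, if_pos (hafter t ht).1]
        rw [(hafter t ht).2, afterFiring, dif_pos hne]
      have hnof : ∀ t, s < t → t < r → ∀ m u, ¬ Fires X S.finiteRate η m t u := by
        intro t h1 h2 m u h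
        exact hbefore t h2 ⟨t, h1, le_rfl, firing_nonempty_iff.2 ⟨m, u, h⟩⟩
      -- The left limit at the first firing time `r` is still the initial state, hence `t ≤ r` and
      -- not `t < r`.
      refine ⟨fun t => if t ≤ r then (η, k + 1) else zm t, ⟨fun t ht => ?_, fun t ht => ?_,
        fun t ht hst => ?_, fun t ht m u h => ?_⟩⟩
      · rcases lt_or_ge t r with htr | htr
        · filter_upwards [Ioo_mem_nhdsGT htr] with t' ht'
          rw [hrun1 t htr, hrun1 t' ht'.2]
        · filter_upwards [hzm.right t htr, self_mem_nhdsWithin] with t' h1 h2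
          rw [hrun2 t htr, hrun2 t' (htr.trans (Set.mem_Ioi.1 h2).le), h1]
      · rcases le_or_gt t r with htr | htr
        · filter_upwards [self_mem_nhdsWithin] with t' ht'
          rw [if_pos htr, hrun1 t' ((Set.mem_Iio.1 ht').trans_le htr)]
        · filter_upwards [hzm.left t htr, Ioo_mem_nhdsLT htr] with t' h1 h2
          rw [if_neg (not_le.2 htr), hrun2 t' h2.1.le, h1]
      · rcases lt_trichotomy t r with htr | htr | htr
        · rw [if_pos htr.le]
          exact hrun1 t htr
        · subst htr
          obtain ⟨m, u, h⟩ := firing_nonempty_iff.1 hne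
          rw [if_pos le_rfl] at hst
          exact absurd (hfire.2 h) (hst m u)
        · rw [if_neg (not_le.2 htr)] at hst ⊢
          rw [hrun2 t htr.le]
          exact hzm.stay t htr hst
      · rcases lt_trichotomy t r with htr | htr | htr
        · rw [if_pos htr.le] at h
          exact absurd (hfire.1 h) (hnof t ht htr m u)
        · subst htr
          rw [if_pos le_rfl] at h ⊢
          -- The chosen mark is the one that fires, since the clocks are simple.
          obtain ⟨u', h1, h2, h3⟩ := hne.some_mem
          have hm := (hS _ _ _ _ _ hr0 h1 h.2.1 h2 h.1).1
          rw [hrun2 t le_rfl, hstart, ← hm]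
          rfl
        · rw [if_neg (not_le.2 htr)] at h ⊢
          rw [hrun2 t htr.le]
          exact hzm.jump t htr m u h

/-- A longer horizon uses at least as many transitions, so a budget that suffices up to `T` suffices
at all earlier times. -/
theorem run_snd_anti (hF : ClocksFinite X S.finiteRate) {t T : ℝ} (htT : t ≤ T) (k : ℕ)
    (s : ℝ) (hs : 0 ≤ s) (η : FiniteConfig V) : (S.run X T k s η).2 ≤ (S.run X t k s η).2 := by
  induction k generalizing s η with
  | zero => simp [run]
  | succ k ih =>
    by_cases h : (S.firingTimes X η.1 s t).Nonempty
    · obtain ⟨r, hsr, hne, hbefore, hafter⟩ := exists_first_firing hF hs h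
      have hrt : r ≤ t := by
        by_contra hlt
        exact hbefore t (not_le.1 hlt) h
      have h2 := hafter T (hrt.trans htT)
      rw [run, run, if_pos h, if_pos h2.1]
      rw [(hafter t hrt).2, h2.2]
      exact ih r (hs.trans hsr.le) _
    · rw [run.eq_2 S X t, if_neg h]
      exact run_snd_le _ _ _ _

variable (S X) in
/-- The flow makes only finitely many transitions in bounded time. -/
def Nonexplosive : Prop := ∀ (η : FiniteConfig V) (t : ℝ), ∃ k, (S.run X t k 0 η).2 ≠ 0

/-- The flow on finite configurations is a jump path. -/
theorem exists_isJumpPath_finiteFlow (hS : ClocksSimple X) (hF : ClocksFinite X S.finiteRate)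
    (hN : S.Nonexplosive X) (η : FiniteConfig V) :
    S.finiteFlow X 0 0 η = η ∧ ∃ zm, IsJumpPath X S.finiteRate (fun m e => e.transition m) 0
      (fun t => S.finiteFlow X 0 t η) zm := by
  have heq : ∀ {T k}, (S.run X T k 0 η).2 ≠ 0 → ∀ t, t ≤ T →
      (S.run X t k 0 η).2 ≠ 0 ∧ S.finiteFlow X 0 t η = (S.run X t k 0 η).1 := by
    intro T k hk t ht
    have h1 := run_snd_anti hF ht k 0 le_rfl η
    have h2 : (S.run X t k 0 η).2 ≠ 0 := by omega
    exact ⟨h2, finiteFlow_eq_run h2⟩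
  choose k hk using hN η
  have hpath := fun k => (exists_isJumpPath_run hS hF k 0 le_rfl η).2
  choose zm hzm using hpath
  -- The budget for the horizon `t + 1` works on both sides of `t`, which is needed for right limits
  -- at `t`.
  refine ⟨?_, fun t => (zm (k (t + 1)) t).1, ⟨fun t ht => ?_, fun t ht => ?_, fun t ht hst => ?_,
    fun t ht m u h => ?_⟩⟩
  · rw [(heq (hk 0) 0 le_rfl).2, (exists_isJumpPath_run hS hF _ 0 le_rfl η).1]
  · filter_upwards [(hzm (k (t + 1))).right t ht, Ioo_mem_nhdsGT (lt_add_one t)] with t' h1 h2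
    rw [(heq (hk (t + 1)) t (by linarith)).2, (heq (hk (t + 1)) t' h2.2.le).2, h1]
  · filter_upwards [(hzm (k (t + 1))).left t ht, self_mem_nhdsWithin] with t' h1 h2
    rw [(heq (hk (t + 1)) t' (le_of_lt (lt_trans (show t' < t from h2) (lt_add_one t)))).2, h1]
  all_goals
    obtain ⟨hne, hflow⟩ := heq (hk (t + 1)) t (by linarith)
    -- Unused transitions remain at the left limit, so the rates with and without the counter agree
    -- there.
    have hmne : (zm (k (t + 1)) t).2 ≠ 0 := by
      obtain ⟨t', h1, h2⟩ := (((hzm (k (t + 1))).left t ht).and self_mem_nhdsWithin).exists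
      rw [← h1]
      exact (heq (hk (t + 1)) t' (le_of_lt (lt_trans (show t' < t from h2) (lt_add_one t)))).1
    have hfire : ∀ {m u}, Fires X S.countRate (zm (k (t + 1)) t) m t u ↔
        Fires X S.finiteRate (zm (k (t + 1)) t).1 m t u := by
      intro m u
      simp [Fires, ReactionDiffusion.countRate, finiteRate, hmne]
  · rw [hflow, (hzm (k (t + 1))).stay t ht fun m u h => hst m u (hfire.1 h)]
  · rw [hflow, (hzm (k (t + 1))).jump t ht m u (hfire.2 h)]
    rfl

end ReactionDiffusion

/-! ### Measurability of right-continuous processes -/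

/-- The right neighbour of `r` in the grid of mesh `1 / (n + 1)`. -/
noncomputable def rightGrid (n : ℕ) (r : ℝ) : ℝ := ((⌊((n : ℝ) + 1) * r⌋₊ + 1 : ℕ) : ℝ) / (n + 1)

theorem lt_rightGrid (n : ℕ) (r : ℝ) : r < rightGrid n r := by
  rw [rightGrid, lt_div_iff₀ (by positivity), mul_comm]
  push_cast
  exact Nat.lt_floor_add_one _

theorem rightGrid_le (n : ℕ) {r : ℝ} (hr : 0 ≤ r) : rightGrid n r ≤ r + 1 / (n + 1) := by
  have hn : (0 : ℝ) < n + 1 := by positivity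
  have h := Nat.floor_le (a := ((n : ℝ) + 1) * r) (by positivity)
  have h2 : 1 / ((n : ℝ) + 1) * (n + 1) = 1 := one_div_mul_cancel hn.ne'
  rw [rightGrid, div_le_iff₀ hn]
  push_cast
  linarith

theorem tendsto_rightGrid {r : ℝ} (hr : 0 ≤ r) : Tendsto (fun n => rightGrid n r) atTop (𝓝 r) := by
  refine tendsto_of_tendsto_of_tendsto_of_le_of_le (h := fun n : ℕ => r + 1 / ((n : ℝ) + 1))
    tendsto_const_nhds ?_ (fun n => (lt_rightGrid n r).le) fun n => rightGrid_le n hr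
  simpa using (tendsto_const_nhds (x := r)).add tendsto_one_div_add_atTop_nhds_zero_nat

/-- A right-continuous process is progressively measurable. -/
theorem measurable_of_rightContinuous {Ω β : Type*} {mΩ : MeasurableSpace Ω} [TopologicalSpace β]
    [TopologicalSpace.PseudoMetrizableSpace β] [MeasurableSpace β] [BorelSpace β] {h : ℝ → Ω → β} {t : ℝ}
    (ht : 0 ≤ t) (hmeas : ∀ r ∈ Set.Icc 0 t, Measurable (h r))
    (hcont : ∀ ω, ∀ r ∈ Set.Ico 0 t, ContinuousWithinAt (fun r => h r ω) (Set.Ici r) r) :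
    Measurable fun p : ℝ × Ω => h (max 0 (min p.1 t)) p.2 := by
  let cl : ℝ → ℝ := fun r => max 0 (min r t)
  have hcl : ∀ r, 0 ≤ cl r := fun r => le_max_left _ _
  have hclt : ∀ r, cl r ≤ t := fun r => max_le ht (min_le_right _ _)
  have hclm : Measurable cl := measurable_const.max (measurable_id.min measurable_const)
  -- Approximation from the right by grid times, capped at `t` so that only values on `[0, t]`
  -- enter; at the time `t` itself the approximation is constant.
  refine measurable_of_tendsto_metrizable
    (f := fun n (p : ℝ × Ω) => h (min (rightGrid n (cl p.1)) t) p.2) (fun n => ?_) ?_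
  · have hg : Measurable fun q : ℕ × Ω =>
        h (min (((q.1 + 1 : ℕ) : ℝ) / ((n : ℝ) + 1)) t) q.2 :=
      measurable_from_prod_countable_right fun k =>
        hmeas (min (((k + 1 : ℕ) : ℝ) / ((n : ℝ) + 1)) t)
          ⟨le_min (by positivity) ht, min_le_right _ _⟩
    exact hg.comp (f := fun p : ℝ × Ω => (⌊((n : ℝ) + 1) * cl p.1⌋₊, p.2))
      ((Nat.measurable_floor.comp ((hclm.comp measurable_fst).const_mul _)).prodMk measurable_snd)
  · rw [tendsto_pi_nhds]
    rintro ⟨r, ω⟩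
    change Tendsto (fun n => h (min (rightGrid n (cl r)) t) ω) atTop (𝓝 (h (cl r) ω))
    rcases (hclt r).eq_or_lt with heq | hlt
    · refine tendsto_const_nhds.congr fun n => ?_
      rw [min_eq_right (heq ▸ (lt_rightGrid n (cl r)).le), heq]
    · refine (hcont ω (cl r) ⟨hcl r, hlt⟩).tendsto.comp (tendsto_nhdsWithin_iff.2 ⟨?_, ?_⟩)
      · have := (tendsto_rightGrid (hcl r)).min (tendsto_const_nhds (x := t))
        rwa [min_eq_left hlt.le] at this
      · exact Eventually.of_forall fun n => le_min (lt_rightGrid n _).le hlt.le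

/-! ### Dynkin's formula for jump processes -/

/-- Strict inequalities turn into weak ones under left limits: an adapted condition `r < τ` produces
the condition `r ≤ τ` on jump times. -/
theorem eventually_lt_iff_le (c r : ℝ) : ∀ᶠ r' in 𝓝[<] r, (r' < c ↔ r ≤ c) := by
  rcases le_or_gt r c with h | h
  · filter_upwards [self_mem_nhdsWithin] with r' hr'
    simp [h, (Set.mem_Iio.1 hr').trans_le h]
  · filter_upwards [Ioo_mem_nhdsLT h] with r' hr'
    exact iff_of_false (not_lt.2 hr'.1.le) (not_le.2 h)

theorem eventually_le_iff_lt (c r : ℝ) : ∀ᶠ r' in 𝓝[<] r, (c ≤ r' ↔ c < r) := by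
  filter_upwards [eventually_lt_iff_le c r] with r' h
  rw [← not_lt, h, not_le]

/-- The jumps are sorted by mark and by the state before the jump; the weight is then constant on
each class. -/
theorem tsum_subtype_eq_tsum_tsum_encard {M E : Type*} {J : Set (M × ℝ × ℝ)} {zm : ℝ → E}
    {S : M → E → Set (ℝ × ℝ)} (hS : ∀ m e p, p ∈ S m e ↔ (m, p) ∈ J ∧ zm p.1 = e)
    (g : M → E → ℝ≥0∞) :
    ∑' q : J, g q.1.1 (zm q.1.2.1) = ∑' m, ∑' e, g m e * ((S m e).encard : ℝ≥0∞) := by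
  classical
  have h1 : ∀ m e, g m e * ((S m e).encard : ℝ≥0∞) =
      ∑' p : ℝ × ℝ, if (m, p) ∈ J ∧ zm p.1 = e then g m e else 0 := by
    intro m e
    rw [← ENNReal.tsum_set_one, tsum_subtype (S m e) (fun _ => (1 : ℝ≥0∞)), ← ENNReal.tsum_mul_left]
    refine tsum_congr fun p => ?_
    by_cases h : p ∈ S m e
    · simp [h, (hS m e p).1 h]
    · simp [h, mt (hS m e p).2 h]
  have h2 : ∀ m, ∑' e, g m e * ((S m e).encard : ℝ≥0∞) =
      ∑' p : ℝ × ℝ, J.indicator (fun q => g q.1 (zm q.2.1)) (m, p) := by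
    intro m
    simp_rw [h1]
    rw [ENNReal.tsum_comm]
    refine tsum_congr fun p => ?_
    rw [tsum_eq_single (zm p.1) fun e he => if_neg fun h => he h.2.symm]
    simp [Set.indicator_apply]
  simp_rw [h2]
  rw [tsum_subtype J (fun q => g q.1 (zm q.2.1)), ENNReal.tsum_prod']

/-- A process whose paths are jump paths started in a fixed state. -/
structure IsJumpProcess {V E Ω : Type*} (X : Mark V → Ω → Set (ℝ × ℝ)) (R : Mark V → E → ℝ)
    (Γ : Mark V → E → E) (Z Zm : ℝ → Ω → E) : Prop where
  path : ∀ ω, IsJumpPath (fun m => X m ω) R Γ 0 (fun t => Z t ω) fun t => Zm t ω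
  start : ∃ e₀, ∀ ω, Z 0 ω = e₀
  simple : ∀ ω, ClocksSimple fun m => X m ω
  finite : ∀ ω, ClocksFinite (fun m => X m ω) R

/-- A nonnegative stopping time for the past of the clocks. -/
structure IsClockStop {V Ω : Type*} (X : Mark V → Ω → Set (ℝ × ℝ)) (τ : Ω → ℝ) : Prop where
  nonneg : ∀ ω, 0 ≤ τ ω
  meas : ∀ r, 0 ≤ r → MeasurableSet[clockPast X r] {ω | τ ω ≤ r}

namespace IsJumpProcess

variable {V E Ω : Type*} [Countable V] [Countable E] {X : Mark V → Ω → Set (ℝ × ℝ)}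
  {R : Mark V → E → ℝ} {Γ : Mark V → E → E} {Z Zm : ℝ → Ω → E}

theorem measurableSet_eq (hZ : IsJumpProcess X R Γ Z Zm) {t : ℝ} (ht : 0 ≤ t) (e : E) :
    MeasurableSet[clockPast X t] {ω | Z t ω = e} := by
  obtain ⟨e₀, h0⟩ := hZ.start
  exact measurableSet_jumpPath hZ.path h0 hZ.simple hZ.finite ht e

theorem measurable_comp (hZ : IsJumpProcess X R Γ Z Zm) {t : ℝ} (ht : 0 ≤ t) {β : Type*}
    [MeasurableSpace β] (F : E → β) : Measurable[clockPast X t] fun ω => F (Z t ω) := by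
  intro B _
  have : (fun ω => F (Z t ω)) ⁻¹' B = ⋃ e ∈ F ⁻¹' B, {ω | Z t ω = e} := by
    ext ω; simp
  rw [this]
  exact MeasurableSet.biUnion (Set.to_countable _) fun e _ => hZ.measurableSet_eq ht e

variable [MeasurableSpace Ω] {P : Measure Ω} [IsProbabilityMeasure P] {τ : Ω → ℝ}

omit [Countable V] [Countable E] [IsProbabilityMeasure P] in
theorem _root_.IsClockStop.measurable (hX : IsPoissonClocks X P) (hτ : IsClockStop X τ) :
    Measurable τ := by
  refine measurable_of_Iic fun r => ?_
  rcases lt_or_ge r 0 with h | h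
  · have : τ ⁻¹' Set.Iic r = ∅ := by
      ext ω
      simp [h.trans_le (hτ.nonneg ω)]
    rw [this]
    exact MeasurableSet.empty
  · exact hX.clockPast_le r _ (hτ.meas r h)

/-- The expected sum over the jumps of a process between two times. -/
theorem lintegral_jumps (hZ : IsJumpProcess X R Γ Z Zm) (hX : IsPoissonClocks X P)
    (hτ : IsClockStop X τ) {s t : ℝ} (hs : 0 ≤ s) {A : Set Ω}
    (hA : MeasurableSet[clockPast X s] A) (g : Mark V → E → ℝ≥0∞) :
    AEMeasurable (fun ω => ∑' q : IsJumpPath.jumps (fun m => X m ω) R (fun t => Zm t ω)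
        (min s (τ ω)) (min t (τ ω)), g q.1.1 (Zm q.1.2.1 ω)) (P.restrict A) ∧
    ∫⁻ ω in A, (∑' q : IsJumpPath.jumps (fun m => X m ω) R (fun t => Zm t ω)
        (min s (τ ω)) (min t (τ ω)), g q.1.1 (Zm q.1.2.1 ω)) ∂P =
      ∫⁻ ω in A, (∫⁻ r in Set.Ioc s t, {r | r < τ ω}.indicator
        (fun r => ∑' m, ENNReal.ofReal (R m (Z r ω)) * g m (Z r ω)) r) ∂P := by
  have hAm : MeasurableSet A := hX.clockPast_le s _ hA
  obtain ⟨T, hT⟩ := exists_nat_ge t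
  -- The inequalities are chosen so that `D` is adapted and its left limit `Dm` describes jump times
  -- in `(s, t]` up to and including `τ`.
  let D : E → ℝ → Set Ω := fun e r => {ω | s ≤ r ∧ r < t ∧ ω ∈ A ∧ Z r ω = e ∧ r < τ ω}
  let Dm : E → ℝ → Set Ω := fun e r => {ω | s < r ∧ r ≤ t ∧ ω ∈ A ∧ Zm r ω = e ∧ r ≤ τ ω}
  have hD : ∀ e r, 0 ≤ r → MeasurableSet[clockPast X r] (D e r) := by
    intro e r hr
    by_cases hsr : s ≤ r ∧ r < t
    · have : D e r = A ∩ {ω | Z r ω = e} ∩ {ω | τ ω ≤ r}ᶜ := by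
        ext ω
        simp only [D, hsr.1, hsr.2, Set.mem_ofPred_eq, Set.mem_inter_iff, Set.mem_compl_iff, not_le]
        tauto
      rw [this]
      exact ((clockPast_mono X hsr.1 _ hA).inter (hZ.measurableSet_eq hr e)).inter
        (hτ.meas r hr).compl
    · have : D e r = ∅ := by
        ext ω
        simp only [D, Set.mem_ofPred_eq, Set.mem_empty_iff_false, iff_false]
        exact fun h => hsr ⟨h.1, h.2.1⟩
      rw [this]
      exact @MeasurableSet.empty _ (clockPast X r)
  have hDm : ∀ e r, 0 ≤ r → MeasurableSet (D e r) := fun e r hr => hX.clockPast_le r _ (hD e r hr)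
  have hleft : ∀ e ω, ∀ r, 0 < r → ∀ᶠ r' in 𝓝[<] r, (ω ∈ D e r' ↔ ω ∈ Dm e r) := by
    intro e ω r hr
    filter_upwards [eventually_le_iff_lt s r, eventually_lt_iff_le t r,
      eventually_lt_iff_le (τ ω) r, (hZ.path ω).left r hr] with r' h1 h2 h3 h4
    simp only [D, Dm, Set.mem_ofPred_eq, h1, h2, h3, h4]
  -- For a fixed state `e` the height `R m e` is deterministic, so the compensation formula applies
  -- to each pair `(m, e)`.
  let S : Ω → Mark V → E → Set (ℝ × ℝ) := fun ω m e =>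
    {p ∈ X m ω ∩ Set.Ioc (0 : ℝ) T ×ˢ Set.Ioo 0 (R m e) | ω ∈ Dm e p.1}
  have hSae : ∀ m e, AEMeasurable (fun ω => ((S ω m e).encard : ℝ≥0∞)) P := fun m e =>
    hX.aemeasurable_encard_leftLim T (hDm e) (hleft e) m _
  have hpath : ∀ ω ∈ A, ∑' q : IsJumpPath.jumps (fun m => X m ω) R (fun t => Zm t ω)
      (min s (τ ω)) (min t (τ ω)), g q.1.1 (Zm q.1.2.1 ω) =
        ∑' m, ∑' e, g m e * ((S ω m e).encard : ℝ≥0∞) := by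
    intro ω hω
    refine tsum_subtype_eq_tsum_tsum_encard (zm := fun t => Zm t ω) ?_ g
    rintro m e ⟨r, u⟩
    simp only [S, Dm, IsJumpPath.jumps, Fires, Set.mem_ofPred_eq, Set.mem_inter_iff, Set.mem_prod,
      Set.mem_Ioc, Set.mem_Ioo, hω, true_and]
    constructor
    · rintro ⟨⟨h1, ⟨h2, h3⟩, h4, h5⟩, h6, h7, h8, h9⟩
      exact ⟨⟨(min_le_left _ _).trans_lt h6, le_min h7 h9, h1, h4, h8 ▸ h5⟩, h8⟩
    · rintro ⟨⟨h1, h2, h3, h4, h5⟩, h6⟩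
      have hsr : s < r := by
        rcases min_lt_iff.1 h1 with h | h
        · exact h
        · exact absurd (h2.trans (min_le_right _ _)) (not_le.2 h)
      exact ⟨⟨h3, ⟨hs.trans_lt hsr, (h2.trans (min_le_left _ _)).trans hT⟩, h4, h6 ▸ h5⟩, hsr,
        h2.trans (min_le_left _ _), h6, h2.trans (min_le_right _ _)⟩
  have hmeasSum : AEMeasurable (fun ω => ∑' m, ∑' e, g m e * ((S ω m e).encard : ℝ≥0∞)) P :=
    AEMeasurable.tsum fun m => AEMeasurable.tsum fun e => (hSae m e).const_mul _
  have hae : (fun ω => ∑' m, ∑' e, g m e * ((S ω m e).encard : ℝ≥0∞)) =ᵐ[P.restrict A]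
      fun ω => ∑' q : IsJumpPath.jumps (fun m => X m ω) R (fun t => Zm t ω)
        (min s (τ ω)) (min t (τ ω)), g q.1.1 (Zm q.1.2.1 ω) := by
    filter_upwards [ae_restrict_mem hAm] with ω hω
    exact (hpath ω hω).symm
  refine ⟨hmeasSum.restrict.congr hae, ?_⟩
  rw [← lintegral_congr_ae hae]
  have hjoint : ∀ e, Measurable fun p : ℝ × Ω =>
      {p : ℝ × Ω | 0 < p.1 ∧ p.2 ∈ Dm e p.1}.indicator (1 : ℝ × Ω → ℝ≥0∞) p := fun e =>
    measurable_one.indicator (measurableSet_leftLim (hDm e) (hleft e))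
  have hjoint_eq : ∀ e r ω, 0 < r → {p : ℝ × Ω | 0 < p.1 ∧ p.2 ∈ Dm e p.1}.indicator
      (1 : ℝ × Ω → ℝ≥0∞) (r, ω) = (Dm e r).indicator (1 : Ω → ℝ≥0∞) ω := by
    intro e r ω hr
    by_cases h : ω ∈ Dm e r <;> simp [h, hr]
  -- the right-hand side as a double series
  have hrhs : ∀ ω ∈ A, ∫⁻ r in Set.Ioc s t, {r | r < τ ω}.indicator
        (fun r => ∑' m, ENNReal.ofReal (R m (Z r ω)) * g m (Z r ω)) r =
      ∑' m, ∑' e, ENNReal.ofReal (R m e) * g m e *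
        ∫⁻ r in Set.Ioc (0 : ℝ) T, (Dm e r).indicator (1 : Ω → ℝ≥0∞) ω := by
    intro ω hω
    have hIoc : ∀ e, Measurable fun r : ℝ =>
        {p : ℝ × Ω | 0 < p.1 ∧ p.2 ∈ Dm e p.1}.indicator (1 : ℝ × Ω → ℝ≥0∞) (r, ω) := fun e =>
      (hjoint e).comp measurable_prodMk_right
    have h1 : ∀ e, ∫⁻ r in Set.Ioc (0 : ℝ) T, (Dm e r).indicator (1 : Ω → ℝ≥0∞) ω =
        ∫⁻ r in Set.Ioc (0 : ℝ) T,
          {p : ℝ × Ω | 0 < p.1 ∧ p.2 ∈ Dm e p.1}.indicator (1 : ℝ × Ω → ℝ≥0∞) (r, ω) := fun e =>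
      setLIntegral_congr_fun measurableSet_Ioc fun r hr => (hjoint_eq e r ω hr.1).symm
    simp_rw [h1, ← lintegral_const_mul _ (hIoc _)]
    simp_rw [← lintegral_tsum fun e => ((hIoc e).const_mul _).aemeasurable]
    rw [← lintegral_tsum fun m => (Measurable.tsum fun e =>
      ((hIoc e).const_mul _)).aemeasurable]
    rw [← lintegral_indicator measurableSet_Ioc, ← lintegral_indicator measurableSet_Ioc]
    refine lintegral_congr_ae ?_
    -- Under `dr` the left limit may be replaced by the value of the path, and `r ≤ τ` by `r < τ`.
    have hnull := (((hZ.path ω).countable_ne (hZ.finite ω)).union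
      (Set.countable_singleton (τ ω))).measure_zero volume
    filter_upwards [measure_eq_zero_iff_ae_notMem.1 hnull] with r hr
    simp only [Set.mem_union, Set.mem_ofPred_eq, Set.mem_singleton_iff, not_or, not_and,
      not_not] at hr
    by_cases hr0 : r ∈ Set.Ioc (0 : ℝ) T
    · rw [Set.indicator_of_mem hr0]
      have hval : ∀ m, ∑' e, ENNReal.ofReal (R m e) * g m e *
          {p : ℝ × Ω | 0 < p.1 ∧ p.2 ∈ Dm e p.1}.indicator (1 : ℝ × Ω → ℝ≥0∞) (r, ω) =
          if s < r ∧ r ≤ t ∧ r < τ ω then ENNReal.ofReal (R m (Z r ω)) * g m (Z r ω) else 0 := by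
        intro m
        rw [tsum_eq_single (Z r ω)]
        · rw [hjoint_eq _ _ _ hr0.1]
          have : ω ∈ Dm (Z r ω) r ↔ s < r ∧ r ≤ t ∧ r < τ ω := by
            simp only [Dm, Set.mem_ofPred_eq, hω, true_and, ← hr.1 hr0.1]
            rw [Ne.le_iff_lt hr.2]
          by_cases h : s < r ∧ r ≤ t ∧ r < τ ω
          · simp [this.2 h, h]
          · rw [if_neg h, Set.indicator_of_notMem (mt this.1 h), mul_zero]
        · intro e he
          rw [hjoint_eq _ _ _ hr0.1, Set.indicator_of_notMem, mul_zero]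
          rintro ⟨-, -, -, h, -⟩
          exact he (h.symm.trans (hr.1 hr0.1).symm)
      simp_rw [hval]
      by_cases h : s < r ∧ r ≤ t
      · rw [Set.indicator_of_mem (Set.mem_Ioc.2 h)]
        by_cases h' : r < τ ω <;> simp [h, h']
      · rw [Set.indicator_of_notMem (mt Set.mem_Ioc.1 h)]
        simp [← and_assoc, h]
    · rw [Set.indicator_of_notMem hr0, Set.indicator_of_notMem]
      exact fun h => hr0 ⟨hs.trans_lt h.1, h.2.trans hT⟩
  have hrhs' : ∫⁻ ω in A, (∫⁻ r in Set.Ioc s t, {r | r < τ ω}.indicator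
        (fun r => ∑' m, ENNReal.ofReal (R m (Z r ω)) * g m (Z r ω)) r) ∂P =
      ∫⁻ ω in A, (∑' m, ∑' e, ENNReal.ofReal (R m e) * g m e *
        ∫⁻ r in Set.Ioc (0 : ℝ) T, (Dm e r).indicator (1 : Ω → ℝ≥0∞) ω) ∂P :=
    setLIntegral_congr_fun hAm hrhs
  have hinner : ∀ e, Measurable fun ω =>
      ∫⁻ r in Set.Ioc (0 : ℝ) T, (Dm e r).indicator (1 : Ω → ℝ≥0∞) ω := by
    intro e
    have h1 : (fun ω => ∫⁻ r in Set.Ioc (0 : ℝ) T, (Dm e r).indicator (1 : Ω → ℝ≥0∞) ω) =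
        fun ω => ∫⁻ r in Set.Ioc (0 : ℝ) T,
          {p : ℝ × Ω | 0 < p.1 ∧ p.2 ∈ Dm e p.1}.indicator (1 : ℝ × Ω → ℝ≥0∞) (r, ω) := by
      funext ω
      exact setLIntegral_congr_fun measurableSet_Ioc fun r hr => (hjoint_eq e r ω hr.1).symm
    rw [h1]
    exact (hjoint e).lintegral_prod_left'
  rw [hrhs', lintegral_tsum fun m => (AEMeasurable.tsum fun e =>
      ((hSae m e).const_mul _).restrict), lintegral_tsum fun m => (Measurable.tsum fun e =>
      ((hinner e).const_mul _)).aemeasurable]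
  refine tsum_congr fun m => ?_
  rw [lintegral_tsum fun e => ((hSae m e).const_mul _).restrict, lintegral_tsum fun e =>
      ((hinner e).const_mul _).aemeasurable]
  refine tsum_congr fun e => ?_
  have hSA : ∀ ω ∉ A, ((S ω m e).encard : ℝ≥0∞) = 0 := by
    intro ω hω
    have : S ω m e = ∅ := by
      ext p
      simp only [S, Dm, Set.mem_ofPred_eq, Set.mem_empty_iff_false, iff_false]
      exact fun h => hω h.2.2.2.1
    simp [this]
  have hIA : ∀ ω ∉ A, ∫⁻ r in Set.Ioc (0 : ℝ) T, (Dm e r).indicator (1 : Ω → ℝ≥0∞) ω = 0 := by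
    intro ω hω
    have : ∀ r, (Dm e r).indicator (1 : Ω → ℝ≥0∞) ω = 0 := fun r =>
      Set.indicator_of_notMem (fun h => hω h.2.2.1) _
    simp [this]
  rw [setLIntegral_eq_of_support_subset, setLIntegral_eq_of_support_subset]
  · rw [lintegral_const_mul'' _ (hSae m e), lintegral_const_mul _ (hinner e),
      hX.compensation T (hD e) (hleft e) m (R m e)]
    ring
  · intro ω hω
    by_contra h
    exact hω (by simp [hIA ω h])
  · intro ω hω
    by_contra h
    exact hω (by simp [hSA ω h])


end IsJumpProcess

/-- The generator of a jump process. -/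
noncomputable def jumpGen {V E : Type*} (R : Mark V → E → ℝ) (Γ : Mark V → E → E) (W : E → ℝ)
    (e : E) : ℝ := ∑' m, R m e * (W (Γ m e) - W e)

/-- Splits an absolutely convergent series into positive and negative parts, so that identities for
sums in `[0, ∞]` can be used for signed increments. The two bounds keep both parts finite. -/
theorem ENNReal.toReal_sub_toReal_tsum {M : Type*} {c w : M → ℝ} (hc : ∀ m, 0 ≤ c m)
    (h : Summable fun m => c m * |w m|) :
    (∑' m, ENNReal.ofReal (c m) * ENNReal.ofReal (w m)).toReal -
      (∑' m, ENNReal.ofReal (c m) * ENNReal.ofReal (-w m)).toReal = ∑' m, c m * w m ∧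
    ∑' m, ENNReal.ofReal (c m) * ENNReal.ofReal (w m) ≤ ENNReal.ofReal (∑' m, c m * |w m|) ∧
    ∑' m, ENNReal.ofReal (c m) * ENNReal.ofReal (-w m) ≤ ENNReal.ofReal (∑' m, c m * |w m|) := by
  have h1 : ∀ v : M → ℝ, (∀ m, |v m| = |w m|) →
      Summable (fun m => c m * max (v m) 0) ∧
      ∑' m, ENNReal.ofReal (c m) * ENNReal.ofReal (v m) =
        ENNReal.ofReal (∑' m, c m * max (v m) 0) ∧
      ∑' m, ENNReal.ofReal (c m) * ENNReal.ofReal (v m) ≤ ENNReal.ofReal (∑' m, c m * |w m|) := by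
    intro v hv
    have hnn : ∀ m, 0 ≤ c m * max (v m) 0 := fun m => mul_nonneg (hc m) (le_max_right _ _)
    have hle : ∀ m, c m * max (v m) 0 ≤ c m * |w m| := fun m =>
      mul_le_mul_of_nonneg_left (max_le ((le_abs_self _).trans_eq (hv m)) (abs_nonneg _)) (hc m)
    have hs := Summable.of_nonneg_of_le hnn hle h
    have he : ∑' m, ENNReal.ofReal (c m) * ENNReal.ofReal (v m) =
        ENNReal.ofReal (∑' m, c m * max (v m) 0) := by
      rw [ENNReal.ofReal_tsum_of_nonneg hnn hs]
      refine tsum_congr fun m => ?_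
      rw [ENNReal.ofReal_mul (hc m), ENNReal.ofReal_max, ENNReal.ofReal_zero, max_eq_left zero_le]
    exact ⟨hs, he, he ▸ ENNReal.ofReal_le_ofReal (hs.tsum_le_tsum hle h)⟩
  obtain ⟨s1, e1, l1⟩ := h1 w fun _ => rfl
  obtain ⟨s2, e2, l2⟩ := h1 (fun m => -w m) fun m => abs_neg _
  refine ⟨?_, l1, l2⟩
  rw [e1, e2, ENNReal.toReal_ofReal (tsum_nonneg fun m => mul_nonneg (hc m) (le_max_right _ _)),
    ENNReal.toReal_ofReal (tsum_nonneg fun m => mul_nonneg (hc m) (le_max_right _ _)),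
    ← s1.tsum_sub s2]
  refine tsum_congr fun m => ?_
  rw [← mul_sub, max_zero_sub_max_neg_zero_eq_self]

theorem IsJumpPath.restart {V E : Type*} {X : Mark V → Set (ℝ × ℝ)} {R : Mark V → E → ℝ}
    {Γ : Mark V → E → E} {s s' : ℝ} {z zm : ℝ → E} (hz : IsJumpPath X R Γ s z zm) (h : s ≤ s') :
    IsJumpPath X R Γ s' z zm :=
  ⟨fun t ht => hz.right t (h.trans ht), fun t ht => hz.left t (h.trans_lt ht),
    fun t ht => hz.stay t (h.trans_lt ht), fun t ht => hz.jump t (h.trans_lt ht)⟩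

/-- The increment of a function along a path as a difference of two positive sums. -/
theorem IsJumpPath.sub_eq_tsum {V E : Type*} {X : Mark V → Set (ℝ × ℝ)} {R : Mark V → E → ℝ}
    {Γ : Mark V → E → E} {z zm : ℝ → E} (hz : IsJumpPath X R Γ 0 z zm) (hS : ClocksSimple X)
    (hF : ClocksFinite X R) {a b : ℝ} (ha : 0 ≤ a) (hab : a ≤ b) (W : E → ℝ) :
    W (z b) - W (z a) =
      (∑' q : IsJumpPath.jumps X R zm a b,
        ENNReal.ofReal (W (Γ q.1.1 (zm q.1.2.1)) - W (zm q.1.2.1))).toReal -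
      (∑' q : IsJumpPath.jumps X R zm a b,
        ENNReal.ofReal (-(W (Γ q.1.1 (zm q.1.2.1)) - W (zm q.1.2.1)))).toReal := by
  obtain ⟨hfin, hW⟩ := (hz.restart ha).jumps_finite_and_sub_eq ha hS hF b hab
  have := hfin.to_subtype
  have := Fintype.ofFinite (IsJumpPath.jumps X R zm a b)
  have h := (ENNReal.toReal_sub_toReal_tsum (c := fun _ : IsJumpPath.jumps X R zm a b => 1)
    (w := fun q => W (Γ q.1.1 (zm q.1.2.1)) - W (zm q.1.2.1)) (fun _ => zero_le_one)
    (Summable.of_finite)).1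
  simp only [ENNReal.ofReal_one, one_mul] at h
  rw [h, hW W, ← finsum_set_coe_eq_finsum_mem, finsum_eq_sum_of_fintype, tsum_fintype]

namespace IsJumpProcess

variable {V E Ω : Type*} [Countable V] [Countable E] {X : Mark V → Ω → Set (ℝ × ℝ)}
  {R : Mark V → E → ℝ} {Γ : Mark V → E → E} {Z Zm : ℝ → Ω → E}
  [MeasurableSpace Ω] {P : Measure Ω} [IsProbabilityMeasure P] {τ : Ω → ℝ}

omit [IsProbabilityMeasure P] in
theorem measurable_uncurry (hZ : IsJumpProcess X R Γ Z Zm) (hX : IsPoissonClocks X P) {β : Type*}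
    [TopologicalSpace β] [TopologicalSpace.PseudoMetrizableSpace β] [MeasurableSpace β]
    [BorelSpace β] (F : E → β) {t : ℝ} (ht : 0 ≤ t) :
    Measurable fun p : ℝ × Ω => F (Z (max 0 (min p.1 t)) p.2) := by
  refine measurable_of_rightContinuous (h := fun r ω => F (Z r ω)) ht
    (fun r hr => (hZ.measurable_comp hr.1 F).mono (hX.clockPast_le r) le_rfl) fun ω r hr => ?_
  refine continuousWithinAt_Ioi_iff_Ici.1 ?_
  refine tendsto_const_nhds.congr' ?_
  filter_upwards [(hZ.path ω).right r hr.1] with r' h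
  rw [h]

omit [IsProbabilityMeasure P] in
theorem measurable_indicator_lt (hZ : IsJumpProcess X R Γ Z Zm) (hX : IsPoissonClocks X P)
    (hτ : Measurable τ) {β : Type*} [TopologicalSpace β]
    [TopologicalSpace.PseudoMetrizableSpace β] [MeasurableSpace β] [BorelSpace β] [Zero β]
    (F : E → β) {t : ℝ} (ht : 0 ≤ t) :
    Measurable fun p : ℝ × Ω =>
      {r | r < τ p.2}.indicator (fun r => F (Z (max 0 (min r t)) p.2)) p.1 := by
  have h : MeasurableSet {p : ℝ × Ω | p.1 < τ p.2} :=
    measurableSet_lt measurable_fst (hτ.comp measurable_snd)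
  exact (hZ.measurable_uncurry hX F ht).indicator h

/-- Dynkin's formula for a jump process up to a stopping time before which the rates of change are
bounded. -/
theorem dynkin (hZ : IsJumpProcess X R Γ Z Zm) (hX : IsPoissonClocks X P)
    (hτ : IsClockStop X τ) {s t : ℝ} (hs : 0 ≤ s) (hst : s ≤ t) {A : Set Ω}
    (hA : MeasurableSet[clockPast X s] A) (hR : ∀ m e, 0 ≤ R m e) (W : E → ℝ)
    (hsum : ∀ e, Summable fun m => R m e * |W (Γ m e) - W e|) {K : ℝ}
    (hK : ∀ ω r, 0 ≤ r → r < τ ω → ∑' m, R m (Z r ω) * |W (Γ m (Z r ω)) - W (Z r ω)| ≤ K) :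
    (Integrable (fun ω => W (Z (min t (τ ω)) ω) - W (Z (min s (τ ω)) ω)) P ∧
      Integrable (fun ω => ∫ r in s..t,
        {r | r < τ ω}.indicator (fun r => jumpGen R Γ W (Z r ω)) r) P ∧
      ∀ ω, IntervalIntegrable ({r | r < τ ω}.indicator fun r => jumpGen R Γ W (Z r ω))
        volume s t) ∧
    ∫ ω in A, (W (Z (min t (τ ω)) ω) - W (Z (min s (τ ω)) ω)) ∂P =
      ∫ ω in A, (∫ r in s..t, {r | r < τ ω}.indicator (fun r => jumpGen R Γ W (Z r ω)) r) ∂P := by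
  have ht : 0 ≤ t := hs.trans hst
  -- The rate of upward changes of `v`. It is used for `W` and for `-W`, whose difference is the
  -- generator.
  let G : (E → ℝ) → E → ℝ≥0∞ := fun v e =>
    ∑' m, ENNReal.ofReal (R m e) * ENNReal.ofReal (v (Γ m e) - v e)
  have hG := fun e => ENNReal.toReal_sub_toReal_tsum (hR · e) (hsum e)
  have hGW : ∀ e, (G W e).toReal - (G (-W) e).toReal = jumpGen R Γ W e := by
    intro e
    rw [jumpGen, ← (hG e).1]
    simp only [G, Pi.neg_apply, neg_sub_neg, neg_sub]
  have hGle : ∀ v ∈ ({W, -W} : Set (E → ℝ)), ∀ ω r, 0 ≤ r → r < τ ω →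
      G v (Z r ω) ≤ ENNReal.ofReal K := by
    intro v hv ω r hr hrτ
    refine le_trans ?_ (ENNReal.ofReal_le_ofReal (hK ω r hr hrτ))
    rcases hv with rfl | rfl
    · exact (hG _).2.1
    · have := (hG (Z r ω)).2.2
      simpa only [G, Pi.neg_apply, neg_sub_neg, neg_sub] using this
  let J : (E → ℝ) → Ω → ℝ≥0∞ := fun v ω =>
    ∑' q : IsJumpPath.jumps (fun m => X m ω) R (fun t => Zm t ω) (min s (τ ω)) (min t (τ ω)),
      ENNReal.ofReal (v (Γ q.1.1 (Zm q.1.2.1 ω)) - v (Zm q.1.2.1 ω))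
  have hJW : ∀ ω, W (Z (min t (τ ω)) ω) - W (Z (min s (τ ω)) ω) =
      (J W ω).toReal - (J (-W) ω).toReal := by
    intro ω
    rw [(hZ.path ω).sub_eq_tsum (hZ.simple ω) (hZ.finite ω) (le_min hs (hτ.nonneg ω))
      (min_le_min_right _ hst) W]
    simp only [J, Pi.neg_apply, neg_sub_neg, neg_sub]
  let H : (E → ℝ) → Ω → ℝ≥0∞ := fun v ω =>
    ∫⁻ r in Set.Ioc s t, {r | r < τ ω}.indicator (fun r => G v (Z r ω)) r
  have hJH : ∀ v B, MeasurableSet[clockPast X s] B →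
      AEMeasurable (J v) (P.restrict B) ∧ ∫⁻ ω in B, J v ω ∂P = ∫⁻ ω in B, H v ω ∂P :=
    fun v B hB => hZ.lintegral_jumps hX hτ hs hB
      fun m e => ENNReal.ofReal (v (Γ m e) - v e)
  -- Joint measurability is available for the process with time clipped to `[0, t]`; on `(s, t]`
  -- clipping changes nothing.
  have hclip : ∀ r ∈ Set.Ioc s t, max 0 (min r t) = r := fun r hr => by
    rw [min_eq_left hr.2, max_eq_right (hs.trans hr.1.le)]
  have hHm : ∀ v, Measurable (H v) := by
    intro v
    have h1 : H v = fun ω => ∫⁻ r in Set.Ioc s t,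
        {r | r < τ ω}.indicator (fun r => G v (Z (max 0 (min r t)) ω)) r := by
      funext ω
      refine setLIntegral_congr_fun measurableSet_Ioc fun r hr => ?_
      simp only [Set.indicator_apply, hclip r hr]
    rw [h1]
    exact (hZ.measurable_indicator_lt hX (hτ.measurable hX) (G v) ht).lintegral_prod_left'
  have hHle : ∀ v ∈ ({W, -W} : Set (E → ℝ)), ∀ ω,
      H v ω ≤ ENNReal.ofReal K * ENNReal.ofReal (t - s) := by
    intro v hv ω
    calc H v ω ≤ ∫⁻ _ in Set.Ioc s t, ENNReal.ofReal K := by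
          refine setLIntegral_mono measurable_const fun r hr => ?_
          by_cases h : r < τ ω
          · rw [Set.indicator_of_mem (show r ∈ {r | r < τ ω} from h)]
            exact hGle v hv ω r (hs.trans hr.1.le) h
          · rw [Set.indicator_of_notMem (show r ∉ {r | r < τ ω} from h)]
            exact zero_le
      _ = _ := by simp
  have hfin : ENNReal.ofReal K * ENNReal.ofReal (t - s) < ∞ :=
    ENNReal.mul_lt_top ENNReal.ofReal_lt_top ENNReal.ofReal_lt_top
  have hHint : ∀ v ∈ ({W, -W} : Set (E → ℝ)), ∀ B, ∫⁻ ω in B, H v ω ∂P ≠ ∞ := by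
    intro v hv B
    refine ((lintegral_mono (hHle v hv)).trans_lt ?_).ne
    rw [lintegral_const]
    exact ENNReal.mul_lt_top hfin (measure_lt_top _ _)
  have hHreal : ∀ ω, (H W ω).toReal - (H (-W) ω).toReal =
      (∫ r in s..t, {r | r < τ ω}.indicator (fun r => jumpGen R Γ W (Z r ω)) r) ∧
      IntervalIntegrable ({r | r < τ ω}.indicator fun r => jumpGen R Γ W (Z r ω))
        volume s t := by
    intro ω
    have hm : ∀ v, AEMeasurable (fun r => {r | r < τ ω}.indicator (fun r => G v (Z r ω)) r)
        (volume.restrict (Set.Ioc s t)) := by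
      intro v
      refine (((hZ.measurable_indicator_lt hX (hτ.measurable hX) (G v) ht).comp
        (measurable_prodMk_right (y := ω))).aemeasurable).congr ?_
      filter_upwards [ae_restrict_mem measurableSet_Ioc] with r hr
      simp only [Function.comp_apply, Set.indicator_apply, hclip r hr]
    have hlt : ∀ v ∈ ({W, -W} : Set (E → ℝ)), ∀ᵐ r ∂volume.restrict (Set.Ioc s t),
        {r | r < τ ω}.indicator (fun r => G v (Z r ω)) r < ∞ := fun v hv =>
      ae_lt_top' (hm v) ((hHle v hv ω).trans_lt hfin).ne
    have hi : ∀ v ∈ ({W, -W} : Set (E → ℝ)), Integrable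
        (fun r => ({r | r < τ ω}.indicator (fun r => G v (Z r ω)) r).toReal)
        (volume.restrict (Set.Ioc s t)) := fun v hv =>
      integrable_toReal_of_lintegral_ne_top (hm v) ((hHle v hv ω).trans_lt hfin).ne
    have hsub : ∀ r, ({r | r < τ ω}.indicator (fun r => G W (Z r ω)) r).toReal -
        ({r | r < τ ω}.indicator (fun r => G (-W) (Z r ω)) r).toReal =
          {r | r < τ ω}.indicator (fun r => jumpGen R Γ W (Z r ω)) r := by
      intro r
      by_cases h : r < τ ω
      · simp only [Set.indicator_of_mem (show r ∈ {r | r < τ ω} from h), hGW]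
      · simp [Set.indicator_of_notMem (show r ∉ {r | r < τ ω} from h)]
    rw [intervalIntegral.integral_of_le hst, ← integral_toReal (hm W) (hlt W (by simp)),
      ← integral_toReal (hm (-W)) (hlt (-W) (by simp)),
      ← integral_sub (hi W (by simp)) (hi (-W) (by simp))]
    refine ⟨setIntegral_congr_fun measurableSet_Ioc fun r hr => hsub r, ?_⟩
    rw [intervalIntegrable_iff_integrableOn_Ioc_of_le hst]
    exact ((hi W (by simp)).sub (hi (-W) (by simp))).congr (Eventually.of_forall hsub)
  -- Integrability of the jump sums is read off the compensator, which is at most `K (t - s)`.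
  have hJint : ∀ v ∈ ({W, -W} : Set (E → ℝ)), ∀ B, MeasurableSet[clockPast X s] B →
      ∫⁻ ω in B, J v ω ∂P ≠ ∞ := fun v hv B hB => by
    rw [(hJH v B hB).2]
    exact hHint v hv B
  have hJi : ∀ v ∈ ({W, -W} : Set (E → ℝ)), ∀ B, MeasurableSet[clockPast X s] B →
      Integrable (fun ω => (J v ω).toReal) (P.restrict B) := fun v hv B hB =>
    integrable_toReal_of_lintegral_ne_top (hJH v B hB).1 (hJint v hv B hB)
  have hHi : ∀ v ∈ ({W, -W} : Set (E → ℝ)), ∀ B, Integrable (fun ω => (H v ω).toReal)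
      (P.restrict B) := fun v hv B =>
    integrable_toReal_of_lintegral_ne_top (hHm v).aemeasurable (hHint v hv B)
  have hJHr : ∀ v ∈ ({W, -W} : Set (E → ℝ)),
      ∫ ω in A, (J v ω).toReal ∂P = ∫ ω in A, (H v ω).toReal ∂P := by
    intro v hv
    rw [integral_toReal (hJH v A hA).1 (ae_lt_top' (hJH v A hA).1 (hJint v hv A hA)),
      integral_toReal (hHm v).aemeasurable (ae_lt_top' (hHm v).aemeasurable (hHint v hv A)),
      (hJH v A hA).2]
  have huniv : MeasurableSet[clockPast X s] Set.univ := @MeasurableSet.univ _ (clockPast X s)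
  simp_rw [hJW, ← fun ω => (hHreal ω).1]
  refine ⟨⟨?_, ?_, fun ω => (hHreal ω).2⟩, ?_⟩
  · have h1 := hJi W (by simp) Set.univ huniv
    have h2 := hJi (-W) (by simp) Set.univ huniv
    rw [Measure.restrict_univ] at h1 h2
    exact h1.sub h2
  · have h1 := hHi W (by simp) Set.univ
    have h2 := hHi (-W) (by simp) Set.univ
    rw [Measure.restrict_univ] at h1 h2
    exact h1.sub h2
  · rw [integral_sub (hJi W (by simp) A hA) (hJi (-W) (by simp) A hA),
      integral_sub (hHi W (by simp) A) (hHi (-W) (by simp) A), hJHr W (by simp), hJHr (-W) (by simp)]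

end IsJumpProcess

/-! ### Hitting times -/

section Hitting

variable {V E Ω : Type*} {Z : ℝ → Ω → E} {B : Set E} {T : ℝ} {ω : Ω}

/-- The first time at which `Z` is in `B`, or `T` if this does not happen before. -/
noncomputable def hitTime (Z : ℝ → Ω → E) (B : Set E) (T : ℝ) (ω : Ω) : ℝ :=
  sInf ({t | 0 ≤ t ∧ Z t ω ∈ B} ∪ {T})

theorem hitTime_bddBelow (hT : 0 ≤ T) : BddBelow ({t | 0 ≤ t ∧ Z t ω ∈ B} ∪ {T}) := by
  refine ⟨0, ?_⟩
  rintro x (hx | rfl)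
  · exact hx.1
  · exact hT

theorem hitTime_le (hT : 0 ≤ T) : hitTime Z B T ω ≤ T :=
  csInf_le (hitTime_bddBelow hT) (Or.inr rfl)

theorem hitTime_nonneg (hT : 0 ≤ T) : 0 ≤ hitTime Z B T ω := by
  refine le_csInf ⟨T, Or.inr rfl⟩ ?_
  rintro x (hx | rfl)
  · exact hx.1
  · exact hT

theorem notMem_of_lt_hitTime (hT : 0 ≤ T) {r : ℝ} (hr : 0 ≤ r) (h : r < hitTime Z B T ω) :
    Z r ω ∉ B := fun hB => not_lt.2 (csInf_le (hitTime_bddBelow hT) (Or.inl ⟨hr, hB⟩)) h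

/-- Right constancy makes the infimum attained; the assumption `< T` excludes the cap. -/
theorem mem_of_hitTime_lt (hright : ∀ t, 0 ≤ t → ∀ᶠ t' in 𝓝[>] t, Z t' ω = Z t ω) (hT : 0 ≤ T)
    (h : hitTime Z B T ω < T) : Z (hitTime Z B T ω) ω ∈ B := by
  by_contra hB
  obtain ⟨c, hc, hcz⟩ := mem_nhdsGT_iff_exists_Ioo_subset.1 (hright _ (hitTime_nonneg hT))
  obtain ⟨x, hx, hxc⟩ := exists_lt_of_csInf_lt ⟨T, Or.inr rfl⟩ (lt_min (Set.mem_Ioi.1 hc) h)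
  have hle := csInf_le (hitTime_bddBelow hT) hx
  rcases hx with hx | rfl
  · rcases hle.eq_or_lt with he | hlt
    · exact hB ((congrArg (fun r => Z r ω) he).symm ▸ hx.2)
    · have : Z x ω = Z (hitTime Z B T ω) ω := hcz ⟨hlt, hxc.trans_le (min_le_left _ _)⟩
      exact hB (this ▸ hx.2)
  · exact absurd hxc (not_lt.2 (min_le_right _ _))

theorem hitTime_le_iff (hright : ∀ t, 0 ≤ t → ∀ᶠ t' in 𝓝[>] t, Z t' ω = Z t ω) (hT : 0 ≤ T)
    {r : ℝ} (hr : r < T) : hitTime Z B T ω ≤ r ↔ ∃ t, 0 ≤ t ∧ t ≤ r ∧ Z t ω ∈ B := by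
  constructor
  · intro h
    exact ⟨_, hitTime_nonneg hT, h, mem_of_hitTime_lt hright hT (h.trans_lt hr)⟩
  · rintro ⟨t, h0, h1, h2⟩
    exact (csInf_le (hitTime_bddBelow hT) (Or.inl ⟨h0, h2⟩)).trans h1

/-- A right-constant path visits a set in `[0, r]` iff it does so at a rational time or at `r`. -/
theorem exists_le_mem_iff_rat (hright : ∀ t, 0 ≤ t → ∀ᶠ t' in 𝓝[>] t, Z t' ω = Z t ω) {r : ℝ}
    (hr : 0 ≤ r) : (∃ t, 0 ≤ t ∧ t ≤ r ∧ Z t ω ∈ B) ↔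
      Z r ω ∈ B ∨ ∃ q : ℚ, 0 ≤ (q : ℝ) ∧ (q : ℝ) ≤ r ∧ Z q ω ∈ B := by
  constructor
  · rintro ⟨t, h0, h1, h2⟩
    rcases h1.eq_or_lt with rfl | h1
    · exact Or.inl h2
    · obtain ⟨c, hc, hcz⟩ := mem_nhdsGT_iff_exists_Ioo_subset.1 (hright t h0)
      obtain ⟨q, hq1, hq2⟩ := exists_rat_btwn (lt_min (Set.mem_Ioi.1 hc) h1)
      have hq : Z q ω = Z t ω := hcz ⟨hq1, hq2.trans_le (min_le_left _ _)⟩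
      exact Or.inr ⟨q, h0.trans hq1.le, (hq2.trans_le (min_le_right _ _)).le, hq ▸ h2⟩
  · rintro (h | ⟨q, h⟩)
    · exact ⟨r, hr, le_rfl, h⟩
    · exact ⟨q, h⟩

theorem measurableSet_exists_le_mem {m : MeasurableSpace Ω} [Countable E] {r : ℝ} (hr : 0 ≤ r)
    (hmeas : ∀ t, 0 ≤ t → t ≤ r → ∀ e, MeasurableSet {ω | Z t ω = e})
    (hright : ∀ ω t, 0 ≤ t → ∀ᶠ t' in 𝓝[>] t, Z t' ω = Z t ω) (B : Set E) :
    MeasurableSet {ω | ∃ t, 0 ≤ t ∧ t ≤ r ∧ Z t ω ∈ B} := by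
  have hB : ∀ t, 0 ≤ t → t ≤ r → MeasurableSet {ω | Z t ω ∈ B} := by
    intro t h0 h1
    have : {ω | Z t ω ∈ B} = ⋃ e ∈ B, {ω | Z t ω = e} := by ext ω; simp
    rw [this]
    exact MeasurableSet.biUnion (Set.to_countable _) fun e _ => hmeas t h0 h1 e
  have : {ω | ∃ t, 0 ≤ t ∧ t ≤ r ∧ Z t ω ∈ B} = {ω | Z r ω ∈ B} ∪
      ⋃ (q : ℚ) (_ : 0 ≤ (q : ℝ)) (_ : (q : ℝ) ≤ r), {ω | Z q ω ∈ B} := by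
    ext ω
    simp only [Set.mem_ofPred_eq, exists_le_mem_iff_rat (hright ω) hr, Set.mem_union,
      Set.mem_iUnion, exists_prop]
  rw [this]
  exact MeasurableSet.union (hB r hr le_rfl) (MeasurableSet.iUnion fun q =>
    MeasurableSet.iUnion fun h0 => MeasurableSet.iUnion fun h1 => hB q h0 h1)

theorem measurableSet_hitTime_le {m : MeasurableSpace Ω} [Countable E] {r : ℝ} (hr : 0 ≤ r)
    (hmeas : ∀ t, 0 ≤ t → t ≤ r → ∀ e, MeasurableSet {ω | Z t ω = e})
    (hright : ∀ ω t, 0 ≤ t → ∀ᶠ t' in 𝓝[>] t, Z t' ω = Z t ω) (B : Set E) (hT : 0 ≤ T) :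
    MeasurableSet {ω | hitTime Z B T ω ≤ r} := by
  rcases lt_or_ge r T with h | h
  · simp_rw [hitTime_le_iff (hright _) hT h]
    exact measurableSet_exists_le_mem hr hmeas hright B
  · have : {ω | hitTime Z B T ω ≤ r} = Set.univ :=
      Set.eq_univ_of_forall fun ω => (hitTime_le hT).trans h
    rw [this]
    exact MeasurableSet.univ

theorem measurable_hitTime {m : MeasurableSpace Ω} [Countable E]
    (hmeas : ∀ t, 0 ≤ t → t ≤ T → ∀ e, MeasurableSet {ω | Z t ω = e})
    (hright : ∀ ω t, 0 ≤ t → ∀ᶠ t' in 𝓝[>] t, Z t' ω = Z t ω) (B : Set E) (hT : 0 ≤ T) :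
    Measurable (hitTime Z B T) := by
  refine measurable_of_Iic fun r => ?_
  rcases lt_or_ge r 0 with h | h
  · have : hitTime Z B T ⁻¹' Set.Iic r = ∅ := by
      ext ω
      simp [h.trans_le (hitTime_nonneg hT)]
    rw [this]
    exact MeasurableSet.empty
  rcases le_or_gt r T with h' | h'
  · exact measurableSet_hitTime_le h (fun t h0 h1 => hmeas t h0 (h1.trans h')) hright B hT
  · have : hitTime Z B T ⁻¹' Set.Iic r = Set.univ :=
      Set.eq_univ_of_forall fun ω => (hitTime_le hT).trans h'.le
    rw [this]
    exact MeasurableSet.univ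

theorem isClockStop_hitTime {X : Mark V → Ω → Set (ℝ × ℝ)} [Countable E]
    (hmeas : ∀ t, 0 ≤ t → ∀ e, MeasurableSet[clockPast X t] {ω | Z t ω = e})
    (hright : ∀ ω t, 0 ≤ t → ∀ᶠ t' in 𝓝[>] t, Z t' ω = Z t ω) (B : Set E) (hT : 0 ≤ T) :
    IsClockStop X (hitTime Z B T) :=
  ⟨fun _ => hitTime_nonneg hT, fun r hr => @measurableSet_hitTime_le E Ω Z T (clockPast X r) _ r hr
    (fun t h0 h1 e => clockPast_mono X h1 _ (hmeas t h0 e)) hright B hT⟩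

/-- The caps are consistent: stopping at the hitting time capped at `s` is stopping at the minimum
of `s` and the one capped at `T`. -/
theorem hitTime_eq_min {s : ℝ} (hs : 0 ≤ s) (hst : s ≤ T) :
    hitTime Z B s ω = min s (hitTime Z B T ω) := by
  refine le_antisymm (le_min (hitTime_le hs) (le_csInf ⟨T, Or.inr rfl⟩ ?_))
    (le_csInf ⟨s, Or.inr rfl⟩ ?_)
  · rintro x (hx | rfl)
    · exact csInf_le (hitTime_bddBelow hs) (Or.inl hx)
    · exact (hitTime_le hs).trans hst
  · rintro x (hx | rfl)
    · exact (min_le_right _ _).trans (csInf_le (hitTime_bddBelow (hs.trans hst)) (Or.inl hx))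
    · exact min_le_left _ _

end Hitting

/-! ### Sums over the marks -/

theorem hasSum_prod_of_nonneg {A B : Type*} {g : A × B → ℝ} {a : A → ℝ} {s : ℝ} (hg : 0 ≤ g)
    (h : ∀ x, HasSum (fun y => g (x, y)) (a x)) (ha : HasSum a s) : HasSum g s := by
  have hs : Summable g := (summable_prod_of_nonneg hg).2
    ⟨fun x => (h x).summable, by simpa only [(h _).tsum_eq] using ha.summable⟩
  have := hs.hasSum.prod_fiberwise h
  rw [← this.unique ha]
  exact hs.hasSum

theorem hasSum_mark {V : Type*} {g : Mark V → ℝ} {a b c : ℝ}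
    (ha : HasSum (fun x => g (.birth x)) a) (hb : HasSum (fun x => g (.death x)) b)
    (hc : HasSum (fun q : V × V => g (.jump q.1 q.2)) c) : HasSum g (a + (b + c)) := by
  let e : V ⊕ V ⊕ (V × V) ≃ Mark V :=
    { toFun := Sum.elim .birth (Sum.elim .death fun q => .jump q.1 q.2)
      invFun := fun m => match m with
        | .birth x => .inl x
        | .death x => .inr (.inl x)
        | .jump x y => .inr (.inr (x, y))
      left_inv := by rintro (x | x | x) <;> rfl
      right_inv := by rintro (x | x | x) <;> rfl }
  rw [← e.hasSum_iff]
  exact HasSum.sum (f := g ∘ e) ha (HasSum.sum (f := (g ∘ e) ∘ Sum.inr) hb hc)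

/-- The change of `∑ₓ w(x) η(x)` under a transition. -/
def Mark.incr {V : Type*} (w : V → ℝ) : Mark V → ℝ
  | .birth x => w x
  | .death x => -w x
  | .jump x y => w y - w x

/-- The sum of the weights of the sites that take part in a transition. -/
def Mark.size {V : Type*} (w : V → ℝ) : Mark V → ℝ
  | .birth x => w x
  | .death x => w x
  | .jump x y => w y + w x

theorem Mark.abs_incr_le {V : Type*} {w : V → ℝ} (hw : ∀ x, 0 ≤ w x) (m : Mark V) :
    |m.incr w| ≤ m.size w := by
  cases m with
  | birth x => exact (abs_of_nonneg (hw x)).le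
  | death x => exact (abs_neg (w x)).trans_le (abs_of_nonneg (hw x)).le
  | jump x y =>
    simp only [incr, size, abs_le]
    constructor <;> linarith [hw x, hw y]

theorem Mark.size_nonneg {V : Type*} {w : V → ℝ} (hw : ∀ x, 0 ≤ w x) (m : Mark V) :
    0 ≤ m.size w := (abs_nonneg _).trans (m.abs_incr_le hw)

theorem hasSum_mul_single {V : Type*} [DecidableEq V] (w : V → ℝ) (x : V) :
    HasSum (fun z => w z * ((Pi.single x 1 : V → ℕ) z : ℝ)) (w x) := by
  have h := hasSum_single (f := fun z => w z * ((Pi.single x 1 : V → ℕ) z : ℝ)) x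
    fun z hz => by simp [hz]
  simpa using h

namespace ReactionDiffusion

variable {V : Type*} (S : ReactionDiffusion V)

variable {S} in
theorem ne_zero_of_rate_death {x : V} {η : V → ℕ} (h : S.rate (.death x) η ≠ 0) : η x ≠ 0 :=
  fun h0 => h (by rw [rate, h0, S.Fminus_zero])

variable {S} in
theorem ne_zero_of_rate_jump {x y : V} {η : V → ℕ} (h : S.rate (.jump x y) η ≠ 0) : η x ≠ 0 :=
  fun h0 => h (by rw [rate, h0, Nat.cast_zero, mul_zero])

variable {S} in
-- A nonzero rate means that the site losing a particle is occupied, so the truncated subtraction is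
-- an honest one.
theorem hasSum_transition (w : V → ℝ) {m : Mark V} {η : V → ℕ} (hm : S.rate m η ≠ 0) {a : ℝ}
    (h : HasSum (fun x => w x * (η x : ℝ)) a) :
    HasSum (fun x => w x * (transition m η x : ℝ)) (a + m.incr w) := by
  classical
  have hsub : ∀ x, η x ≠ 0 → ∀ z,
      (((η - Pi.single x 1 : V → ℕ) z : ℕ) : ℝ) = η z - ((Pi.single x 1 : V → ℕ) z : ℝ) := by
    intro x hx z
    rw [Pi.sub_apply, Nat.cast_sub]
    by_cases hz : z = x
    · subst hz
      simpa using Nat.one_le_iff_ne_zero.2 hx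
    · simp [hz]
  cases m with
  | birth x =>
    convert! h.add (hasSum_mul_single w x) using 1
    funext z
    simp only [transition, Pi.add_apply]
    push_cast
    rw [mul_add]
  | death x =>
    convert! h.sub (hasSum_mul_single w x) using 1
    funext z
    rw [← mul_sub, ← hsub x (ne_zero_of_rate_death hm)]
    simp only [transition]
  | jump x y =>
    convert! (h.sub (hasSum_mul_single w x)).add (hasSum_mul_single w y) using 1
    · funext z
      rw [← mul_sub, ← hsub x (ne_zero_of_rate_jump hm), ← mul_add]
      simp only [transition, Pi.add_apply]
      push_cast
      congr!
    · simp only [Mark.incr]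
      ring

/-- Weights on the sites whose mean under the jump kernel is at most a multiple of them. -/
structure IsWeight (w : V → ℝ) (C : ℝ) : Prop where
  nonneg : ∀ x, 0 ≤ w x
  summable : ∀ x, Summable fun y => S.p x y * w y
  le : ∀ x, ∑' y, S.p x y * w y ≤ C * w x

/-- Two weights are used: `1` for the total mass, which controls explosion, and `α` for the metric.
-/
theorem isWeight_one : S.IsWeight 1 1 :=
  ⟨fun _ => zero_le_one, fun x => by simpa using (S.p_hasSum x).summable,
    fun x => by simp [(S.p_hasSum x).tsum_eq]⟩

theorem exists_alpha_le : ∃ b, ∀ x, S.α x ≤ b :=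
  ⟨∑' x, S.α x, fun x => S.α_summable.le_tsum x fun y _ => (S.α_pos y).le⟩

theorem exists_isWeight_alpha : ∃ C, 0 ≤ C ∧ S.IsWeight S.α C := by
  obtain ⟨C, hC⟩ := S.α_localization
  obtain ⟨b, hb⟩ := S.exists_alpha_le
  refine ⟨max C 0, le_max_right _ _, fun x => (S.α_pos x).le, fun x => ?_, fun x => ?_⟩
  · exact Summable.of_nonneg_of_le (fun y => mul_nonneg (S.p_nonneg x y) (S.α_pos y).le)
      (fun y => mul_le_mul_of_nonneg_left (hb y) (S.p_nonneg x y))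
      ((S.p_hasSum x).summable.mul_right b)
  · have h := hC ⟨x, rfl⟩
    simp only [← mul_div_assoc] at h
    rw [tsum_div_const, div_le_iff₀ (S.α_pos x)] at h
    exact h.trans (mul_le_mul_of_nonneg_right (le_max_left _ _) (S.α_pos x).le)

end ReactionDiffusion

/-- The weighted number of particles. -/
noncomputable def weightSum {V : Type*} (w : V → ℝ) (η : V → ℕ) : ℝ := ∑' x, w x * (η x : ℝ)

namespace FiniteConfig

variable {V : Type*}

theorem finite_support (η : FiniteConfig V) : {x | η.1 x ≠ 0}.Finite := by
  have h := η.2.tendsto_cofinite_zero.eventually (Iio_mem_nhds one_pos)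
  refine Set.Finite.subset h fun x hx hlt => hx ?_
  have : η.1 x < 1 := by exact_mod_cast Set.mem_Iio.1 hlt
  omega

theorem summable_of_zero (η : FiniteConfig V) {g : V → ℝ} (h : ∀ x, η.1 x = 0 → g x = 0) :
    Summable g :=
  summable_of_hasFiniteSupport (η.finite_support.subset fun x hx h0 => hx (h x h0))

theorem summable_mul (η : FiniteConfig V) (w : V → ℝ) : Summable fun x => w x * (η.1 x : ℝ) :=
  η.summable_of_zero fun x h => by simp [h]

instance [Countable V] : Countable (FiniteConfig V) := by
  classical
  let g : FiniteConfig V → V →₀ ℕ := fun η => Finsupp.ofSupportFinite η.1 η.finite_support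
  refine Function.Injective.countable (f := g) fun η ζ h => Subtype.ext (funext fun x => ?_)
  exact DFunLike.congr_fun h x

theorem weightSum_nonneg {w : V → ℝ} (hw : ∀ x, 0 ≤ w x) (η : V → ℕ) : 0 ≤ weightSum w η :=
  tsum_nonneg fun x => mul_nonneg (hw x) (Nat.cast_nonneg _)

theorem weightSum_mono {w : V → ℝ} (hw : ∀ x, 0 ≤ w x) {η ξ : FiniteConfig V} (h : η.1 ≤ ξ.1) :
    weightSum w η.1 ≤ weightSum w ξ.1 :=
  (η.summable_mul w).tsum_le_tsum
    (fun x => mul_le_mul_of_nonneg_left (by exact_mod_cast h x) (hw x)) (ξ.summable_mul w)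

theorem le_mass (η : FiniteConfig V) (x : V) : (η.1 x : ℝ) ≤ weightSum 1 η.1 := by
  have := (η.summable_mul 1).le_tsum x fun y _ => by simp
  simpa [weightSum] using this

end FiniteConfig

/-! ### Rates and drift of weighted particle numbers. -/

namespace ReactionDiffusion

variable {V : Type*} (S : ReactionDiffusion V) {w : V → ℝ} {C : ℝ}

theorem weightSum_transition_sub {m : Mark V} (η : FiniteConfig V) (hm : S.rate m η.1 ≠ 0) :
    weightSum w (η.transition m).1 - weightSum w η.1 = m.incr w := by
  have h := hasSum_transition w hm (η.summable_mul w).hasSum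
  rw [weightSum, weightSum]
  exact sub_eq_of_eq_add' h.tsum_eq

/-- Only occupied sites contribute, because `F⁺`, `F⁻` and the jump rates vanish at `0`; for each of
them the sum over the targets of a jump converges by the weight condition. -/
theorem hasSum_rate_size (hw : S.IsWeight w C) (η : FiniteConfig V) :
    HasSum (fun m => S.rate m η.1 * m.size w)
      (∑' x, S.Fplus (η.1 x) * w x + (∑' x, S.Fminus (η.1 x) * w x +
        ∑' x, (η.1 x : ℝ) * (∑' y, S.p x y * w y + w x))) := by
  refine hasSum_mark (Summable.hasSum ?_) (Summable.hasSum ?_) ?_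
  · exact η.summable_of_zero fun x h => by simp [h, rate, S.Fplus_zero]
  · exact η.summable_of_zero fun x h => by simp [h, rate, S.Fminus_zero]
  · refine hasSum_prod_of_nonneg (fun q => mul_nonneg (S.rate_nonneg _ _)
      (Mark.size_nonneg hw.nonneg _)) (fun x => ?_)
      (η.summable_of_zero (fun x h => by simp [h])).hasSum
    have h := (((hw.summable x).hasSum.add ((S.p_hasSum x).mul_right (w x))).mul_left
      (η.1 x : ℝ))
    rw [one_mul] at h
    convert! h using 1
    funext y
    simp only [rate, Mark.size]
    ring

theorem hasSum_rate_incr (hw : S.IsWeight w C) (η : FiniteConfig V) :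
    HasSum (fun m => S.rate m η.1 * m.incr w)
      (∑' x, (S.Fplus (η.1 x) - S.Fminus (η.1 x)) * w x +
        ∑' x, (η.1 x : ℝ) * (∑' y, S.p x y * w y - w x)) := by
  have s1 : Summable fun x => S.Fplus (η.1 x) * w x :=
    η.summable_of_zero fun x h => by simp [h, S.Fplus_zero]
  have s2 : Summable fun x => S.Fminus (η.1 x) * w x :=
    η.summable_of_zero fun x h => by simp [h, S.Fminus_zero]
  have h1 : HasSum (fun q : V × V => S.p q.1 q.2 * (η.1 q.1 : ℝ) * w q.2)
      (∑' x, (η.1 x : ℝ) * ∑' y, S.p x y * w y) := by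
    refine hasSum_prod_of_nonneg (fun q => mul_nonneg (mul_nonneg (S.p_nonneg _ _)
      (Nat.cast_nonneg _)) (hw.nonneg _)) (fun x => ?_)
      (η.summable_of_zero (fun x h => by simp [h])).hasSum
    convert! (hw.summable x).hasSum.mul_left (η.1 x : ℝ) using 1
    funext y
    ring
  have h2 : HasSum (fun q : V × V => S.p q.1 q.2 * (η.1 q.1 : ℝ) * w q.1)
      (∑' x, (η.1 x : ℝ) * w x) := by
    refine hasSum_prod_of_nonneg (fun q => mul_nonneg (mul_nonneg (S.p_nonneg _ _)
      (Nat.cast_nonneg _)) (hw.nonneg _)) (fun x => ?_)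
      (η.summable_of_zero (fun x h => by simp [h])).hasSum
    convert! (S.p_hasSum x).mul_right ((η.1 x : ℝ) * w x) using 1
    · funext y
      ring
    · ring
  have s3 : Summable fun x => (η.1 x : ℝ) * ∑' y, S.p x y * w y :=
    η.summable_of_zero fun x h => by simp [h]
  have s4 : Summable fun x => (η.1 x : ℝ) * w x := η.summable_of_zero fun x h => by simp [h]
  have h := hasSum_mark (g := fun m => S.rate m η.1 * m.incr w) s1.hasSum
    (b := -∑' x, S.Fminus (η.1 x) * w x) ?_ (c := ∑' x, (η.1 x : ℝ) * ∑' y, S.p x y * w y -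
      ∑' x, (η.1 x : ℝ) * w x) ?_
  · convert! h using 1
    simp_rw [sub_mul, mul_sub]
    rw [s1.tsum_sub s2, s3.tsum_sub s4]
    ring
  · convert! s2.hasSum.neg using 1
    funext x
    simp [rate, Mark.incr]
  · convert! h1.sub h2 using 1
    funext q
    simp only [rate, Mark.incr]
    ring

theorem rate_mul_abs_le (hw : ∀ x, 0 ≤ w x) (η : FiniteConfig V) (m : Mark V) :
    S.rate m η.1 * |weightSum w (η.transition m).1 - weightSum w η.1| ≤
      S.rate m η.1 * m.size w := by
  by_cases h : S.rate m η.1 = 0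
  · simp [h]
  · rw [S.weightSum_transition_sub η h]
    exact mul_le_mul_of_nonneg_left (m.abs_incr_le hw) (S.rate_nonneg _ _)

theorem summable_rate_mul_abs (hw : S.IsWeight w C) (η : FiniteConfig V) :
    Summable fun m => S.rate m η.1 * |weightSum w (η.transition m).1 - weightSum w η.1| :=
  Summable.of_nonneg_of_le (fun _ => mul_nonneg (S.rate_nonneg _ _) (abs_nonneg _))
    (fun m => S.rate_mul_abs_le hw.nonneg η m) (S.hasSum_rate_size hw η).summable

/-- With the weight `1` every mark has size at least `1`. -/
theorem summable_rate (η : FiniteConfig V) : Summable fun m => S.rate m η.1 := by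
  refine Summable.of_nonneg_of_le (fun m => S.rate_nonneg _ _) (fun m => ?_)
    (S.hasSum_rate_size S.isWeight_one η).summable
  have : 1 ≤ m.size (1 : V → ℝ) := by cases m <;> simp [Mark.size]
  exact le_mul_of_one_le_right (S.rate_nonneg _ _) this

/-- The rates are bounded on configurations of bounded mass. -/
theorem exists_rate_size_le (hw : S.IsWeight w C) {b : ℝ} (hb : ∀ x, w x ≤ b) (hC : 0 ≤ C) (K : ℕ) :
    ∃ Λ, 0 ≤ Λ ∧ ∀ η : FiniteConfig V, weightSum 1 η.1 < K →
      ∑' m, S.rate m η.1 * m.size w ≤ Λ := by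
  have hF : ∀ k, 0 ≤ S.Fminus k := fun k => (S.Fplus_nonneg k).trans (S.Fplus_le_Fminus k)
  let F := ∑ j ∈ Finset.range (K + 1), S.Fminus j
  have hF0 : 0 ≤ F := Finset.sum_nonneg fun j _ => hF j
  -- The constant `F` dominates `F⁻` at the occupation numbers below `K`, and `F⁻(0) = 0` turns this
  -- into the linear bound `F η(x)`; the factor `|b| K` bounds the weighted mass. The summands in
  -- the first factor come from births, deaths and jumps.
  refine ⟨(F + (F + (C + 1))) * (|b| * K), by positivity, fun η hη => ?_⟩
  rw [(S.hasSum_rate_size hw η).tsum_eq]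
  have hle : ∀ x, S.Fminus (η.1 x) ≤ F * η.1 x := by
    intro x
    rcases Nat.eq_zero_or_pos (η.1 x) with h | h
    · simp [h, S.Fminus_zero]
    · have h1 : η.1 x < K := by exact_mod_cast (η.le_mass x).trans_lt hη
      have h2 : S.Fminus (η.1 x) ≤ F :=
        Finset.single_le_sum (f := S.Fminus) (fun j _ => hF j) (Finset.mem_range.2 (by omega))
      have h3 : (1 : ℝ) ≤ η.1 x := by exact_mod_cast h
      nlinarith
  have hs := η.summable_of_zero (g := fun x => (η.1 x : ℝ) * w x) fun x h => by simp [h]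
  have e1 : ∑' x, S.Fminus (η.1 x) * w x ≤ F * ∑' x, (η.1 x : ℝ) * w x := by
    rw [← tsum_mul_left]
    refine Summable.tsum_le_tsum (fun x => ?_)
      (η.summable_of_zero fun x h => by simp [h, S.Fminus_zero]) (hs.mul_left F)
    rw [← mul_assoc]
    exact mul_le_mul_of_nonneg_right (hle x) (hw.nonneg x)
  have e2 : ∑' x, S.Fplus (η.1 x) * w x ≤ F * ∑' x, (η.1 x : ℝ) * w x := by
    refine le_trans (Summable.tsum_le_tsum (fun x => ?_)
      (η.summable_of_zero fun x h => by simp [h, S.Fplus_zero])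
      (η.summable_of_zero fun x h => by simp [h, S.Fminus_zero])) e1
    exact mul_le_mul_of_nonneg_right (S.Fplus_le_Fminus _) (hw.nonneg x)
  have e3 : ∑' x, (η.1 x : ℝ) * (∑' y, S.p x y * w y + w x) ≤
      (C + 1) * ∑' x, (η.1 x : ℝ) * w x := by
    rw [← tsum_mul_left]
    refine Summable.tsum_le_tsum (fun x => ?_)
      (η.summable_of_zero fun x h => by simp [h]) (hs.mul_left _)
    nlinarith [hw.le x, Nat.cast_nonneg (α := ℝ) (η.1 x)]
  have e4 : ∑' x, (η.1 x : ℝ) * w x ≤ |b| * K := by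
    have h1 : ∑' x, (η.1 x : ℝ) * w x ≤ |b| * weightSum 1 η.1 := by
      rw [weightSum, ← tsum_mul_left]
      refine Summable.tsum_le_tsum (fun x => ?_) hs ((η.summable_mul 1).mul_left _)
      simp only [Pi.one_apply, one_mul]
      rw [mul_comm]
      exact mul_le_mul_of_nonneg_right ((hb x).trans (le_abs_self b)) (Nat.cast_nonneg _)
    exact h1.trans (mul_le_mul_of_nonneg_left hη.le (abs_nonneg b))
  have hpos : 0 ≤ F + (F + (C + 1)) := by positivity
  calc _ ≤ (F + (F + (C + 1))) * ∑' x, (η.1 x : ℝ) * w x := by linarith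
    _ ≤ _ := mul_le_mul_of_nonneg_left e4 hpos

theorem jumpGen_weightSum (hw : S.IsWeight w C) (η : FiniteConfig V) :
    jumpGen S.finiteRate (fun m e => e.transition m) (fun e => weightSum w e.1) η =
      ∑' x, (S.Fplus (η.1 x) - S.Fminus (η.1 x)) * w x +
        ∑' x, (η.1 x : ℝ) * (∑' y, S.p x y * w y - w x) := by
  rw [← (S.hasSum_rate_incr hw η).tsum_eq, jumpGen]
  refine tsum_congr fun m => ?_
  by_cases h : S.rate m η.1 = 0
  · simp [finiteRate, h]
  · rw [S.weightSum_transition_sub η h, finiteRate]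

/-- The generator contracts ordered pairs of configurations up to a linear term. -/
theorem jumpGen_weightSum_sub_le (hw : S.IsWeight w C) {η ξ : FiniteConfig V} (h : η.1 ≤ ξ.1) :
    jumpGen S.finiteRate (fun m e => e.transition m) (fun e => weightSum w e.1) ξ -
      jumpGen S.finiteRate (fun m e => e.transition m) (fun e => weightSum w e.1) η ≤
      (C - 1) * (weightSum w ξ.1 - weightSum w η.1) := by
  rw [S.jumpGen_weightSum hw, S.jumpGen_weightSum hw]
  -- The reaction part contributes nothing positive because `F⁺ - F⁻` is non-increasing; the jump
  -- part is linear.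
  have e1 : ∑' x, (S.Fplus (ξ.1 x) - S.Fminus (ξ.1 x)) * w x ≤
      ∑' x, (S.Fplus (η.1 x) - S.Fminus (η.1 x)) * w x :=
    Summable.tsum_le_tsum (fun x => mul_le_mul_of_nonneg_right (S.antitone_sub (h x)) (hw.nonneg x))
      (ξ.summable_of_zero fun x h => by simp [h, S.Fplus_zero, S.Fminus_zero])
      (η.summable_of_zero fun x h => by simp [h, S.Fplus_zero, S.Fminus_zero])
  have e2 : ∑' x, (ξ.1 x : ℝ) * (∑' y, S.p x y * w y - w x) -
      ∑' x, (η.1 x : ℝ) * (∑' y, S.p x y * w y - w x) ≤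
        (C - 1) * (weightSum w ξ.1 - weightSum w η.1) := by
    have s1 := ξ.summable_of_zero (g := fun x => (ξ.1 x : ℝ) * (∑' y, S.p x y * w y - w x))
      fun x h => by simp [h]
    have s2 := η.summable_of_zero (g := fun x => (η.1 x : ℝ) * (∑' y, S.p x y * w y - w x))
      fun x h => by simp [h]
    rw [weightSum, weightSum, ← s1.tsum_sub s2, ← (ξ.summable_mul w).tsum_sub (η.summable_mul w),
      ← tsum_mul_left]
    refine Summable.tsum_le_tsum (fun x => ?_) (s1.sub s2)
      (((ξ.summable_mul w).sub (η.summable_mul w)).mul_left _)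
    have h1 : (η.1 x : ℝ) ≤ ξ.1 x := by exact_mod_cast h x
    nlinarith [hw.le x]
  linarith

/-- Jumps preserve the mass and births are not faster than deaths. -/
theorem jumpGen_mass_nonpos (η : FiniteConfig V) :
    jumpGen S.finiteRate (fun m e => e.transition m) (fun e => weightSum 1 e.1) η ≤ 0 := by
  rw [S.jumpGen_weightSum S.isWeight_one]
  have h1 : ∑' x, (S.Fplus (η.1 x) - S.Fminus (η.1 x)) * (1 : V → ℝ) x ≤ 0 :=
    tsum_nonpos fun x => by simpa using S.Fplus_le_Fminus _
  simpa [(S.p_hasSum _).tsum_eq] using h1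

end ReactionDiffusion

/-! ### Almost sure properties of the clocks -/

namespace IsPoissonClocks

variable {V Ω : Type*} [MeasurableSpace Ω] {X : Mark V → Ω → Set (ℝ × ℝ)} {P : Measure Ω}

/-- For one clock this is the quadratic bound on two points; for two clocks it is the product of two
linear bounds, by independence. -/
theorem measure_two_points_le (hX : IsPoissonClocks X P) (m m' : Mark V) {a b c : ℝ} (ha : 0 ≤ a) :
    P {ω | ∃ p ∈ X m ω ∩ Set.Ioc a b ×ˢ Set.Ioo 0 c, ∃ p' ∈ X m' ω ∩ Set.Ioc a b ×ˢ Set.Ioo 0 c,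
      ¬ (m = m' ∧ p = p')} ≤ (ENNReal.ofReal c * ENNReal.ofReal (b - a)) ^ 2 := by
  have hm : MeasurableSet (Set.Ioc a b ×ˢ Set.Ioo 0 c) := measurableSet_Ioc.prod measurableSet_Ioo
  have hν := restrict_Ioi_prod_Ioc_prod_Ioo (b := b) (c := c) ha
  have hfin : ENNReal.ofReal c * ENNReal.ofReal (b - a) ≠ ∞ :=
    ENNReal.mul_ne_top ENNReal.ofReal_ne_top ENNReal.ofReal_ne_top
  by_cases h : m = m'
  · subst h
    refine (measure_mono ?_).trans ((hX.poisson m).measure_two_le_count hm (hν ▸ hfin)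
      |>.trans_eq (by rw [hν]))
    rintro ω ⟨p, hp, p', hp', hne⟩
    have : 1 < (X m ω ∩ Set.Ioc a b ×ˢ Set.Ioo 0 c).encard :=
      Set.one_lt_encard_iff.2 ⟨p, p', hp, hp', fun h => hne ⟨rfl, h⟩⟩
    exact Order.add_one_le_of_lt this
  · have hind : IndepFun (fun ω => (X m ω ∩ Set.Ioc a b ×ˢ Set.Ioo 0 c).encard)
        (fun ω => (X m' ω ∩ Set.Ioc a b ×ˢ Set.Ioo 0 c).encard) P :=
      (hX.indep.indepFun h).comp
        (φ := fun F : {A : Set (ℝ × ℝ) // MeasurableSet A} → ℕ∞ => F ⟨_, hm⟩)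
        (ψ := fun F : {A : Set (ℝ × ℝ) // MeasurableSet A} → ℕ∞ => F ⟨_, hm⟩)
        (measurable_pi_apply _) (measurable_pi_apply _)
    have h1 := hind.measure_inter_preimage_eq_mul {k | 1 ≤ k} {k | 1 ≤ k} (by trivial) (by trivial)
    refine (measure_mono ?_).trans (h1.le.trans ?_)
    · rintro ω ⟨p, hp, p', hp', -⟩
      exact ⟨Set.one_le_encard_iff_nonempty.2 ⟨p, hp⟩, Set.one_le_encard_iff_nonempty.2 ⟨p', hp'⟩⟩
    · rw [sq, ← hν]
      exact mul_le_mul' ((hX.poisson m).measure_one_le_count hm (hν ▸ hfin))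
        ((hX.poisson m').measure_one_le_count hm (hν ▸ hfin))

/-- Up to time and height `T` there are `(n + 1) T` cells, each containing a coincidence with
probability at most `(T / (n + 1))²`; the total `T³ / (n + 1)` tends to `0`. -/
theorem ae_clocksSimple [Countable V] (hX : IsPoissonClocks X P) :
    ∀ᵐ ω ∂P, ClocksSimple fun m => X m ω := by
  have key : ∀ (m m' : Mark V) (T : ℕ), ∀ᵐ ω ∂P, ∀ r ∈ Set.Ioc (0 : ℝ) T,
      ∀ u ∈ Set.Ioo (0 : ℝ) T, ∀ u' ∈ Set.Ioo (0 : ℝ) T, (r, u) ∈ X m ω → (r, u') ∈ X m' ω →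
        m = m' ∧ u = u' := by
    intro m m' T
    let bad : ℕ → ℕ → Set Ω := fun n k =>
      {ω | ∃ p ∈ X m ω ∩ Set.Ioc ((k : ℝ) / (n + 1)) ((k + 1 : ℝ) / (n + 1)) ×ˢ Set.Ioo (0 : ℝ) T,
        ∃ p' ∈ X m' ω ∩ Set.Ioc ((k : ℝ) / (n + 1)) ((k + 1 : ℝ) / (n + 1)) ×ˢ Set.Ioo (0 : ℝ) T,
        ¬ (m = m' ∧ p = p')}
    have hbad : ∀ n, P (⋃ k ∈ Finset.range ((n + 1) * T), bad n k) ≤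
        ENNReal.ofReal (T ^ 3 * (1 / ((n : ℝ) + 1))) := by
      intro n
      have hn : (0 : ℝ) < n + 1 := by positivity
      refine (measure_biUnion_finset_le _ _).trans ((Finset.sum_le_sum fun k _ =>
        hX.measure_two_points_le m m' (by positivity)).trans (le_of_eq ?_))
      have : ∀ k : ℕ, (k + 1 : ℝ) / (n + 1) - k / (n + 1) = 1 / (n + 1) := fun k => by ring
      simp_rw [this]
      rw [Finset.sum_const, Finset.card_range, nsmul_eq_mul, ← ENNReal.ofReal_mul (by positivity),
        ← ENNReal.ofReal_pow (by positivity), ← ENNReal.ofReal_natCast,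
        ← ENNReal.ofReal_mul (by positivity)]
      congr 1
      push_cast
      field_simp
    have hlim : Tendsto (fun n : ℕ => ENNReal.ofReal (T ^ 3 * (1 / ((n : ℝ) + 1)))) atTop (𝓝 0) := by
      have h := tendsto_one_div_add_atTop_nhds_zero_nat (𝕜 := ℝ) |>.const_mul ((T : ℝ) ^ 3)
      rw [mul_zero] at h
      simpa using ENNReal.tendsto_ofReal h
    rw [ae_iff]
    refine le_antisymm (ge_of_tendsto' hlim fun n => (measure_mono ?_).trans (hbad n)) zero_le
    intro ω hω
    simp only [Set.mem_ofPred_eq, not_forall] at hω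
    obtain ⟨r, hr, u, hu, u', hu', h1, h2, h3⟩ := hω
    have hr' := hr
    rw [← iUnion_Ioc_grid n T] at hr'
    simp only [Set.mem_iUnion, exists_prop] at hr' ⊢
    obtain ⟨k, hk, hrk⟩ := hr'
    exact ⟨k, hk, (r, u), ⟨h1, hrk, hu⟩, (r, u'), ⟨h2, hrk, hu'⟩,
      fun h => h3 ⟨h.1, congrArg Prod.snd h.2⟩⟩
  have hall := ae_all_iff.2 fun m => ae_all_iff.2 fun m' => ae_all_iff.2 fun T => key m m' T
  filter_upwards [hall] with ω hω m m' r u u' hr hu hu' h1 h2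
  obtain ⟨T, hT⟩ := exists_nat_gt (max r (max u u'))
  have hT1 := (le_max_left _ _).trans_lt hT
  have hT2 := (le_max_right _ _).trans_lt hT
  exact hω m m' T r ⟨hr, hT1.le⟩ u ⟨hu, (le_max_left _ _).trans_lt hT2⟩ u'
    ⟨hu', (le_max_right _ _).trans_lt hT2⟩ h1 h2

/-- The expected number of points below the rates of a fixed state is `T` times the total rate;
countably many states and integer horizons suffice. -/
theorem ae_clocksFinite [Countable V] (hX : IsPoissonClocks X P) {E : Type*} [Countable E]
    {R : Mark V → E → ℝ} (hR : ∀ m e, 0 ≤ R m e) (hsum : ∀ e, Summable fun m => R m e) :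
    ∀ᵐ ω ∂P, ClocksFinite (fun m => X m ω) R := by
  have key : ∀ (e : E) (T : ℕ), ∀ᵐ ω ∂P, {q : Mark V × ℝ × ℝ | 0 < q.2.1 ∧ q.2.1 ≤ T ∧
      Fires (fun m => X m ω) R e q.1 q.2.1 q.2.2}.Finite := by
    intro e T
    have hm := fun m => hX.measurable_toENNReal_count m
      (A := Set.Ioc (0 : ℝ) T ×ˢ Set.Ioo 0 (R m e)) (measurableSet_Ioc.prod measurableSet_Ioo)
    have hint : ∫⁻ ω, ∑' m, ((X m ω ∩ Set.Ioc (0 : ℝ) T ×ˢ Set.Ioo 0 (R m e)).encard : ℝ≥0∞) ∂P ≠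
        ∞ := by
      rw [lintegral_tsum fun m => (hm m).aemeasurable]
      simp_rw [hX.lintegral_count_Ioc _ le_rfl]
      rw [ENNReal.tsum_mul_right, ← ENNReal.ofReal_tsum_of_nonneg (fun m => hR m e) (hsum e)]
      exact ENNReal.mul_ne_top ENNReal.ofReal_ne_top ENNReal.ofReal_ne_top
    filter_upwards [ae_lt_top (Measurable.tsum hm) hint] with ω hω
    rw [← Set.encard_lt_top_iff, ← ENat.toENNReal_lt_top]
    refine lt_of_eq_of_lt ?_ hω
    rw [← ENNReal.tsum_set_one, tsum_subtype _ (fun _ => (1 : ℝ≥0∞)), ENNReal.tsum_prod']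
    refine tsum_congr fun m => ?_
    rw [← ENNReal.tsum_set_one, tsum_subtype _ (fun _ => (1 : ℝ≥0∞))]
    refine tsum_congr fun p => ?_
    refine Set.indicator_eq_indicator ?_ rfl
    simp only [Fires, Set.mem_ofPred_eq, Set.mem_inter_iff, Set.mem_prod, Set.mem_Ioc, Set.mem_Ioo]
    tauto
  filter_upwards [ae_all_iff.2 fun e => ae_all_iff.2 fun T => key e T] with ω hω e T
  obtain ⟨n, hn⟩ := exists_nat_ge T
  exact (hω e n).subset fun q hq => ⟨hq.1, hq.2.1.trans hn, hq.2.2⟩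

end IsPoissonClocks

/-! ### Nonexplosion -/

/-- No integrability is required: the integral of a non-integrable function is `0`, and `c` is
nonnegative. -/
theorem integral_le_mul_measureReal {α : Type*} [MeasurableSpace α] {μ : Measure α}
    [IsFiniteMeasure μ] {f : α → ℝ} {c : ℝ} (hc : 0 ≤ c) (h : ∀ᵐ x ∂μ, f x ≤ c) :
    ∫ x, f x ∂μ ≤ c * μ.real Set.univ := by
  by_cases hf : Integrable f μ
  · refine (integral_mono_ae hf (integrable_const c) h).trans_eq ?_
    rw [integral_const, smul_eq_mul, mul_comm]
  · rw [integral_undef hf]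
    positivity

theorem intervalIntegral_le_mul {f : ℝ → ℝ} {a b c : ℝ} (hab : a ≤ b) (hc : 0 ≤ c)
    (h : ∀ r, a ≤ r → r ≤ b → f r ≤ c) : ∫ r in a..b, f r ≤ c * (b - a) := by
  rw [intervalIntegral.integral_of_le hab]
  refine (integral_le_mul_measureReal hc ?_).trans_eq ?_
  · filter_upwards [ae_restrict_mem measurableSet_Ioc] with r hr
    exact h r hr.1.le hr.2
  · simp [hab]

/-- Dynkin's formula bounds the mean of `W` at time `τ` by `W e₀ + Λ T`; then Markov's inequality.
-/
theorem IsJumpProcess.measure_ge_le {V E Ω : Type*} [Countable V] [Countable E]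
    {X : Mark V → Ω → Set (ℝ × ℝ)} {R : Mark V → E → ℝ} {Γ : Mark V → E → E} {Z Zm : ℝ → Ω → E}
    [MeasurableSpace Ω] {P : Measure Ω} [IsProbabilityMeasure P] {τ : Ω → ℝ}
    (hZ : IsJumpProcess X R Γ Z Zm) (hX : IsPoissonClocks X P)
    (hτ : IsClockStop X τ) {T : ℝ} (hT : 0 ≤ T) (hτT : ∀ ω, τ ω ≤ T) (hR : ∀ m e, 0 ≤ R m e)
    (W : E → ℝ) (hsum : ∀ e, Summable fun m => R m e * |W (Γ m e) - W e|) {K : ℝ}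
    (hK : ∀ ω r, 0 ≤ r → r < τ ω → ∑' m, R m (Z r ω) * |W (Γ m (Z r ω)) - W (Z r ω)| ≤ K)
    {Λ : ℝ} (hΛ : 0 ≤ Λ) (hgen : ∀ ω r, 0 ≤ r → r < τ ω → jumpGen R Γ W (Z r ω) ≤ Λ)
    (hW : ∀ ω r, 0 ≤ W (Z r ω)) {e₀ : E} (h0 : ∀ ω, Z 0 ω = e₀) {c : ℝ} (hc : 0 < c) :
    P {ω | c ≤ W (Z (τ ω) ω)} ≤ ENNReal.ofReal ((W e₀ + Λ * T) / c) := by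
  obtain ⟨⟨hint, -⟩, heq⟩ := hZ.dynkin hX hτ le_rfl hT (@MeasurableSet.univ _ (clockPast X 0)) hR W
    hsum hK
  simp only [min_eq_right (hτT _), min_eq_left (hτ.nonneg _), h0, Measure.restrict_univ]
    at hint heq
  have hint' : Integrable (fun ω => W (Z (τ ω) ω)) P := by
    refine (hint.add (integrable_const (W e₀))).congr (Eventually.of_forall fun ω => ?_)
    simp
  rw [integral_sub hint' (integrable_const _), integral_const, probReal_univ, one_smul] at heq
  have hle : ∫ ω, (∫ r in (0 : ℝ)..T,
      {r | r < τ ω}.indicator (fun r => jumpGen R Γ W (Z r ω)) r) ∂P ≤ Λ * T := by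
    have h := integral_le_mul_measureReal (μ := P) (c := Λ * T) (by positivity)
      (f := fun ω => ∫ r in (0 : ℝ)..T,
        {r | r < τ ω}.indicator (fun r => jumpGen R Γ W (Z r ω)) r)
      (Eventually.of_forall fun ω => by
        have h1 := intervalIntegral_le_mul (f := fun r =>
          {r | r < τ ω}.indicator (fun r => jumpGen R Γ W (Z r ω)) r) hT hΛ fun r hr _ => by
            by_cases h : r < τ ω
            · rw [Set.indicator_of_mem (show r ∈ {r | r < τ ω} from h)]
              exact hgen ω r hr h
            · rw [Set.indicator_of_notMem (show r ∉ {r | r < τ ω} from h)]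
              exact hΛ
        rwa [sub_zero] at h1)
    rwa [probReal_univ, mul_one] at h
  have hmarkov := mul_meas_ge_le_integral_of_nonneg
    (Eventually.of_forall fun ω => hW ω (τ ω)) hint' c
  rw [← ENNReal.ofReal_toReal (measure_ne_top P {ω | c ≤ W (Z (τ ω) ω)})]
  refine ENNReal.ofReal_le_ofReal ?_
  rw [le_div_iff₀ hc, mul_comm]
  exact hmarkov.trans (by linarith)

namespace ReactionDiffusion

variable {V Ω : Type*} [Countable V] {S : ReactionDiffusion V} [MeasurableSpace Ω] {P : Measure Ω}
  [IsProbabilityMeasure P] {X : Mark V → Ω → Set (ℝ × ℝ)}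

omit [Countable V] [MeasurableSpace Ω] in
theorem exists_isJumpProcess_run (hS : ∀ ω, ClocksSimple fun m => X m ω)
    (hF : ∀ ω, ClocksFinite (fun m => X m ω) S.finiteRate) (k : ℕ) (η : FiniteConfig V) :
    ∃ Zm, IsJumpProcess X S.countRate countMap (fun t ω => S.run (fun m => X m ω) t k 0 η) Zm := by
  choose h0 zm hzm using fun ω => exists_isJumpPath_run (hS ω) (hF ω) k 0 le_rfl η
  exact ⟨fun t ω => zm ω t, ⟨hzm, ⟨_, h0⟩, hS, fun ω => ClocksFinite.countRate (hF ω)⟩⟩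

/-- If all `k` transitions are used by time `T`, then either the mass reaches `K`, which is unlikely
because its drift is nonpositive, or `k` transitions occur while the mass is below `K`, where the
total rate is at most `Λ`. Stopping at the first time that the mass reaches `K` separates the two
cases. -/
theorem measure_run_snd_eq_zero_le (hX : IsPoissonClocks X P)
    (hS : ∀ ω, ClocksSimple fun m => X m ω)
    (hF : ∀ ω, ClocksFinite (fun m => X m ω) S.finiteRate) (η : FiniteConfig V) {T : ℝ}
    (hT : 0 ≤ T) {K : ℕ} (hK : 0 < K) : ∃ Λ, 0 ≤ Λ ∧ ∀ k : ℕ, 0 < k →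
      P {ω | (S.run (fun m => X m ω) T k 0 η).2 = 0} ≤
        ENNReal.ofReal (weightSum 1 η.1 / K) + ENNReal.ofReal (Λ * T / k) := by
  obtain ⟨Λ, hΛ, hΛle⟩ := S.exists_rate_size_le S.isWeight_one (b := 1) (fun _ => le_rfl)
    zero_le_one K
  refine ⟨Λ, hΛ, fun k hk => ?_⟩
  obtain ⟨Zm, hZ⟩ := exists_isJumpProcess_run hS hF k η
  have h0 : ∀ ω, S.run (fun m => X m ω) 0 k 0 η = (η, k) := fun ω =>
    (exists_isJumpPath_run (hS ω) (hF ω) k 0 le_rfl η).1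
  let B : Set (FiniteConfig V × ℕ) := {e | (K : ℝ) ≤ weightSum 1 e.1.1}
  let Z : ℝ → Ω → FiniteConfig V × ℕ := fun t ω => S.run (fun m => X m ω) t k 0 η
  have hτ : IsClockStop X (hitTime Z B T) :=
    isClockStop_hitTime (fun t ht e => hZ.measurableSet_eq ht e)
      (fun ω t ht => (hZ.path ω).right t ht) B hT
  have hR : ∀ m (e : FiniteConfig V × ℕ), 0 ≤ S.countRate m e := by
    intro m e
    rw [countRate]
    split_ifs
    exacts [le_rfl, S.rate_nonneg _ _]
  have hcount : ∀ m (e : FiniteConfig V × ℕ), S.countRate m e ≤ S.rate m e.1.1 := by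
    intro m e
    rw [countRate]
    split_ifs
    exacts [S.rate_nonneg _ _, le_rfl]
  have hmass : ∀ ω r, 0 ≤ r → r < hitTime Z B T ω → weightSum 1 (Z r ω).1.1 < K :=
    fun ω r hr h => not_le.1 (notMem_of_lt_hitTime (B := B) hT hr h)
  have hsize : ∀ m : Mark V, 1 ≤ m.size (1 : V → ℝ) := fun m => by cases m <;> simp [Mark.size]
  let W₁ : FiniteConfig V × ℕ → ℝ := fun e => weightSum 1 e.1.1
  let W₂ : FiniteConfig V × ℕ → ℝ := fun e => k - e.2
  have hterm₁ : ∀ m e, S.countRate m e * |W₁ (countMap m e) - W₁ e| ≤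
      S.rate m e.1.1 * m.size 1 := fun m e =>
    (mul_le_mul_of_nonneg_right (hcount m e) (abs_nonneg _)).trans
      (S.rate_mul_abs_le (fun _ => zero_le_one) e.1 m)
  -- The number of used transitions grows by one at each jump; when none is left the truncated
  -- subtraction would fail, but the rate is zero.
  have hdiff : ∀ m e, S.countRate m e * (W₂ (countMap m e) - W₂ e) = S.countRate m e := by
    intro m e
    by_cases h : e.2 = 0
    · simp [countRate, h]
    · have : ((e.2 - 1 : ℕ) : ℝ) = e.2 - 1 := by
        rw [Nat.cast_sub (Nat.one_le_iff_ne_zero.2 h), Nat.cast_one]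
      simp only [W₂, countMap, this]
      ring
  have hterm₂ : ∀ m e, S.countRate m e * |W₂ (countMap m e) - W₂ e| = S.countRate m e := by
    intro m e
    rw [← abs_of_nonneg (hR m e), ← abs_mul, abs_of_nonneg (hR m e), hdiff, abs_of_nonneg (hR m e)]
  have hle₂ : ∀ m e, S.countRate m e ≤ S.rate m e.1.1 * m.size 1 := fun m e =>
    (hcount m e).trans (le_mul_of_one_le_right (S.rate_nonneg _ _) (hsize m))
  have hsz := fun e : FiniteConfig V × ℕ => (S.hasSum_rate_size S.isWeight_one e.1).summable
  have hsum₁ : ∀ e, Summable fun m => S.countRate m e * |W₁ (countMap m e) - W₁ e| := fun e =>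
    Summable.of_nonneg_of_le (fun m => mul_nonneg (hR m e) (abs_nonneg _))
      (fun m => hterm₁ m e) (hsz e)
  have hsum₂ : ∀ e, Summable fun m => S.countRate m e := fun e =>
    Summable.of_nonneg_of_le (fun m => hR m e) (fun m => hle₂ m e) (hsz e)
  have hb₁ := hZ.measure_ge_le hX hτ hT (fun ω => hitTime_le hT) hR W₁ hsum₁ (K := Λ)
    (fun ω r hr h => ((hsum₁ _).tsum_le_tsum (fun m => hterm₁ m _) (hsz _)).trans
      (hΛle _ (hmass ω r hr h))) le_rfl
    (fun ω r hr h => by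
      by_cases h2 : (S.run (fun m => X m ω) r k 0 η).2 = 0
      · simp [jumpGen, countRate, h2]
      · refine le_trans (le_of_eq ?_) (S.jumpGen_mass_nonpos (S.run (fun m => X m ω) r k 0 η).1)
        simp [jumpGen, countRate, h2, W₁, countMap, finiteRate])
    (fun ω r => FiniteConfig.weightSum_nonneg (fun _ => zero_le_one) _) h0
    (c := K) (by exact_mod_cast hK)
  have hb₂ := hZ.measure_ge_le hX hτ hT (fun ω => hitTime_le hT) hR W₂
    (fun e => by simpa only [hterm₂] using hsum₂ e) (K := Λ)
    (fun ω r hr h => by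
      simp_rw [hterm₂]
      exact ((hsum₂ _).tsum_le_tsum (fun m => hle₂ m _) (hsz _)).trans (hΛle _ (hmass ω r hr h)))
    hΛ
    (fun ω r hr h => by
      simp_rw [jumpGen, hdiff]
      exact ((hsum₂ _).tsum_le_tsum (fun m => hle₂ m _) (hsz _)).trans (hΛle _ (hmass ω r hr h)))
    (fun ω r => sub_nonneg.2 (by exact_mod_cast run_snd_le _ _ _ _)) h0
    (c := k) (by exact_mod_cast hk)
  simp only [zero_mul, add_zero, W₂, sub_self, zero_add] at hb₁ hb₂
  refine le_trans (measure_mono ?_) ((measure_union_le _ _).trans (add_le_add hb₁ hb₂))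
  intro ω hω
  rcases (hitTime_le (Z := Z) (B := B) (ω := ω) hT).eq_or_lt with h | h
  · right
    have hω' : (Z T ω).2 = 0 := hω
    change (k : ℝ) ≤ k - (Z (hitTime Z B T ω) ω).2
    rw [h, hω']
    simp
  · left
    exact mem_of_hitTime_lt (fun t ht => (hZ.path ω).right t ht) hT h

/-- First the number of allowed transitions tends to infinity, then the mass level `K`. -/
theorem ae_nonexplosive (hX : IsPoissonClocks X P) (hS : ∀ ω, ClocksSimple fun m => X m ω)
    (hF : ∀ ω, ClocksFinite (fun m => X m ω) S.finiteRate) :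
    ∀ᵐ ω ∂P, S.Nonexplosive fun m => X m ω := by
  have key : ∀ (η : FiniteConfig V) (T : ℕ), ∀ᵐ ω ∂P,
      ∃ k, (S.run (fun m => X m ω) T k 0 η).2 ≠ 0 := by
    intro η T
    rw [ae_iff]
    simp only [ne_eq, not_exists, not_not]
    have h1 : ∀ K : ℕ, 0 < K → P {ω | ∀ k, (S.run (fun m => X m ω) T k 0 η).2 = 0} ≤
        ENNReal.ofReal (weightSum 1 η.1 / K) := by
      intro K hK
      obtain ⟨Λ, -, h⟩ := measure_run_snd_eq_zero_le hX hS hF η (Nat.cast_nonneg T) hK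
      have hlim : Tendsto (fun k : ℕ => ENNReal.ofReal (weightSum 1 η.1 / K) +
          ENNReal.ofReal (Λ * T / k)) atTop (𝓝 (ENNReal.ofReal (weightSum 1 η.1 / K) + 0)) := by
        refine tendsto_const_nhds.add ?_
        simpa using ENNReal.tendsto_ofReal (tendsto_const_div_atTop_nhds_zero_nat (Λ * T))
      rw [add_zero] at hlim
      refine ge_of_tendsto hlim ?_
      filter_upwards [eventually_gt_atTop 0] with k hk
      refine (measure_mono (t := {ω | (S.run (fun m => X m ω) T k 0 η).2 = 0}) ?_).trans (h k hk)
      exact fun ω hω => hω k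
    have hlim : Tendsto (fun K : ℕ => ENNReal.ofReal (weightSum 1 η.1 / K)) atTop (𝓝 0) := by
      simpa using ENNReal.tendsto_ofReal (tendsto_const_div_atTop_nhds_zero_nat (weightSum 1 η.1))
    refine le_antisymm (ge_of_tendsto hlim ?_) zero_le
    filter_upwards [eventually_gt_atTop 0] with K hK
    exact h1 K hK
  filter_upwards [ae_all_iff.2 fun η => ae_all_iff.2 fun T => key η T] with ω hω η t
  obtain ⟨T, hT⟩ := exists_nat_ge t
  obtain ⟨k, hk⟩ := hω η T
  have := run_snd_anti (hF ω) hT k 0 le_rfl η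
  exact ⟨k, by omega⟩

end ReactionDiffusion

/-! ### Monotone coupling -/

theorem transition_mono {V : Type*} (m : Mark V) {a b : V → ℕ} (h : a ≤ b) :
    transition m a ≤ transition m b := by
  intro z
  have hz : a z ≤ b z := h z
  cases m <;> simp only [transition, Pi.add_apply, Pi.sub_apply] <;> omega

namespace ReactionDiffusion

variable {V : Type*} {S : ReactionDiffusion V}

/-- When only the lower configuration moves: a birth has different rates only if `a x < b x`, which
leaves room for a particle; a death lowers `a` anyway; jump rates are monotone, so this case cannot
occur for jumps. -/
theorem transition_le_of_rate_lt {m : Mark V} {a b : V → ℕ} (h : a ≤ b)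
    (hr : S.rate m b < S.rate m a) : transition m a ≤ b := by
  intro z
  have hz : a z ≤ b z := h z
  cases m with
  | birth x =>
    have hx : a x ≠ b x := fun hx => hr.ne (by rw [rate, rate, hx])
    have : a x ≤ b x := h x
    simp only [transition, Pi.add_apply]
    by_cases hzx : z = x
    · subst hzx
      simp
      omega
    · simpa [hzx] using hz
  | death x =>
    simp only [transition, Pi.sub_apply]
    omega
  | jump x y =>
    have : (a x : ℝ) ≤ b x := by exact_mod_cast h x
    exact absurd hr (not_lt.2 (mul_le_mul_of_nonneg_left this (S.p_nonneg x y)))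

/-- When only the upper configuration moves: a birth is harmless, and for a death or a jump the
different rates force `a x < b x`, so a particle can be removed from `b`. -/
theorem le_transition_of_rate_lt {m : Mark V} {a b : V → ℕ} (h : a ≤ b)
    (hr : S.rate m a < S.rate m b) : a ≤ transition m b := by
  classical
  intro z
  have hz : a z ≤ b z := h z
  have hsub : ∀ x, a x ≠ b x → a z ≤ b z - (Pi.single x 1 : V → ℕ) z := by
    intro x hx
    have : a x ≤ b x := h x
    by_cases hzx : z = x
    · subst hzx
      simp
      omega
    · simpa [hzx] using hz
  cases m with
  | birth x =>
    simp only [transition, Pi.add_apply]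
    omega
  | death x =>
    convert! hsub x fun hx => hr.ne (by rw [rate, rate, hx]) using 1
  | jump x y =>
    refine (hsub x fun hx => hr.ne (by rw [rate, rate, hx])).trans ?_
    simp only [transition, Pi.add_apply, Pi.sub_apply]
    convert! Nat.le_add_right _ _ using 3

/-- Paths that are driven by the same clocks remain ordered. -/
theorem isJumpPath_mono {X : Mark V → Set (ℝ × ℝ)} (hS : ClocksSimple X)
    {z zm z' zm' : ℝ → FiniteConfig V}
    (hz : IsJumpPath X S.finiteRate (fun m e => e.transition m) 0 z zm)
    (hz' : IsJumpPath X S.finiteRate (fun m e => e.transition m) 0 z' zm')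
    (h0 : (z 0).1 ≤ (z' 0).1) : ∀ t, 0 ≤ t → (z t).1 ≤ (z' t).1 := by
  refine real_induction h0 ?_ ?_
  · intro t ht h
    filter_upwards [hz.right t ht, hz'.right t ht] with t' h1 h2
    rwa [h1, h2]
  · intro t ht ih
    have hm : (zm t).1 ≤ (zm' t).1 := by
      obtain ⟨t', h1, h2, h3⟩ := ((hz.left t ht).and ((hz'.left t ht).and
        (Ioo_mem_nhdsLT ht))).exists
      rw [← h1, ← h2]
      exact ih t' h3.1.le h3.2
    -- If both paths jump, they do so with the same mark, by simplicity. If only one does, the point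
    -- lies below one rate and not below the other, so the rates are strictly ordered.
    by_cases ha : ∃ m u, Fires X S.finiteRate (zm t) m t u
    · obtain ⟨m, u, ha⟩ := ha
      rw [hz.jump t ht m u ha]
      by_cases hb : ∃ m u, Fires X S.finiteRate (zm' t) m t u
      · obtain ⟨m', u', hb⟩ := hb
        rw [hz'.jump t ht m' u' hb, (hS _ _ _ _ _ ht ha.2.1 hb.2.1 ha.1 hb.1).1]
        exact transition_mono m' hm
      · push Not at hb
        rw [hz'.stay t ht hb]
        exact transition_le_of_rate_lt hm (lt_of_le_of_lt
          (not_lt.1 fun h => hb m u ⟨ha.1, ha.2.1, h⟩) ha.2.2)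
    · push Not at ha
      rw [hz.stay t ht ha]
      by_cases hb : ∃ m u, Fires X S.finiteRate (zm' t) m t u
      · obtain ⟨m, u, hb⟩ := hb
        rw [hz'.jump t ht m u hb]
        exact le_transition_of_rate_lt hm (lt_of_le_of_lt
          (not_lt.1 fun h => ha m u ⟨hb.1, hb.2.1, h⟩) hb.2.2)
      · push Not at hb
        rwa [hz'.stay t ht hb]

end ReactionDiffusion

/-! ### A maximal inequality for ordered pairs -/

/-- Gronwall's inequality for functions with values in `[0, ∞]`. -/
theorem ENNReal.le_two_pow_mul_of_le_add_lintegral {U : ℝ → ℝ≥0∞} {C T : ℝ} (hC : 0 ≤ C)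
    (hT : 0 ≤ T) {B : ℝ≥0∞} (hB : B ≠ ∞) (hU : ∀ t, 0 ≤ t → t ≤ T → U t ≤ B)
    (h : ∀ s t, 0 ≤ s → s ≤ t → t ≤ T →
      U t ≤ U s + ENNReal.ofReal C * ∫⁻ q in Set.Ioc s t, U q) :
    U T ≤ 2 ^ (⌈2 * C * T⌉₊ + 1) * U 0 := by
  -- On a short interval the supremum `M` satisfies `M ≤ U s + M / 2`. The a priori bound `B` makes
  -- `M` finite, so that `M / 2` can be absorbed; no measurability of `U` is involved.
  have hstep : ∀ s t, 0 ≤ s → s ≤ t → t ≤ T → C * (t - s) ≤ 1 / 2 → U t ≤ 2 * U s := by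
    intro s t hs hst htT hCt
    let M := ⨆ q ∈ Set.Icc s t, U q
    have hM : M ≤ B := iSup₂_le fun q hq => hU q (hs.trans hq.1) (hq.2.trans htT)
    have hle : M ≤ U s + 1 / 2 * M := by
      refine iSup₂_le fun q hq => (h s q hs hq.1 (hq.2.trans htT)).trans (add_le_add_right ?_ _)
      have h1 : ∫⁻ r in Set.Ioc s q, U r ≤ M * ENNReal.ofReal (q - s) := by
        refine (setLIntegral_mono (g := fun _ => M) measurable_const fun r hr =>
          le_iSup₂ (f := fun q (_ : q ∈ Set.Icc s t) => U q) r ⟨hr.1.le, hr.2.trans hq.2⟩).trans ?_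
        simp
      calc ENNReal.ofReal C * ∫⁻ r in Set.Ioc s q, U r
          ≤ ENNReal.ofReal C * (M * ENNReal.ofReal (q - s)) := by gcongr
        _ = ENNReal.ofReal (C * (q - s)) * M := by
          rw [ENNReal.ofReal_mul hC]
          ring
        _ ≤ ENNReal.ofReal (1 / 2) * M := by
          gcongr
          exact (mul_le_mul_of_nonneg_left (by linarith [hq.2]) hC).trans hCt
        _ = 1 / 2 * M := by
          rw [ENNReal.ofReal_div_of_pos two_pos, ENNReal.ofReal_one, ENNReal.ofReal_ofNat]
    have hMfin : M ≠ ∞ := ne_top_of_le_ne_top hB hM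
    have hM2 : M ≤ 2 * U s := by
      have h2 : 1 / 2 * M + 1 / 2 * M = M := by
        rw [← add_mul, ENNReal.add_halves, one_mul]
      have h3 : 1 / 2 * M ≠ ∞ := ENNReal.mul_ne_top (by simp) hMfin
      have h4 : 1 / 2 * M ≤ U s := by
        rw [← h2] at hle
        conv_rhs at hle => rw [h2]
        exact (ENNReal.add_le_add_iff_right h3).1 hle
      rw [← h2, two_mul]
      exact add_le_add h4 h4
    exact (le_iSup₂ (f := fun q (_ : q ∈ Set.Icc s t) => U q) t ⟨hst, le_rfl⟩).trans hM2
  -- Enough steps for `C T / N ≤ 1 / 2`; the added `1` keeps `N` positive.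
  let N := ⌈2 * C * T⌉₊ + 1
  have hN : (0 : ℝ) < N := by positivity
  have hNC : 2 * C * T ≤ N := (Nat.le_ceil _).trans (by simp [N])
  have hiter : ∀ k : ℕ, k ≤ N → U (T * (k / N)) ≤ 2 ^ k * U 0 := by
    intro k
    induction k with
    | zero => simp
    | succ k ih =>
      intro hk
      have h1 : T * ((k : ℝ) / N) ≤ T * (((k + 1 : ℕ) : ℝ) / N) := by gcongr; simp
      have h2 : T * (((k + 1 : ℕ) : ℝ) / N) ≤ T :=
        mul_le_of_le_one_right hT ((div_le_one hN).2 (by exact_mod_cast hk))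
      refine (hstep _ _ (by positivity) h1 h2 ?_).trans ?_
      · have : T * (((k + 1 : ℕ) : ℝ) / N) - T * ((k : ℝ) / N) = T / N := by
          push_cast
          field_simp
          ring
        rw [this, ← mul_div_assoc, div_le_div_iff₀ hN two_pos]
        linarith
      · rw [pow_succ', mul_assoc]
        exact mul_le_mul_right (ih (by omega)) 2
  have h := hiter N le_rfl
  rwa [div_self hN.ne', mul_one] at h

theorem ofReal_integral_le_lintegral {α : Type*} [MeasurableSpace α] {μ : Measure α} (f : α → ℝ) :
    ENNReal.ofReal (∫ x, f x ∂μ) ≤ ∫⁻ x, ENNReal.ofReal (f x) ∂μ := by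
  by_cases hf : Integrable f μ
  · rw [integral_eq_lintegral_pos_part_sub_lintegral_neg_part hf]
    exact (ENNReal.ofReal_le_ofReal (sub_le_self _ ENNReal.toReal_nonneg)).trans
      ENNReal.ofReal_toReal_le
  · simp [integral_undef hf]

/-- Also covers entrance exactly at time `T`, where the hitting time coincides with its cap. -/
theorem hitTime_mem_of_exists {E Ω : Type*} {Z : ℝ → Ω → E} {B : Set E} {T : ℝ} {ω : Ω}
    (hright : ∀ t, 0 ≤ t → ∀ᶠ t' in 𝓝[>] t, Z t' ω = Z t ω) (hT : 0 ≤ T)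
    (h : ∃ t, 0 ≤ t ∧ t ≤ T ∧ Z t ω ∈ B) : Z (hitTime Z B T ω) ω ∈ B := by
  obtain ⟨t, h0, h1, h2⟩ := h
  rcases (hitTime_le (Z := Z) (B := B) (ω := ω) hT).lt_or_eq with hlt | heq
  · exact mem_of_hitTime_lt hright hT hlt
  · have : hitTime Z B T ω ≤ t := csInf_le (hitTime_bddBelow hT) (Or.inl ⟨h0, h2⟩)
    have htT : t = T := le_antisymm h1 (heq ▸ this)
    rwa [heq, ← htT]

namespace ReactionDiffusion

variable {V Ω : Type*} (S : ReactionDiffusion V)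

/-- The flow of a finite configuration as a process. -/
noncomputable abbrev finFlow (X : Mark V → Ω → Set (ℝ × ℝ)) (η : FiniteConfig V) (t : ℝ) (ω : Ω) :
    FiniteConfig V := S.finiteFlow (fun m => X m ω) 0 t η

/-- Clocks for which the flow on finite configurations is well defined everywhere. -/
structure GoodClocks (X : Mark V → Ω → Set (ℝ × ℝ)) : Prop where
  simple : ∀ ω, ClocksSimple fun m => X m ω
  finite : ∀ ω, ClocksFinite (fun m => X m ω) S.finiteRate
  nonexplosive : ∀ ω, S.Nonexplosive fun m => X m ω

variable {S} {X : Mark V → Ω → Set (ℝ × ℝ)}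

namespace GoodClocks

variable (hG : S.GoodClocks X)
include hG

theorem finFlow_zero (η : FiniteConfig V) (ω : Ω) : S.finFlow X η 0 ω = η :=
  (exists_isJumpPath_finiteFlow (hG.simple ω) (hG.finite ω) (hG.nonexplosive ω) η).1

theorem exists_isJumpProcess (η : FiniteConfig V) : ∃ Zm,
    IsJumpProcess X S.finiteRate (fun m e => e.transition m) (S.finFlow X η) Zm := by
  choose zm hzm using fun ω =>
    (exists_isJumpPath_finiteFlow (hG.simple ω) (hG.finite ω) (hG.nonexplosive ω) η).2
  exact ⟨fun t ω => zm ω t, ⟨hzm, ⟨η, hG.finFlow_zero η⟩, hG.simple, hG.finite⟩⟩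

theorem eventually_right (η : FiniteConfig V) (ω : Ω) {t : ℝ} (ht : 0 ≤ t) :
    ∀ᶠ t' in 𝓝[>] t, S.finFlow X η t' ω = S.finFlow X η t ω := by
  obtain ⟨Zm, hZ⟩ := hG.exists_isJumpProcess η
  exact (hZ.path ω).right t ht

theorem finFlow_mono {η ξ : FiniteConfig V} (h : η.1 ≤ ξ.1) {t : ℝ} (ht : 0 ≤ t) (ω : Ω) :
    (S.finFlow X η t ω).1 ≤ (S.finFlow X ξ t ω).1 := by
  obtain ⟨Zm, hZ⟩ := hG.exists_isJumpProcess η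
  obtain ⟨Zm', hZ'⟩ := hG.exists_isJumpProcess ξ
  refine isJumpPath_mono (hG.simple ω) (hZ.path ω) (hZ'.path ω) ?_ t ht
  rwa [hG.finFlow_zero, hG.finFlow_zero]

end GoodClocks

variable [Countable V] [MeasurableSpace Ω] {P : Measure Ω} [IsProbabilityMeasure P]

omit [MeasurableSpace Ω] in
theorem GoodClocks.measurableSet_eq (hG : S.GoodClocks X) (η : FiniteConfig V) {t : ℝ}
    (ht : 0 ≤ t) (e : FiniteConfig V) :
    MeasurableSet[clockPast X t] {ω | S.finFlow X η t ω = e} := by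
  obtain ⟨Zm, hZ⟩ := hG.exists_isJumpProcess η
  exact hZ.measurableSet_eq ht e

/-- The maximal inequality for the mass: its drift is nonpositive, and it is stopped on reaching
`K`. -/
theorem measure_exists_mass_ge_le (hX : IsPoissonClocks X P) (hG : S.GoodClocks X)
    (η : FiniteConfig V) {T : ℝ} (hT : 0 ≤ T) {K : ℕ} (hK : 0 < K) :
    P {ω | ∃ t, 0 ≤ t ∧ t ≤ T ∧ S.finFlow X η t ω ∈ {e | (K : ℝ) ≤ weightSum 1 e.1}} ≤
      ENNReal.ofReal (weightSum 1 η.1 / K) := by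
  obtain ⟨Zm, hZ⟩ := hG.exists_isJumpProcess η
  obtain ⟨Λ, -, hΛle⟩ := S.exists_rate_size_le S.isWeight_one (b := 1) (fun _ => le_rfl)
    zero_le_one K
  let B : Set (FiniteConfig V) := {e | (K : ℝ) ≤ weightSum 1 e.1}
  have hτ : IsClockStop X (hitTime (S.finFlow X η) B T) :=
    isClockStop_hitTime (fun t ht e => hZ.measurableSet_eq ht e)
      (fun ω t ht => (hZ.path ω).right t ht) B hT
  have h := hZ.measure_ge_le hX hτ hT (fun ω => hitTime_le hT) (fun m e => S.rate_nonneg m e.1)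
    (fun e => weightSum 1 e.1) (fun e => S.summable_rate_mul_abs S.isWeight_one e) (K := Λ)
    (fun ω r hr h => ((S.summable_rate_mul_abs S.isWeight_one _).tsum_le_tsum
      (S.rate_mul_abs_le (fun _ => zero_le_one) _)
      (S.hasSum_rate_size S.isWeight_one _).summable).trans
      (hΛle _ (not_le.1 (notMem_of_lt_hitTime (B := B) hT hr h)))) le_rfl
    (fun ω r hr h => S.jumpGen_mass_nonpos _)
    (fun ω r => FiniteConfig.weightSum_nonneg (fun _ => zero_le_one) _) (hG.finFlow_zero η)
    (c := K) (by exact_mod_cast hK)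
  rw [zero_mul, add_zero] at h
  exact (measure_mono fun ω hω =>
    hitTime_mem_of_exists (fun t ht => (hZ.path ω).right t ht) hT hω).trans h

/-- The maximal inequality for the distance of the flows of two ordered finite configurations,
stopped when the mass of the larger one is large. -/
theorem measure_hitTime_sub_ge_le (hX : IsPoissonClocks X P) (hG : S.GoodClocks X)
    {w : V → ℝ} {C b : ℝ} (hw : S.IsWeight w C) (hC : 0 ≤ C) (hb : ∀ x, w x ≤ b) {T : ℝ}
    (hT : 0 ≤ T) {η ξ : FiniteConfig V} (hle : η.1 ≤ ξ.1) {ε : ℝ} (hε : 0 < ε) (K : ℕ)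
    {τ : Ω → ℝ} (hτ : IsClockStop X τ) (hτT : ∀ ω, τ ω ≤ T)
    (hτε : ∀ ω r, 0 ≤ r → r < τ ω →
      weightSum w (S.finFlow X ξ r ω).1 - weightSum w (S.finFlow X η r ω).1 ≤ ε)
    (hτK : ∀ ω r, 0 ≤ r → r < τ ω → weightSum 1 (S.finFlow X ξ r ω).1 < K) :
    P {ω | ε ≤ weightSum w (S.finFlow X ξ (τ ω) ω).1 - weightSum w (S.finFlow X η (τ ω) ω).1} ≤
      2 ^ (⌈2 * C * T⌉₊ + 1) * ENNReal.ofReal ((weightSum w ξ.1 - weightSum w η.1) / ε) := by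
  obtain ⟨Zm, hZ⟩ := hG.exists_isJumpProcess η
  obtain ⟨Zm', hZ'⟩ := hG.exists_isJumpProcess ξ
  obtain ⟨Λ, -, hΛle⟩ := S.exists_rate_size_le hw hb hC K
  let W : FiniteConfig V → ℝ := fun e => weightSum w e.1
  let D : ℝ → Ω → ℝ := fun t ω => W (S.finFlow X ξ t ω) - W (S.finFlow X η t ω)
  have hD0 : ∀ t ω, 0 ≤ t → 0 ≤ D t ω := fun t ω ht =>
    sub_nonneg.2 (FiniteConfig.weightSum_mono hw.nonneg (hG.finFlow_mono hle ht ω))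
  have hbound : ∀ e : FiniteConfig V, weightSum 1 e.1 < K →
      ∑' m, S.finiteRate m e * |W (e.transition m) - W e| ≤ Λ := fun e he =>
    ((S.summable_rate_mul_abs hw _).tsum_le_tsum (S.rate_mul_abs_le hw.nonneg _)
      (S.hasSum_rate_size hw _).summable).trans (hΛle _ he)
  -- The mass of the smaller path is below that of the larger one, so the bound on the larger mass
  -- before `τ` serves both.
  have hdyn := fun {s t : ℝ} (hs : 0 ≤ s) (hst : s ≤ t) =>
    hZ.dynkin hX hτ hs hst (@MeasurableSet.univ _ (clockPast X s))
      (fun m e => S.rate_nonneg m e.1) W (S.summable_rate_mul_abs hw) (K := Λ)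
      fun ω r hr h => hbound _ ((FiniteConfig.weightSum_mono (fun _ => zero_le_one)
        (hG.finFlow_mono hle hr ω)).trans_lt (hτK ω r hr h))
  have hdyn' := fun {s t : ℝ} (hs : 0 ≤ s) (hst : s ≤ t) =>
    hZ'.dynkin hX hτ hs hst (@MeasurableSet.univ _ (clockPast X s))
      (fun m e => S.rate_nonneg m e.1) W (S.summable_rate_mul_abs hw) (K := Λ)
      fun ω r hr h => hbound _ (hτK ω r hr h)
  let Y : ℝ → Ω → ℝ := fun t ω => D (min t (τ ω)) ω
  have hY0 : ∀ t ω, 0 ≤ t → 0 ≤ Y t ω := fun t ω ht => hD0 _ ω (le_min ht (hτ.nonneg ω))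
  have hY00 : ∀ ω, Y 0 ω = W ξ - W η := by
    intro ω
    simp only [Y, D, min_eq_left (hτ.nonneg ω), hG.finFlow_zero]
  have hYdiff : ∀ {s t : ℝ}, 0 ≤ s → s ≤ t → Integrable (fun ω => Y t ω - Y s ω) P ∧
      ∫ ω, (Y t ω - Y s ω) ∂P = ∫ ω, (∫ r in s..t, {r | r < τ ω}.indicator (fun r =>
        jumpGen S.finiteRate (fun m e => e.transition m) W (S.finFlow X ξ r ω) -
        jumpGen S.finiteRate (fun m e => e.transition m) W (S.finFlow X η r ω)) r) ∂P := by
    intro s t hs hst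
    obtain ⟨⟨h1, h2, h3⟩, h4⟩ := hdyn hs hst
    obtain ⟨⟨h1', h2', h3'⟩, h4'⟩ := hdyn' hs hst
    rw [Measure.restrict_univ] at h4 h4'
    have heq : ∀ ω, Y t ω - Y s ω =
        (W (S.finFlow X ξ (min t (τ ω)) ω) - W (S.finFlow X ξ (min s (τ ω)) ω)) -
        (W (S.finFlow X η (min t (τ ω)) ω) - W (S.finFlow X η (min s (τ ω)) ω)) := by
      intro ω
      simp only [Y, D]
      ring
    simp_rw [heq]
    refine ⟨h1'.sub h1, ?_⟩
    rw [integral_sub h1' h1, h4, h4', ← integral_sub h2' h2]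
    refine integral_congr_ae (Eventually.of_forall fun ω => ?_)
    simp only
    rw [← intervalIntegral.integral_sub (h3' ω) (h3 ω)]
    congr 1
    funext r
    by_cases h : r < τ ω <;> simp [h]
  have hYint : ∀ {t : ℝ}, 0 ≤ t → Integrable (Y t) P := by
    intro t ht
    have h := (hYdiff le_rfl ht).1.add (integrable_const (W ξ - W η))
    refine h.congr (Eventually.of_forall fun ω => ?_)
    simp [hY00]
  let F : ℝ → Ω → ℝ≥0∞ := fun r ω => {r | r < τ ω}.indicator (fun r => ENNReal.ofReal (D r ω)) r
  let U : ℝ → ℝ≥0∞ := fun t => ENNReal.ofReal (∫ ω, Y t ω ∂P)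
  have hFU : ∀ r, 0 ≤ r → ∫⁻ ω, F r ω ∂P ≤ U r := by
    intro r hr
    simp only [U]
    rw [ofReal_integral_eq_lintegral_ofReal (hYint hr)
      (Eventually.of_forall fun ω => hY0 r ω hr)]
    refine lintegral_mono fun ω => ?_
    by_cases h : r < τ ω
    · simp only [F, Y, Set.indicator_of_mem (show r ∈ {r | r < τ ω} from h), min_eq_left h.le,
        le_refl]
    · simp [F, Set.indicator_of_notMem (show r ∉ {r | r < τ ω} from h)]
  have hFε : ∀ r ω, 0 ≤ r → F r ω ≤ ENNReal.ofReal ε := by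
    intro r ω hr
    by_cases h : r < τ ω
    · simp only [F, Set.indicator_of_mem (show r ∈ {r | r < τ ω} from h)]
      exact ENNReal.ofReal_le_ofReal (hτε ω r hr h)
    · simp [F, Set.indicator_of_notMem (show r ∉ {r | r < τ ω} from h)]
  -- Dynkin's formula for the difference, with drift at most `(C - 1) D ≤ C D` as `D` is
  -- nonnegative, followed by Fubini.
  have hUstep : ∀ s t, 0 ≤ s → s ≤ t →
      U t ≤ U s + ENNReal.ofReal C * ∫⁻ q in Set.Ioc s t, (∫⁻ ω, F q ω ∂P) := by
    intro s t hs hst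
    have ht := hs.trans hst
    have hmeas : AEMeasurable (Function.uncurry fun (r : ℝ) (ω : Ω) => F r ω)
        ((volume.restrict (Set.Ioc s t)).prod P) := by
      have h1 : Measurable fun p : ℝ × Ω => {r | r < τ p.2}.indicator (fun r => ENNReal.ofReal
          (D (max 0 (min r t)) p.2)) p.1 := by
        have hset : MeasurableSet {p : ℝ × Ω | p.1 < τ p.2} :=
          measurableSet_lt measurable_fst ((hτ.measurable hX).comp measurable_snd)
        exact (((hZ'.measurable_uncurry hX W ht).sub
          (hZ.measurable_uncurry hX W ht)).ennreal_ofReal).indicator hset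
      refine h1.aemeasurable.congr ?_
      have h2 : ∀ᵐ p ∂((volume.restrict (Set.Ioc s t)).prod P), p.1 ∈ Set.Ioc s t :=
        Measure.quasiMeasurePreserving_fst.ae (ae_restrict_mem measurableSet_Ioc)
      filter_upwards [h2] with p hp
      simp only [Function.uncurry, F, Set.indicator_apply, min_eq_left hp.2,
        max_eq_right (hs.trans hp.1.le)]
    have hsub : ∫ ω, Y t ω ∂P = ∫ ω, Y s ω ∂P + ∫ ω, (Y t ω - Y s ω) ∂P := by
      rw [integral_sub (hYint ht) (hYint hs)]
      ring
    simp only [U]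
    rw [hsub, lintegral_lintegral_swap hmeas, (hYdiff hs hst).2]
    refine ENNReal.ofReal_add_le.trans (add_le_add_right ?_ _)
    refine (ofReal_integral_le_lintegral _).trans ?_
    rw [← lintegral_const_mul' _ _ ENNReal.ofReal_ne_top]
    refine lintegral_mono fun ω => ?_
    simp only
    rw [intervalIntegral.integral_of_le hst, ← lintegral_const_mul' _ _ ENNReal.ofReal_ne_top]
    refine (ofReal_integral_le_lintegral _).trans ?_
    refine setLIntegral_mono' measurableSet_Ioc fun r hr => ?_
    have hr0 : 0 ≤ r := hs.trans hr.1.le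
    by_cases h : r < τ ω
    · simp only [F, Set.indicator_of_mem (show r ∈ {r | r < τ ω} from h)]
      rw [← ENNReal.ofReal_mul hC]
      refine ENNReal.ofReal_le_ofReal
        ((S.jumpGen_weightSum_sub_le hw (hG.finFlow_mono hle hr0 ω)).trans ?_)
      exact mul_le_mul_of_nonneg_right (by linarith) (hD0 r ω hr0)
    · simp [Set.indicator_of_notMem (show r ∉ {r | r < τ ω} from h)]
  -- The finite a priori bound that Gronwall's inequality needs comes from `D ≤ ε` before `τ`.
  have hgron := ENNReal.le_two_pow_mul_of_le_add_lintegral (U := U) hC hT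
    (B := U 0 + ENNReal.ofReal C * (ENNReal.ofReal ε * ENNReal.ofReal T))
    (by simp [U, ENNReal.mul_ne_top])
    (fun t ht htT => by
      refine (hUstep 0 t le_rfl ht).trans ?_
      gcongr
      refine (setLIntegral_mono' (g := fun _ => ENNReal.ofReal ε) measurableSet_Ioc fun r hr => ?_).trans ?_
      · refine (lintegral_mono fun ω => hFε r ω hr.1.le).trans ?_
        simp
      · rw [setLIntegral_const, Real.volume_Ioc, sub_zero]
        gcongr)
    (fun s t hs hst htT => (hUstep s t hs hst).trans (add_le_add_right
      (mul_le_mul_right (setLIntegral_mono' measurableSet_Ioc fun r hr =>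
        hFU r (hs.trans hr.1.le)) _) _))
  have hU0 : U 0 = ENNReal.ofReal (W ξ - W η) := by
    simp only [U, hY00]
    simp
  have hmarkov := mul_meas_ge_le_integral_of_nonneg
    (Eventually.of_forall fun ω => hY0 T ω hT) (hYint hT) ε
  have hset : {ω | ε ≤ Y T ω} = {ω | ε ≤ weightSum w (S.finFlow X ξ (τ ω) ω).1 -
      weightSum w (S.finFlow X η (τ ω) ω).1} := by
    simp only [Y, D, W, min_eq_right (hτT _)]
  rw [← hset, ENNReal.ofReal_div_of_pos hε, ← mul_div_assoc, ENNReal.le_div_iff_mul_le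
    (Or.inl (by simpa using hε)) (Or.inl ENNReal.ofReal_ne_top)]
  rw [hU0] at hgron
  refine le_trans ?_ hgron
  rw [← ENNReal.ofReal_toReal (measure_ne_top P {ω | ε ≤ Y T ω}),
    ← ENNReal.ofReal_mul ENNReal.toReal_nonneg, mul_comm]
  exact ENNReal.ofReal_le_ofReal hmarkov

/-- The maximal inequality for the distance of the flows of two ordered finite configurations. -/
theorem measure_exists_sub_ge_le (hX : IsPoissonClocks X P) (hG : S.GoodClocks X)
    {w : V → ℝ} {C b : ℝ} (hw : S.IsWeight w C) (hC : 0 ≤ C) (hb : ∀ x, w x ≤ b) {T : ℝ}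
    (hT : 0 ≤ T) {η ξ : FiniteConfig V} (hle : η.1 ≤ ξ.1) {ε : ℝ} (hε : 0 < ε) :
    P {ω | ∃ t, 0 ≤ t ∧ t ≤ T ∧
      ε ≤ weightSum w (S.finFlow X ξ t ω).1 - weightSum w (S.finFlow X η t ω).1} ≤
      2 ^ (⌈2 * C * T⌉₊ + 1) * ENNReal.ofReal ((weightSum w ξ.1 - weightSum w η.1) / ε) := by
  set c := 2 ^ (⌈2 * C * T⌉₊ + 1) * ENNReal.ofReal ((weightSum w ξ.1 - weightSum w η.1) / ε)
  have key : ∀ K : ℕ, 0 < K → P {ω | ∃ t, 0 ≤ t ∧ t ≤ T ∧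
      ε ≤ weightSum w (S.finFlow X ξ t ω).1 - weightSum w (S.finFlow X η t ω).1} ≤
        c + ENNReal.ofReal (weightSum 1 ξ.1 / K) := by
    intro K hK
    let Z : ℝ → Ω → FiniteConfig V × FiniteConfig V := fun t ω =>
      (S.finFlow X η t ω, S.finFlow X ξ t ω)
    -- The pair is stopped when the distance reaches `ε` or the larger mass reaches `K`. The bound
    -- on the distance does not involve `K`, so `K` is sent to infinity at the end.
    let B : Set (FiniteConfig V × FiniteConfig V) :=
      {e | ε ≤ weightSum w e.2.1 - weightSum w e.1.1 ∨ (K : ℝ) ≤ weightSum 1 e.2.1}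
    have hright : ∀ ω t, 0 ≤ t → ∀ᶠ t' in 𝓝[>] t, Z t' ω = Z t ω := fun ω t ht => by
      filter_upwards [hG.eventually_right η ω ht, hG.eventually_right ξ ω ht] with t' h1 h2
      exact Prod.ext h1 h2
    have hτ : IsClockStop X (hitTime Z B T) := by
      refine isClockStop_hitTime (fun t ht e => ?_) hright B hT
      have : {ω | Z t ω = e} = {ω | S.finFlow X η t ω = e.1} ∩ {ω | S.finFlow X ξ t ω = e.2} := by
        ext ω
        exact Prod.ext_iff
      rw [this]
      exact @MeasurableSet.inter _ (clockPast X t) _ _ (hG.measurableSet_eq η ht _)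
        (hG.measurableSet_eq ξ ht _)
    have hbefore : ∀ ω r, 0 ≤ r → r < hitTime Z B T ω → Z r ω ∉ B := fun ω r hr h =>
      notMem_of_lt_hitTime hT hr h
    have h1 := measure_hitTime_sub_ge_le hX hG hw hC hb hT hle hε K hτ (fun ω => hitTime_le hT)
      (fun ω r hr h => (not_le.1 fun h' => hbefore ω r hr h (Or.inl h')).le)
      (fun ω r hr h => not_le.1 fun h' => hbefore ω r hr h (Or.inr h'))
    refine le_trans (measure_mono ?_) ((measure_union_le _ _).trans
      (add_le_add h1 (measure_exists_mass_ge_le hX hG ξ hT hK)))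
    rintro ω ⟨t, ht0, htT, ht⟩
    rcases hitTime_mem_of_exists (Z := Z) (B := B) (hright ω) hT ⟨t, ht0, htT, Or.inl ht⟩
      with h | h
    · exact Or.inl h
    · exact Or.inr ⟨_, hitTime_nonneg hT, hitTime_le hT, h⟩
  have hlim : Tendsto (fun K : ℕ => c + ENNReal.ofReal (weightSum 1 ξ.1 / K)) atTop
      (𝓝 (c + 0)) := by
    refine tendsto_const_nhds.add ?_
    simpa using ENNReal.tendsto_ofReal (tendsto_const_div_atTop_nhds_zero_nat (weightSum 1 ξ.1))
  rw [add_zero] at hlim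
  refine ge_of_tendsto hlim ?_
  filter_upwards [eventually_gt_atTop 0] with K hK
  exact key K hK

end ReactionDiffusion

/-! ### The infinite-volume flow -/

namespace ReactionDiffusion

variable {V : Type*} {S : ReactionDiffusion V}

theorem weightSum_le_of_le {η : V → ℕ} {ζ : S.Config} (h : η ≤ ζ.1) :
    Summable (fun x => S.α x * (η x : ℝ)) ∧ weightSum S.α η ≤ weightSum S.α ζ.1 := by
  have hle : ∀ x, S.α x * (η x : ℝ) ≤ S.α x * (ζ.1 x : ℝ) := fun x =>
    mul_le_mul_of_nonneg_left (by exact_mod_cast h x) (S.α_pos x).le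
  have hs := Summable.of_nonneg_of_le
    (fun x => mul_nonneg (S.α_pos x).le (Nat.cast_nonneg _)) hle ζ.2
  exact ⟨hs, hs.tsum_le_tsum hle ζ.2⟩

theorem dist_eq_of_le {η ζ : S.Config} (h : η.1 ≤ ζ.1) :
    dist η ζ = weightSum S.α ζ.1 - weightSum S.α η.1 := by
  change ∑' x, S.α x * |(η.1 x : ℝ) - (ζ.1 x : ℝ)| = _
  rw [weightSum, weightSum, ← ζ.2.tsum_sub η.2]
  refine tsum_congr fun x => ?_
  have : (η.1 x : ℝ) ≤ ζ.1 x := by exact_mod_cast h x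
  rw [abs_of_nonpos (by linarith)]
  ring

/-- Occupation numbers are integers, so a disagreement at `x` costs at least `α x`. -/
theorem eq_of_dist_lt {η ζ : S.Config} {x : V} (h : dist η ζ < S.α x) : η.1 x = ζ.1 x := by
  by_contra hne
  have h1 : (1 : ℝ) ≤ |(η.1 x : ℝ) - (ζ.1 x : ℝ)| := by
    have : (1 : ℤ) ≤ |(η.1 x : ℤ) - (ζ.1 x : ℤ)| := Int.one_le_abs (by omega)
    exact_mod_cast this
  have h2 : S.α x * |(η.1 x : ℝ) - (ζ.1 x : ℝ)| ≤ dist η ζ :=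
    (S.summable_dist η ζ).le_tsum x fun y _ => mul_nonneg (S.α_pos y).le (abs_nonneg _)
  nlinarith [S.α_pos x]

theorem eventually_eq_of_tendsto {a : ℕ → S.Config} {η : S.Config} (h : Tendsto a atTop (𝓝 η))
    (x : V) : ∀ᶠ n in atTop, (a n).1 x = η.1 x := by
  filter_upwards [h.eventually (Metric.ball_mem_nhds η (S.α_pos x))] with n hn
  exact eq_of_dist_lt (Metric.mem_ball.1 hn)

variable (S) in
/-- An increasing sequence of finite configurations that converges fast to `η`. -/
structure Approximates (a : ℕ → FiniteConfig V) (η : S.Config) : Prop where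
  mono : Monotone fun n => (a n).1
  le : ∀ n, (a n).1 ≤ η.1
  sub_le : ∀ n, weightSum S.α η.1 - weightSum S.α (a n).1 ≤ (1 / 4) ^ n

/-- Restrictions of `η` to finite sets that carry all but `(1/4)ⁿ` of its weight; `partialSups`
makes the sets increase. -/
theorem exists_approximates (η : S.Config) : ∃ a, S.Approximates a η := by
  classical
  have h : ∀ n : ℕ, ∃ F : Finset V, ∀ F', F ⊆ F' →
      weightSum S.α η.1 - ∑ x ∈ F', S.α x * (η.1 x : ℝ) ≤ (1 / 4) ^ n := by
    intro n
    have h1 := η.2.hasSum.eventually (lt_mem_nhds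
      (sub_lt_self (weightSum S.α η.1) (show (0 : ℝ) < (1 / 4) ^ n by positivity)))
    obtain ⟨F, hF⟩ := eventually_atTop.1 h1
    exact ⟨F, fun F' hF' => by linarith [hF F' hF']⟩
  choose F hF using h
  let a : ℕ → FiniteConfig V := fun n =>
    ⟨fun x => if x ∈ partialSups F n then η.1 x else 0, by
      refine summable_of_ne_finset_zero (s := partialSups F n) fun x hx => ?_
      simp [hx]⟩
  refine ⟨a, ⟨fun n k hnk x => ?_, fun n x => ?_, fun n => ?_⟩⟩
  · simp only [a]
    by_cases hx : x ∈ partialSups F n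
    · simp [hx, (partialSups F).monotone hnk hx]
    · simp [hx]
  · simp only [a]
    split_ifs <;> simp
  · have : weightSum S.α (a n).1 = ∑ x ∈ partialSups F n, S.α x * (η.1 x : ℝ) := by
      rw [weightSum, tsum_eq_sum (s := partialSups F n) fun x hx => by simp [a, hx]]
      exact Finset.sum_congr rfl fun x hx => by simp [a, hx]
    rw [this]
    exact hF n (partialSups F n) (le_partialSups F n)

namespace Approximates

variable {a : ℕ → FiniteConfig V} {η : S.Config} (ha : S.Approximates a η)
include ha

theorem tendsto : Tendsto (fun n => S.ofFinite (a n)) atTop (𝓝 η) := by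
  rw [tendsto_iff_dist_tendsto_zero]
  refine squeeze_zero (fun n => dist_nonneg) (fun n => ?_)
    (tendsto_pow_atTop_nhds_zero_of_lt_one (r := (1 / 4 : ℝ)) (by norm_num) (by norm_num))
  rw [dist_eq_of_le (η := S.ofFinite (a n)) (ha.le n)]
  exact ha.sub_le n

theorem eventually_eq (x : V) : ∀ᶠ n in atTop, (a n).1 x = η.1 x :=
  eventually_eq_of_tendsto ha.tendsto x

/-- On the finite support of `ζ` the approximation eventually equals `η`. -/
theorem exists_le {ζ : FiniteConfig V} (h : ζ.1 ≤ η.1) : ∃ k, ζ.1 ≤ (a k).1 := by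
  have : ∀ᶠ n in atTop, ∀ x ∈ {x | ζ.1 x ≠ 0}, (a n).1 x = η.1 x :=
    (ζ.finite_support.eventually_all).2 fun x _ => ha.eventually_eq x
  obtain ⟨k, hk⟩ := this.exists
  refine ⟨k, fun x => ?_⟩
  by_cases hx : ζ.1 x = 0
  · simp [hx]
  · rw [hk x hx]
    exact h x

end Approximates

theorem sum_half_pow_le (n m : ℕ) : ∑ k ∈ Finset.Ico n m, (1 / 2 : ℝ) ^ k ≤ 2 * (1 / 2) ^ n := by
  rcases le_or_gt n m with h | h
  · have hm : (0 : ℝ) < (1 / 2) ^ m := by positivity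
    rw [geom_sum_Ico (by norm_num) h]
    have : ((1 / 2 : ℝ) ^ m - (1 / 2) ^ n) / (1 / 2 - 1) = 2 * (1 / 2) ^ n - 2 * (1 / 2) ^ m := by
      field_simp
      ring
    linarith
  · rw [Finset.Ico_eq_empty (by omega), Finset.sum_empty]
    positivity

/-- An increasing sequence of finite configurations with summable increments converges. -/
theorem exists_limit {b : ℕ → FiniteConfig V} (hb : Monotone fun n => (b n).1) {N : ℕ}
    (h : ∀ n, N ≤ n → weightSum S.α (b (n + 1)).1 - weightSum S.α (b n).1 ≤ (1 / 2) ^ n) :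
    ∃ ψ : S.Config, (∀ n, (b n).1 ≤ ψ.1) ∧
      ∀ n, N ≤ n → weightSum S.α ψ.1 - weightSum S.α (b n).1 ≤ 2 * (1 / 2) ^ n := by
  have hα := fun x => (S.α_pos x).le
  have hWmono : Monotone fun n => weightSum S.α (b n).1 := fun n m hnm =>
    FiniteConfig.weightSum_mono hα (hb hnm)
  have hW : ∀ n m, N ≤ n → weightSum S.α (b m).1 ≤ weightSum S.α (b n).1 + 2 * (1 / 2) ^ n := by
    intro n m hn
    have h2 : (0 : ℝ) ≤ 2 * (1 / 2) ^ n := by positivity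
    rcases le_or_gt m n with hmn | hmn
    · linarith [hWmono hmn]
    · have h1 := Finset.sum_Ico_sub (fun k => weightSum S.α (b k).1) hmn.le
      have h3 : ∑ k ∈ Finset.Ico n m, (weightSum S.α (b (k + 1)).1 - weightSum S.α (b k).1) ≤
          ∑ k ∈ Finset.Ico n m, (1 / 2 : ℝ) ^ k :=
        Finset.sum_le_sum fun k hk => h k (hn.trans (Finset.mem_Ico.1 hk).1)
      linarith [sum_half_pow_le n m]
  have hbdd : ∀ x, BddAbove (Set.range fun n => (b n).1 x) := by
    intro x
    obtain ⟨M, hM⟩ := exists_nat_ge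
      ((weightSum S.α (b N).1 + 2 * (1 / 2) ^ N) / S.α x)
    refine ⟨M, ?_⟩
    rintro _ ⟨n, rfl⟩
    have h1 : S.α x * ((b n).1 x : ℝ) ≤ weightSum S.α (b n).1 :=
      ((b n).summable_mul S.α).le_tsum x fun y _ => mul_nonneg (hα y) (Nat.cast_nonneg _)
    have h2 : ((b n).1 x : ℝ) ≤ (weightSum S.α (b N).1 + 2 * (1 / 2) ^ N) / S.α x := by
      rw [le_div_iff₀ (S.α_pos x), mul_comm]
      exact h1.trans (hW N n le_rfl)
    exact_mod_cast h2.trans hM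
  -- The weights are bounded, hence so is each coordinate; a bounded increasing sequence of integers
  -- attains its supremum.
  let ψ : V → ℕ := fun x => ⨆ n, (b n).1 x
  have hle : ∀ n, (b n).1 ≤ ψ := fun n x => le_ciSup (hbdd x) n
  have hev : ∀ x, ∀ᶠ n in atTop, (b n).1 x = ψ x := by
    intro x
    obtain ⟨n, hn⟩ := Nat.sSup_mem ⟨_, Set.mem_range_self 0⟩ (hbdd x)
    filter_upwards [eventually_ge_atTop n] with m hm
    exact le_antisymm (hle m x) (hn.symm.le.trans (hb hm x))
  have hfin : ∀ n, N ≤ n → ∀ F : Finset V, ∑ x ∈ F, S.α x * (ψ x : ℝ) ≤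
      weightSum S.α (b n).1 + 2 * (1 / 2) ^ n := by
    intro n hn F
    obtain ⟨m, hm⟩ := (F.eventually_all.2 fun x _ => hev x).exists
    refine le_trans ?_ (hW n m hn)
    rw [Finset.sum_congr rfl fun x hx => by rw [← hm x hx]]
    exact ((b m).summable_mul S.α).sum_le_tsum F fun x _ =>
      mul_nonneg (hα x) (Nat.cast_nonneg _)
  have hnn : ∀ x, 0 ≤ S.α x * (ψ x : ℝ) := fun x => mul_nonneg (hα x) (Nat.cast_nonneg _)
  refine ⟨⟨ψ, summable_of_sum_le hnn (hfin N le_rfl)⟩, hle, fun n hn => ?_⟩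
  have := Real.tsum_le_of_sum_le hnn (hfin n hn)
  change weightSum S.α ψ - _ ≤ _
  rw [weightSum]
  linarith

variable (S) in
/-- The flows of the configurations `a n` converge fast and locally uniformly in time. -/
def FlowConverges (X : Mark V → Set (ℝ × ℝ)) (a : ℕ → FiniteConfig V) : Prop :=
  ∀ T : ℝ, ∃ N, ∀ n, N ≤ n → ∀ t, 0 ≤ t → t ≤ T →
    weightSum S.α (S.finiteFlow X 0 t (a (n + 1))).1 -
      weightSum S.α (S.finiteFlow X 0 t (a n)).1 ≤ (1 / 2) ^ n

/-! ### The infinite-volume flow along an approximating sequence. -/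

section

variable {Ω : Type*} {X : Mark V → Ω → Set (ℝ × ℝ)} (hG : S.GoodClocks X)
  {a : ℕ → FiniteConfig V} {η : S.Config} (ha : S.Approximates a η)
include hG ha

/-- Each `a' n` lies below some `a k`, and each `a k` lies below `a' n` for large `n`, by finiteness
of supports. Order preservation transfers both relations to the flows, so the limit is squeezed to
`ψ`. -/
theorem flow_tendsto_of_le_of_sub_le {ω : Ω} {t : ℝ} (ht : 0 ≤ t) {ψ : S.Config}
    (h1 : ∀ n, (S.finFlow X (a n) t ω).1 ≤ ψ.1) {N : ℕ}
    (h2 : ∀ n, N ≤ n →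
      weightSum S.α ψ.1 - weightSum S.α (S.finFlow X (a n) t ω).1 ≤ 2 * (1 / 2) ^ n)
    (a' : ℕ → FiniteConfig V) (hmono : Monotone fun n => (a' n).1)
    (hlim : Tendsto (fun n => S.ofFinite (a' n)) atTop (𝓝 η)) :
    Tendsto (fun n => S.ofFinite (S.finFlow X (a' n) t ω)) atTop (𝓝 ψ) := by
  have hle' : ∀ n, (a' n).1 ≤ η.1 := by
    intro n x
    obtain ⟨m, hm1, hm2⟩ := ((eventually_eq_of_tendsto hlim x).and
      (eventually_ge_atTop n)).exists
    exact (hmono hm2 x).trans hm1.le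
  have hψ : ∀ n, (S.finFlow X (a' n) t ω).1 ≤ ψ.1 := by
    intro n
    obtain ⟨k, hk⟩ := ha.exists_le (hle' n)
    exact (hG.finFlow_mono hk ht ω).trans (h1 k)
  have hge : ∀ k, ∀ᶠ n in atTop, (a k).1 ≤ (a' n).1 := by
    intro k
    have := ((a k).finite_support.eventually_all).2
      fun x _ => eventually_eq_of_tendsto hlim x
    filter_upwards [this] with n hn x
    by_cases hx : (a k).1 x = 0
    · simp [hx]
    · exact (ha.le k x).trans (hn x hx).symm.le
  rw [Metric.tendsto_atTop']
  intro ε hε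
  obtain ⟨k, hk⟩ := exists_pow_lt_of_lt_one (half_pos hε) (show (1 / 2 : ℝ) < 1 by norm_num)
  obtain ⟨n₀, hn₀⟩ := eventually_atTop.1 (hge (max k N))
  refine ⟨n₀, fun n hn => ?_⟩
  rw [dist_eq_of_le (η := S.ofFinite (S.finFlow X (a' n) t ω)) (hψ n)]
  have e1 := FiniteConfig.weightSum_mono (fun x => (S.α_pos x).le)
    (hG.finFlow_mono (hn₀ n hn.le) ht ω)
  have e2 := h2 (max k N) (le_max_right _ _)
  have e3 : (1 / 2 : ℝ) ^ max k N ≤ (1 / 2) ^ k :=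
    pow_le_pow_of_le_one (by norm_num) (by norm_num) (le_max_left _ _)
  change weightSum S.α ψ.1 - weightSum S.α (S.finFlow X (a' n) t ω).1 < ε
  linarith

/-- The flow is the limit of the flows of the approximating configurations. -/
theorem flow_spec {ω : Ω} {t : ℝ} (ht : 0 ≤ t) {N : ℕ}
    (hN : ∀ n, N ≤ n → weightSum S.α (S.finFlow X (a (n + 1)) t ω).1 -
      weightSum S.α (S.finFlow X (a n) t ω).1 ≤ (1 / 2) ^ n) :
    (∀ n, (S.finFlow X (a n) t ω).1 ≤ (S.flow (fun m => X m ω) t η).1) ∧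
      (∀ n, N ≤ n → weightSum S.α (S.flow (fun m => X m ω) t η).1 -
        weightSum S.α (S.finFlow X (a n) t ω).1 ≤ 2 * (1 / 2) ^ n) ∧
      Tendsto (fun n => S.ofFinite (S.finFlow X (a n) t ω)) atTop
        (𝓝 (S.flow (fun m => X m ω) t η)) := by
  obtain ⟨ψ, h1, h2⟩ := exists_limit (b := fun n => S.finFlow X (a n) t ω)
    (fun n m hnm => hG.finFlow_mono (ha.mono hnm) ht ω) hN
  have hlim := flow_tendsto_of_le_of_sub_le hG ha ht h1 h2
  have hex : ∃ ξ : S.Config, ∀ a : ℕ → FiniteConfig V, (Monotone fun n => (a n).1) →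
      Tendsto (fun n => S.ofFinite (a n)) atTop (𝓝 η) →
      Tendsto (fun n => S.ofFinite (S.finiteFlow (fun m => X m ω) 0 t (a n))) atTop (𝓝 ξ) :=
    ⟨ψ, hlim⟩
  have hflow : S.flow (fun m => X m ω) t η = ψ := by
    rw [flow, dif_pos hex]
    exact tendsto_nhds_unique (hex.choose_spec a ha.mono ha.tendsto)
      (hlim a ha.mono ha.tendsto)
  rw [hflow]
  exact ⟨h1, h2, hlim a ha.mono ha.tendsto⟩

variable (hc : ∀ ω, S.FlowConverges (fun m => X m ω) a)
include hc

theorem finFlow_le_flow (ω : Ω) {t : ℝ} (ht : 0 ≤ t) (n : ℕ) :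
    (S.finFlow X (a n) t ω).1 ≤ (S.flow (fun m => X m ω) t η).1 := by
  obtain ⟨N, hN⟩ := hc ω t
  exact (flow_spec hG ha ht fun n hn => hN n hn t ht le_rfl).1 n

theorem finFlow_tendsto_flow (ω : Ω) {t : ℝ} (ht : 0 ≤ t) :
    Tendsto (fun n => S.ofFinite (S.finFlow X (a n) t ω)) atTop
        (𝓝 (S.flow (fun m => X m ω) t η)) := by
  obtain ⟨N, hN⟩ := hc ω t
  exact (flow_spec hG ha ht fun n hn => hN n hn t ht le_rfl).2.2

theorem exists_weightSum_flow_sub_le (ω : Ω) (T : ℝ) : ∃ N, ∀ n, N ≤ n → ∀ t, 0 ≤ t → t ≤ T →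
    weightSum S.α (S.flow (fun m => X m ω) t η).1 - weightSum S.α (S.finFlow X (a n) t ω).1 ≤
      2 * (1 / 2) ^ n := by
  obtain ⟨N, hN⟩ := hc ω T
  exact ⟨N, fun n hn t ht htT =>
    (flow_spec hG ha ht fun n hn => hN n hn t ht htT).2.1 n hn⟩

theorem flow_zero (ω : Ω) : S.flow (fun m => X m ω) 0 η = η := by
  refine tendsto_nhds_unique (finFlow_tendsto_flow hG ha hc ω le_rfl) ?_
  simp_rw [hG.finFlow_zero]
  exact ha.tendsto

end

/-- The maximal inequality for consecutive approximations and Borel-Cantelli, for each integer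
horizon. -/
theorem ae_flowConverges [Countable V] {Ω : Type*} [MeasurableSpace Ω] {P : Measure Ω}
    [IsProbabilityMeasure P] {X : Mark V → Ω → Set (ℝ × ℝ)} (hX : IsPoissonClocks X P)
    (hG : S.GoodClocks X) {a : ℕ → FiniteConfig V} {η : S.Config} (ha : S.Approximates a η) :
    ∀ᵐ ω ∂P, S.FlowConverges (fun m => X m ω) a := by
  obtain ⟨C, hC, hw⟩ := S.exists_isWeight_alpha
  obtain ⟨b, hb⟩ := S.exists_alpha_le
  have key : ∀ T : ℕ, ∀ᵐ ω ∂P, ∀ᶠ n in atTop, ω ∉ {ω | ∃ t, 0 ≤ t ∧ t ≤ (T : ℝ) ∧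
      (1 / 2 : ℝ) ^ n ≤ weightSum S.α (S.finFlow X (a (n + 1)) t ω).1 -
        weightSum S.α (S.finFlow X (a n) t ω).1} := by
    intro T
    refine ae_eventually_notMem ?_
    have hle : ∀ n, P {ω | ∃ t, 0 ≤ t ∧ t ≤ (T : ℝ) ∧
        (1 / 2 : ℝ) ^ n ≤ weightSum S.α (S.finFlow X (a (n + 1)) t ω).1 -
          weightSum S.α (S.finFlow X (a n) t ω).1} ≤
        2 ^ (⌈2 * C * T⌉₊ + 1) * ENNReal.ofReal ((1 / 2) ^ n) := by
      intro n
      refine (measure_exists_sub_ge_le hX hG hw hC hb (Nat.cast_nonneg T) (ha.mono (Nat.le_succ n))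
        (by positivity)).trans ?_
      gcongr
      -- The increment is at most `(1/4)ⁿ` and the threshold is `(1/2)ⁿ`; the quotient `(1/2)ⁿ` is
      -- summable.
      rw [div_le_iff₀ (by positivity), ← mul_pow]
      norm_num only
      have h1 := ha.sub_le n
      have h2 := (weightSum_le_of_le (ha.le (n + 1))).2
      norm_num only at h1
      linarith
    refine ne_top_of_le_ne_top ?_ (ENNReal.tsum_le_tsum hle)
    rw [ENNReal.tsum_mul_left, ← ENNReal.ofReal_tsum_of_nonneg (fun n => by positivity)
      (summable_geometric_of_lt_one (by norm_num) (by norm_num))]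
    exact ENNReal.mul_ne_top (by simp) ENNReal.ofReal_ne_top
  filter_upwards [ae_all_iff.2 key] with ω hω T
  obtain ⟨n, hn⟩ := exists_nat_ge T
  obtain ⟨N, hN⟩ := eventually_atTop.1 (hω n)
  refine ⟨N, fun k hk t ht htT => ?_⟩
  have := hN k hk
  simp only [not_exists, not_and, not_le] at this
  exact (this t ht (htT.trans hn)).le

end ReactionDiffusion

/-! ### The generator on local functions -/

theorem transition_apply_le {V : Type*} (m : Mark V) (η : V → ℕ) (z : V) :
    transition m η z ≤ η z + 1 := by
  classical
  have h : ∀ x : V, (Pi.single x 1 : V → ℕ) z ≤ 1 := fun x => by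
    by_cases hz : z = x
    · subst hz; simp
    · simp [hz]
  cases m with
  | birth x =>
    have := h x
    simp only [transition, Pi.add_apply]
    convert! Nat.add_le_add_left this (η z) using 3
  | death x =>
    simp only [transition, Pi.sub_apply]
    omega
  | jump x y =>
    have := h y
    simp only [transition, Pi.add_apply, Pi.sub_apply]
    refine Nat.add_le_add (Nat.sub_le _ _) ?_
    convert! this using 3

theorem transition_apply_eq {V : Type*} {m : Mark V} {B : Set V}
    (h : m.size (B.indicator (1 : V → ℝ)) = 0) (η : V → ℕ) {z : V} (hz : z ∈ B) :
    transition m η z = η z := by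
  have hne : ∀ {x}, B.indicator (1 : V → ℝ) x = 0 → z ≠ x := by
    rintro x hx rfl
    simp [hz] at hx
  have hnn : ∀ x, 0 ≤ B.indicator (1 : V → ℝ) x := fun x =>
    Set.indicator_nonneg (fun _ _ => zero_le_one) x
  cases m with
  | birth x => simp [transition, hne h]
  | death x => simp [transition, hne h]
  | jump x y =>
    have h' : B.indicator (1 : V → ℝ) y + B.indicator (1 : V → ℝ) x = 0 := h
    have hx : B.indicator (1 : V → ℝ) x = 0 := by linarith [hnn x, hnn y]
    have hy : B.indicator (1 : V → ℝ) y = 0 := by linarith [hnn x, hnn y]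
    simp [transition, hne hx, hne hy]

theorem Mark.size_indicator_eq_zero_or {V : Type*} (m : Mark V) (B : Set V) :
    m.size (B.indicator (1 : V → ℝ)) = 0 ∨ 1 ≤ m.size (B.indicator (1 : V → ℝ)) := by
  have h : ∀ x, B.indicator (1 : V → ℝ) x = 0 ∨ B.indicator (1 : V → ℝ) x = 1 := fun x => by
    by_cases hx : x ∈ B <;> simp [hx]
  cases m with
  | birth x => rcases h x with h | h <;> simp [size, h]
  | death x => rcases h x with h | h <;> simp [size, h]
  | jump x y =>
    rcases h x with h₁ | h₁ <;> rcases h y with h₂ | h₂ <;> simp [size, h₁, h₂]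

namespace ReactionDiffusion

variable {V : Type*} {S : ReactionDiffusion V}

variable (S) in
/-- Functions that depend only on the configuration in `B`. -/
def LocalOn (B : Finset V) (g : S.Config → ℝ) : Prop :=
  ∀ η ζ : S.Config, (∀ x ∈ B, η.1 x = ζ.1 x) → g η = g ζ

/-- These are the marks that touch `B`. Infinitely many jumps lead into `B`; the indicator of `B` is
at most `c α` with `c = ∑ 1 / α` over `B`, so the localization property of `α` bounds their total
rate by the weight of `ζ`. -/
theorem summable_rate_size_indicator (B : Finset V) (ζ : S.Config) {C : ℝ}
    (hw : S.IsWeight S.α C) :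
    Summable (fun m => S.rate m ζ.1 * m.size ((B : Set V).indicator 1)) ∧
    ∑' m, S.rate m ζ.1 * m.size ((B : Set V).indicator 1) ≤
      ∑ x ∈ B, S.Fplus (ζ.1 x) + (∑ x ∈ B, S.Fminus (ζ.1 x) +
        (∑ x ∈ B, 1 / S.α x) * (C + 1) * weightSum S.α ζ.1) := by
  classical
  let u : V → ℝ := (B : Set V).indicator 1
  let c := ∑ x ∈ B, 1 / S.α x
  have hc : 0 ≤ c := Finset.sum_nonneg fun x _ => by have := S.α_pos x; positivity
  have hu0 : ∀ x, 0 ≤ u x := fun x => Set.indicator_nonneg (fun _ _ => zero_le_one) x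
  have hu : ∀ x, u x ≤ c * S.α x := by
    intro x
    by_cases hx : x ∈ B
    · have h1 : 1 / S.α x ≤ c := Finset.single_le_sum (f := fun x => 1 / S.α x)
        (fun y _ => by have := S.α_pos y; positivity) hx
      rw [div_le_iff₀ (S.α_pos x)] at h1
      simpa [u, hx] using h1
    · simp only [u, Set.indicator_of_notMem (show x ∉ (B : Set V) by simpa using hx)]
      have := S.α_pos x
      positivity
  have hpu : ∀ x, Summable fun y => S.p x y * u y := fun x =>
    Summable.of_nonneg_of_le (fun y => mul_nonneg (S.p_nonneg _ _) (hu0 y))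
      (fun y => (mul_le_mul_of_nonneg_left (hu y) (S.p_nonneg _ _)).trans_eq (mul_left_comm _ _ _))
      ((hw.summable x).mul_left c)
  have hpule : ∀ x, ∑' y, S.p x y * u y ≤ c * (C * S.α x) := fun x => by
    refine ((hpu x).tsum_le_tsum (fun y => (mul_le_mul_of_nonneg_left (hu y)
      (S.p_nonneg _ _)).trans_eq (mul_left_comm _ _ _)) ((hw.summable x).mul_left c)).trans ?_
    rw [tsum_mul_left]
    exact mul_le_mul_of_nonneg_left (hw.le x) hc
  have hle : ∀ x, (ζ.1 x : ℝ) * (∑' y, S.p x y * u y + u x) ≤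
      c * (C + 1) * (S.α x * (ζ.1 x : ℝ)) := by
    intro x
    have h1 := mul_le_mul_of_nonneg_left (add_le_add (hpule x) (hu x))
      (Nat.cast_nonneg (α := ℝ) (ζ.1 x))
    exact h1.trans_eq (by ring)
  have hsum : Summable fun x => (ζ.1 x : ℝ) * (∑' y, S.p x y * u y + u x) :=
    Summable.of_nonneg_of_le (fun x => mul_nonneg (Nat.cast_nonneg _) (add_nonneg
      (tsum_nonneg fun y => mul_nonneg (S.p_nonneg _ _) (hu0 y)) (hu0 x))) hle (ζ.2.mul_left _)
  have hfin : ∀ F : V → ℝ, HasSum (fun x => F x * u x) (∑ x ∈ B, F x) := by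
    intro F
    have h : HasSum (fun x => F x * u x) (∑ x ∈ B, F x * u x) :=
      hasSum_sum_of_ne_finset_zero fun x hx => by simp [u, hx]
    convert! h using 1
    exact Finset.sum_congr rfl fun x hx => by simp [u, hx]
  have h := hasSum_mark (g := fun m => S.rate m ζ.1 * m.size u) (hfin fun x => S.Fplus (ζ.1 x))
    (hfin fun x => S.Fminus (ζ.1 x)) (c := ∑' x, (ζ.1 x : ℝ) * (∑' y, S.p x y * u y + u x)) (by
      refine hasSum_prod_of_nonneg (fun q => mul_nonneg (S.rate_nonneg _ _)
        (Mark.size_nonneg hu0 _)) (fun x => ?_) hsum.hasSum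
      have h := (((hpu x).hasSum.add ((S.p_hasSum x).mul_right (u x))).mul_left (ζ.1 x : ℝ))
      rw [one_mul] at h
      convert! h using 1
      funext y
      simp only [rate, Mark.size]
      ring)
  refine ⟨h.summable, ?_⟩
  rw [h.tsum_eq]
  have := hsum.tsum_le_tsum hle (ζ.2.mul_left _)
  rw [tsum_mul_left] at this
  gcongr
  exact this

namespace LocalOn

variable {B : Finset V} {g : S.Config → ℝ} (hg : S.LocalOn B g)
include hg

/-- Only finitely many restrictions to `B` have all entries at most `k`, and `g` factors through the
restriction. -/
theorem exists_abs_le (k : ℕ) : ∃ b, 0 ≤ b ∧ ∀ ζ : S.Config, (∀ x ∈ B, ζ.1 x ≤ k) → |g ζ| ≤ b := by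
  classical
  have hfin : ((fun ζ : S.Config => |g ζ|) '' {ζ | ∀ x ∈ B, ζ.1 x ≤ k}).Finite := by
    let r : S.Config → B → ℕ := fun ζ x => ζ.1 x
    have h1 : (r '' {ζ | ∀ x ∈ B, ζ.1 x ≤ k}).Finite := by
      refine (Set.Finite.pi' (t := fun _ : B => Set.Iic k) fun _ => Set.finite_Iic k).subset ?_
      rintro _ ⟨ζ, hζ, rfl⟩ x
      exact hζ x x.2
    refine (h1.image fun q => if h : ∃ ζ : S.Config, r ζ = q then |g h.choose| else 0).subset ?_
    rintro _ ⟨ζ, hζ, rfl⟩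
    refine ⟨r ζ, ⟨ζ, hζ, rfl⟩, ?_⟩
    have hex : ∃ ζ' : S.Config, r ζ' = r ζ := ⟨ζ, rfl⟩
    simp only [dif_pos hex]
    rw [hg hex.choose ζ fun x hx => congrFun hex.choose_spec ⟨x, hx⟩]
  obtain ⟨b, hb⟩ := hfin.bddAbove
  exact ⟨max b 0, le_max_right _ _, fun ζ hζ => (hb ⟨ζ, hζ, rfl⟩).trans (le_max_left _ _)⟩

/-- Nothing changes unless the mark touches `B`, in which case its size is at least `1`. The bound
is taken at level `k + 1` because a transition can add a particle. -/
theorem abs_move_sub_le {k : ℕ} {b : ℝ} (hb : 0 ≤ b)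
    (hbg : ∀ ζ : S.Config, (∀ x ∈ B, ζ.1 x ≤ k + 1) → |g ζ| ≤ b) {ζ : S.Config}
    (hζ : ∀ x ∈ B, ζ.1 x ≤ k) (m : Mark V) :
    |g (S.move m ζ) - g ζ| ≤ 2 * b * m.size ((B : Set V).indicator 1) := by
  rcases m.size_indicator_eq_zero_or (B : Set V) with h | h
  · have : g (S.move m ζ) = g ζ := hg _ _ fun x hx => transition_apply_eq h ζ.1 hx
    simp [this, h]
  · have h1 : |g (S.move m ζ)| ≤ b := hbg _ fun x hx =>
      (transition_apply_le m ζ.1 x).trans (Nat.succ_le_succ (hζ x hx))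
    have h2 : |g ζ| ≤ b := hbg _ fun x hx => (hζ x hx).trans (Nat.le_succ k)
    calc |g (S.move m ζ) - g ζ| ≤ |g (S.move m ζ)| + |g ζ| := abs_sub _ _
      _ ≤ 2 * b * 1 := by linarith
      _ ≤ _ := mul_le_mul_of_nonneg_left h (by positivity)

/-- Bounds on the rates of change of a local function. -/
theorem exists_rate_le (K : ℝ) : ∃ Λ, 0 ≤ Λ ∧ ∀ ζ : S.Config, weightSum S.α ζ.1 ≤ K →
    |g ζ| ≤ Λ ∧ Summable (fun m => S.rate m ζ.1 * |g (S.move m ζ) - g ζ|) ∧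
      ∑' m, S.rate m ζ.1 * |g (S.move m ζ) - g ζ| ≤ Λ := by
  obtain ⟨C, hC, hw⟩ := S.exists_isWeight_alpha
  -- In the ball of radius `K` each occupation number in `B` is at most `|K| / α x`, hence at most
  -- `k`.
  obtain ⟨k, hk⟩ := exists_nat_ge (∑ x ∈ B, |K| / S.α x)
  obtain ⟨b, hb, hbg⟩ := hg.exists_abs_le (k + 1)
  have hF : ∀ k, 0 ≤ S.Fminus k := fun k => (S.Fplus_nonneg k).trans (S.Fplus_le_Fminus k)
  have hc : 0 ≤ ∑ x ∈ B, 1 / S.α x :=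
    Finset.sum_nonneg fun x _ => by have := S.α_pos x; positivity
  let F := ∑ j ∈ Finset.range (k + 1), S.Fminus j
  have hF0 : 0 ≤ F := Finset.sum_nonneg fun j _ => hF j
  let Λ := b + 2 * b * (∑ _x ∈ B, F + (∑ _x ∈ B, F +
    (∑ x ∈ B, 1 / S.α x) * (C + 1) * |K|))
  have hs : 0 ≤ ∑ _x ∈ B, F := Finset.sum_nonneg fun _ _ => hF0
  refine ⟨Λ, by positivity, fun ζ hζ => ?_⟩
  have hζk : ∀ x ∈ B, ζ.1 x ≤ k := by
    intro x hx
    have h1 : S.α x * (ζ.1 x : ℝ) ≤ |K| := (ζ.2.le_tsum x fun y _ =>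
      mul_nonneg (S.α_pos y).le (Nat.cast_nonneg _)).trans (hζ.trans (le_abs_self K))
    have h2 : (ζ.1 x : ℝ) ≤ |K| / S.α x := by
      rw [le_div_iff₀ (S.α_pos x), mul_comm]
      exact h1
    have h3 : |K| / S.α x ≤ ∑ x ∈ B, |K| / S.α x :=
      Finset.single_le_sum (f := fun x => |K| / S.α x)
        (fun y _ => by have := S.α_pos y; positivity) hx
    exact_mod_cast h2.trans (h3.trans hk)
  have hFle : ∀ x ∈ B, S.Fminus (ζ.1 x) ≤ F := fun x hx =>
    Finset.single_le_sum (f := S.Fminus) (fun j _ => hF j)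
      (Finset.mem_range.2 (Nat.lt_succ_of_le (hζk x hx)))
  have hb1 : |g ζ| ≤ b := hbg ζ fun x hx => (hζk x hx).trans (Nat.le_succ k)
  obtain ⟨hsum, hle⟩ := S.summable_rate_size_indicator B ζ hw
  have hterm : ∀ m, S.rate m ζ.1 * |g (S.move m ζ) - g ζ| ≤
      2 * b * (S.rate m ζ.1 * m.size ((B : Set V).indicator 1)) := fun m =>
    (mul_le_mul_of_nonneg_left (hg.abs_move_sub_le hb hbg hζk m) (S.rate_nonneg _ _)).trans_eq
      (mul_left_comm _ _ _)
  have hsum' := Summable.of_nonneg_of_le (fun m => mul_nonneg (S.rate_nonneg _ _) (abs_nonneg _))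
    hterm (hsum.mul_left (2 * b))
  have htot : ∑' m, S.rate m ζ.1 * m.size ((B : Set V).indicator 1) ≤
      ∑ _x ∈ B, F + (∑ _x ∈ B, F + (∑ x ∈ B, 1 / S.α x) * (C + 1) * |K|) := by
    refine hle.trans ?_
    gcongr with x hx x hx
    · exact (S.Fplus_le_Fminus _).trans (hFle x hx)
    · exact hFle x hx
    · exact hζ.trans (le_abs_self K)
  refine ⟨hb1.trans (le_add_of_nonneg_right (by positivity)), hsum', ?_⟩
  refine (hsum'.tsum_le_tsum hterm (hsum.mul_left _)).trans ?_
  rw [tsum_mul_left]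
  exact (mul_le_mul_of_nonneg_left htot (by positivity)).trans (le_add_of_nonneg_left hb)

theorem summable_abs (ζ : S.Config) :
    Summable fun m => S.rate m ζ.1 * |g (S.move m ζ) - g ζ| := by
  obtain ⟨Λ, -, h⟩ := hg.exists_rate_le (weightSum S.α ζ.1)
  exact (h ζ le_rfl).2.1

theorem summable (ζ : S.Config) : Summable fun m => S.rate m ζ.1 * (g (S.move m ζ) - g ζ) := by
  refine Summable.of_norm ((hg.summable_abs ζ).congr fun m => ?_)
  rw [Real.norm_eq_abs, abs_mul, abs_of_nonneg (S.rate_nonneg _ _)]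

theorem abs_gen_le (ζ : S.Config) :
    |S.gen g ζ| ≤ ∑' m, S.rate m ζ.1 * |g (S.move m ζ) - g ζ| := by
  have h : ∀ m, ‖S.rate m ζ.1 * (g (S.move m ζ) - g ζ)‖ =
      S.rate m ζ.1 * |g (S.move m ζ) - g ζ| := fun m => by
    rw [Real.norm_eq_abs, abs_mul, abs_of_nonneg (S.rate_nonneg _ _)]
  have h1 := norm_tsum_le_tsum_norm (f := fun m => S.rate m ζ.1 * (g (S.move m ζ) - g ζ))
    (by simpa only [h] using hg.summable_abs ζ)
  simp only [h] at h1
  exact h1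

theorem sq : S.LocalOn B fun ζ => g ζ ^ 2 := fun η ζ h => by simp only [hg η ζ h]

/-- Termwise, `v² - u² - 2 u (v - u) = (v - u)²`. -/
theorem hasSum_carre (ζ : S.Config) :
    HasSum (fun m => S.rate m ζ.1 * (g (S.move m ζ) - g ζ) ^ 2) (S.carre g ζ) := by
  have h := (hg.sq.summable ζ).hasSum.sub ((hg.summable ζ).hasSum.mul_left (2 * g ζ))
  convert! h using 1
  funext m
  ring

/-- Convergence freezes the finitely many coordinates in `B`, so the values do not merely converge
but become equal. -/
theorem tendsto {a : ℕ → S.Config} {ζ : S.Config} (h : Tendsto a atTop (𝓝 ζ)) :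
    ∀ᶠ n in atTop, g (a n) = g ζ := by
  have := (B.eventually_all (p := fun x n => (a n).1 x = ζ.1 x)).2
    fun x _ => eventually_eq_of_tendsto h x
  filter_upwards [this] with n hn
  exact hg _ _ hn

/-- The generator of a local function is continuous along increasing sequences. -/
theorem tendsto_gen {a : ℕ → S.Config} {ζ : S.Config} (h : Tendsto a atTop (𝓝 ζ))
    (hle : ∀ n, (a n).1 ≤ ζ.1) : Tendsto (fun n => S.gen g (a n)) atTop (𝓝 (S.gen g ζ)) := by
  obtain ⟨C, hC, hw⟩ := S.exists_isWeight_alpha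
  let k := ∑ x ∈ B, ζ.1 x
  have hk : ∀ x ∈ B, ζ.1 x ≤ k := fun x hx =>
    Finset.single_le_sum (f := ζ.1) (fun _ _ => Nat.zero_le _) hx
  obtain ⟨b, hb, hbg⟩ := hg.exists_abs_le (k + 1)
  have hB : ∀ᶠ n in atTop, ∀ x ∈ B, (a n).1 x = ζ.1 x :=
    B.eventually_all.2 fun x _ => eventually_eq_of_tendsto h x
  refine tendsto_tsum_of_dominated_convergence
    (bound := fun m => 2 * b * (S.rate m ζ.1 * m.size ((B : Set V).indicator 1)))
    ((S.summable_rate_size_indicator B ζ hw).1.mul_left _) (fun m => ?_) ?_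
  · refine tendsto_const_nhds.congr' ?_
    have hrate : ∀ᶠ n in atTop, S.rate m (a n).1 = S.rate m ζ.1 := by
      have hx : ∀ x, ∀ᶠ n in atTop, (a n).1 x = ζ.1 x := eventually_eq_of_tendsto h
      cases m with
      | birth x => filter_upwards [hx x] with n hn; simp [rate, hn]
      | death x => filter_upwards [hx x] with n hn; simp [rate, hn]
      | jump x y => filter_upwards [hx x] with n hn; simp [rate, hn]
    have hmove : ∀ᶠ n in atTop, ∀ x ∈ B, (S.move m (a n)).1 x = (S.move m ζ).1 x := by
      filter_upwards [hB] with n hn x hx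
      have := hn x hx
      cases m <;> simp [move, transition, this]
    filter_upwards [hrate, hmove, hB] with n h1 h2 h3
    rw [h1, hg _ _ h2, hg _ _ h3]
  · filter_upwards [hB] with n hn m
    rw [Real.norm_eq_abs, abs_mul, abs_of_nonneg (S.rate_nonneg _ _)]
    have h1 := hg.abs_move_sub_le hb hbg (ζ := a n) (fun x hx => (hn x hx).le.trans (hk x hx)) m
    -- The terms at `ζ` dominate: jump rates increase with the configuration, reaction rates at
    -- sites of `B` already agree, and reactions outside `B` have size zero.
    have hrate : S.rate m (a n).1 * m.size ((B : Set V).indicator 1) ≤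
        S.rate m ζ.1 * m.size ((B : Set V).indicator 1) := by
      cases m with
      | birth x =>
        by_cases hx : x ∈ B
        · simp [rate, hn x hx]
        · simp [Mark.size, hx]
      | death x =>
        by_cases hx : x ∈ B
        · simp [rate, hn x hx]
        · simp [Mark.size, hx]
      | jump x y =>
        refine mul_le_mul_of_nonneg_right (mul_le_mul_of_nonneg_left ?_ (S.p_nonneg _ _))
          (Mark.size_nonneg (fun x => Set.indicator_nonneg (fun _ _ => zero_le_one) x) _)
        exact_mod_cast hle n x
    calc S.rate m (a n).1 * |g (S.move m (a n)) - g (a n)|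
        ≤ S.rate m (a n).1 * (2 * b * m.size ((B : Set V).indicator 1)) :=
          mul_le_mul_of_nonneg_left h1 (S.rate_nonneg _ _)
      _ = 2 * b * (S.rate m (a n).1 * m.size ((B : Set V).indicator 1)) := mul_left_comm _ _ _
      _ ≤ _ := mul_le_mul_of_nonneg_left hrate (by positivity)

end LocalOn

end ReactionDiffusion

/-! ### Progressive measurability and bounded Dynkin martingales -/

/-- Joint measurability of a process on the time interval `[0, t]`. -/
def MeasurableUpTo {Ω : Type*} [MeasurableSpace Ω] (t : ℝ) (h : ℝ → Ω → ℝ) : Prop :=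
  Measurable fun p : ℝ × Ω => h (max 0 (min p.1 t)) p.2

theorem max_zero_min_of_mem {r t : ℝ} (hr : r ∈ Set.Icc 0 t) : max 0 (min r t) = r := by
  rw [min_eq_left hr.2, max_eq_right hr.1]

namespace MeasurableUpTo

variable {Ω : Type*}

theorem mono {t : ℝ} {h : ℝ → Ω → ℝ} {m m' : MeasurableSpace Ω} (hm : m ≤ m') (hh : @MeasurableUpTo Ω m t h) :
    @MeasurableUpTo Ω m' t h := by
  refine Measurable.mono hh ?_ le_rfl
  exact sup_le_sup le_rfl (MeasurableSpace.comap_mono hm)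

theorem intervalIntegral_eq {t : ℝ} {h : ℝ → Ω → ℝ} {ω : Ω} {a b : ℝ} (ha : 0 ≤ a) (hab : a ≤ b) (hb : b ≤ t) :
    ∫ r in a..b, h r ω = ∫ r in Set.Ioc a b, h (max 0 (min r t)) ω := by
  rw [intervalIntegral.integral_of_le hab]
  refine setIntegral_congr_fun measurableSet_Ioc fun r hr => ?_
  simp only [max_zero_min_of_mem ⟨ha.trans hr.1.le, hr.2.trans hb⟩]

variable [MeasurableSpace Ω] {t : ℝ} {h g : ℝ → Ω → ℝ}

theorem measurable (hh : MeasurableUpTo t h) {r : ℝ} (hr : r ∈ Set.Icc 0 t) :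
    Measurable (h r) := by
  have := Measurable.comp hh (measurable_prodMk_left (x := r) (β := Ω))
  simpa only [Function.comp_def, max_zero_min_of_mem hr] using this

theorem measurable_path (hh : MeasurableUpTo t h) (ω : Ω) :
    Measurable fun r => h (max 0 (min r t)) ω :=
  Measurable.comp hh (measurable_prodMk_right (y := ω) (α := ℝ))

theorem intervalIntegrable (hh : MeasurableUpTo t h) {ω : Ω} {K : ℝ}
    (hK : ∀ r, 0 ≤ r → r ≤ t → |h r ω| ≤ K) {a b : ℝ} (ha : 0 ≤ a) (hab : a ≤ b) (hb : b ≤ t) :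
    IntervalIntegrable (fun r => h r ω) volume a b := by
  rw [intervalIntegrable_iff_integrableOn_Ioc_of_le hab]
  have ht := ha.trans (hab.trans hb)
  have : IntegrableOn (fun r => h (max 0 (min r t)) ω) (Set.Ioc a b) volume :=
    Measure.integrableOn_of_bounded (M := K) (by simp)
      (hh.measurable_path ω).aestronglyMeasurable (ae_of_all _ fun r =>
        hK _ (le_max_left _ _) (max_le ht (min_le_right _ _)))
  refine this.congr_fun (fun r hr => ?_) measurableSet_Ioc
  simp only [max_zero_min_of_mem ⟨ha.trans hr.1.le, hr.2.trans hb⟩]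

theorem measurable_intervalIntegral (hh : MeasurableUpTo t h) {a b : ℝ} (ha : 0 ≤ a) (hab : a ≤ b)
    (hb : b ≤ t) : Measurable fun ω => ∫ r in a..b, h r ω := by
  simp_rw [intervalIntegral_eq ha hab hb]
  exact (StronglyMeasurable.integral_prod_left' (f := fun p : ℝ × Ω => h (max 0 (min p.1 t)) p.2)
    (Measurable.stronglyMeasurable hh)).measurable

/-- Fubini's theorem for a bounded process. -/
theorem setIntegral_intervalIntegral (hh : MeasurableUpTo t h) {P : Measure Ω} [IsFiniteMeasure P]
    {K : ℝ} (hK : ∀ r ω, 0 ≤ r → r ≤ t → |h r ω| ≤ K) {a b : ℝ} (ha : 0 ≤ a) (hab : a ≤ b) (hb : b ≤ t)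
    (A : Set Ω) : ∫ ω in A, (∫ r in a..b, h r ω) ∂P = ∫ r in a..b, (∫ ω in A, h r ω ∂P) := by
  simp_rw [intervalIntegral_eq (h := h) ha hab hb]
  rw [intervalIntegral.integral_of_le hab, integral_integral_swap]
  · refine setIntegral_congr_fun measurableSet_Ioc fun r hr => ?_
    simp only [max_zero_min_of_mem ⟨ha.trans hr.1.le, hr.2.trans hb⟩]
  · have : IsFiniteMeasure (volume.restrict (Set.Ioc a b)) := ⟨by simp⟩
    refine Integrable.of_bound (C := K) ?_ (ae_of_all _ fun p =>
      hK _ _ (le_max_left _ _) (max_le (ha.trans (hab.trans hb)) (min_le_right _ _)))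
    exact (Measurable.comp hh measurable_swap).aestronglyMeasurable

theorem of_rightContinuous (ht : 0 ≤ t) (hmeas : ∀ r ∈ Set.Icc 0 t, Measurable (h r))
    (hcont : ∀ ω, ∀ r ∈ Set.Ico 0 t, ContinuousWithinAt (fun r => h r ω) (Set.Ici r) r) :
    MeasurableUpTo t h :=
  measurable_of_rightContinuous ht hmeas hcont

theorem of_tendsto (ht : 0 ≤ t) {f : ℕ → ℝ → Ω → ℝ} (hf : ∀ n, MeasurableUpTo t (f n))
    (hlim : ∀ r ω, 0 ≤ r → r ≤ t → Tendsto (fun n => f n r ω) atTop (𝓝 (h r ω))) :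
    MeasurableUpTo t h :=
  measurable_of_tendsto_metrizable hf (tendsto_pi_nhds.2 fun _ =>
    hlim _ _ (le_max_left _ _) (max_le ht (min_le_right _ _)))

theorem sub (hh : MeasurableUpTo t h) (hg : MeasurableUpTo t g) :
    MeasurableUpTo t fun r ω => h r ω - g r ω := Measurable.sub hh hg

theorem mul (hh : MeasurableUpTo t h) (hg : MeasurableUpTo t g) :
    MeasurableUpTo t fun r ω => h r ω * g r ω := Measurable.mul hh hg

theorem of_measurable {Y : Ω → ℝ} (hY : Measurable Y) : MeasurableUpTo t fun _ ω => Y ω :=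
  hY.comp measurable_snd

theorem const (c : ℝ) : MeasurableUpTo t fun _ (_ : Ω) => c := measurable_const

end MeasurableUpTo

theorem abs_intervalIntegral_le {h : ℝ → ℝ} {K : ℝ} (hK : ∀ r, 0 ≤ r → |h r| ≤ K) {a b : ℝ}
    (ha : 0 ≤ a) (hab : a ≤ b) : |∫ r in a..b, h r| ≤ K * (b - a) := by
  have := intervalIntegral.norm_integral_le_of_norm_le_const (a := a) (b := b) (f := h) (C := K)
    fun r hr => hK r (ha.trans (by rw [Set.uIoc_of_le hab] at hr; exact hr.1.le))
  rwa [Real.norm_eq_abs, abs_of_nonneg (sub_nonneg.2 hab)] at this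

/-- The primitive of a bounded function is Lipschitz. -/
theorem lipschitzOnWith_intervalIntegral {h : ℝ → ℝ} {K T : ℝ} (hK : ∀ r, 0 ≤ r → |h r| ≤ K)
    (hi : ∀ a b, 0 ≤ a → a ≤ b → b ≤ T → IntervalIntegrable h volume a b) :
    LipschitzOnWith K.toNNReal (fun t => ∫ r in (0 : ℝ)..t, h r) (Set.Icc 0 T) := by
  have hK0 : 0 ≤ K := (abs_nonneg _).trans (hK 0 le_rfl)
  have key : ∀ a b, 0 ≤ a → a ≤ b → b ≤ T →
      |(∫ r in (0 : ℝ)..b, h r) - ∫ r in (0 : ℝ)..a, h r| ≤ K * |b - a| := by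
    intro a b ha hab hb
    rw [intervalIntegral.integral_interval_sub_left (hi 0 b le_rfl (ha.trans hab) hb)
      (hi 0 a le_rfl ha (hab.trans hb)), abs_of_nonneg (sub_nonneg.2 hab)]
    exact abs_intervalIntegral_le hK ha hab
  refine LipschitzOnWith.of_dist_le_mul fun x hx y hy => ?_
  rw [Real.coe_toNNReal _ hK0, Real.dist_eq, Real.dist_eq]
  rcases le_total x y with hxy | hxy
  · rw [abs_sub_comm, abs_sub_comm x]
    exact key x y hx.1 hxy hy.2
  · exact key y x hy.1 hxy hx.2

/-- The product rule for the primitive, which is absolutely continuous. -/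
theorem two_mul_integral_primitive_mul {h : ℝ → ℝ} {t : ℝ} (hi : IntervalIntegrable h volume 0 t) :
    2 * ∫ r in (0 : ℝ)..t, (∫ s in (0 : ℝ)..r, h s) * h r = (∫ r in (0 : ℝ)..t, h r) ^ 2 := by
  have hac := hi.absolutelyContinuousOnInterval_intervalIntegral (c := 0) (by simp)
  have h1 := hac.integral_deriv_mul_eq_sub hac
  rw [← intervalIntegral.integral_const_mul]
  simp only [intervalIntegral.integral_same, ← pow_two] at h1
  rw [zero_pow two_ne_zero, sub_zero] at h1
  rw [← h1]
  refine intervalIntegral.integral_congr_ae ?_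
  filter_upwards [hi.ae_hasDerivAt_integral] with r hr hr'
  rw [(hr (Set.uIoc_subset_uIcc hr') 0 (by simp)).deriv]
  ring

/-! ### Martingales from bounded processes that satisfy Dynkin's formula. -/

theorem martingale_of_setIntegral_eq {Ω : Type*} {mΩ : MeasurableSpace Ω} {P : Measure Ω}
    [IsFiniteMeasure P] {𝓖 : Filtration ℝ≥0 mΩ} {M : ℝ≥0 → Ω → ℝ}
    (hadap : ∀ t, Measurable[𝓖 t] (M t)) (hint : ∀ t, Integrable (M t) P)
    (h : ∀ s t, s ≤ t → ∀ A, MeasurableSet[𝓖 s] A → ∫ ω in A, M t ω ∂P = ∫ ω in A, M s ω ∂P) :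
    Martingale M 𝓖 P := by
  refine ⟨fun t => (hadap t).stronglyMeasurable, fun s t hst => ?_⟩
  exact (ae_eq_condExp_of_forall_setIntegral_eq (𝓖.le s) (hint t)
    (fun A _ _ => (hint s).integrableOn) (fun A hA _ => (h s t hst A hA).symm)
    (hadap s).stronglyMeasurable.aestronglyMeasurable).symm

theorem MeasureTheory.Martingale.integral_mul_eq {Ω : Type*} {mΩ : MeasurableSpace Ω}
    {P : Measure Ω} [IsFiniteMeasure P] {𝓖 : Filtration ℝ≥0 mΩ} {M : ℝ≥0 → Ω → ℝ}
    (hM : Martingale M 𝓖 P) {s t : ℝ≥0} (hst : s ≤ t) {Y : Ω → ℝ} (hY : Measurable[𝓖 s] Y) {c : ℝ}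
    (hc : ∀ ω, |Y ω| ≤ c) {A : Set Ω} (hA : MeasurableSet[𝓖 s] A) :
    ∫ ω in A, Y ω * M t ω ∂P = ∫ ω in A, Y ω * M s ω ∂P := by
  rw [← setIntegral_condExp (𝓖.le s) ((hM.integrable t).bdd_mul (c := c)
    (hY.mono (𝓖.le s) le_rfl).aestronglyMeasurable (ae_of_all _ hc)) hA]
  refine integral_congr_ae (ae_restrict_of_ae ?_)
  filter_upwards [condExp_stronglyMeasurable_mul_of_bound (𝓖.le s) hY.stronglyMeasurable
    (hM.integrable t) c (ae_of_all _ hc), hM.2 s t hst] with ω h1 h2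
  exact h1.trans (congrArg (Y ω * ·) h2)

/-- A bounded process `u` with a bounded rate of change `l` in the sense of Dynkin's formula. -/
structure IsBoundedDynkin {Ω : Type*} {mΩ : MeasurableSpace Ω} (𝓖 : Filtration ℝ≥0 mΩ)
    (P : Measure Ω) (u l : ℝ → Ω → ℝ) : Prop where
  measurable_fst : ∀ t : ℝ≥0, @MeasurableUpTo Ω (𝓖 t) t u
  measurable_snd : ∀ t : ℝ≥0, @MeasurableUpTo Ω (𝓖 t) t l
  bounded_fst : ∃ C, ∀ r ω, 0 ≤ r → |u r ω| ≤ C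
  bounded_snd : ∃ K, ∀ r ω, 0 ≤ r → |l r ω| ≤ K
  setIntegral_eq : ∀ s t : ℝ≥0, s ≤ t → ∀ A, MeasurableSet[𝓖 s] A →
    ∫ ω in A, (u t ω - u s ω) ∂P = ∫ ω in A, (∫ r in (s : ℝ)..t, l r ω) ∂P

namespace IsBoundedDynkin

variable {Ω : Type*} {mΩ : MeasurableSpace Ω} {𝓖 : Filtration ℝ≥0 mΩ} {P : Measure Ω}
  [IsFiniteMeasure P] {u l : ℝ → Ω → ℝ} (h : IsBoundedDynkin 𝓖 P u l)
include h

omit [IsFiniteMeasure P] in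
theorem intervalIntegrable (ω : Ω) {a b : ℝ} (ha : 0 ≤ a) (hab : a ≤ b) :
    IntervalIntegrable (fun r => l r ω) volume a b := by
  obtain ⟨K, hK⟩ := h.bounded_snd
  lift b to ℝ≥0 using ha.trans hab
  exact ((h.measurable_snd b).mono (𝓖.le b)).intervalIntegrable (fun r hr _ => hK r ω hr) ha hab le_rfl

omit [IsFiniteMeasure P] in
theorem measurable_integral (t : ℝ≥0) :
    @MeasurableUpTo Ω (𝓖 t) t fun r ω => ∫ q in (0 : ℝ)..r, l q ω := by
  obtain ⟨K, hK⟩ := h.bounded_snd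
  refine @MeasurableUpTo.of_rightContinuous Ω (𝓖 t) t _ t.2 (fun r hr =>
    @MeasurableUpTo.measurable_intervalIntegral Ω (𝓖 t) t l (h.measurable_snd t) 0 r le_rfl hr.1 hr.2)
    fun ω r hr => ?_
  have hlip := lipschitzOnWith_intervalIntegral (h := fun r => l r ω) (T := t)
    (fun r hr => hK r ω hr) fun a b ha hab _ => h.intervalIntegrable ω ha hab
  exact ((hlip.continuousOn r (Set.Ico_subset_Icc_self hr)).mono_of_mem_nhdsWithin
    (mem_of_superset (Icc_mem_nhdsGE hr.2) (Set.Icc_subset_Icc_left hr.1)))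

omit [IsFiniteMeasure P] in
theorem measurable_martingale (c : ℝ) (t : ℝ≥0) :
    @MeasurableUpTo Ω (𝓖 t) t fun r ω => u r ω - c - ∫ q in (0 : ℝ)..r, l q ω :=
  @MeasurableUpTo.sub Ω (𝓖 t) t _ _ (@MeasurableUpTo.sub Ω (𝓖 t) t _ _ (h.measurable_fst t)
    (@MeasurableUpTo.const Ω (𝓖 t) t c)) (h.measurable_integral t)

omit [IsFiniteMeasure P] in
theorem exists_abs_le (c : ℝ) : ∃ C, ∀ (r : ℝ≥0) ω,
    |u r ω| ≤ C ∧ |l r ω| ≤ C ∧ |∫ q in (0 : ℝ)..r, l q ω| ≤ C * r ∧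
    |u r ω - c - ∫ q in (0 : ℝ)..r, l q ω| ≤ C + C * r := by
  obtain ⟨K, hK⟩ := h.bounded_snd
  obtain ⟨C, hC⟩ := h.bounded_fst
  refine ⟨max (C + |c|) K, fun r ω => ?_⟩
  have h1 := hC r ω r.2
  have h2 := hK r ω r.2
  have h3 : |∫ q in (0 : ℝ)..r, l q ω| ≤ K * r := by
    simpa using abs_intervalIntegral_le (fun r hr => hK r ω hr) le_rfl r.2
  have h4 : K * r ≤ max (C + |c|) K * r := mul_le_mul_of_nonneg_right (le_max_right _ _) r.2
  have h5 := le_max_left (C + |c|) K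
  have h6 : |u r ω - c - ∫ q in (0 : ℝ)..r, l q ω| ≤ |u r ω| + |c| +
      |∫ q in (0 : ℝ)..r, l q ω| := (abs_sub _ _).trans (by gcongr; exact abs_sub _ _)
  exact ⟨by linarith [abs_nonneg c], h2.trans (le_max_right _ _), h3.trans h4, by linarith⟩

/-- The compensated process is a martingale. -/
theorem martingale (c : ℝ) : Martingale
    (fun (t : ℝ≥0) ω => u t ω - c - ∫ r in (0 : ℝ)..t, l r ω) 𝓖 P := by
  obtain ⟨C, hC⟩ := h.exists_abs_le c
  have hmeas : ∀ t : ℝ≥0, Measurable[𝓖 t] fun ω => u t ω - c - ∫ r in (0 : ℝ)..t, l r ω :=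
    fun t => @MeasurableUpTo.measurable Ω (𝓖 t) t _ (h.measurable_martingale c t) t ⟨t.2, le_rfl⟩
  have hint : ∀ t : ℝ≥0, Integrable (fun ω => u t ω - c - ∫ r in (0 : ℝ)..t, l r ω) P := fun t =>
    Integrable.of_bound ((hmeas t).mono (𝓖.le t) le_rfl).aestronglyMeasurable _
      (ae_of_all _ fun ω => (hC t ω).2.2.2)
  refine martingale_of_setIntegral_eq hmeas hint fun s t hst A hA => ?_
  have hu : ∀ t : ℝ≥0, Integrable (u t) P := fun t => Integrable.of_bound
    ((@MeasurableUpTo.measurable Ω (𝓖 t) t _ (h.measurable_fst t) t ⟨t.2, le_rfl⟩).mono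
      (𝓖.le t) le_rfl).aestronglyMeasurable _ (ae_of_all _ fun ω => (hC t ω).1)
  have hI : Integrable (fun ω => ∫ r in (s : ℝ)..t, l r ω) P := by
    obtain ⟨K, hK⟩ := h.bounded_snd
    exact Integrable.of_bound (((h.measurable_snd t).mono (𝓖.le t)).measurable_intervalIntegral s.2
      hst le_rfl).aestronglyMeasurable _ (ae_of_all _ fun ω =>
        abs_intervalIntegral_le (fun r hr => hK r ω hr) s.2 hst)
  rw [← sub_eq_zero, ← integral_sub (hint t).integrableOn (hint s).integrableOn]
  have : ∀ ω, u t ω - c - (∫ r in (0 : ℝ)..t, l r ω) - (u s ω - c - ∫ r in (0 : ℝ)..s, l r ω) =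
      (u t ω - u s ω) - ∫ r in (s : ℝ)..t, l r ω := fun ω => by
    have := intervalIntegral.integral_interval_sub_left (h.intervalIntegrable ω le_rfl t.coe_nonneg)
      (h.intervalIntegrable ω le_rfl s.coe_nonneg)
    linarith
  simp_rw [this]
  rw [integral_sub (f := fun ω => u t ω - u s ω) ((hu t).sub (hu s)).integrableOn hI.integrableOn,
    h.setIntegral_eq s t hst A hA, sub_self]

/-- The integral `∫ (M_t - M_r) l_r dr` is a martingale. -/
theorem martingale_mul (c : ℝ) : Martingale (fun (t : ℝ≥0) ω =>
    (u t ω - c - ∫ r in (0 : ℝ)..t, l r ω) * (∫ r in (0 : ℝ)..t, l r ω) -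
      ∫ r in (0 : ℝ)..t, (u r ω - c - ∫ q in (0 : ℝ)..r, l q ω) * l r ω) 𝓖 P := by
  obtain ⟨C, hC⟩ := h.exists_abs_le c
  have hM := h.martingale c
  let M : ℝ → Ω → ℝ := fun r ω => u r ω - c - ∫ q in (0 : ℝ)..r, l q ω
  let I : ℝ → Ω → ℝ := fun r ω => ∫ q in (0 : ℝ)..r, l q ω
  have hC0 : ∀ ω : Ω, 0 ≤ C := fun ω => (abs_nonneg _).trans (hC 0 ω).1
  have hMb : ∀ (t : ℝ≥0) (r : ℝ) ω, 0 ≤ r → r ≤ t → |M r ω| ≤ C + C * t := fun t r ω hr hrt => by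
    have h1 := (hC ⟨r, hr⟩ ω).2.2.2
    have h2 := mul_le_mul_of_nonneg_left hrt (hC0 ω)
    exact h1.trans (add_le_add_right h2 C)
  have hMm : ∀ t : ℝ≥0, @MeasurableUpTo Ω (𝓖 t) t M := h.measurable_martingale c
  have hIm : ∀ t : ℝ≥0, @MeasurableUpTo Ω (𝓖 t) t I := h.measurable_integral
  have hMl : ∀ t : ℝ≥0, @MeasurableUpTo Ω (𝓖 t) t fun r ω => M r ω * l r ω := fun t =>
    @MeasurableUpTo.mul Ω (𝓖 t) t _ _ (hMm t) (h.measurable_snd t)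
  have hat : ∀ (t : ℝ≥0) (g : ℝ → Ω → ℝ), @MeasurableUpTo Ω (𝓖 t) t g → Measurable[𝓖 t] (g t) :=
    fun t g hg => @MeasurableUpTo.measurable Ω (𝓖 t) t _ hg t ⟨t.2, le_rfl⟩
  have hMlb : ∀ (t : ℝ≥0) (r : ℝ) ω, 0 ≤ r → r ≤ t → |M r ω * l r ω| ≤ (C + C * t) * C := by
    intro t r ω hr hrt
    rw [abs_mul]
    exact mul_le_mul (hMb t r ω hr hrt) (hC ⟨r, hr⟩ ω).2.1 (abs_nonneg _)
      ((abs_nonneg _).trans (hMb t r ω hr hrt))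
  have hMli : ∀ (ω : Ω) {a b : ℝ}, 0 ≤ a → a ≤ b →
      IntervalIntegrable (fun r => M r ω * l r ω) volume a b := by
    intro ω a b ha hab
    lift b to ℝ≥0 using ha.trans hab
    exact ((hMl b).mono (𝓖.le b)).intervalIntegrable (fun r hr hrb => hMlb b r ω hr hrb) ha hab
      le_rfl
  have hKm : ∀ t : ℝ≥0, Measurable[𝓖 t] fun ω => M t ω * I t ω - ∫ r in (0 : ℝ)..t, M r ω * l r ω :=
    fun t => ((hat t M (hMm t)).mul (hat t I (hIm t))).sub
      (@MeasurableUpTo.measurable_intervalIntegral Ω (𝓖 t) t _ (hMl t) 0 t le_rfl t.2 le_rfl)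
  have hMi : ∀ t : ℝ≥0, Integrable (M t) P := hM.integrable
  have hIi : ∀ s t : ℝ≥0, s ≤ t → Integrable (fun ω => I s ω * M t ω) P := fun s t _ =>
    (hMi t).bdd_mul (c := C * s) (((hat s I (hIm s)).mono (𝓖.le s) le_rfl).aestronglyMeasurable)
      (ae_of_all _ fun ω => (hC s ω).2.2.1)
  have hKi : ∀ t : ℝ≥0,
      Integrable (fun ω => M t ω * I t ω - ∫ r in (0 : ℝ)..t, M r ω * l r ω) P := fun t => by
    refine Integrable.sub (by simpa only [mul_comm] using hIi t t le_rfl) ?_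
    refine Integrable.of_bound (C := (C + C * t) * C * t) ?_ (ae_of_all _ fun ω => ?_)
    · exact (((hMl t).mono (𝓖.le t)).measurable_intervalIntegral le_rfl t.2
        le_rfl).aestronglyMeasurable
    · have := intervalIntegral.norm_integral_le_of_norm_le_const (a := 0) (b := (t : ℝ))
        (f := fun r => M r ω * l r ω) (C := (C + C * t) * C) fun r hr => by
          rw [Set.uIoc_of_le t.coe_nonneg] at hr
          exact hMlb t r ω hr.1.le hr.2
      simpa using this
  refine martingale_of_setIntegral_eq hKm hKi fun s t hst A hA => ?_
  have hst' : (s : ℝ) ≤ t := hst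
  have hYm : MeasurableUpTo t fun r ω => (M t ω - M r ω) * l r ω :=
    ((MeasurableUpTo.of_measurable ((hat t M (hMm t)).mono (𝓖.le t) le_rfl)).sub
      ((hMm t).mono (𝓖.le t))).mul ((h.measurable_snd t).mono (𝓖.le t))
  have hYb : ∀ (r : ℝ) ω, 0 ≤ r → r ≤ t → |(M t ω - M r ω) * l r ω| ≤
      ((C + C * t) + (C + C * t)) * C := by
    intro r ω hr hrt
    rw [abs_mul]
    have h1 := (abs_sub (M t ω) (M r ω)).trans
      (add_le_add (hMb t t ω t.2 le_rfl) (hMb t r ω hr hrt))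
    exact mul_le_mul h1 (hC ⟨r, hr⟩ ω).2.1 (abs_nonneg _) ((abs_nonneg _).trans h1)
  have hYi : Integrable (fun ω => ∫ r in (s : ℝ)..t, (M t ω - M r ω) * l r ω) P := by
    refine Integrable.of_bound (hYm.measurable_intervalIntegral s.2 hst'
      le_rfl).aestronglyMeasurable (((C + C * t) + (C + C * t)) * C * |(t : ℝ) - s|)
      (ae_of_all _ fun ω => ?_)
    refine intervalIntegral.norm_integral_le_of_norm_le_const fun r hr => ?_
    rw [Set.uIoc_of_le hst'] at hr
    exact hYb r ω (s.2.trans hr.1.le) hr.2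
  -- By Fubini it suffices to fix `r`: then `l_r` is bounded and known at time `r`, so it is
  -- orthogonal to the martingale increment `M_t - M_r` on `A`.
  have hzero : ∫ ω in A, (∫ r in (s : ℝ)..t, (M t ω - M r ω) * l r ω) ∂P = 0 := by
    rw [hYm.setIntegral_intervalIntegral hYb s.coe_nonneg hst' le_rfl]
    refine (intervalIntegral.integral_congr fun r hr => ?_).trans intervalIntegral.integral_zero
    rw [Set.uIcc_of_le hst'] at hr
    have hr0 : 0 ≤ r := s.2.trans hr.1
    lift r to ℝ≥0 using hr0
    have hl : Measurable[𝓖 r] (l r) := hat r l (h.measurable_snd r)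
    have e1 := hM.integral_mul_eq (s := r) (t := t) hr.2 hl (c := C) (fun ω => (hC r ω).2.1)
      (𝓖.mono (show s ≤ r from hr.1) _ hA)
    have hi : ∀ q : ℝ≥0, Integrable (fun ω => l r ω * M q ω) P := fun q =>
      (hMi q).bdd_mul (c := C) (hl.mono (𝓖.le r) le_rfl).aestronglyMeasurable
        (ae_of_all _ fun ω => (hC r ω).2.1)
    calc ∫ ω in A, (M t ω - M r ω) * l r ω ∂P
        = ∫ ω in A, (l r ω * M t ω - l r ω * M r ω) ∂P := by
          congr! 2 with ω
          ring
      _ = 0 := by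
          rw [integral_sub (hi t).integrableOn (hi r).integrableOn]
          exact sub_eq_zero.2 e1
  have e2 := hM.integral_mul_eq hst (hat s I (hIm s)) (c := C * s) (fun ω => (hC s ω).2.2.1) hA
  -- The increment is `I_s (M_t - M_s)`, which has mean zero on `A` by the martingale property, plus
  -- the integral treated above.
  have hpt : ∀ ω, (M t ω * I t ω - ∫ r in (0 : ℝ)..t, M r ω * l r ω) -
      (M s ω * I s ω - ∫ r in (0 : ℝ)..s, M r ω * l r ω) =
      (I s ω * M t ω - I s ω * M s ω) + ∫ r in (s : ℝ)..t, (M t ω - M r ω) * l r ω := by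
    intro ω
    have h1 := intervalIntegral.integral_interval_sub_left (hMli ω le_rfl t.coe_nonneg)
      (hMli ω le_rfl s.coe_nonneg)
    have h2 := intervalIntegral.integral_interval_sub_left (h.intervalIntegrable ω le_rfl t.coe_nonneg)
      (h.intervalIntegrable ω le_rfl s.coe_nonneg)
    simp_rw [sub_mul]
    rw [intervalIntegral.integral_sub ((h.intervalIntegrable ω s.coe_nonneg hst').const_mul _)
      (hMli ω s.coe_nonneg hst'), intervalIntegral.integral_const_mul, ← h1, ← h2]
    ring
  change ∫ ω in A, (M t ω * I t ω - ∫ r in (0 : ℝ)..t, M r ω * l r ω) ∂P =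
    ∫ ω in A, (M s ω * I s ω - ∫ r in (0 : ℝ)..s, M r ω * l r ω) ∂P
  rw [← sub_eq_zero, ← integral_sub (hKi t).integrableOn (hKi s).integrableOn]
  simp_rw [hpt]
  rw [integral_add (f := fun ω => I s ω * M t ω - I s ω * M s ω) ((hIi s t hst).sub (hIi s s le_rfl)).integrableOn hYi.integrableOn, hzero,
    integral_sub (hIi s t hst).integrableOn (hIi s s le_rfl).integrableOn, add_zero]
  exact sub_eq_zero.2 e2

omit [IsFiniteMeasure P] in
theorem intervalIntegrable_mul (ω : Ω) {t : ℝ} (ht : 0 ≤ t) :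
    IntervalIntegrable (fun r => u r ω * l r ω) volume 0 t := by
  obtain ⟨C, hC⟩ := h.bounded_fst
  obtain ⟨K, hK⟩ := h.bounded_snd
  lift t to ℝ≥0 using ht
  refine (((h.measurable_fst t).mono (𝓖.le t)).mul
    ((h.measurable_snd t).mono (𝓖.le t))).intervalIntegrable (K := C * K) (fun r hr _ => ?_)
    le_rfl t.coe_nonneg le_rfl
  rw [abs_mul]
  exact mul_le_mul (hC r ω hr) (hK r ω hr) (abs_nonneg _) ((abs_nonneg _).trans (hC r ω hr))

/-- The compensated square of the compensated process is a martingale. -/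
theorem martingale_sq {l₂ : ℝ → Ω → ℝ} (h₂ : IsBoundedDynkin 𝓖 P (fun r ω => u r ω ^ 2) l₂)
    (c : ℝ) : Martingale (fun (t : ℝ≥0) ω => (u t ω - c - ∫ r in (0 : ℝ)..t, l r ω) ^ 2 -
      ∫ r in (0 : ℝ)..t, (l₂ r ω - 2 * u r ω * l r ω)) 𝓖 P := by
  -- Expanding the square, all terms agree except `2 ∫ (∫ l) l` against `(∫ l)²`, which is the
  -- product rule `h1` below.
  have key := ((h₂.martingale (c ^ 2)).sub ((h.martingale c).smul (2 * c))).sub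
    ((h.martingale_mul c).smul 2)
  convert key using 1
  funext t ω
  have hl := h.intervalIntegrable ω le_rfl t.coe_nonneg
  have hI : ContinuousOn (fun r => ∫ q in (0 : ℝ)..r, l q ω) (Set.uIcc 0 t) :=
    (hl.absolutelyContinuousOnInterval_intervalIntegral (by simp)).continuousOn
  have hIl := hl.continuousOn_mul hI
  have hul := h.intervalIntegrable_mul ω t.coe_nonneg
  have h1 := two_mul_integral_primitive_mul hl
  have h2 : ∫ r in (0 : ℝ)..t, (l₂ r ω - 2 * u r ω * l r ω) =
      (∫ r in (0 : ℝ)..t, l₂ r ω) - 2 * ∫ r in (0 : ℝ)..t, u r ω * l r ω := by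
    simp_rw [mul_assoc]
    rw [intervalIntegral.integral_sub (h₂.intervalIntegrable ω le_rfl t.coe_nonneg)
      (hul.const_mul 2), intervalIntegral.integral_const_mul]
  have h3 : ∫ r in (0 : ℝ)..t, (u r ω - c - ∫ q in (0 : ℝ)..r, l q ω) * l r ω =
      (∫ r in (0 : ℝ)..t, u r ω * l r ω) - c * (∫ r in (0 : ℝ)..t, l r ω) -
        ∫ r in (0 : ℝ)..t, (∫ q in (0 : ℝ)..r, l q ω) * l r ω := by
    simp_rw [sub_mul]
    rw [intervalIntegral.integral_sub (hul.sub (hl.const_mul c)) hIl,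
      intervalIntegral.integral_sub hul (hl.const_mul c), intervalIntegral.integral_const_mul]
  simp only [Pi.sub_apply, Pi.smul_apply, smul_eq_mul]
  rw [h2, h3]
  linear_combination h1

end IsBoundedDynkin

/-! ### Exit from balls -/

namespace ReactionDiffusion

variable {V Ω : Type*} (S : ReactionDiffusion V)

/-- The times by which the flow has come arbitrarily close to the exterior of the ball of
radius `k`. -/
def exitTimes (X : Mark V → Ω → Set (ℝ × ℝ)) (a : ℕ → FiniteConfig V) (k : ℝ) (ω : Ω) : Set ℝ :=
  {r | ∀ j : ℕ, ∃ n r', 0 ≤ r' ∧ r' ≤ r ∧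
    k - 1 / ((j : ℝ) + 1) < weightSum S.α (S.finFlow X (a n) r' ω).1}

/-- The exit time from the ball of radius `k`, capped at `T`. -/
noncomputable def exitTime (X : Mark V → Ω → Set (ℝ × ℝ)) (a : ℕ → FiniteConfig V) (k : ℝ) :
    ℝ → Ω → ℝ :=
  hitTime (fun r ω => r ∈ S.exitTimes X a k ω) {p : Prop | p}

variable {S} {X : Mark V → Ω → Set (ℝ × ℝ)} {a : ℕ → FiniteConfig V} {k : ℝ} {ω : Ω} {r s : ℝ}

theorem exitTimes_upper (h : r ∈ S.exitTimes X a k ω) (hrs : r ≤ s) : s ∈ S.exitTimes X a k ω := by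
  intro j
  obtain ⟨n, r', h1, h2, h3⟩ := h j
  exact ⟨n, r', h1, h2.trans hrs, h3⟩

theorem exitTimes_anti {k' : ℝ} (hk : k ≤ k') : S.exitTimes X a k' ω ⊆ S.exitTimes X a k ω := by
  intro r h j
  obtain ⟨n, r', h1, h2, h3⟩ := h j
  exact ⟨n, r', h1, h2, by linarith⟩

theorem nonneg_of_mem_exitTimes (h : r ∈ S.exitTimes X a k ω) : 0 ≤ r := by
  obtain ⟨n, r', h1, h2, h3⟩ := h 0
  exact h1.trans h2

theorem finFlow_le_of_notMem_exitTimes (h : r ∉ S.exitTimes X a k ω) (n : ℕ) (hs : 0 ≤ s)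
    (hsr : s ≤ r) : weightSum S.α (S.finFlow X (a n) s ω).1 ≤ k := by
  simp only [exitTimes, Set.mem_ofPred_eq, not_forall, not_exists, not_and, not_lt] at h
  obtain ⟨j, hj⟩ := h
  have : 0 < 1 / ((j : ℝ) + 1) := by positivity
  linarith [hj n s hs hsr]

theorem lt_exitTime_iff {T : ℝ} (hT : 0 ≤ T) (hr : 0 ≤ r) (hrT : r < T)
    (hright : ∀ r, 0 ≤ r → r ∉ S.exitTimes X a k ω → ∃ s, r < s ∧ s ∉ S.exitTimes X a k ω) :
    r < S.exitTime X a k T ω ↔ r ∉ S.exitTimes X a k ω := by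
  constructor
  · intro h hE
    exact notMem_of_lt_hitTime hT hr h hE
  · intro h
    obtain ⟨s, hs1, hs2⟩ := hright r hr h
    refine (lt_min hs1 hrT).trans_le (le_csInf ⟨T, Or.inr rfl⟩ ?_)
    rintro x (hx | rfl)
    · refine (min_le_left _ _).trans (le_of_not_gt fun hxs => hs2 (exitTimes_upper hx.2 hxs.le))
    · exact min_le_right _ _

theorem eventually_exitTimes_eq
    (hright : ∀ r, 0 ≤ r → r ∉ S.exitTimes X a k ω → ∃ s, r < s ∧ s ∉ S.exitTimes X a k ω)
    (hr : 0 ≤ r) : ∀ᶠ s in 𝓝[>] r, (s ∈ S.exitTimes X a k ω) = (r ∈ S.exitTimes X a k ω) := by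
  by_cases h : r ∈ S.exitTimes X a k ω
  · filter_upwards [self_mem_nhdsWithin] with s hs
    exact propext (iff_of_true (exitTimes_upper h (Set.mem_Ioi.1 hs).le) h)
  · obtain ⟨c, hc1, hc2⟩ := hright r hr h
    filter_upwards [Ioo_mem_nhdsGT hc1] with s hs
    exact propext (iff_of_false (fun h' => hc2 (exitTimes_upper h' hs.2.le)) h)

section

variable (hG : S.GoodClocks X) {η : S.Config} (ha : S.Approximates a η)
  (hc : ∀ ω, S.FlowConverges (fun m => X m ω) a)

include hG in
/-- Between the initial time and the exit the flow is bounded. -/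
theorem finFlow_apply_le (hS : ∀ n, (a n).1 ≤ η.1) {n : ℕ} (hr : 0 ≤ r)
    (h : ∀ s, 0 ≤ s → s < r → weightSum S.α (S.finFlow X (a n) s ω).1 ≤ k) (x : V) :
    ((S.finFlow X (a n) r ω).1 x : ℝ) ≤ max (η.1 x : ℝ) (k / S.α x + 1) := by
  rcases hr.eq_or_lt with rfl | hr0
  · rw [hG.finFlow_zero]
    exact (Nat.cast_le.2 (hS n x)).trans (le_max_left _ _)
  · obtain ⟨Zm, hZ⟩ := hG.exists_isJumpProcess (a n)
    obtain ⟨s, hs, hs0, hsr⟩ := ((hZ.path ω).left r hr0).and (Ioo_mem_nhdsLT hr0) |>.exists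
    have h1 : S.α x * ((Zm r ω).1 x : ℝ) ≤ k := by
      rw [← hs]
      exact (((S.finFlow X (a n) s ω).summable_mul S.α).le_tsum x fun y _ =>
        mul_nonneg (S.α_pos y).le (Nat.cast_nonneg _)).trans (h s hs0.le hsr)
    have h2 : ((Zm r ω).1 x : ℝ) ≤ k / S.α x := by
      rwa [le_div_iff₀ (S.α_pos x), mul_comm]
    refine le_trans ?_ (le_max_right _ _)
    by_cases hf : ∃ m u, Fires (fun m => X m ω) S.finiteRate (Zm r ω) m r u
    · obtain ⟨m, u, hf⟩ := hf
      rw [(hZ.path ω).jump r hr0 m u hf]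
      have : (((Zm r ω).transition m).1 x : ℝ) ≤ (Zm r ω).1 x + 1 := by
        exact_mod_cast transition_apply_le m (Zm r ω).1 x
      linarith
    · rw [(hZ.path ω).stay r hr0 fun m u h => hf ⟨m, u, h⟩]
      linarith

include hG ha hc

theorem flow_le_of_notMem_exitTimes (h : r ∉ S.exitTimes X a k ω) (hs : 0 ≤ s)
    (hsr : s ≤ r) : weightSum S.α (S.flow (fun m => X m ω) s η).1 ≤ k := by
  obtain ⟨N, hN⟩ := exists_weightSum_flow_sub_le hG ha hc ω s
  refine ge_of_tendsto (x := atTop) (f := fun n : ℕ => k + 2 * (1 / 2 : ℝ) ^ n) ?_ ?_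
  · simpa using tendsto_const_nhds.add ((tendsto_pow_atTop_nhds_zero_of_lt_one (r := (1 / 2 : ℝ))
      (by norm_num) (by norm_num)).const_mul 2)
  · filter_upwards [eventually_ge_atTop N] with n hn
    linarith [hN n hn s hs le_rfl, finFlow_le_of_notMem_exitTimes h n hs hsr]

/-- All approximating flows lie below the limit flow, which exceeds one fixed approximation by
little, uniformly in time; that approximation is constant just after `r`. A margin `1 / (j + 1)` at
`r` therefore leaves half of it shortly afterwards, whence the index `2 j + 1`. -/
theorem exists_gt_notMem_exitTimes (hr : 0 ≤ r) (h : r ∉ S.exitTimes X a k ω) :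
    ∃ s, r < s ∧ s ∉ S.exitTimes X a k ω := by
  have hα := fun x => (S.α_pos x).le
  simp only [exitTimes, Set.mem_ofPred_eq, not_forall, not_exists, not_and, not_lt] at h ⊢
  obtain ⟨j, hj⟩ := h
  obtain ⟨N, hN⟩ := exists_weightSum_flow_sub_le hG ha hc ω (r + 1)
  have hpos : (0 : ℝ) < 1 / ((j : ℝ) + 1) / 4 := by positivity
  obtain ⟨i, hi⟩ := exists_pow_lt_of_lt_one hpos (show (1 / 2 : ℝ) < 1 by norm_num)
  have hn : (1 / 2 : ℝ) ^ max N i ≤ (1 / 2) ^ i :=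
    pow_le_pow_of_le_one (by norm_num) (by norm_num) (le_max_right _ _)
  obtain ⟨c, hc1, hc2⟩ := mem_nhdsGT_iff_exists_Ioo_subset.1
    (hG.eventually_right (a (max N i)) ω hr)
  have hc1' : r < c := hc1
  refine ⟨min ((r + c) / 2) (r + 1), lt_min (by linarith) (by linarith), 2 * j + 1,
    fun n r' h0 h1 => ?_⟩
  have e1 : (1 : ℝ) / ((2 * j + 1 : ℕ) + 1) = 1 / ((j : ℝ) + 1) / 2 := by
    push_cast
    field_simp
    ring
  rw [e1]
  rcases le_or_gt r' r with h2 | h2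
  · linarith [hj n r' h0 h2]
  · have h3 : S.finFlow X (a (max N i)) r' ω = S.finFlow X (a (max N i)) r ω :=
      hc2 ⟨h2, by have := h1.trans (min_le_left _ _); linarith⟩
    have h4 := hN (max N i) (le_max_left _ _) r' h0 (h1.trans (min_le_right _ _))
    have h5 := (weightSum_le_of_le (finFlow_le_flow hG ha hc ω h0 n)).2
    rw [h3] at h4
    linarith [hj (max N i) r hr le_rfl]

omit ha hc in
theorem measurableSet_mem_exitTimes {m : MeasurableSpace Ω} [Countable V] (hr : 0 ≤ r)
    (hm : ∀ t, 0 ≤ t → t ≤ r → ∀ n e, MeasurableSet {ω | S.finFlow X (a n) t ω = e}) :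
    MeasurableSet {ω | r ∈ S.exitTimes X a k ω} := by
  have : {ω | r ∈ S.exitTimes X a k ω} = ⋂ j : ℕ, ⋃ n, {ω | ∃ r', 0 ≤ r' ∧ r' ≤ r ∧
      S.finFlow X (a n) r' ω ∈ {e | k - 1 / ((j : ℝ) + 1) < weightSum S.α e.1}} := by
    ext ω
    simp only [exitTimes, Set.mem_ofPred_eq, Set.mem_iInter, Set.mem_iUnion]
  rw [this]
  exact MeasurableSet.iInter fun j => MeasurableSet.iUnion fun n =>
    measurableSet_exists_le_mem hr (fun t h0 h1 e => hm t h0 h1 n e)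
      (fun ω t ht => hG.eventually_right (a n) ω ht) _

theorem measurable_exitTime {m : MeasurableSpace Ω} [Countable V] {T : ℝ} (hT : 0 ≤ T)
    (hm : ∀ t, 0 ≤ t → t ≤ T → ∀ n e, MeasurableSet {ω | S.finFlow X (a n) t ω = e}) :
    Measurable (S.exitTime X a k T) := by
  refine measurable_hitTime (fun t h0 h1 e => ?_) (fun ω t ht => eventually_exitTimes_eq
    (fun r hr h => exists_gt_notMem_exitTimes hG ha hc hr h) ht) _ hT
  have hE := measurableSet_mem_exitTimes hG (k := k) h0 fun s hs0 hst n e => hm s hs0 (hst.trans h1) n e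
  -- The state space of this hitting problem is `Prop`, so a state is either the event or its
  -- complement.
  by_cases he : e
  · convert! hE using 1
    ext ω
    simp [he]
  · convert! hE.compl using 1
    ext ω
    simp [he]

theorem isClockStop_exitTime [Countable V] {T : ℝ} (hT : 0 ≤ T) :
    IsClockStop X (S.exitTime X a k T) := by
  refine isClockStop_hitTime (fun t h0 e => ?_) (fun ω t ht => eventually_exitTimes_eq
    (fun r hr h => exists_gt_notMem_exitTimes hG ha hc hr h) ht) _ hT
  have hE := @measurableSet_mem_exitTimes _ _ _ _ _ k _ hG (clockPast X t) _ h0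
    fun s hs0 hst n e => clockPast_mono X hst _ (hG.measurableSet_eq (a n) hs0 e)
  by_cases he : e
  · convert! hE using 1
    ext ω
    simp [he]
  · convert! @MeasurableSet.compl _ _ (clockPast X t) hE using 1
    ext ω
    simp [he]

end

end ReactionDiffusion

/-! ### Dynkin's formula for the infinite-volume flow -/

theorem continuousWithinAt_of_eventually {β : Type*} [TopologicalSpace β] {h : ℝ → β} {r : ℝ}
    (hr : ∀ᶠ s in 𝓝[>] r, h s = h r) : ContinuousWithinAt h (Set.Ici r) r :=
  continuousWithinAt_Ioi_iff_Ici.1 (tendsto_const_nhds.congr' (hr.mono fun _ => Eq.symm))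

namespace ReactionDiffusion

variable {V Ω : Type*} {S : ReactionDiffusion V} {X : Mark V → Ω → Set (ℝ × ℝ)}
  {a : ℕ → FiniteConfig V} {η : S.Config} (hG : S.GoodClocks X) (ha : S.Approximates a η)
  (hc : ∀ ω, S.FlowConverges (fun m => X m ω) a) (k : ℝ) {B : Finset V} {g : S.Config → ℝ}

variable (S X g) in
/-- The value of `g` along the flow stopped at the exit from a ball. -/
noncomputable def stoppedFlow (a : ℕ → FiniteConfig V) (η : S.Config) (k : ℝ) (t : ℝ) (ω : Ω) : ℝ :=
  g (S.flow (fun m => X m ω) (S.exitTime X a k t ω) η)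

open scoped Classical in
variable (S X g) in
/-- The generator along the flow before the exit from a ball. -/
noncomputable def stoppedGen (a : ℕ → FiniteConfig V) (η : S.Config) (k : ℝ) (t : ℝ) (ω : Ω) : ℝ :=
  if t ∈ S.exitTimes X a k ω then 0 else S.gen g (S.flow (fun m => X m ω) t η)

theorem exitTime_nonneg {t : ℝ} (ht : 0 ≤ t) (ω : Ω) : 0 ≤ S.exitTime X a k t ω := hitTime_nonneg ht

theorem exitTime_le {t : ℝ} (ht : 0 ≤ t) (ω : Ω) : S.exitTime X a k t ω ≤ t := hitTime_le ht

theorem notMem_exitTimes_of_lt {t : ℝ} (ht : 0 ≤ t) {r : ℝ} (hr : 0 ≤ r) {ω : Ω}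
    (h : r < S.exitTime X a k t ω) : r ∉ S.exitTimes X a k ω := notMem_of_lt_hitTime ht hr h

theorem exitTime_eq_min {s t : ℝ} (hs : 0 ≤ s) (hst : s ≤ t) (ω : Ω) :
    S.exitTime X a k s ω = min s (S.exitTime X a k t ω) := hitTime_eq_min hs hst

section

include hG ha hc

/-- Up to and including the exit the occupation numbers in `B` are bounded uniformly over the
approximations; the limit takes one of the approximating values. -/
theorem exists_abs_stopped_le (hg : S.LocalOn B g) : ∃ b, ∀ t ω, 0 ≤ t →
    (∀ n, |g (S.ofFinite (S.finFlow X (a n) (S.exitTime X a k t ω) ω))| ≤ b) ∧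
    |S.stoppedFlow X g a η k t ω| ≤ b := by
  obtain ⟨q, hq⟩ := exists_nat_ge (∑ x ∈ B, |max (η.1 x : ℝ) (k / S.α x + 1)|)
  obtain ⟨b, hb, hbg⟩ := hg.exists_abs_le q
  have hn : ∀ t ω, 0 ≤ t →
      ∀ n, |g (S.ofFinite (S.finFlow X (a n) (S.exitTime X a k t ω) ω))| ≤ b := by
    intro t ω ht n
    refine hbg _ fun x hx => ?_
    have h1 := finFlow_apply_le hG ha.le (k := k) (ω := ω) (n := n)
      (exitTime_nonneg (S := S) (X := X) (a := a) k ht ω) (fun s hs0 hs =>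
        finFlow_le_of_notMem_exitTimes (notMem_exitTimes_of_lt k ht hs0 hs) n hs0 le_rfl) x
    have h2 := Finset.single_le_sum (f := fun x => |max (η.1 x : ℝ) (k / S.α x + 1)|)
      (fun y _ => abs_nonneg _) hx
    exact_mod_cast h1.trans ((le_abs_self _).trans (h2.trans hq))
  refine ⟨b, fun t ω ht => ⟨hn t ω ht, ?_⟩⟩
  obtain ⟨n, hn'⟩ := (hg.tendsto (finFlow_tendsto_flow hG ha hc ω
    (exitTime_nonneg (S := S) (X := X) (a := a) k ht ω))).exists
  rw [stoppedFlow, ← hn']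
  exact hn t ω ht n

theorem exists_abs_stoppedGen_le (hg : S.LocalOn B g) : ∃ Λ, 0 ≤ Λ ∧ ∀ t ω, 0 ≤ t →
    |S.stoppedGen X g a η k t ω| ≤ Λ ∧ (t ∉ S.exitTimes X a k ω → ∀ n,
      ∑' m, S.rate m (S.finFlow X (a n) t ω).1 * |g (S.move m (S.ofFinite (S.finFlow X (a n) t ω)))
        - g (S.ofFinite (S.finFlow X (a n) t ω))| ≤ Λ) := by
  obtain ⟨Λ, h0, hΛ⟩ := hg.exists_rate_le k
  refine ⟨Λ, h0, fun t ω ht => ⟨?_, fun h n =>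
    (hΛ (S.ofFinite _) (finFlow_le_of_notMem_exitTimes h n ht le_rfl)).2.2⟩⟩
  rw [stoppedGen]
  split_ifs with h
  · simpa using h0
  · exact (hg.abs_gen_le _).trans (hΛ _ (flow_le_of_notMem_exitTimes hG ha hc h ht le_rfl)).2.2

theorem lt_exitTime_iff' {t : ℝ} (ht : 0 ≤ t) {r : ℝ} (hr : 0 ≤ r) (hrt : r < t) (ω : Ω) :
    r < S.exitTime X a k t ω ↔ r ∉ S.exitTimes X a k ω :=
  lt_exitTime_iff ht hr hrt fun _ h0 h => exists_gt_notMem_exitTimes hG ha hc h0 h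

/-- Dynkin's formula for the flow stopped at the exit from a ball. -/
theorem setIntegral_stoppedFlow_sub [Countable V] [MeasurableSpace Ω] {P : Measure Ω} [IsProbabilityMeasure P]
    (hX : IsPoissonClocks X P) (hg : S.LocalOn B g) {s t : ℝ} (hs : 0 ≤ s) (hst : s ≤ t)
    {A : Set Ω} (hA : MeasurableSet[clockPast X s] A) :
    ∫ ω in A, (S.stoppedFlow X g a η k t ω - S.stoppedFlow X g a η k s ω) ∂P =
      ∫ ω in A, (∫ r in s..t, S.stoppedGen X g a η k r ω) ∂P := by
  have ht := hs.trans hst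
  obtain ⟨b, hb⟩ := exists_abs_stopped_le hG ha hc k hg
  obtain ⟨Λ, hΛ0, hΛ⟩ := exists_abs_stoppedGen_le hG ha hc k hg
  let τ := S.exitTime X a k t
  have hτs : ∀ ω, min s (τ ω) = S.exitTime X a k s ω := fun ω => (exitTime_eq_min k hs hst ω).symm
  have hτt : ∀ ω, min t (τ ω) = τ ω := fun ω => min_eq_right (exitTime_le k ht ω)
  have hgen : ∀ n ω r, 0 ≤ r → r < τ ω → |S.gen g (S.ofFinite (S.finFlow X (a n) r ω))| ≤ Λ :=
    fun n ω r hr h => (hg.abs_gen_le _).trans ((hΛ r ω hr).2 (notMem_exitTimes_of_lt k ht hr h) n)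
  have hdyn : ∀ n, _ := fun n => (hG.exists_isJumpProcess (a n)).choose_spec.dynkin hX
    (isClockStop_exitTime hG ha hc (k := k) ht) hs hst hA (fun m e => S.rate_nonneg m e.1)
    (fun e => g (S.ofFinite e)) (fun e => hg.summable_abs (S.ofFinite e)) (K := Λ)
    fun ω r hr h => (hΛ r ω hr).2 (notMem_exitTimes_of_lt k ht hr h) n
  -- The integrands are uniformly bounded and, path by path, eventually constant in `n`.
  have hleft : Tendsto (fun n => ∫ ω in A, (g (S.ofFinite (S.finFlow X (a n) (min t (τ ω)) ω)) -
      g (S.ofFinite (S.finFlow X (a n) (min s (τ ω)) ω))) ∂P) atTop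
      (𝓝 (∫ ω in A, (S.stoppedFlow X g a η k t ω - S.stoppedFlow X g a η k s ω) ∂P)) := by
    refine tendsto_integral_of_dominated_convergence (fun _ => b + b)
      (fun n => (hdyn n).1.1.aestronglyMeasurable.restrict) (integrable_const _)
      (fun n => ae_of_all _ fun ω => ?_) (ae_of_all _ fun ω => ?_)
    · rw [hτs, hτt]
      exact (abs_sub _ _).trans (add_le_add ((hb t ω ht).1 n) ((hb s ω hs).1 n))
    · simp_rw [hτs, hτt]
      refine tendsto_const_nhds.congr' ?_
      filter_upwards [hg.tendsto (finFlow_tendsto_flow hG ha hc ω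
          (exitTime_nonneg (S := S) (X := X) (a := a) k ht ω)),
        hg.tendsto (finFlow_tendsto_flow hG ha hc ω
          (exitTime_nonneg (S := S) (X := X) (a := a) k hs ω))] with n h1 h2
      rw [h1, h2]
      rfl
  have hright : Tendsto (fun n => ∫ ω in A, (∫ r in s..t, {r | r < τ ω}.indicator
      (fun r => S.gen g (S.ofFinite (S.finFlow X (a n) r ω))) r) ∂P) atTop
      (𝓝 (∫ ω in A, (∫ r in s..t, S.stoppedGen X g a η k r ω) ∂P)) := by
    have hbd : ∀ n ω r, 0 ≤ r → ‖{r | r < τ ω}.indicator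
        (fun r => S.gen g (S.ofFinite (S.finFlow X (a n) r ω))) r‖ ≤ Λ := by
      intro n ω r hr
      by_cases h : r < τ ω
      · rw [Set.indicator_of_mem (show r ∈ {r | r < τ ω} from h)]
        exact hgen n ω r hr h
      · rw [Set.indicator_of_notMem (show r ∉ {r | r < τ ω} from h), norm_zero]
        exact hΛ0
    refine tendsto_integral_of_dominated_convergence (fun _ => Λ * |t - s|)
      (fun n => (hdyn n).1.2.1.aestronglyMeasurable.restrict) (integrable_const _)
      (fun n => ae_of_all _ fun ω => ?_) (ae_of_all _ fun ω => ?_)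
    · refine intervalIntegral.norm_integral_le_of_norm_le_const fun r hr => ?_
      rw [Set.uIoc_of_le hst] at hr
      exact hbd n ω r (hs.trans hr.1.le)
    · refine intervalIntegral.tendsto_integral_filter_of_dominated_convergence (fun _ => Λ)
        (Eventually.of_forall fun n => ?_) (Eventually.of_forall fun n => ae_of_all _ fun r hr => ?_)
        intervalIntegrable_const ?_
      · rw [Set.uIoc_of_le hst]
        exact ((hdyn n).1.2.2 ω).1.aestronglyMeasurable
      · rw [Set.uIoc_of_le hst] at hr
        exact hbd n ω r (hs.trans hr.1.le)
      · filter_upwards [measure_eq_zero_iff_ae_notMem.1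
          ((Set.countable_singleton t).measure_zero volume)] with r hrt hr
        rw [Set.uIoc_of_le hst] at hr
        have hr0 := hs.trans hr.1.le
        have hiff := lt_exitTime_iff' hG ha hc k ht hr0
          (lt_of_le_of_ne hr.2 (by simpa using hrt)) ω
        by_cases h : r < τ ω
        · simp_rw [Set.indicator_of_mem (show r ∈ {r | r < τ ω} from h)]
          rw [stoppedGen, if_neg (hiff.1 h)]
          exact hg.tendsto_gen (finFlow_tendsto_flow hG ha hc ω hr0)
            fun n => finFlow_le_flow hG ha hc ω hr0 n
        · simp_rw [Set.indicator_of_notMem (show r ∉ {r | r < τ ω} from h)]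
          rw [stoppedGen, if_pos (not_not.1 (mt hiff.2 h))]
          exact tendsto_const_nhds
  exact tendsto_nhds_unique hleft (hright.congr fun n => (hdyn n).2.symm)

/-- As a function of the cap, the exit time is `min s` of a fixed number, hence continuous. -/
theorem measurableUpTo_exitTime [Countable V] {m : MeasurableSpace Ω} {t : ℝ} (ht : 0 ≤ t)
    (hm : ∀ r, 0 ≤ r → r ≤ t → ∀ n e, MeasurableSet {ω | S.finFlow X (a n) r ω = e}) :
    MeasurableUpTo t (S.exitTime X a k) := by
  refine MeasurableUpTo.of_rightContinuous ht (fun r hr => measurable_exitTime hG ha hc hr.1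
    fun s hs0 hsr => hm s hs0 (hsr.trans hr.2)) fun ω r hr => ?_
  have hmin : ∀ s ∈ Set.Ico r t, S.exitTime X a k s ω = min s (S.exitTime X a k t ω) :=
    fun s hs => exitTime_eq_min k (hr.1.trans hs.1) hs.2.le ω
  refine ContinuousWithinAt.congr_of_eventuallyEq
    (f := fun s => min s (S.exitTime X a k t ω)) (by fun_prop) ?_ (hmin r ⟨le_rfl, hr.2⟩)
  filter_upwards [Ico_mem_nhdsGE hr.2] with s hs using hmin s hs

omit ha hc in
theorem measurableUpTo_comp_finFlow [Countable V] {m : MeasurableSpace Ω} {t : ℝ} (ht : 0 ≤ t)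
    (hm : ∀ r, 0 ≤ r → r ≤ t → ∀ n e, MeasurableSet {ω | S.finFlow X (a n) r ω = e})
    (F : FiniteConfig V → ℝ) (n : ℕ) : MeasurableUpTo t fun r ω => F (S.finFlow X (a n) r ω) := by
  refine MeasurableUpTo.of_rightContinuous ht (fun r hr D _ => ?_) fun ω r hr =>
    continuousWithinAt_of_eventually ((hG.eventually_right (a n) ω hr.1).mono fun s hs => by rw [hs])
  have : (fun ω => F (S.finFlow X (a n) r ω)) ⁻¹' D =
      ⋃ e ∈ F ⁻¹' D, {ω | S.finFlow X (a n) r ω = e} := by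
    ext ω; simp
  rw [this]
  exact MeasurableSet.biUnion (Set.to_countable _) fun e _ => hm r hr.1 hr.2 n e

/-- Each approximation is a progressively measurable process evaluated at a progressively measurable
time; the stopped flow is their limit. -/
theorem measurableUpTo_stoppedFlow [Countable V] {m : MeasurableSpace Ω} {t : ℝ} (ht : 0 ≤ t)
    (hm : ∀ r, 0 ≤ r → r ≤ t → ∀ n e, MeasurableSet {ω | S.finFlow X (a n) r ω = e})
    (hg : S.LocalOn B g) : MeasurableUpTo t (S.stoppedFlow X g a η k) := by
  refine MeasurableUpTo.of_tendsto ht (f := fun n r ω =>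
    g (S.ofFinite (S.finFlow X (a n) (S.exitTime X a k r ω) ω))) (fun n => ?_) fun r ω hr _ => ?_
  · have h1 := measurableUpTo_comp_finFlow hG ht hm (fun e => g (S.ofFinite e)) n
    have h2 := measurableUpTo_exitTime hG ha hc k ht hm
    have h3 := Measurable.comp h1 (Measurable.prodMk h2 measurable_snd)
    refine (congrArg Measurable (funext fun p => ?_)).mp h3
    simp only [Function.comp_apply]
    have h0 : (0 : ℝ) ≤ max 0 (min p.1 t) := le_max_left _ _
    rw [max_zero_min_of_mem (r := S.exitTime X a k (max 0 (min p.1 t)) p.2)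
      ⟨exitTime_nonneg k h0 _, (exitTime_le k h0 _).trans (max_le ht (min_le_right _ _))⟩]
  · refine tendsto_const_nhds.congr' ?_
    filter_upwards [hg.tendsto (finFlow_tendsto_flow hG ha hc ω
      (exitTime_nonneg (S := S) (X := X) (a := a) k hr ω))] with n hn
    rw [hn, stoppedFlow]

open scoped Classical in
theorem measurableUpTo_stoppedGen [Countable V] {m : MeasurableSpace Ω} {t : ℝ} (ht : 0 ≤ t)
    (hm : ∀ r, 0 ≤ r → r ≤ t → ∀ n e, MeasurableSet {ω | S.finFlow X (a n) r ω = e})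
    (hg : S.LocalOn B g) : MeasurableUpTo t (S.stoppedGen X g a η k) := by
  have hE : MeasurableUpTo t fun r ω => if r ∈ S.exitTimes X a k ω then (0 : ℝ) else 1 := by
    refine MeasurableUpTo.of_rightContinuous ht (fun r hr => ?_) fun ω r hr =>
      continuousWithinAt_of_eventually ((eventually_exitTimes_eq
        (fun _ h0 h => exists_gt_notMem_exitTimes hG ha hc h0 h) hr.1).mono fun s hs =>
          if_congr (iff_of_eq hs) rfl rfl)
    exact Measurable.ite (measurableSet_mem_exitTimes hG hr.1 fun s hs0 hsr =>
      hm s hs0 (hsr.trans hr.2)) measurable_const measurable_const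
  refine MeasurableUpTo.of_tendsto ht (f := fun n r ω =>
    (if r ∈ S.exitTimes X a k ω then (0 : ℝ) else 1) *
      S.gen g (S.ofFinite (S.finFlow X (a n) r ω))) (fun n => hE.mul
    (measurableUpTo_comp_finFlow hG ht hm (fun e => S.gen g (S.ofFinite e)) n))
    fun r ω hr _ => ?_
  rw [stoppedGen]
  split_ifs with h
  · simp
  · simpa using hg.tendsto_gen (finFlow_tendsto_flow hG ha hc ω hr)
      fun n => finFlow_le_flow hG ha hc ω hr n

/-- Dynkin's formula is known for events of the past of the clocks; a set of `𝓖` differs from such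
an event by a null set only. -/
theorem isBoundedDynkin [Countable V] {mΩ : MeasurableSpace Ω} {P : Measure Ω}
    [IsProbabilityMeasure P] (hX : IsPoissonClocks X P) {𝓖 : Filtration ℝ≥0 mΩ}
    (h𝓖 : ∀ (t : ℝ≥0) n e, MeasurableSet[𝓖 t] {ω | S.finFlow X (a n) t ω = e})
    (h𝓖' : ∀ (t : ℝ≥0) A, MeasurableSet[𝓖 t] A → ∃ A', MeasurableSet[clockPast X t] A' ∧ A =ᵐ[P] A')
    (hg : S.LocalOn B g) :
    IsBoundedDynkin 𝓖 P (S.stoppedFlow X g a η k) (S.stoppedGen X g a η k) where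
  measurable_fst t := @measurableUpTo_stoppedFlow _ _ _ _ _ _ hG ha hc k _ _ _ (𝓖 t) _ t.2
    (fun r hr hrt n e => 𝓖.mono (show (⟨r, hr⟩ : ℝ≥0) ≤ t from hrt) _ (h𝓖 ⟨r, hr⟩ n e)) hg
  measurable_snd t := @measurableUpTo_stoppedGen _ _ _ _ _ _ hG ha hc k _ _ _ (𝓖 t) _ t.2
    (fun r hr hrt n e => 𝓖.mono (show (⟨r, hr⟩ : ℝ≥0) ≤ t from hrt) _ (h𝓖 ⟨r, hr⟩ n e)) hg
  bounded_fst := by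
    obtain ⟨b, hb⟩ := exists_abs_stopped_le hG ha hc k hg
    exact ⟨b, fun r ω hr => (hb r ω hr).2⟩
  bounded_snd := by
    obtain ⟨Λ, -, hΛ⟩ := exists_abs_stoppedGen_le hG ha hc k hg
    exact ⟨Λ, fun r ω hr => (hΛ r ω hr).1⟩
  setIntegral_eq s t hst A hA := by
    obtain ⟨A', hA', hAA'⟩ := h𝓖' s A hA
    rw [setIntegral_congr_set hAA', setIntegral_congr_set hAA']
    exact setIntegral_stoppedFlow_sub hG ha hc k hX hg s.2 hst hA'

end

end ReactionDiffusion

/-! ### Paths that are locally constant on both sides -/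

/-- Paths that are constant immediately before and after each time. -/
structure IsStepPath (h : ℝ → ℝ) : Prop where
  right : ∀ t, 0 ≤ t → ∀ᶠ s in 𝓝[>] t, h s = h t
  left : ∀ t, 0 < t → ∃ l, ∀ᶠ s in 𝓝[<] t, h s = l

theorem IsStepPath.comp_min {h : ℝ → ℝ} (hh : IsStepPath h) (e : ℝ) :
    IsStepPath fun t => h (min t e) := by
  refine ⟨fun t ht => ?_, fun t ht => ?_⟩
  · rcases lt_or_ge t e with hte | hte
    · filter_upwards [hh.right t ht, Ioo_mem_nhdsGT hte] with s h1 h2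
      rw [min_eq_left h2.2.le, min_eq_left hte.le, h1]
    · filter_upwards [self_mem_nhdsWithin] with s hs
      rw [min_eq_right hte, min_eq_right (hte.trans (Set.mem_Ioi.1 hs).le)]
  · rcases le_or_gt t e with hte | hte
    · obtain ⟨l, hl⟩ := hh.left t ht
      refine ⟨l, ?_⟩
      filter_upwards [hl, self_mem_nhdsWithin] with s h1 h2
      rw [min_eq_left ((Set.mem_Iio.1 h2).le.trans hte), h1]
    · refine ⟨h e, ?_⟩
      filter_upwards [Ioo_mem_nhdsLT hte] with s hs
      rw [min_eq_right hs.1.le]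

theorem IsStepPath.of_local {h : ℝ → ℝ}
    (H : ∀ T, ∃ g, IsStepPath g ∧ ∀ t, 0 ≤ t → t ≤ T → h t = g t) : IsStepPath h := by
  refine ⟨fun t ht => ?_, fun t ht => ?_⟩
  · obtain ⟨g, hg, h1⟩ := H (t + 1)
    filter_upwards [hg.right t ht, Ioo_mem_nhdsGT (lt_add_one t)] with s h2 h3
    rw [h1 t ht (by linarith), h1 s (ht.trans h3.1.le) h3.2.le, h2]
  · obtain ⟨g, hg, h1⟩ := H t
    obtain ⟨l, hl⟩ := hg.left t ht
    refine ⟨l, ?_⟩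
    filter_upwards [hl, Ioo_mem_nhdsLT ht] with s h2 h3
    rw [h1 s h3.1.le h3.2.le, h2]

theorem tendsto_coe_nhdsGT (t : ℝ≥0) : Tendsto ((↑) : ℝ≥0 → ℝ) (𝓝[>] t) (𝓝[>] (t : ℝ)) :=
  tendsto_nhdsWithin_iff.2 ⟨(NNReal.continuous_coe.tendsto t).mono_left nhdsWithin_le_nhds,
    eventually_nhdsWithin_of_forall fun _ hs => NNReal.coe_lt_coe.2 hs⟩

theorem tendsto_coe_nhdsLT (t : ℝ≥0) : Tendsto ((↑) : ℝ≥0 → ℝ) (𝓝[<] t) (𝓝[<] (t : ℝ)) :=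
  tendsto_nhdsWithin_iff.2 ⟨(NNReal.continuous_coe.tendsto t).mono_left nhdsWithin_le_nhds,
    eventually_nhdsWithin_of_forall fun _ hs => NNReal.coe_lt_coe.2 hs⟩

theorem IsStepPath.isCadlagPath {h : ℝ → ℝ} (hh : IsStepPath h) :
    IsCadlagPath fun t : ℝ≥0 => h t := by
  refine fun t => ⟨?_, ?_⟩
  · refine continuousWithinAt_Ioi_iff_Ici.1 (tendsto_const_nhds.congr' ?_)
    filter_upwards [(tendsto_coe_nhdsGT t).eventually (hh.right t t.2)] with s hs using hs.symm
  · rcases eq_or_ne t 0 with rfl | ht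
    · refine ⟨0, ?_⟩
      have : Set.Iio (0 : ℝ≥0) = ∅ := by ext s; simp
      rw [this, nhdsWithin_empty]
      exact tendsto_bot
    · obtain ⟨l, hl⟩ := hh.left t (by exact_mod_cast pos_iff_ne_zero.2 ht)
      refine ⟨l, tendsto_const_nhds.congr' ?_⟩
      filter_upwards [(tendsto_coe_nhdsLT t).eventually hl] with s hs using hs.symm

theorem Continuous.isCadlagPath {g : ℝ≥0 → ℝ} (hg : Continuous g) : IsCadlagPath g := fun t =>
  ⟨hg.continuousWithinAt, g t, (hg.tendsto t).mono_left nhdsWithin_le_nhds⟩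

theorem IsCadlagPath.sub {g h : ℝ≥0 → ℝ} (hg : IsCadlagPath g) (hh : IsCadlagPath h) :
    IsCadlagPath fun t => g t - h t := fun t =>
  ⟨(hg t).1.sub (hh t).1, _, (hg t).2.choose_spec.sub (hh t).2.choose_spec⟩

theorem IsCadlagPath.pow {g : ℝ≥0 → ℝ} (hg : IsCadlagPath g) (n : ℕ) :
    IsCadlagPath fun t => g t ^ n := fun t =>
  ⟨(hg t).1.pow n, _, (hg t).2.choose_spec.pow n⟩

theorem continuous_intervalIntegral_coe {h : ℝ → ℝ}
    (hi : ∀ t, 0 ≤ t → IntervalIntegrable h volume 0 t) :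
    Continuous fun t : ℝ≥0 => ∫ r in (0 : ℝ)..t, h r := by
  rw [continuous_iff_continuousAt]
  intro t
  have h1 := ((hi (t + 1) (by positivity)).absolutelyContinuousOnInterval_intervalIntegral
    (c := 0) (by simp)).continuousOn
  rw [Set.uIcc_of_le (by positivity)] at h1
  refine ContinuousWithinAt.continuousAt (s := Set.Iic (t + 1)) ?_
    (Iic_mem_nhds (lt_add_of_pos_right t one_pos))
  exact (h1 t ⟨t.2, (lt_add_one _).le⟩).comp NNReal.continuous_coe.continuousWithinAt
    fun s hs => ⟨s.2, by exact_mod_cast (Set.mem_Iic.1 hs)⟩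

/-! ### Modification of processes on null sets -/

theorem Measurable.of_ae_eq {Ω : Type*} {mΩ : MeasurableSpace Ω} {P : Measure Ω}
    {m : MeasurableSpace Ω} (hm : ∀ N, P N = 0 → MeasurableSet[m] N) {f g : Ω → ℝ}
    (hf : Measurable[m] f) (hfg : f =ᵐ[P] g) : Measurable[m] g := by
  intro D hD
  let N := {ω | ¬ f ω = g ω}
  have hN : P N = 0 := ae_iff.1 hfg
  have : g ⁻¹' D = (f ⁻¹' D ∩ Nᶜ) ∪ (g ⁻¹' D ∩ N) := by
    ext ω
    by_cases h : f ω = g ω <;> simp [N, h]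
  rw [this]
  exact @MeasurableSet.union _ m _ _ (@MeasurableSet.inter _ m _ _ (hf hD)
    (@MeasurableSet.compl _ _ m (hm N hN))) (hm _ (measure_mono_null Set.inter_subset_right hN))

theorem MeasureTheory.Martingale.of_ae_eq {Ω : Type*} {mΩ : MeasurableSpace Ω} {P : Measure Ω}
    {𝓖 : Filtration ℝ≥0 mΩ} (h𝓖 : ∀ t N, P N = 0 → MeasurableSet[𝓖 t] N) {Y Z : ℝ≥0 → Ω → ℝ}
    (hZ : Martingale Z 𝓖 P) (h : ∀ t, Z t =ᵐ[P] Y t) : Martingale Y 𝓖 P :=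
  ⟨fun t => (((hZ.1 t).measurable.of_ae_eq (h𝓖 t) (h t))).stronglyMeasurable, fun s t hst =>
    (condExp_congr_ae (h t).symm).trans ((hZ.2 s t hst).trans (h s))⟩

/-! ### Localization -/

namespace ReactionDiffusion

variable {V Ω : Type*} {S : ReactionDiffusion V} {X : Mark V → Ω → Set (ℝ × ℝ)}
  {a : ℕ → FiniteConfig V} {η : S.Config} {k : ℝ} {ω : Ω} {B : Finset V} {g : S.Config → ℝ}

open scoped Classical in
variable (S X a) in
/-- The exit time from the ball of radius `k`. -/
noncomputable def exitStop (k : ℝ) (ω : Ω) : WithTop ℝ≥0 :=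
  if (S.exitTimes X a k ω).Nonempty then ((sInf (S.exitTimes X a k ω)).toNNReal : WithTop ℝ≥0) else ⊤

section

variable (hG : S.GoodClocks X) (ha : S.Approximates a η)
  (hc : ∀ ω, S.FlowConverges (fun m => X m ω) a)
include hG ha hc

theorem sInf_mem_exitTimes (h : (S.exitTimes X a k ω).Nonempty) :
    sInf (S.exitTimes X a k ω) ∈ S.exitTimes X a k ω := by
  by_contra hn
  obtain ⟨s, hs1, hs2⟩ := exists_gt_notMem_exitTimes hG ha hc
    (Real.sInf_nonneg fun _ h => nonneg_of_mem_exitTimes h) hn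
  obtain ⟨r, hr1, hr2⟩ := exists_lt_of_csInf_lt h hs1
  exact hs2 (exitTimes_upper hr1 hr2.le)

/-- The exit times form an upper set that contains its infimum when nonempty. -/
theorem exitStop_le_iff (t : ℝ≥0) : S.exitStop X a k ω ≤ t ↔ (t : ℝ) ∈ S.exitTimes X a k ω := by
  rw [exitStop]
  split_ifs with h
  · rw [WithTop.coe_le_coe, Real.toNNReal_le_iff_le_coe]
    exact ⟨exitTimes_upper (sInf_mem_exitTimes hG ha hc h),
      csInf_le ⟨0, fun _ h => nonneg_of_mem_exitTimes h⟩⟩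
  · simp only [top_le_iff, WithTop.coe_ne_top, false_iff]
    exact fun h' => h ⟨_, h'⟩

theorem min_exitStop (t : ℝ≥0) :
    min (t : WithTop ℝ≥0) (S.exitStop X a k ω) = ((S.exitTime X a k t ω).toNNReal : WithTop ℝ≥0) := by
  refine eq_of_forall_ge_iff fun c => ?_
  induction c with
  | top => exact iff_of_true le_top le_top
  | coe r =>
    rw [min_le_iff, WithTop.coe_le_coe, WithTop.coe_le_coe, exitStop_le_iff hG ha hc,
      Real.toNNReal_le_iff_le_coe]
    rcases le_or_gt t r with h | h
    · exact iff_of_true (Or.inl h) ((exitTime_le k t.coe_nonneg ω).trans (NNReal.coe_le_coe.2 h))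
    · have := lt_exitTime_iff' hG ha hc k t.coe_nonneg r.coe_nonneg (NNReal.coe_lt_coe.2 h) ω
      rw [← not_lt (b := S.exitTime X a k t ω), this, not_not]
      exact or_iff_right (not_le.2 h)

theorem exists_notMem_exitTimes (T : ℝ) (ω : Ω) : ∃ n : ℕ, T ∉ S.exitTimes X a n ω := by
  rcases lt_or_ge T 0 with hT | hT
  · exact ⟨0, fun h => not_lt.2 (nonneg_of_mem_exitTimes h) hT⟩
  obtain ⟨N, hN⟩ := exists_weightSum_flow_sub_le hG ha hc ω T
  obtain ⟨Zm, hZ⟩ := hG.exists_isJumpProcess (a N)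
  obtain ⟨C, hC⟩ := ((((hZ.path ω).finite_image T hT)).image
    fun e => weightSum S.α e.1).bddAbove
  -- One approximation is bounded by `C` up to `T`, all the others exceed it by at most `2`, and the
  -- margin for `j = 0` is `1`.
  obtain ⟨n, hn⟩ := exists_nat_ge (C + 3)
  refine ⟨n, ?_⟩
  simp only [exitTimes, Set.mem_ofPred_eq, not_forall, not_exists, not_and, not_lt]
  refine ⟨0, fun i r h0 h1 => ?_⟩
  have h2 := (weightSum_le_of_le (finFlow_le_flow hG ha hc ω h0 i)).2
  have h3 := hN N le_rfl r h0 h1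
  have h4 : weightSum S.α (S.finFlow X (a N) r ω).1 ≤ C := hC ⟨_, ⟨r, ⟨h0, h1⟩, rfl⟩, rfl⟩
  have h5 : (1 / 2 : ℝ) ^ N ≤ 1 := pow_le_one₀ (by norm_num) (by norm_num)
  norm_num
  linarith

theorem isLocalizingSequence_exitStop [Countable V] {mΩ : MeasurableSpace Ω} (P : Measure Ω)
    {𝓖 : Filtration ℝ≥0 mΩ}
    (h𝓖 : ∀ (t : ℝ≥0) n e, MeasurableSet[𝓖 t] {ω | S.finFlow X (a n) t ω = e}) :
    IsLocalizingSequence 𝓖 (fun n : ℕ => S.exitStop X a n) P where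
  isStoppingTime n t := by
    simp_rw [exitStop_le_iff hG ha hc]
    exact @measurableSet_mem_exitTimes _ _ _ _ _ _ _ hG (𝓖 t) _ t.coe_nonneg
      fun r hr hrt n e => 𝓖.mono (show (⟨r, hr⟩ : ℝ≥0) ≤ t from hrt) _ (h𝓖 ⟨r, hr⟩ n e)
  tendsto_top := ae_of_all _ fun ω => by
    refine tendsto_order.2 ⟨fun c hc' => ?_, fun c hc' => absurd hc' not_top_lt⟩
    lift c to ℝ≥0 using hc'.ne
    obtain ⟨n, hn⟩ := exists_notMem_exitTimes hG ha hc c ω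
    filter_upwards [eventually_ge_atTop n] with m hm
    rw [← not_le, exitStop_le_iff hG ha hc]
    exact fun h => hn (exitTimes_anti (Nat.cast_le.2 hm) h)
  mono := ae_of_all _ fun ω n m hnm => by
    refine le_of_forall_ge fun c h => ?_
    induction c with
    | top => exact le_top
    | coe r =>
      rw [exitStop_le_iff hG ha hc] at h ⊢
      exact exitTimes_anti (Nat.cast_le.2 hnm) h

/-- The indicator of a positive stopping time is harmless because `Y` starts at zero. -/
theorem stoppedProcess_exitStop {Y : ℝ≥0 → Ω → ℝ} (hY : Y 0 ω = 0) (t : ℝ≥0) :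
    stoppedProcess (fun i => {ω | ⊥ < S.exitStop X a k ω}.indicator (Y i)) (S.exitStop X a k) t ω =
      Y (S.exitTime X a k t ω).toNNReal ω := by
  rw [stoppedProcess, min_exitStop hG ha hc, WithTop.untopA_eq_untop WithTop.coe_ne_top, WithTop.untop_coe]
  by_cases h : ⊥ < S.exitStop X a k ω
  · rw [Set.indicator_of_mem (show ω ∈ {ω | ⊥ < S.exitStop X a k ω} from h)]
  · rw [Set.indicator_of_notMem (show ω ∉ {ω | ⊥ < S.exitStop X a k ω} from h)]
    have h0 := min_exitStop hG ha hc (k := k) (ω := ω) t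
    rw [not_bot_lt_iff.1 h, min_eq_right bot_le] at h0
    have : (S.exitTime X a k t ω).toNNReal = 0 := WithTop.coe_injective h0.symm
    rw [this, hY]

/-- Here `Y'` is built from the altered clocks, for which everything holds path by path, and `Y`
from the original ones; completeness of the filtration carries the conclusion across the null set.
-/
theorem isLocalMartingale_of_stopped [Countable V] {mΩ : MeasurableSpace Ω} {P : Measure Ω}
    {𝓖 : Filtration ℝ≥0 mΩ}
    (h𝓖 : ∀ (t : ℝ≥0) n e, MeasurableSet[𝓖 t] {ω | S.finFlow X (a n) t ω = e})
    (hnull : ∀ t N, P N = 0 → MeasurableSet[𝓖 t] N) {Y Y' : ℝ≥0 → Ω → ℝ}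
    (hYY' : ∀ᵐ ω ∂P, ∀ t, Y' t ω = Y t ω) (hY' : ∀ ω, Y' 0 ω = 0) {Z : ℕ → ℝ≥0 → Ω → ℝ}
    (hZ : ∀ k, Martingale (Z k) 𝓖 P) (hcad : ∀ k ω, IsCadlagPath fun t => Z k t ω)
    (hYZ : ∀ (k : ℕ) (t : ℝ≥0) ω, Y' (S.exitTime X a k t ω).toNNReal ω = Z k t ω) :
    IsLocalMartingale Y 𝓖 P := by
  refine ⟨fun n : ℕ => S.exitStop X a n, isLocalizingSequence_exitStop hG ha hc P h𝓖, fun k => ?_⟩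
  have key : ∀ᵐ ω ∂P, ∀ t, Z k t ω = stoppedProcess
      (fun i => {ω | ⊥ < S.exitStop X a k ω}.indicator (Y i)) (S.exitStop X a k) t ω := by
    filter_upwards [hYY'] with ω hω t
    rw [stoppedProcess_exitStop hG ha hc (by rw [← hω, hY']), ← hω, hYZ]
  refine ⟨(hZ k).of_ae_eq hnull fun t => key.mono fun ω h => h t, ?_⟩
  filter_upwards [key] with ω hω
  have := hcad k ω
  simp_rw [hω] at this
  exact this

/-- On `[0, T]` a single approximation is closer to the flow than the smallest `α x` on `B`, so it
agrees with the flow there, and it is a jump path. -/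
theorem isStepPath_flow (hg : S.LocalOn B g) (ω : Ω) :
    IsStepPath fun t => g (S.flow (fun m => X m ω) t η) := by
  refine IsStepPath.of_local fun T => ?_
  obtain ⟨N, hN⟩ := exists_weightSum_flow_sub_le hG ha hc ω T
  have hlim : Tendsto (fun n : ℕ => 2 * (1 / 2 : ℝ) ^ n) atTop (𝓝 0) := by
    simpa using (tendsto_pow_atTop_nhds_zero_of_lt_one (r := (1 / 2 : ℝ))
      (by norm_num) (by norm_num)).const_mul 2
  obtain ⟨n, hn, hnN⟩ := ((B.eventually_all (p := fun x n => 2 * (1 / 2 : ℝ) ^ n < S.α x)).2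
    fun x _ => hlim.eventually (gt_mem_nhds (S.α_pos x))).and (eventually_ge_atTop N) |>.exists
  obtain ⟨Zm, hZ⟩ := hG.exists_isJumpProcess (a n)
  refine ⟨fun t => g (S.ofFinite (S.finFlow X (a n) t ω)), ⟨fun t ht => ?_, fun t ht => ?_⟩,
    fun t ht htT => hg _ _ fun x hx => ?_⟩
  · exact ((hZ.path ω).right t ht).mono fun s hs => by simp only [hs]
  · exact ⟨g (S.ofFinite (Zm t ω)), ((hZ.path ω).left t ht).mono fun s hs => by simp only [hs]⟩
  · refine (eq_of_dist_lt (η := S.ofFinite (S.finFlow X (a n) t ω)) ?_).symm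
    rw [dist_eq_of_le (η := S.ofFinite (S.finFlow X (a n) t ω)) (finFlow_le_flow hG ha hc ω ht n)]
    exact (hN n hnN t ht htT).trans_lt (hn x hx)

theorem isCadlagPath_stoppedFlow (hg : S.LocalOn B g) (k : ℝ) (ω : Ω) :
    IsCadlagPath fun t : ℝ≥0 => S.stoppedFlow X g a η k t ω := by
  refine IsStepPath.isCadlagPath (h := fun t => S.stoppedFlow X g a η k t ω)
    (IsStepPath.of_local fun T => ⟨_, (isStepPath_flow hG ha hc hg ω).comp_min
      (S.exitTime X a k T ω), fun t ht htT => ?_⟩)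
  simp only [stoppedFlow]
  rw [exitTime_eq_min k ht htT]

open scoped Classical in
-- The two integrands can differ only at `t` and at the exit time.
theorem integral_ite_exitTimes (F : ℝ → ℝ) {t : ℝ} (ht : 0 ≤ t) (k : ℝ) (ω : Ω) :
    ∫ r in (0 : ℝ)..t, (if r ∈ S.exitTimes X a k ω then 0 else F r) =
      ∫ r in (0 : ℝ)..S.exitTime X a k t ω, F r := by
  have hτ := exitTime_le (S := S) (X := X) (a := a) k ht ω
  rw [intervalIntegral.integral_of_le ht, intervalIntegral.integral_of_le
    (exitTime_nonneg k ht ω), ← Set.inter_eq_self_of_subset_right (Set.Ioc_subset_Ioc_right hτ),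
    ← setIntegral_indicator measurableSet_Ioc]
  refine setIntegral_congr_ae measurableSet_Ioc ?_
  filter_upwards [measure_eq_zero_iff_ae_notMem.1
    ((Set.toFinite {t, S.exitTime X a k t ω}).countable.measure_zero volume)] with r hr hr'
  simp only [Set.mem_insert_iff, Set.mem_singleton_iff, not_or] at hr
  have hiff := lt_exitTime_iff' hG ha hc k ht hr'.1.le (lt_of_le_of_ne hr'.2 hr.1) ω
  by_cases h : r ∈ S.exitTimes X a k ω
  · rw [if_pos h, Set.indicator_of_notMem]
    exact fun h' => hiff.1 (lt_of_le_of_ne h'.2 hr.2) h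
  · rw [if_neg h, Set.indicator_of_mem]
    exact ⟨hr'.1, (hiff.2 h).le⟩

omit hG ha hc in
theorem exitTime_eq_self {r : ℝ} (hr : 0 ≤ r) (h : r ∉ S.exitTimes X a k ω) :
    S.exitTime X a k r ω = r := by
  refine le_antisymm (exitTime_le k hr ω) (le_csInf ⟨r, Or.inr rfl⟩ ?_)
  rintro x (hx | rfl)
  · exact le_of_not_gt fun hxr => h (exitTimes_upper hx.2 hxr.le)
  · exact le_rfl

/-- Take a ball so large that the exit happens after `t`; up to then the bounded stopped processes
are the unstopped ones. -/
theorem intervalIntegrable_gen_carre [Countable V] {mΩ : MeasurableSpace Ω} {P : Measure Ω}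
    [IsProbabilityMeasure P] (hX : IsPoissonClocks X P) {𝓖 : Filtration ℝ≥0 mΩ}
    (h𝓖 : ∀ (t : ℝ≥0) n e, MeasurableSet[𝓖 t] {ω | S.finFlow X (a n) t ω = e})
    (h𝓖' : ∀ (t : ℝ≥0) A, MeasurableSet[𝓖 t] A → ∃ A', MeasurableSet[clockPast X t] A' ∧ A =ᵐ[P] A')
    (hg : S.LocalOn B g) (ω : Ω) (t : ℝ≥0) :
    IntervalIntegrable (fun s => S.gen g (S.flow (fun m => X m ω) s η)) volume 0 t ∧
      IntervalIntegrable (fun s => S.carre g (S.flow (fun m => X m ω) s η)) volume 0 t := by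
  obtain ⟨n, hn⟩ := exists_notMem_exitTimes hG ha hc t ω
  have h1 := isBoundedDynkin hG ha hc n hX h𝓖 h𝓖' hg
  have h2 := isBoundedDynkin hG ha hc n hX h𝓖 h𝓖' hg.sq
  have hnot : ∀ r ∈ Set.uIoc 0 (t : ℝ), 0 ≤ r ∧ r ∉ S.exitTimes X a n ω := by
    intro r hr
    rw [Set.uIoc_of_le t.coe_nonneg] at hr
    exact ⟨hr.1.le, fun h => hn (exitTimes_upper h hr.2)⟩
  refine ⟨(h1.intervalIntegrable ω le_rfl t.coe_nonneg).congr fun r hr => ?_,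
    ((h2.intervalIntegrable ω le_rfl t.coe_nonneg).sub
      ((h1.intervalIntegrable_mul ω t.coe_nonneg).const_mul 2)).congr fun r hr => ?_⟩
  · simp only [stoppedGen, if_neg (hnot r hr).2]
  · simp only [stoppedGen, stoppedFlow, if_neg (hnot r hr).2, carre,
      exitTime_eq_self (hnot r hr).1 (hnot r hr).2]
    ring

theorem isLocalMartingale_dynkin [Countable V] {mΩ : MeasurableSpace Ω} {P : Measure Ω}
    [IsProbabilityMeasure P] (hX : IsPoissonClocks X P) {𝓖 : Filtration ℝ≥0 mΩ}
    (h𝓖 : ∀ (t : ℝ≥0) n e, MeasurableSet[𝓖 t] {ω | S.finFlow X (a n) t ω = e})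
    (h𝓖' : ∀ (t : ℝ≥0) A, MeasurableSet[𝓖 t] A → ∃ A', MeasurableSet[clockPast X t] A' ∧ A =ᵐ[P] A')
    (hnull : ∀ t N, P N = 0 → MeasurableSet[𝓖 t] N) (hg : S.LocalOn B g)
    {Y : Mark V → Ω → Set (ℝ × ℝ)} (hXY : ∀ᵐ ω ∂P, ∀ m, X m ω = Y m ω) :
    IsLocalMartingale (S.dynkinM Y g η) 𝓖 P ∧ IsLocalMartingale (S.dynkinN Y g η) 𝓖 P := by
  classical
  have h1 := fun k : ℕ => isBoundedDynkin hG ha hc k hX h𝓖 h𝓖' hg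
  have h2 := fun k : ℕ => isBoundedDynkin hG ha hc k hX h𝓖 h𝓖' hg.sq
  have hM0 : ∀ ω, S.dynkinM X g η 0 ω = 0 := fun ω => by
    simp [dynkinM, flow_zero hG ha hc ω]
  have hM : ∀ (k : ℕ) (t : ℝ≥0) ω, S.dynkinM X g η (S.exitTime X a k t ω).toNNReal ω =
      S.stoppedFlow X g a η k t ω - g η - ∫ r in (0 : ℝ)..t, S.stoppedGen X g a η k r ω := by
    intro k t ω
    rw [dynkinM, Real.coe_toNNReal _ (exitTime_nonneg k t.coe_nonneg ω),
      ← integral_ite_exitTimes hG ha hc _ t.coe_nonneg k ω]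
    rfl
  have hcadM : ∀ (k : ℕ) ω, IsCadlagPath fun t : ℝ≥0 =>
      S.stoppedFlow X g a η k t ω - g η - ∫ r in (0 : ℝ)..t, S.stoppedGen X g a η k r ω :=
    fun k ω => ((isCadlagPath_stoppedFlow hG ha hc hg k ω).sub
      continuous_const.isCadlagPath).sub (continuous_intervalIntegral_coe fun t ht =>
        (h1 k).intervalIntegrable ω le_rfl ht).isCadlagPath
  refine ⟨isLocalMartingale_of_stopped hG ha hc h𝓖 hnull (Y' := S.dynkinM X g η) ?_ hM0
    (fun k => (h1 k).martingale (g η)) hcadM hM, ?_⟩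
  · filter_upwards [hXY] with ω hω t
    simp only [dynkinM, hω]
  refine isLocalMartingale_of_stopped hG ha hc h𝓖 hnull (Y' := S.dynkinN X g η) ?_ (fun ω => ?_)
    (fun k => (h1 k).martingale_sq (h2 k) (g η)) (fun k ω => ((hcadM k ω).pow 2).sub
      (continuous_intervalIntegral_coe fun t ht => ?_).isCadlagPath) fun k t ω => ?_
  · filter_upwards [hXY] with ω hω t
    simp only [dynkinN, dynkinM, hω]
  · simp [dynkinN, hM0]
  · simp_rw [mul_assoc]
    exact ((h2 k).intervalIntegrable ω le_rfl ht).sub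
      (((h1 k).intervalIntegrable_mul ω ht).const_mul 2)
  · rw [dynkinN, hM, Real.coe_toNNReal _ (exitTime_nonneg k t.coe_nonneg ω),
      ← integral_ite_exitTimes hG ha hc _ t.coe_nonneg k ω]
    congr 1
    refine intervalIntegral.integral_congr fun r hr => ?_
    rw [Set.uIcc_of_le t.coe_nonneg] at hr
    by_cases h : r ∈ S.exitTimes X a k ω
    · simp [stoppedGen, h]
    · simp only [stoppedGen, stoppedFlow, if_neg h, carre, exitTime_eq_self hr.1 h]

end

end ReactionDiffusion

/-! ### Almost sure properties of the clocks -/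

/-- Bad samples receive the clocks of one good sample. Since every altered sample is an original
one, properties that already held everywhere are kept. -/
theorem IsPoissonClocks.exists_modification {V Ω : Type*} [MeasurableSpace Ω] {P : Measure Ω}
    [IsProbabilityMeasure P] [P.IsComplete] {X : Mark V → Ω → Set (ℝ × ℝ)}
    (hX : IsPoissonClocks X P) {p : (Mark V → Set (ℝ × ℝ)) → Prop}
    (hp : ∀ᵐ ω ∂P, p fun m => X m ω) : ∃ X' : Mark V → Ω → Set (ℝ × ℝ), IsPoissonClocks X' P ∧
      (∀ ω, p fun m => X' m ω) ∧ (∀ ω, ∃ ω', ∀ m, X' m ω = X m ω') ∧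
      ∀ᵐ ω ∂P, ∀ m, X m ω = X' m ω := by
  classical
  obtain ⟨ω₀, h₀⟩ := hp.exists
  refine ⟨_, hX.modify (S := {ω | p fun m => X m ω}) hp ω₀, fun ω => ?_, fun ω => ?_, ?_⟩
  · by_cases h : p fun m => X m ω
    · simp [h]
    · simpa [h] using h₀
  · by_cases h : p fun m => X m ω
    · exact ⟨ω, fun m => by simp [h]⟩
    · exact ⟨ω₀, fun m => by simp [h]⟩
  · filter_upwards [hp] with ω hω m
    simp [hω]

namespace ReactionDiffusion

variable {V : Type*} [Countable V] {S : ReactionDiffusion V}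

/-- Three successive alterations: nonexplosion is proved for clocks that are simple and finite
everywhere, and convergence for clocks without explosion. -/
theorem exists_goodClocks {Ω : Type*} [MeasurableSpace Ω] {P : Measure Ω} [IsProbabilityMeasure P]
    [P.IsComplete] {X : Mark V → Ω → Set (ℝ × ℝ)} (hX : IsPoissonClocks X P)
    {a : ℕ → FiniteConfig V} {η : S.Config} (ha : S.Approximates a η) :
    ∃ X' : Mark V → Ω → Set (ℝ × ℝ), IsPoissonClocks X' P ∧ S.GoodClocks X' ∧
      (∀ ω, S.FlowConverges (fun m => X' m ω) a) ∧ ∀ᵐ ω ∂P, ∀ m, X m ω = X' m ω := by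
  obtain ⟨X₁, hX₁, h₁, -, e₁⟩ := hX.exists_modification
    (p := fun x => ClocksSimple x ∧ ClocksFinite x S.finiteRate)
    (hX.ae_clocksSimple.and (hX.ae_clocksFinite (fun m e => S.rate_nonneg m e.1) S.summable_rate))
  obtain ⟨X₂, hX₂, h₂, r₂, e₂⟩ := hX₁.exists_modification (p := S.Nonexplosive)
    (S.ae_nonexplosive hX₁ (fun ω => (h₁ ω).1) fun ω => (h₁ ω).2)
  have hG₂ : S.GoodClocks X₂ := by
    refine ⟨fun ω => ?_, fun ω => ?_, h₂⟩
    · obtain ⟨ω', h⟩ := r₂ ω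
      simpa only [h] using (h₁ ω').1
    · obtain ⟨ω', h⟩ := r₂ ω
      simpa only [h] using (h₁ ω').2
  obtain ⟨X₃, hX₃, h₃, r₃, e₃⟩ := hX₂.exists_modification (p := fun x => S.FlowConverges x a)
    (ae_flowConverges hX₂ hG₂ ha)
  refine ⟨X₃, hX₃, ⟨fun ω => ?_, fun ω => ?_, fun ω => ?_⟩, h₃, ?_⟩
  · obtain ⟨ω', h⟩ := r₃ ω
    simpa only [h] using hG₂.simple ω'
  · obtain ⟨ω', h⟩ := r₃ ω
    simpa only [h] using hG₂.finite ω'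
  · obtain ⟨ω', h⟩ := r₃ ω
    simpa only [h] using hG₂.nonexplosive ω'
  · filter_upwards [e₁, e₂, e₃] with ω h1 h2 h3 m
    rw [h1, h2, h3]

/-! ### Comparison of the completed flow filtration with the past of the altered clocks. -/

section Filtration

variable {Ω : Type*} {mΩ : MeasurableSpace Ω} {P : Measure Ω}
  {X X' : Mark V → Ω → Set (ℝ × ℝ)}

omit [Countable V] in
theorem measurableSet_flowFiltration_of_null (t : ℝ≥0) {N : Set Ω}
    (hN : P N = 0) : MeasurableSet[flowFiltration S X P t] N := by
  change MeasurableSet[(flowSigma S X t ⊔ MeasurableSpace.generateFrom {N : Set Ω | P N = 0})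
      ⊓ completedSigma P] N
  refine MeasurableSpace.measurableSet_inf.2 ⟨?_, NullMeasurableSet.of_null hN⟩
  exact (le_sup_right : _ ≤ flowSigma S X t ⊔ _) _ (MeasurableSpace.measurableSet_generateFrom hN)

theorem measurableSet_flowFiltration_eq (hG : S.GoodClocks X')
    (hX' : @IsPoissonClocks V Ω (completedSigma P) X' (completedMeasure P))
    (hXX' : ∀ᵐ ω ∂P, ∀ m, X m ω = X' m ω) (t : ℝ≥0) (ζ e : FiniteConfig V) :
    MeasurableSet[flowFiltration S X P t] {ω | S.finFlow X' ζ t ω = e} := by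
  change MeasurableSet[(flowSigma S X t ⊔ MeasurableSpace.generateFrom {N : Set Ω | P N = 0})
      ⊓ completedSigma P] _
  refine MeasurableSpace.measurableSet_inf.2 ⟨?_, @IsPoissonClocks.clockPast_le V Ω (completedSigma P) _ _ hX' t _ (hG.measurableSet_eq ζ t.2 e)⟩
  have h1 : MeasurableSet[flowSigma S X t] {ω | S.finFlow X ζ t ω = e} := by
    have hle : MeasurableSpace.comap (fun ω => (S.finiteFlow (fun m => X m ω) 0 (t : ℝ) ζ).1)
        MeasurableSpace.pi ≤ flowSigma S X t :=
      le_iSup₂_of_le t le_rfl (le_iSup_of_le ζ le_rfl)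
    refine hle _ ⟨{e.1}, MeasurableSet.singleton _, ?_⟩
    ext ω
    exact Subtype.ext_iff.symm
  let N := {ω | ¬ ∀ m, X m ω = X' m ω}
  have hN : ∀ C ⊆ N, MeasurableSet[flowSigma S X t ⊔
      MeasurableSpace.generateFrom {N : Set Ω | P N = 0}] C := fun C hC =>
    (le_sup_right : _ ≤ flowSigma S X t ⊔ _) _
      (MeasurableSpace.measurableSet_generateFrom (measure_mono_null hC (ae_iff.1 hXX')))
  have : {ω | S.finFlow X' ζ t ω = e} = ({ω | S.finFlow X ζ t ω = e} ∩ Nᶜ) ∪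
      ({ω | S.finFlow X' ζ t ω = e} ∩ N) := by
    ext ω
    by_cases h : ∀ m, X m ω = X' m ω
    · simp [N, h, finFlow]
    · simp only [N, Set.mem_ofPred_eq, Set.mem_union, Set.mem_inter_iff, Set.mem_compl_iff, h,
        not_false_eq_true, not_true_eq_false, and_false, false_or, and_true]
  rw [this]
  refine @MeasurableSet.union _ (_ ⊔ _) _ _ (@MeasurableSet.inter _ (_ ⊔ _) _ _
    ((le_sup_left : _ ≤ flowSigma S X t ⊔ _) _ h1) (@MeasurableSet.compl _ _ (_ ⊔ _) (hN N le_rfl)))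
    (hN _ Set.inter_subset_right)

/-- It is enough to treat the generators: null sets are equivalent to `∅`, and the original flow
agrees almost surely with the altered one, which is adapted to the altered clocks. -/
theorem exists_measurableSet_clockPast (hG : S.GoodClocks X')
    (hXX' : ∀ᵐ ω ∂P, ∀ m, X m ω = X' m ω) (t : ℝ≥0) {A : Set Ω}
    (hA : MeasurableSet[flowFiltration S X P t] A) :
    ∃ A', MeasurableSet[clockPast X' t] A' ∧ A =ᵐ[P] A' := by
  have hle : flowSigma S X t ⊔ MeasurableSpace.generateFrom {N : Set Ω | P N = 0} ≤
      eventuallyMeasurableSpace (clockPast X' t) (ae P) := by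
    refine sup_le (iSup₂_le fun s hs => iSup_le fun ζ => ?_)
      (MeasurableSpace.generateFrom_le fun N hN =>
        ⟨∅, @MeasurableSet.empty _ (clockPast X' t), ae_eq_empty.2 hN⟩)
    rintro _ ⟨D, -, rfl⟩
    refine ⟨{ω | (S.finFlow X' ζ s ω).1 ∈ D}, ?_, ?_⟩
    · have : {ω | (S.finFlow X' ζ s ω).1 ∈ D} =
          ⋃ e ∈ {e : FiniteConfig V | e.1 ∈ D}, {ω | S.finFlow X' ζ s ω = e} := by
        ext ω; simp
      rw [this]
      exact MeasurableSet.biUnion (Set.to_countable _) fun e _ =>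
        clockPast_mono X' (NNReal.coe_le_coe.2 hs) _ (hG.measurableSet_eq ζ s.2 e)
    · filter_upwards [hXX'] with ω hω
      refine propext ?_
      change (S.finFlow X ζ s ω).1 ∈ D ↔ (S.finFlow X' ζ s ω).1 ∈ D
      simp only [finFlow, hω]
  exact hle _ (MeasurableSpace.measurableSet_inf.1 hA).1

end Filtration

end ReactionDiffusion

/-- Continuous local functions `f` belong to `𝒟`. The first three conjuncts say that `L f`, `Q f`
and the time integrals in the definition of `M^{L,f}` and `N^{L,f}` are well defined. -/
theorem mainTheorem7 {V : Type*} [Countable V] (S : ReactionDiffusion V)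
    {Ω : Type*} [MeasurableSpace Ω] (P : Measure Ω) [IsProbabilityMeasure P]
    (X : Mark V → Ω → Set (ℝ × ℝ)) (hX : IsPoissonClocks X P)
    (f : S.Config → ℝ) (hf : Continuous f) (hloc : S.IsLocal f) :
    (∀ η : S.Config, Summable fun m : Mark V => S.rate m η.1 * (f (S.move m η) - f η)) ∧
    (∀ η : S.Config, HasSum
      (fun m : Mark V => S.rate m η.1 * (f (S.move m η) - f η) ^ 2) (S.carre f η)) ∧
    (∀ η : S.Config, ∀ᵐ ω ∂P, ∀ t : ℝ≥0,
      IntervalIntegrable (fun s => S.gen f (S.flow (fun m => X m ω) s η)) volume 0 t ∧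
      IntervalIntegrable (fun s => S.carre f (S.flow (fun m => X m ω) s η)) volume 0 t) ∧
    f ∈ S.dynkinClass X P := by

  obtain ⟨B, hB⟩ := hloc
  have hg : S.LocalOn B f := hB
  have key : ∀ η : S.Config,
      (∀ᵐ ω ∂P, ∀ t : ℝ≥0,
        IntervalIntegrable (fun s => S.gen f (S.flow (fun m => X m ω) s η)) volume 0 t ∧
        IntervalIntegrable (fun s => S.carre f (S.flow (fun m => X m ω) s η)) volume 0 t) ∧
      IsLocalMartingale (S.dynkinM X f η) (flowFiltration S X P) (completedMeasure P) ∧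
      IsLocalMartingale (S.dynkinN X f η) (flowFiltration S X P) (completedMeasure P) := by
    intro η
    obtain ⟨a, ha⟩ := S.exists_approximates η
    -- The argument runs on the completed space, since altering the clocks on an arbitrary null set
    -- keeps the counts measurable only there.
    have hprob : @IsProbabilityMeasure Ω (completedSigma P) (completedMeasure P) :=
      @IsProbabilityMeasure.mk Ω (completedSigma P) (completedMeasure P)
        ((congrFun (Measure.coe_completion P) Set.univ).trans measure_univ)
    have hcomp : @Measure.IsComplete Ω (completedSigma P) (completedMeasure P) :=
      Measure.completion.isComplete P
    obtain ⟨X', hX', hG, hc, hXX'⟩ := @ReactionDiffusion.exists_goodClocks V _ S Ω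
      (completedSigma P) (completedMeasure P) hprob hcomp X hX.completion a η ha
    have hXX : ∀ᵐ ω ∂P, ∀ m, X m ω = X' m ω := hXX'
    have h1 := fun (t : ℝ≥0) (n : ℕ) (e : FiniteConfig V) =>
      ReactionDiffusion.measurableSet_flowFiltration_eq hG hX' hXX t (a n) e
    have h2 := fun (t : ℝ≥0) (A : Set Ω) (hA : MeasurableSet[flowFiltration S X P t] A) =>
      ReactionDiffusion.exists_measurableSet_clockPast hG hXX t hA
    have h3 : ∀ (t : ℝ≥0) (N : Set Ω), completedMeasure P N = 0 →
        MeasurableSet[flowFiltration S X P t] N := fun t N hN =>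
      ReactionDiffusion.measurableSet_flowFiltration_of_null t
        ((congrFun (Measure.coe_completion P) N).symm.trans hN)
    refine ⟨?_, @ReactionDiffusion.isLocalMartingale_dynkin V Ω S X' a η B f hG ha hc _
      (completedSigma P) (completedMeasure P) hprob hX' _ h1 h2 h3 hg X
      (hXX'.mono fun ω h m => (h m).symm)⟩
    filter_upwards [hXX] with ω hω t
    simp only [hω]
    exact @ReactionDiffusion.intervalIntegrable_gen_carre V Ω S X' a η B f hG ha hc _
      (completedSigma P) (completedMeasure P) hprob hX' _ h1 h2 hg ω t
  exact ⟨hg.summable, hg.hasSum_carre, fun η => (key η).1, fun η => (key η).2⟩
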